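/- Let $n\ge 2$, let $M$ be a smooth manifold of dimension $d$ and $E\to M$ a smooth real vector bundle of rank $r$. Let $\rho_2:E\to TM$ and $\rho_{n+1}:\wedge^nE\to TM$ be smooth bundle maps and let $b_2$ and $b_{n+1}$ be a binary and an $(n+1)$-ary skew-symmetric $\mathbb R$-multilinear operation on $\Gamma(E)$ with $$b_2(e,fe')=f\,b_2(e,e')+\rho_2(e)(f)\,e',$$ $$b_{n+1}(fe,e^{(1)},\dots,e^{(n)})=f\,b_{n+1}(e,e^{(1)},\dots,e^{(n)})+(-1)^n\rho_{n+1}(e^{(1)}\wedge\dots\wedge e^{(n)})(f)\,e .$$ These data form a *gapped Lie $n$-algebroid* if $b_2$ satisfies the Jacobi identity and the *mixed Jacobi identity* holds: $$\sum_{\sigma\in S_{n+2}}\mathrm{sgn}(\sigma)\Big(\tfrac1{(n+1)!}\,b_2\big(b_{n+1}(e^{(\sigma 1)},\dots,e^{(\sigma(n+1))}),e^{(\sigma(n+2))}\big)+\tfrac{(-1)^{n+1}}{2\,n!}\,b_{n+1}\big(b_2(e^{(\sigma1)},e^{(\sigma2)}),e^{(\sigma3)},\dots,e^{(\sigma(n+2))}\big)\Big)=0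 .$$ The *mixed morphism condition* is $$\rho_2\big(b_{n+1}(e^{(1)},\dots,e^{(n+1)})\big)+\tfrac{(-1)^{n+1}}{2(n-1)!}\sum_{\sigma\in S_{n+1}}\mathrm{sgn}(\sigma)\,\rho_{n+1}\big(b_2(e^{(\sigma1)},e^{(\sigma2)})\wedge e^{(\sigma3)}\wedge\dots\wedge e^{(\sigma(n+1))}\big)=\sum_{k=1}^{n+1}(-1)^{n+1-k}\big[\rho_{n+1}(\hat e[k]),\rho_2(e^{(k)})\big],$$ where $\hat e[k]$ is the wedge product of all $e^{(i)}$ with $i\neq k$, in order. Let $(x^\mu,a^a,\dot x^\mu,\dot a^a)$, of degrees $(0,1,n-1,n)$, be the coordinates of the graded manifold $T[n-1]E[1]$ induced by a chart of $M$ and a frame $(e_a)$ of $E$ over its domain. Under a change of chart and of frame, $e_a=g^b{}_a e'_b$, they transform by $a'^b=g^b{}_aa^a$, $\dot x'^\mu=\frac{\partial x'^\mu}{\partial x^\nu}\dot x^\nu$, $\dot a'^b=g^b{}_a\dot a^a+\partial_\nu g^b{}_a\,a^a\dot x^\nu$. Write $\rho_2(e_a)=\rho_a{}^\mu\partial_\mu$,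 $\rho_{n+1}(e_{a_1}\wedge\dots\wedge e_{a_n})=\rho_{a_1\dots a_n}{}^\mu\partial_\mu$, $b_2(e_a,e_b)=C^c_{ab}e_c$, $b_{n+1}(e_{a_1},\dots,e_{a_{n+1}})=C^a_{a_1\dots a_{n+1}}e_a$ and put $$Q^{\widehat E}=\rho_a{}^\mu a^a\frac{\partial}{\partial x^\mu}-\tfrac12C^a_{bc}a^ba^c\frac{\partial}{\partial a^a}+\Big(\rho_a{}^\mu\dot a^a+\partial_\nu\rho_a{}^\mu a^a\dot x^\nu+\tfrac1{n!}\rho_{a_1\dots a_n}{}^\mu a^{a_1}\cdots a^{a_n}\Big)\frac{\partial}{\partial\dot x^\mu}$$ $$\qquad-\Big(C^a_{bc}a^b\dot a^c+\tfrac12\partial_\mu C^a_{bc}\dot x^\mu a^ba^c+\tfrac{(-1)^{n+1}}{(n+1)!}C^a_{a_1\dots a_{n+1}}a^{a_1}\cdots a^{a_{n+1}}\Big)\frac{\partial}{\partial\dot a^a}.$$ 1. These local expressions define a vector field $Q^{\widehat E}$ of degree $1$ on $T[n-1]E[1]$: each is a graded derivation of degree $1$ of the algebra of functions of the coordinates,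 and they agree under changes of coordinates. 2. $(Q^{\widehat E})^2=0$ if and only if the data form a gapped Lie $n$-algebroid. Equivalently, $(Q^{\widehat E})^2=0$ if and only if $(E,b_2,\rho_2)$ is a Lie algebroid (that is, $b_2$ satisfies the Jacobi identity and $\rho_2(b_2(e,e'))=[\rho_2(e),\rho_2(e')]$) and the mixed morphism condition and the mixed Jacobi identity hold. 3. Let $(\Pi,R,H)$ be a twisted R-Poisson structure of order $n+1$ on $M$: $\Pi$ is a bivector field with $[\Pi,\Pi]=0$, $H$ is a closed $(n+2)$-form and $R$ is an $(n+1)$-vector field with $[\Pi,R]=(-1)^{n+1}\langle\Pi^{\otimes(n+2)},H\rangle$. Here $H$ is contracted with the first indices of the bivectors, and $[\cdot,\cdot]$ is the Schouten–Nijenhuis bracket, normalised for a $p$-vector $U=\frac1{p!}U^{\mu_1\dots\mu_p}\partial_{\mu_1}\wedge\dots\wedge\partial_{\mu_p}$ and a $q$-vector $V$ by $$[U,V]=\tfrac{(-1)^p}{p!\,q!}\Big(q\,V^{\kappa\nu_2\dots\nu_q}\partial_\kappa U^{\mu_1\dots\mu_p}\,\partial_{\mu_1}\wedge\dots\wedge\partial_{\mu_p}\wedge\partial_{\nu_2}\wedge\dots\wedge\partial_{\nu_q}+(-1)^pp\,U^{\kappa\mu_2\dots\mu_p}\partial_\kappa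 V^{\nu_1\dots\nu_q}\,\partial_{\mu_2}\wedge\dots\wedge\partial_{\mu_p}\wedge\partial_{\nu_1}\wedge\dots\wedge\partial_{\nu_q}\Big).$$ Let $(x^\mu,a_\mu,y^\mu,z_\mu)$, of degrees $(0,1,n-1,n)$, be the coordinates of $T^*[n]T^*[1]M$ induced by a chart; under a change of chart, with $g_\mu{}^\nu=\partial x^\nu/\partial x'^\mu$, $a'_\mu=g_\mu{}^\nu a_\nu$, $y'^\mu=\frac{\partial x'^\mu}{\partial x^\nu}y^\nu$, $z'_\mu=g_\mu{}^\nu z_\nu+(-1)^n\partial_\lambda g_\mu{}^\nu\,a_\nu y^\lambda$. Put $f_\mu{}^{\nu_1\dots\nu_{n+1}}=\partial_\mu R^{\nu_1\dots\nu_{n+1}}-\Pi^{\nu_1\kappa_1}\cdots\Pi^{\nu_{n+1}\kappa_{n+1}}H_{\mu\kappa_1\dots\kappa_{n+1}}$ and $$Q_H^{RP_n}=\Pi^{\mu\nu}a_\mu\frac{\partial}{\partial x^\nu}-\tfrac12\partial_\rho\Pi^{\mu\nu}a_\mu a_\nu\frac{\partial}{\partial a_\rho}+\Big((-1)^n\Pi^{\nu\mu}z_\nu-\partial_\nu\Pi^{\mu\kappa}a_\kappa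 y^\nu+\tfrac1{n!}R^{\mu\nu_1\dots\nu_n}a_{\nu_1}\cdots a_{\nu_n}\Big)\frac{\partial}{\partial y^\mu}$$ $$\qquad-\Big(\partial_\mu\Pi^{\nu\kappa}a_\nu z_\kappa+\tfrac{(-1)^n}2\partial_\mu\partial_\nu\Pi^{\kappa\lambda}y^\nu a_\kappa a_\lambda-\tfrac{(-1)^n}{(n+1)!}f_\mu{}^{\nu_1\dots\nu_{n+1}}a_{\nu_1}\cdots a_{\nu_{n+1}}\Big)\frac{\partial}{\partial z_\mu}.$$ These local expressions define a vector field $Q_H^{RP_n}$ of degree $1$ on $T^*[n]T^*[1]M$, and $(Q_H^{RP_n})^2=0$. -/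

import Mathlib

open scoped Manifold ContDiff Bundle

noncomputable section

namespace GappedLie

/-! ### Smooth functions on an open subset of `ℝ^d` -/

/-- The space `ℝ^d` in which coordinates take their values. -/
abbrev Euc (d : ℕ) : Type := EuclideanSpace ℝ (Fin d)

/-- The algebra `C^∞(V)` of smooth real functions on an open subset `V` of `ℝ^d`. -/
def smoothFun {d : ℕ} (V : TopologicalSpace.Opens (Euc d)) : Subalgebra ℝ (V → ℝ) where
  carrier := {f | ∃ g : Euc d → ℝ, ContDiffOn ℝ ∞ g V ∧ ∀ y : V, f y = g y}
  mul_mem' := by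
    rintro f f' ⟨g, hg, h⟩ ⟨g', hg', h'⟩
    exact ⟨g * g', hg.mul hg', fun y => by simp [h y, h' y]⟩
  add_mem' := by
    rintro f f' ⟨g, hg, h⟩ ⟨g', hg', h'⟩
    exact ⟨g + g', hg.add hg', fun y => by simp [h y, h' y]⟩
  algebraMap_mem' := by
    intro c
    exact ⟨fun _ => c, contDiffOn_const, fun y => by simp⟩

/-- The partial derivative `∂f/∂x^μ` at a point of `V` of a function `f` on the open set `V`. -/
def pderivAt {d : ℕ} {V : TopologicalSpace.Opens (Euc d)} (μ : Fin d) (f : V → ℝ) (y : V) : ℝ :=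
  fderiv ℝ (Function.extend Subtype.val f 0) (y : Euc d) (EuclideanSpace.single μ 1)

theorem pderivAt_eq {d : ℕ} {V : TopologicalSpace.Opens (Euc d)} (μ : Fin d) {f : V → ℝ}
    {g : Euc d → ℝ} (h : ∀ y : V, f y = g y) (y : V) :
    pderivAt μ f y = fderiv ℝ g (y : Euc d) (EuclideanSpace.single μ 1) := by
  have : Function.extend Subtype.val f 0 =ᶠ[nhds (y : Euc d)] g := by
    filter_upwards [V.isOpen.mem_nhds y.2] with z hz
    have := Subtype.val_injective.extend_apply f 0 (⟨z, hz⟩ : V)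
    rw [← h ⟨z, hz⟩]
    exact this
  unfold pderivAt
  rw [this.fderiv_eq]

theorem pderivAt_mem {d : ℕ} {V : TopologicalSpace.Opens (Euc d)} (μ : Fin d) {f : V → ℝ}
    (hf : f ∈ smoothFun V) : pderivAt μ f ∈ smoothFun V := by
  obtain ⟨g, hg, h⟩ := hf
  refine ⟨fun y => fderiv ℝ g y (EuclideanSpace.single μ 1), ?_, pderivAt_eq μ h⟩
  exact (hg.fderiv_of_isOpen V.isOpen (m := ∞) (by simp)).clm_apply contDiffOn_const

theorem exists_extension_of_mem {d : ℕ} {V : TopologicalSpace.Opens (Euc d)} {f : V → ℝ}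
    (hf : f ∈ smoothFun V) :
    ∃ g : Euc d → ℝ, (∀ y : V, DifferentiableAt ℝ g y) ∧ ∀ y : V, f y = g y := by
  obtain ⟨g, hg, h⟩ := hf
  exact ⟨g, fun y => (hg.contDiffAt (V.isOpen.mem_nhds y.2)).differentiableAt (by simp), h⟩

theorem pderivAt_add {d : ℕ} {V : TopologicalSpace.Opens (Euc d)} (μ : Fin d) {f f' : V → ℝ}
    (hf : f ∈ smoothFun V) (hf' : f' ∈ smoothFun V) :
    pderivAt μ (f + f') = pderivAt μ f + pderivAt μ f' := by
  obtain ⟨g, hg, h⟩ := exists_extension_of_mem hf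
  obtain ⟨g', hg', h'⟩ := exists_extension_of_mem hf'
  funext y
  rw [pderivAt_eq μ (g := g + g') (fun z => by simp [h z, h' z]) y, Pi.add_apply,
    pderivAt_eq μ h, pderivAt_eq μ h', fderiv_add (hg y) (hg' y)]
  simp

theorem pderivAt_smul {d : ℕ} {V : TopologicalSpace.Opens (Euc d)} (μ : Fin d) (c : ℝ)
    {f : V → ℝ} (hf : f ∈ smoothFun V) : pderivAt μ (c • f) = c • pderivAt μ f := by
  obtain ⟨g, hg, h⟩ := exists_extension_of_mem hf
  funext y
  rw [pderivAt_eq μ (g := c • g) (fun z => by simp [h z]) y, Pi.smul_apply,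
    pderivAt_eq μ h, fderiv_const_smul (hg y)]
  simp

theorem pderivAt_mul {d : ℕ} {V : TopologicalSpace.Opens (Euc d)} (μ : Fin d) {f f' : V → ℝ}
    (hf : f ∈ smoothFun V) (hf' : f' ∈ smoothFun V) :
    pderivAt μ (f * f') = f * pderivAt μ f' + f' * pderivAt μ f := by
  obtain ⟨g, hg, h⟩ := exists_extension_of_mem hf
  obtain ⟨g', hg', h'⟩ := exists_extension_of_mem hf'
  funext y
  rw [pderivAt_eq μ (g := g * g') (fun z => by simp [h z, h' z]) y, Pi.add_apply, Pi.mul_apply,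
    Pi.mul_apply, pderivAt_eq μ h, pderivAt_eq μ h', fderiv_mul (hg y) (hg' y), h y, h' y]
  simp

/-- The partial derivative `∂/∂x^μ` as a linear endomorphism of `C^∞(V)`. -/
def pderivLinear {d : ℕ} (V : TopologicalSpace.Opens (Euc d)) (μ : Fin d) :
    smoothFun V →ₗ[ℝ] smoothFun V where
  toFun f := ⟨pderivAt μ f.1, pderivAt_mem μ f.2⟩
  map_add' f f' := Subtype.ext (pderivAt_add μ f.2 f'.2)
  map_smul' c f := Subtype.ext (pderivAt_smul μ c f.2)

/-- The partial derivative `∂/∂x^μ` as a derivation of `C^∞(V)`. -/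
def pderiv {d : ℕ} (V : TopologicalSpace.Opens (Euc d)) (μ : Fin d) :
    Derivation ℝ (smoothFun V) (smoothFun V) :=
  Derivation.mk' (pderivLinear V μ) fun f f' => Subtype.ext (pderivAt_mul μ f.2 f'.2)

/-! ### The graded algebra of functions of a coordinate chart -/

/-- The coordinates of positive degree on `T[n-1]E[1]`: `a^a` (degree `1`), `ẋ^μ`
(degree `n - 1`) and `ȧ^a` (degree `n`). -/
inductive Gen (d r : ℕ) : Type
  | a (i : Fin r) : Gen d r
  | xdot (μ : Fin d) : Gen d r
  | adot (i : Fin r) : Gen d r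
  deriving DecidableEq, Fintype

/-- The degree of a coordinate of positive degree. -/
def Gen.deg (n : ℕ) {d r : ℕ} : Gen d r → ℕ
  | .a _ => 1
  | .xdot _ => n - 1
  | .adot _ => n

/-- The relations which say that `C^∞` functions multiply as they should and are central, and that
the coordinates of positive degree commute in the graded sense. -/
inductive GrRel (n d r : ℕ) (A : Type*) [CommRing A] [Algebra ℝ A] :
    FreeAlgebra ℝ (A ⊕ Gen d r) → FreeAlgebra ℝ (A ⊕ Gen d r) → Prop
  | add (f g : A) : GrRel n d r A (FreeAlgebra.ι ℝ (.inl (f + g)))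
      (FreeAlgebra.ι ℝ (.inl f) + FreeAlgebra.ι ℝ (.inl g))
  | mul (f g : A) : GrRel n d r A (FreeAlgebra.ι ℝ (.inl (f * g)))
      (FreeAlgebra.ι ℝ (.inl f) * FreeAlgebra.ι ℝ (.inl g))
  | const (c : ℝ) : GrRel n d r A (FreeAlgebra.ι ℝ (.inl (algebraMap ℝ A c)))
      (algebraMap ℝ (FreeAlgebra ℝ (A ⊕ Gen d r)) c)
  | central (f : A) (g : Gen d r) : GrRel n d r A
      (FreeAlgebra.ι ℝ (.inr g) * FreeAlgebra.ι ℝ (.inl f))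
      (FreeAlgebra.ι ℝ (.inl f) * FreeAlgebra.ι ℝ (.inr g))
  | comm (g h : Gen d r) : GrRel n d r A
      (FreeAlgebra.ι ℝ (.inr g) * FreeAlgebra.ι ℝ (.inr h))
      ((-1 : ℝ) ^ (g.deg n * h.deg n) • (FreeAlgebra.ι ℝ (.inr h) * FreeAlgebra.ι ℝ (.inr g)))

/-- The free graded commutative algebra over `A` on the coordinates of positive degree. With
`A = C^∞(V)` this is the algebra of functions on the coordinate chart of `T[n-1]E[1]`
(or of `T^*[n]T^*[1]M`) over the coordinate domain `V`. -/
abbrev GrAlg (n d r : ℕ) (A : Type*) [CommRing A] [Algebra ℝ A] : Type _ :=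
  RingQuot (GrRel n d r A)

namespace GrAlg

variable {n d r : ℕ} {A : Type*} [CommRing A] [Algebra ℝ A]

/-- The quotient map from the free algebra. -/
def mk : FreeAlgebra ℝ (A ⊕ Gen d r) →ₐ[ℝ] GrAlg n d r A :=
  RingQuot.mkAlgHom ℝ (GrRel n d r A)

/-- A function of degree `0`. -/
def fn (f : A) : GrAlg n d r A := mk (FreeAlgebra.ι ℝ (.inl f))

/-- A coordinate of positive degree. -/
def gen (g : Gen d r) : GrAlg n d r A := mk (FreeAlgebra.ι ℝ (.inr g))

theorem mk_rel {x y : FreeAlgebra ℝ (A ⊕ Gen d r)} (h : GrRel n d r A x y) :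
    (mk x : GrAlg n d r A) = mk y :=
  RingQuot.mkAlgHom_rel ℝ h

theorem fn_add (f g : A) : (fn (f + g) : GrAlg n d r A) = fn f + fn g := by
  simpa [fn] using mk_rel (n := n) (.add f g : GrRel n d r A _ _)

theorem fn_mul (f g : A) : (fn (f * g) : GrAlg n d r A) = fn f * fn g := by
  simpa [fn] using mk_rel (n := n) (.mul f g : GrRel n d r A _ _)

theorem fn_algebraMap (c : ℝ) :
    (fn (algebraMap ℝ A c) : GrAlg n d r A) = algebraMap ℝ (GrAlg n d r A) c := by
  have := mk_rel (n := n) (.const c : GrRel n d r A _ _)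
  rwa [AlgHom.commutes] at this

theorem fn_zero : (fn (0 : A) : GrAlg n d r A) = 0 := by
  simpa using fn_algebraMap (n := n) (d := d) (r := r) (A := A) 0

theorem gen_mul_fn (f : A) (g : Gen d r) :
    (gen g * fn f : GrAlg n d r A) = fn f * gen g := by
  simpa [fn, gen] using mk_rel (n := n) (.central f g : GrRel n d r A _ _)

theorem gen_mul_gen (g h : Gen d r) :
    (gen g * gen h : GrAlg n d r A) = (-1 : ℝ) ^ (g.deg n * h.deg n) • (gen h * gen g) := by
  simpa [gen] using mk_rel (n := n) (.comm g h : GrRel n d r A _ _)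

/-- The universal property of the algebra. -/
def lift {B : Type*} [Ring B] [Algebra ℝ B] (φ : A → B) (v : Gen d r → B)
    (hadd : ∀ f g, φ (f + g) = φ f + φ g) (hmul : ∀ f g, φ (f * g) = φ f * φ g)
    (hconst : ∀ c, φ (algebraMap ℝ A c) = algebraMap ℝ B c)
    (hcentral : ∀ f g, v g * φ f = φ f * v g)
    (hcomm : ∀ g h, v g * v h = (-1 : ℝ) ^ (g.deg n * h.deg n) • (v h * v g)) :
    GrAlg n d r A →ₐ[ℝ] B :=
  RingQuot.liftAlgHom ℝ ⟨FreeAlgebra.lift ℝ (Sum.elim φ v), by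
    intro x y h
    cases h with
    | add f g => simp [hadd]
    | mul f g => simp [hmul]
    | const c => simp [hconst]
    | central f g => simp [hcentral]
    | comm g h => simp [hcomm g h]⟩

section lift

variable {B : Type*} [Ring B] [Algebra ℝ B] (φ : A → B) (v : Gen d r → B)
    (hadd : ∀ f g, φ (f + g) = φ f + φ g) (hmul : ∀ f g, φ (f * g) = φ f * φ g)
    (hconst : ∀ c, φ (algebraMap ℝ A c) = algebraMap ℝ B c)
    (hcentral : ∀ f g, v g * φ f = φ f * v g)
    (hcomm : ∀ g h, v g * v h = (-1 : ℝ) ^ (g.deg n * h.deg n) • (v h * v g))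

theorem lift_fn (f : A) : lift φ v hadd hmul hconst hcentral hcomm (fn f) = φ f := by
  unfold lift fn mk
  rw [RingQuot.liftAlgHom_mkAlgHom_apply]
  simp

theorem lift_gen (g : Gen d r) : lift φ v hadd hmul hconst hcentral hcomm (gen g) = v g := by
  unfold lift gen mk
  rw [RingQuot.liftAlgHom_mkAlgHom_apply]
  simp

end lift

/-- Algebra homomorphisms out of the graded algebra agree if they agree on functions and on
coordinates. -/
theorem hom_ext {B : Type*} [Ring B] [Algebra ℝ B] {S T : GrAlg n d r A →ₐ[ℝ] B}
    (hf : ∀ f, S (fn f) = T (fn f)) (hg : ∀ g, S (gen g) = T (gen g)) : S = T := by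
  apply RingQuot.ringQuot_ext'
  apply FreeAlgebra.hom_ext
  funext x
  rcases x with f | g
  · exact hf f
  · exact hg g

/-- The parity automorphism, `u ↦ (-1)^{|u|} u` on homogeneous elements. -/
def parity : GrAlg n d r A →ₐ[ℝ] GrAlg n d r A :=
  lift fn (fun g => (-1 : ℝ) ^ g.deg n • gen g) fn_add fn_mul fn_algebraMap
    (fun f g => by simp [gen_mul_fn])
    (fun g h => by
      simp only [smul_mul_smul_comm]
      rw [gen_mul_gen g h, smul_comm,
        mul_comm ((-1 : ℝ) ^ g.deg n) ((-1 : ℝ) ^ h.deg n)])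

/-- The `ℝ`-subspace of elements of degree `k`: the span of the products of a function and of
coordinates whose degrees add up to `k`. -/
def homogeneous (k : ℕ) : Submodule ℝ (GrAlg n d r A) :=
  Submodule.span ℝ {u | ∃ (f : A) (l : List (Gen d r)),
    (l.map (Gen.deg n)).sum = k ∧ u = fn f * (l.map gen).prod}

/-- All coordinates: `x^μ`, of degree `0`, and those of positive degree. -/
abbrev Coord (d r : ℕ) : Type := Fin d ⊕ Gen d r

/-- The degree of a coordinate. -/
def coordDeg (n : ℕ) {d r : ℕ} : Coord d r → ℕ
  | .inl _ => 0
  | .inr g => g.deg n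

/-- The derivative of a function of degree `0` in the direction of a coordinate. -/
def baseDeriv (D : Fin d → Derivation ℝ A A) : Coord d r → A → A
  | .inl μ, f => D μ f
  | .inr _, _ => 0

/-- The derivative of a coordinate of positive degree in the direction of a coordinate. -/
def genDeriv : Coord d r → Gen d r → ℝ
  | .inl _, _ => 0
  | .inr g, h => if g = h then 1 else 0

theorem tri_mul {B : Type*} [Ring B] (a b c a' b' c' : B) :
    (!![a, b; 0, c] : Matrix (Fin 2) (Fin 2) B) * !![a', b'; 0, c'] =
      !![a * a', a * b' + b * c'; 0, c * c'] := by
  simp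

theorem tri_smul {B : Type*} [Ring B] [Algebra ℝ B] (k : ℝ) (a b c : B) :
    k • (!![a, b; 0, c] : Matrix (Fin 2) (Fin 2) B) = !![k • a, k • b; 0, k • c] := by
  ext i j
  fin_cases i <;> fin_cases j <;> simp

theorem partialHom_aux (c : Coord d r) (g h : Gen d r) :
    ((-1 : ℝ) ^ (coordDeg n c * g.deg n) • gen g * algebraMap ℝ _ (genDeriv c h) +
      algebraMap ℝ _ (genDeriv c g) * gen h : GrAlg n d r A) =
    (-1 : ℝ) ^ (g.deg n * h.deg n) •
      ((-1 : ℝ) ^ (coordDeg n c * h.deg n) • gen h * algebraMap ℝ _ (genDeriv c g) +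
        algebraMap ℝ _ (genDeriv c h) * gen g) := by
  have hs : ∀ k : ℕ, (-1 : ℝ) ^ k * (-1 : ℝ) ^ k = 1 := fun k => by
    rw [← mul_pow]; simp
  rcases c with μ | k
  · simp [genDeriv]
  · by_cases h1 : k = g <;> by_cases h2 : k = h
    · subst h1; subst h2
      simp [genDeriv, coordDeg, smul_add, smul_smul, hs, add_comm]
    · subst h1
      simp [genDeriv, coordDeg, h2, smul_smul, hs]
    · subst h2
      simp [genDeriv, coordDeg, h1, mul_comm]
    · simp [genDeriv, h1, h2]

/-- The algebra map `u ↦ !![σ u, ∂u; 0, u]`, where `∂` is the left partial derivative along the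
coordinate `c` and `σ u = (-1)^{|c| |u|} u`. That it is multiplicative is the graded Leibniz rule
for `∂`. -/
def partialHom (D : Fin d → Derivation ℝ A A) (c : Coord d r) :
    GrAlg n d r A →ₐ[ℝ] Matrix (Fin 2) (Fin 2) (GrAlg n d r A) :=
  lift (fun f => !![fn f, fn (baseDeriv D c f); 0, fn f])
    (fun g => !![(-1 : ℝ) ^ (coordDeg n c * g.deg n) • gen g,
      algebraMap ℝ _ (genDeriv c g); 0, gen g])
    (fun f g => by
      ext i j
      fin_cases i <;> fin_cases j <;> cases c <;> simp [baseDeriv, fn_add, fn_zero])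
    (fun f g => by
      ext i j
      fin_cases i <;> fin_cases j <;> cases c <;>
        simp [baseDeriv, fn_add, fn_mul, fn_zero, Matrix.mul_apply]
      rw [← fn_mul, ← fn_mul, mul_comm])
    (fun c' => by
      ext i j
      fin_cases i <;> fin_cases j <;> cases c <;>
        simp [baseDeriv, fn_zero, fn_algebraMap, Matrix.algebraMap_matrix_apply])
    (fun f g => by
      ext i j
      fin_cases i <;> fin_cases j <;> cases c <;>
        simp [baseDeriv, fn_zero, gen_mul_fn, genDeriv, coordDeg, Matrix.mul_apply])
    (fun g h => by
      rw [tri_mul, tri_mul, tri_smul, partialHom_aux c g h, smul_mul_smul_comm,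
        smul_mul_smul_comm, gen_mul_gen g h, smul_comm,
        mul_comm ((-1 : ℝ) ^ (coordDeg n c * g.deg n))])

/-- The left partial derivative `∂/∂c` of the graded algebra along the coordinate `c`, where the
derivations `D μ` play the part of `∂/∂x^μ` on functions of degree `0`. -/
def partialDeriv (D : Fin d → Derivation ℝ A A) (c : Coord d r) :
    GrAlg n d r A →ₗ[ℝ] GrAlg n d r A :=
  (Matrix.entryLinearMap ℝ (GrAlg n d r A) (0 : Fin 2) (1 : Fin 2)).comp
    (partialHom D c).toLinearMap

theorem partialDeriv_fn (D : Fin d → Derivation ℝ A A) (c : Coord d r) (f : A) :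
    (partialDeriv D c (fn f) : GrAlg n d r A) = fn (baseDeriv D c f) := by
  simp [partialDeriv, partialHom, lift_fn]

theorem partialDeriv_gen (D : Fin d → Derivation ℝ A A) (c : Coord d r) (g : Gen d r) :
    (partialDeriv D c (gen g) : GrAlg n d r A) = algebraMap ℝ _ (genDeriv c g) := by
  simp [partialDeriv, partialHom, lift_gen]

/-- The vector field `∑_c X^c ∂/∂c` with the components `X^c`. -/
def vectorField (D : Fin d → Derivation ℝ A A) (X : Coord d r → GrAlg n d r A) :
    GrAlg n d r A →ₗ[ℝ] GrAlg n d r A :=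
  ∑ c, (LinearMap.mulLeft ℝ (X c)).comp (partialDeriv D c)

/-- `Q` is a vector field of degree `1`: a graded derivation which raises the degree by `1`. -/
structure IsDegreeOneVectorField (Q : GrAlg n d r A →ₗ[ℝ] GrAlg n d r A) : Prop where
  leibniz : ∀ u v, Q (u * v) = Q u * v + parity u * Q v
  degree : ∀ k, ∀ u ∈ homogeneous k, Q u ∈ homogeneous (k + 1)

/-- The monomial `a^{I 0} a^{I 1} ⋯` in the coordinates of degree `1`. -/
def mono {k : ℕ} (I : Fin k → Fin r) : GrAlg n d r A :=
  (List.ofFn fun i => (gen (.a (I i)) : GrAlg n d r A)).prod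

/-- The components of the vector field on `T[n-1]E[1]` with anchor components `ρ a μ = ρ_a^μ`,
`ρn I μ = ρ_I^μ` and structure functions `C a b c = C_{ab}^c`, `Cn I c = C_I^c`. -/
def qHat (D : Fin d → Derivation ℝ A A) (ρ : Fin r → Fin d → A)
    (ρn : (Fin n → Fin r) → Fin d → A) (C : Fin r → Fin r → Fin r → A)
    (Cn : (Fin (n + 1) → Fin r) → Fin r → A) : Coord d r → GrAlg n d r A
  | .inl μ => ∑ a, fn (ρ a μ) * gen (.a a)
  | .inr (.a c) => -((1 / 2 : ℝ) • ∑ a, ∑ b, fn (C a b c) * gen (.a a) * gen (.a b))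
  | .inr (.xdot μ) =>
      (∑ a, fn (ρ a μ) * gen (.adot a))
      + (∑ ν, ∑ a, fn (D ν (ρ a μ)) * gen (.a a) * gen (.xdot ν))
      + (1 / (n.factorial : ℝ)) • ∑ I : Fin n → Fin r, fn (ρn I μ) * mono I
  | .inr (.adot c) =>
      -((∑ a, ∑ b, fn (C a b c) * gen (.a a) * gen (.adot b))
        + (1 / 2 : ℝ) • (∑ μ, ∑ a, ∑ b,
            fn (D μ (C a b c)) * gen (.xdot μ) * gen (.a a) * gen (.a b))
        + ((-1 : ℝ) ^ (n + 1) / ((n + 1).factorial : ℝ)) •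
            ∑ I : Fin (n + 1) → Fin r, fn (Cn I c) * mono I)

/-- The algebra map `T` from functions in primed coordinates to functions in unprimed ones is the
change of coordinates `f ↦ tr f`, `a'^b = g^b_a a^a`, `ẋ'^μ = (∂x'^μ/∂x^ν) ẋ^ν`,
`ȧ'^b = g^b_a ȧ^a + s ∂_ν g^b_a a^a ẋ^ν`, where `x' μ` is the `μ`-th primed coordinate of degree
`0` as a function of the unprimed ones and `g b a = g^b_a`. -/
structure IsCoordChange {A' : Type*} [CommRing A'] [Algebra ℝ A'] (s : ℝ)
    (D : Fin d → Derivation ℝ A A) (tr : A' → A) (x' : Fin d → A) (g : Fin r → Fin r → A)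
    (T : GrAlg n d r A' →ₐ[ℝ] GrAlg n d r A) : Prop where
  fn : ∀ f, T (fn f) = GrAlg.fn (tr f)
  a : ∀ b, T (gen (.a b)) = ∑ a, GrAlg.fn (g b a) * gen (.a a)
  xdot : ∀ μ, T (gen (.xdot μ)) = ∑ ν, GrAlg.fn (D ν (x' μ)) * gen (.xdot ν)
  adot : ∀ b, T (gen (.adot b)) = (∑ a, GrAlg.fn (g b a) * gen (.adot a))
    + s • ∑ ν, ∑ a, GrAlg.fn (D ν (g b a)) * gen (.a a) * gen (.xdot ν)

end GrAlg

/-! ### Charts -/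

section Chart

variable {d : ℕ} {M : Type*} [TopologicalSpace M] [ChartedSpace (Euc d) M]

/-- The domain of the coordinates of a chart, as an open subset of `ℝ^d`. -/
def chartTarget (φ : OpenPartialHomeomorph M (Euc d)) : TopologicalSpace.Opens (Euc d) :=
  ⟨φ.target, φ.open_target⟩

/-- The `μ`-th component `dx^μ(v)` of a tangent vector `v` in the chart `φ`. -/
def dx (φ : OpenPartialHomeomorph M (Euc d)) (x : M) (μ : Fin d) :
    TangentSpace 𝓘(ℝ, Euc d) x →ₗ[ℝ] ℝ :=
  ((EuclideanSpace.proj μ : Euc d →L[ℝ] ℝ).comp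
    (mfderiv 𝓘(ℝ, Euc d) 𝓘(ℝ, Euc d) φ x : TangentSpace 𝓘(ℝ, Euc d) x →L[ℝ] Euc d)).toLinearMap

/-- The coordinate vector `∂/∂x^μ` of the chart `φ` at the point with coordinates `y`. -/
def ddx (φ : OpenPartialHomeomorph M (Euc d)) (y : Euc d) (μ : Fin d) :
    TangentSpace 𝓘(ℝ, Euc d) (φ.symm y) :=
  mfderiv 𝓘(ℝ, Euc d) 𝓘(ℝ, Euc d) φ.symm y (EuclideanSpace.single μ (1 : ℝ) : Euc d)

/-- A function which is smooth on the domain of a chart, as a function of the coordinates. -/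
def inCoord [IsManifold 𝓘(ℝ, Euc d) ∞ M]
    {φ : OpenPartialHomeomorph M (Euc d)}
    (hφ : φ ∈ IsManifold.maximalAtlas 𝓘(ℝ, Euc d) ∞ M) (h : M → ℝ)
    (hh : ContMDiffOn 𝓘(ℝ, Euc d) 𝓘(ℝ, ℝ) ∞ h φ.source) : smoothFun (chartTarget φ) :=
  ⟨fun y => h (φ.symm y), fun y => h (φ.symm y), by
    rw [← contMDiffOn_iff_contDiffOn]
    exact hh.comp (contMDiffOn_symm_of_mem_maximalAtlas hφ) (fun y hy => φ.map_target hy),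
    fun _ => rfl⟩

theorem contMDiffOn_extend {φ : OpenPartialHomeomorph M (Euc d)}
    (hφ : φ ∈ IsManifold.maximalAtlas 𝓘(ℝ, Euc d) ∞ M) (f : smoothFun (chartTarget φ)) :
    ContMDiffOn 𝓘(ℝ, Euc d) 𝓘(ℝ, ℝ) ∞
      (fun x => Function.extend Subtype.val f.1 0 (φ x)) φ.source := by
  obtain ⟨g, hg, h⟩ := f.2
  have : ContMDiffOn 𝓘(ℝ, Euc d) 𝓘(ℝ, ℝ) ∞ (fun x => g (φ x)) φ.source :=
    (contMDiffOn_iff_contDiffOn.2 hg).comp (contMDiffOn_of_mem_maximalAtlas hφ)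
      (fun x hx => φ.map_source hx)
  refine this.congr fun x hx => ?_
  have := Subtype.val_injective.extend_apply f.1 0 (⟨φ x, φ.map_source hx⟩ : chartTarget φ)
  exact this.trans (h _)

/-- A function of the coordinates of the chart `φ'`, rewritten as a function of the coordinates of
a chart `φ` with a smaller domain. -/
def transfer [IsManifold 𝓘(ℝ, Euc d) ∞ M]
    {φ φ' : OpenPartialHomeomorph M (Euc d)}
    (hφ : φ ∈ IsManifold.maximalAtlas 𝓘(ℝ, Euc d) ∞ M)
    (hφ' : φ' ∈ IsManifold.maximalAtlas 𝓘(ℝ, Euc d) ∞ M) (h : φ.source ⊆ φ'.source)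
    (f : smoothFun (chartTarget φ')) : smoothFun (chartTarget φ) :=
  inCoord hφ (fun x => Function.extend Subtype.val f.1 0 (φ' x)) ((contMDiffOn_extend hφ' f).mono h)

theorem contMDiffOn_coord {φ : OpenPartialHomeomorph M (Euc d)}
    (hφ : φ ∈ IsManifold.maximalAtlas 𝓘(ℝ, Euc d) ∞ M) (μ : Fin d) :
    ContMDiffOn 𝓘(ℝ, Euc d) 𝓘(ℝ, ℝ) ∞ (fun x => φ x μ) φ.source :=
  (EuclideanSpace.proj μ : Euc d →L[ℝ] ℝ).contMDiff.comp_contMDiffOn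
    (contMDiffOn_of_mem_maximalAtlas hφ)

theorem contMDiffOn_dx [IsManifold 𝓘(ℝ, Euc d) ∞ M]
    {φ : OpenPartialHomeomorph M (Euc d)}
    (hφ : φ ∈ IsManifold.maximalAtlas 𝓘(ℝ, Euc d) ∞ M) (μ : Fin d)
    {X : (x : M) → TangentSpace 𝓘(ℝ, Euc d) x}
    (hX : ContMDiff 𝓘(ℝ, Euc d) 𝓘(ℝ, Euc d).tangent ∞
      (fun x => (⟨x, X x⟩ : TangentBundle 𝓘(ℝ, Euc d) M))) :
    ContMDiffOn 𝓘(ℝ, Euc d) 𝓘(ℝ, ℝ) ∞ (fun x => dx φ x μ (X x)) φ.source := by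
  have h1 := (contMDiffOn_of_mem_maximalAtlas hφ).contMDiffOn_tangentMapWithin
    (m := ∞) (n := ∞) (by simp) φ.open_source.uniqueMDiffOn
  have h2 := h1.comp hX.contMDiffOn (s := φ.source) (fun x hx => hx)
  have h3 := (contMDiff_snd_tangentBundle_modelSpace (Euc d) 𝓘(ℝ, Euc d) (n := ∞)).comp_contMDiffOn
    h2
  refine ((EuclideanSpace.proj μ : Euc d →L[ℝ] ℝ).contMDiff.comp_contMDiffOn h3).congr
    fun x hx => ?_
  simp only [dx, Function.comp, tangentMapWithin]
  rw [mfderivWithin_of_isOpen φ.open_source hx]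
  rfl

end Chart

/-! ### Anchors and brackets on a vector bundle -/

/-- The space `Γ(E)` of smooth sections of a vector bundle `E` of rank `r`. -/
abbrev Sec (d r : ℕ) {M : Type*} [TopologicalSpace M] [ChartedSpace (Euc d) M]
    (E : M → Type*) [∀ x, AddCommGroup (E x)] [∀ x, Module ℝ (E x)]
    [∀ x, TopologicalSpace (E x)] [TopologicalSpace (Bundle.TotalSpace (Euc r) E)]
    [FiberBundle (Euc r) E] : Type _ :=
  ContMDiffSection 𝓘(ℝ, Euc d) (Euc r) ∞ E

section Bundle

variable {n d r : ℕ} {M : Type*} [TopologicalSpace M] [ChartedSpace (Euc d) M]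
  {E : M → Type*} [∀ x, AddCommGroup (E x)] [∀ x, Module ℝ (E x)]
  [∀ x, TopologicalSpace (E x)] [TopologicalSpace (Bundle.TotalSpace (Euc r) E)]
  [FiberBundle (Euc r) E] [VectorBundle ℝ (Euc r) E]

/-- The product `f e` of a smooth function and a smooth section. -/
def fsmul (f : C^∞⟮𝓘(ℝ, Euc d), M; 𝓘(ℝ, ℝ), ℝ⟯) (e : Sec d r E) : Sec d r E :=
  ⟨fun x => f x • e x, f.contMDiff.smul_section e.contMDiff⟩

/-- The derivative `v(f)` of a smooth function along a tangent vector. -/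
def derivAlong (f : C^∞⟮𝓘(ℝ, Euc d), M; 𝓘(ℝ, ℝ), ℝ⟯) {x : M} (v : TangentSpace 𝓘(ℝ, Euc d) x) :
    ℝ :=
  mfderiv 𝓘(ℝ, Euc d) 𝓘(ℝ, ℝ) f x v

/-- The components of a smooth section in a smooth local frame are smooth. -/
theorem contMDiffOn_coeff {s : Fin r → (x : M) → E x} {u : Set M}
    (hu : IsOpen u) (hs : IsLocalFrameOn 𝓘(ℝ, Euc d) (Euc r) ∞ s u) (e : Sec d r E) (i : Fin r) :
    ContMDiffOn 𝓘(ℝ, Euc d) 𝓘(ℝ, ℝ) ∞ (fun x => hs.coeff i x (e x)) u := by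
  intro x₀ hx₀
  refine ContMDiffAt.contMDiffWithinAt ?_
  set t := trivializationAt (Euc r) E x₀ with ht
  have hxt : x₀ ∈ t.baseSet := FiberBundle.mem_baseSet_trivializationAt' x₀
  let A : M → Matrix (Fin r) (Fin r) ℝ := fun x => Matrix.of fun k j => (t ⟨x, s j x⟩).2 k
  let v : M → Fin r → ℝ := fun x k => (t ⟨x, e x⟩).2 k
  have hA : ∀ k j, ContMDiffAt 𝓘(ℝ, Euc d) 𝓘(ℝ, ℝ) ∞ (fun x => A x k j) x₀ := by
    intro k j
    have := ((hs.contMDiffOn j).contMDiffAt (hu.mem_nhds hx₀))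
    rw [Bundle.contMDiffAt_section] at this
    exact (EuclideanSpace.proj k : Euc r →L[ℝ] ℝ).contMDiff.contMDiffAt.comp x₀ this
  have hv : ∀ k, ContMDiffAt 𝓘(ℝ, Euc d) 𝓘(ℝ, ℝ) ∞ (fun x => v x k) x₀ := by
    intro k
    have := e.contMDiff x₀
    rw [Bundle.contMDiffAt_section] at this
    exact (EuclideanSpace.proj k : Euc r →L[ℝ] ℝ).contMDiff.contMDiffAt.comp x₀ this
  have hdet : ∀ B : M → Matrix (Fin r) (Fin r) ℝ,
      (∀ k j, ContMDiffAt 𝓘(ℝ, Euc d) 𝓘(ℝ, ℝ) ∞ (fun x => B x k j) x₀) →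
      ContMDiffAt 𝓘(ℝ, Euc d) 𝓘(ℝ, ℝ) ∞ (fun x => (B x).det) x₀ := by
    intro B hB
    simp only [Matrix.det_apply']
    refine ContMDiffAt.sum fun σ _ => contMDiffAt_const.mul ?_
    exact contMDiffAt_finsetProd fun k _ => hB _ _
  have key : ∀ x ∈ u ∩ t.baseSet, (A x).det ≠ 0 ∧
      (A x).det * hs.coeff i x (e x) = ((A x).updateCol i (v x)).det := by
    rintro x ⟨hxu, hxb⟩
    let L := t.linearEquivAt ℝ x hxb
    have hL : ∀ w : E x, (t ⟨x, w⟩).2 = L w := fun w => rfl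
    let b : Module.Basis (Fin r) ℝ (E x) := hs.toBasisAt hxu
    let b' := (b.map L)
    let c := (EuclideanSpace.basisFun (Fin r) ℝ).toBasis
    have hAb : A x = c.toMatrix b' := by
      ext k j
      simp [A, hL, Module.Basis.toMatrix_apply, c, b', b]
    have hu1 : IsUnit (A x).det := by
      rw [hAb]
      have := c.isUnit_det b'
      rwa [Module.Basis.det_apply] at this
    refine ⟨hu1.ne_zero, ?_⟩
    have hsum : (A x).mulVec (fun j => hs.coeff j x (e x)) = v x := by
      have h1 := hs.coeff_sum_eq (t := fun x => e x) hxu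
      funext k
      have h2 : v x k = (L (e x)) k := rfl
      rw [h2]
      conv_rhs => rw [h1]
      simp [Matrix.mulVec, dotProduct, A, hL, mul_comm]
    have := Matrix.cramer_apply (A x) (v x) i
    rw [← this, ← hsum, Matrix.cramer_eq_adjugate_mulVec, Matrix.mulVec_mulVec,
      Matrix.adjugate_mul]
    simp [Matrix.smul_mulVec]
  have hev : (fun x => hs.coeff i x (e x)) =ᶠ[nhds x₀]
      fun x => ((A x).det)⁻¹ * ((A x).updateCol i (v x)).det := by
    filter_upwards [(hu.inter t.open_baseSet).mem_nhds ⟨hx₀, hxt⟩] with x hx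
    obtain ⟨h1, h2⟩ := key x hx
    rw [← h2]
    field_simp
  refine ContMDiffAt.congr_of_eventuallyEq ?_ hev
  refine ContMDiffAt.mul ?_ (hdet _ ?_)
  · exact (contDiffAt_inv ℝ (key x₀ ⟨hx₀, hxt⟩).1).contMDiffAt.comp x₀ (hdet A hA)
  · intro k j
    by_cases h : j = i
    · subst h
      simpa using hv k
    · simpa [Matrix.updateCol_ne h] using hA k j

/-- The anchors and brackets `(E, b₂, b_{n+1}, ρ₂, ρ_{n+1})`: bundle maps `ρ₂ : E → TM` and
`ρ_{n+1} : ⋀ⁿ E → TM`, the latter as an alternating map, and skew-symmetric operations on sections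
which satisfy the two Leibniz rules. -/
structure AnchoredBrackets (n d r : ℕ) {M : Type*} [TopologicalSpace M] [ChartedSpace (Euc d) M]
    [IsManifold 𝓘(ℝ, Euc d) ∞ M]
    (E : M → Type*) [∀ x, AddCommGroup (E x)] [∀ x, Module ℝ (E x)]
    [∀ x, TopologicalSpace (E x)] [TopologicalSpace (Bundle.TotalSpace (Euc r) E)]
    [FiberBundle (Euc r) E] [VectorBundle ℝ (Euc r) E] where
  rho2 : ∀ x, E x →ₗ[ℝ] TangentSpace 𝓘(ℝ, Euc d) x
  rho2_smooth : ∀ e : Sec d r E, ContMDiff 𝓘(ℝ, Euc d) 𝓘(ℝ, Euc d).tangent ∞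
    (fun x => (⟨x, rho2 x (e x)⟩ : TangentBundle 𝓘(ℝ, Euc d) M))
  rhoN : ∀ x, E x [⋀^Fin n]→ₗ[ℝ] TangentSpace 𝓘(ℝ, Euc d) x
  rhoN_smooth : ∀ e : Fin n → Sec d r E, ContMDiff 𝓘(ℝ, Euc d) 𝓘(ℝ, Euc d).tangent ∞
    (fun x => (⟨x, rhoN x (fun i => e i x)⟩ : TangentBundle 𝓘(ℝ, Euc d) M))
  b2 : Sec d r E [⋀^Fin 2]→ₗ[ℝ] Sec d r E
  bN : Sec d r E [⋀^Fin (n + 1)]→ₗ[ℝ] Sec d r E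
  leibniz2 : ∀ (f : C^∞⟮𝓘(ℝ, Euc d), M; 𝓘(ℝ, ℝ), ℝ⟯) (e e' : Sec d r E) (x : M),
    b2 ![e, fsmul f e'] x = f x • b2 ![e, e'] x
      + derivAlong f (rho2 x (e x)) • e' x
  leibnizN : ∀ (f : C^∞⟮𝓘(ℝ, Euc d), M; 𝓘(ℝ, ℝ), ℝ⟯) (e : Sec d r E)
    (e' : Fin n → Sec d r E) (x : M),
    bN (Fin.cons (fsmul f e) e') x = f x • bN (Fin.cons e e') x
      + ((-1 : ℝ) ^ n * derivAlong f (rhoN x (fun i => e' i x))) • e x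

namespace AnchoredBrackets

variable [IsManifold 𝓘(ℝ, Euc d) ∞ M] (S : AnchoredBrackets n d r E)

/-- The Jacobi identity of the binary bracket. -/
def Jacobi : Prop :=
  ∀ e₁ e₂ e₃ : Sec d r E,
    S.b2 ![S.b2 ![e₁, e₂], e₃] + S.b2 ![S.b2 ![e₂, e₃], e₁] + S.b2 ![S.b2 ![e₃, e₁], e₂] = 0

/-- The anchor of the binary bracket is a homomorphism, `ρ₂(b₂(e, e')) = [ρ₂(e), ρ₂(e')]`. -/
def AnchorHom : Prop :=
  ∀ (e e' : Sec d r E) (x : M), S.rho2 x (S.b2 ![e, e'] x) =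
    VectorField.mlieBracket 𝓘(ℝ, Euc d) (fun y => S.rho2 y (e y)) (fun y => S.rho2 y (e' y)) x

/-- The axioms of the ground Lie algebroid `(E, b₂, ρ₂)`; the Leibniz rule is part of the data. -/
def IsGroundLieAlgebroid : Prop :=
  S.Jacobi ∧ S.AnchorHom

/-- The mixed morphism condition. The sum over all permutations with the factor `1 / (2 (n-1)!)`
is the signed sum over all pairs of arguments of `b₂`. -/
def MixedMorphism : Prop :=
  ∀ (e : Fin (n + 1) → Sec d r E) (x : M),
    S.rho2 x (S.bN e x)
      + ((-1 : ℝ) ^ (n + 1) / (2 * ((n - 1).factorial : ℝ))) •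
          ∑ σ : Equiv.Perm (Fin (n + 1)), ((Equiv.Perm.sign σ : ℤ) : ℝ) •
            S.rhoN x (fun i : Fin n =>
              if (i : ℕ) = 0 then S.b2 ![e (σ 0), e (σ 1)] x else e (σ i.succ) x)
      = ∑ i : Fin (n + 1), (-1 : ℝ) ^ (n - (i : ℕ)) •
          VectorField.mlieBracket 𝓘(ℝ, Euc d)
            (fun y => S.rhoN y (fun k => e (i.succAbove k) y)) (fun y => S.rho2 y (e i y)) x

/-- The mixed Jacobi identity. The sums over all permutations with the factors `1 / (n+1)!` and
`1 / (2 n!)` are the signed sums over all ways to distribute the arguments. -/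
def MixedJacobi : Prop :=
  ∀ e : Fin (n + 2) → Sec d r E,
    ∑ σ : Equiv.Perm (Fin (n + 2)), ((Equiv.Perm.sign σ : ℤ) : ℝ) •
      ((1 / ((n + 1).factorial : ℝ)) •
          S.b2 ![S.bN (fun i => e (σ i.castSucc)), e (σ (Fin.last (n + 1)))]
        + ((-1 : ℝ) ^ (n + 1) / (2 * (n.factorial : ℝ))) •
          S.bN (Fin.cons (S.b2 ![e (σ 0), e (σ 1)]) (fun i => e (σ i.succ.succ)))) = 0

/-- Gapped Lie `n`-algebroids: `b₂` is a Lie bracket and the mixed Jacobi identity holds; the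
Leibniz rules are part of the data. -/
def IsGappedLieAlgebroid : Prop :=
  S.Jacobi ∧ S.MixedJacobi

end AnchoredBrackets

/-- The data of coordinates `(x^μ, a^a, ẋ^μ, ȧ^a)` of `T[n-1]E[1]`: a chart of `M` and sections of
`E` which are a frame over the domain of the chart. Such frames exist near every point, and near
every point every local frame coincides with one of them. -/
structure BundleCoord (d r : ℕ) {M : Type*} [TopologicalSpace M] [ChartedSpace (Euc d) M]
    (E : M → Type*) [∀ x, AddCommGroup (E x)] [∀ x, Module ℝ (E x)]
    [∀ x, TopologicalSpace (E x)] [TopologicalSpace (Bundle.TotalSpace (Euc r) E)]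
    [FiberBundle (Euc r) E] where
  chart : OpenPartialHomeomorph M (Euc d)
  chart_mem : chart ∈ IsManifold.maximalAtlas 𝓘(ℝ, Euc d) ∞ M
  frame : Fin r → Sec d r E
  isFrame : IsLocalFrameOn 𝓘(ℝ, Euc d) (Euc r) ∞ (fun a x => frame a x) chart.source

namespace BundleCoord

variable [IsManifold 𝓘(ℝ, Euc d) ∞ M] (κ κ' : BundleCoord d r E)

/-- The open subset of `ℝ^d` over which the coordinates are defined. -/
abbrev domain : TopologicalSpace.Opens (Euc d) := chartTarget κ.chart

/-- The algebra of functions on `T[n-1]E[1]` over the domain of the coordinates. -/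
abbrev Fun (n : ℕ) : Type := GrAlg n d r (smoothFun κ.domain)

/-- The component along `frame c` of a section, as a function of the coordinates. -/
def secComp (e : Sec d r E) (c : Fin r) : smoothFun κ.domain :=
  inCoord κ.chart_mem (fun x => κ.isFrame.coeff c x (e x))
    (contMDiffOn_coeff κ.chart.open_source κ.isFrame e c)

/-- The component along `∂/∂x^μ` of a smooth vector field, as a function of the coordinates. -/
def vecComp (X : (x : M) → TangentSpace 𝓘(ℝ, Euc d) x)
    (hX : ContMDiff 𝓘(ℝ, Euc d) 𝓘(ℝ, Euc d).tangent ∞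
      (fun x => (⟨x, X x⟩ : TangentBundle 𝓘(ℝ, Euc d) M))) (μ : Fin d) : smoothFun κ.domain :=
  inCoord κ.chart_mem (fun x => dx κ.chart x μ (X x)) (contMDiffOn_dx κ.chart_mem μ hX)

/-- The matrix `g^b_a` with `e_a = g^b_a e'_b` for the frames `e` of `κ` and `e'` of `κ'`, as
functions of the coordinates `κ`. -/
def frameChange (h : κ.chart.source ⊆ κ'.chart.source) (b a : Fin r) : smoothFun κ.domain :=
  inCoord κ.chart_mem (fun x => κ'.isFrame.coeff b x (κ.frame a x))
    ((contMDiffOn_coeff κ'.chart.open_source κ'.isFrame (κ.frame a) b).mono h)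

end BundleCoord

/-- The coordinate `x^μ` of a chart as a function of the coordinates of a smaller chart. -/
def coordChange [IsManifold 𝓘(ℝ, Euc d) ∞ M] {φ φ' : OpenPartialHomeomorph M (Euc d)}
    (hφ : φ ∈ IsManifold.maximalAtlas 𝓘(ℝ, Euc d) ∞ M)
    (hφ' : φ' ∈ IsManifold.maximalAtlas 𝓘(ℝ, Euc d) ∞ M) (h : φ.source ⊆ φ'.source)
    (μ : Fin d) : smoothFun (chartTarget φ) :=
  inCoord hφ (fun x => φ' x μ) ((contMDiffOn_coord hφ' μ).mono h)

/-- The vector field `Q^Ê` on `T[n-1]E[1]` in the coordinates `κ`, with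
`ρ₂(e_a) = ρ_a^μ ∂_μ`, `ρ_{n+1}(e_{a₁} ∧ … ∧ e_{aₙ}) = ρ_{a₁…aₙ}^μ ∂_μ`,
`b₂(e_a, e_b) = C_{ab}^c e_c` and `b_{n+1}(e_{a₁}, …) = C_{a₁…}^c e_c`. -/
def AnchoredBrackets.Q [IsManifold 𝓘(ℝ, Euc d) ∞ M] (S : AnchoredBrackets n d r E)
    (κ : BundleCoord d r E) : κ.Fun n →ₗ[ℝ] κ.Fun n :=
  GrAlg.vectorField (pderiv κ.domain)
    (GrAlg.qHat (pderiv κ.domain)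
      (fun a μ => κ.vecComp (fun x => S.rho2 x (κ.frame a x)) (S.rho2_smooth _) μ)
      (fun I μ => κ.vecComp (fun x => S.rhoN x (fun i => κ.frame (I i) x))
        (S.rhoN_smooth fun i => κ.frame (I i)) μ)
      (fun a b c => κ.secComp (S.b2 ![κ.frame a, κ.frame b]) c)
      (fun I c => κ.secComp (S.bN fun i => κ.frame (I i)) c))

end Bundle

/-! ### Twisted R-Poisson structures -/

section RPoisson

/-- The Schouten-Nijenhuis bracket in coordinates: the components `[U, V]^{λ₁…λₖ}` of the bracket
of multivector fields of orders `p + 1` and `q + 1` with the components `U`, `V`, where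
`U = 1/(p+1)! U^{μ…} ∂_μ ∧ …`, and similarly for `V` and `[U, V]`. -/
def schouten {d : ℕ} {A : Type*} [CommRing A] [Algebra ℝ A] (D : Fin d → Derivation ℝ A A)
    {p q k : ℕ} (hk : k = p + q + 1) (U : (Fin (p + 1) → Fin d) → A)
    (V : (Fin (q + 1) → Fin d) → A) (l : Fin k → Fin d) : A :=
  ((-1 : ℝ) ^ (p + 1) / (((p + 1).factorial : ℝ) * ((q + 1).factorial : ℝ))) •
    ∑ σ : Equiv.Perm (Fin k), ((Equiv.Perm.sign σ : ℤ) : ℝ) • ∑ κ : Fin d,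
      (((q + 1 : ℕ) : ℝ) •
          (V (Fin.cons κ fun j : Fin q => l (σ ⟨p + 1 + j, by omega⟩))
            * D κ (U fun i => l (σ ⟨i, by omega⟩)))
        + ((-1 : ℝ) ^ (p + 1) * ((p + 1 : ℕ) : ℝ)) •
          (U (Fin.cons κ fun i : Fin p => l (σ ⟨i, by omega⟩))
            * D κ (V fun j => l (σ ⟨p + j, by omega⟩))))

/-- A `2`-vector field `Π`, an `(n+1)`-vector field `R` and an `(n+2)`-form `H` on `M`, all
smooth. -/
structure RPoissonData (n d : ℕ) (M : Type*) [TopologicalSpace M] [ChartedSpace (Euc d) M] where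
  P : ∀ x : M, Module.Dual ℝ (TangentSpace 𝓘(ℝ, Euc d) x) [⋀^Fin 2]→ₗ[ℝ] ℝ
  R : ∀ x : M, Module.Dual ℝ (TangentSpace 𝓘(ℝ, Euc d) x) [⋀^Fin (n + 1)]→ₗ[ℝ] ℝ
  H : ∀ x : M, TangentSpace 𝓘(ℝ, Euc d) x [⋀^Fin (n + 2)]→ₗ[ℝ] ℝ
  P_smooth : ∀ φ ∈ IsManifold.maximalAtlas 𝓘(ℝ, Euc d) ∞ M, ∀ I : Fin 2 → Fin d,
    (fun y : chartTarget φ => P (φ.symm y) fun k => dx φ (φ.symm y) (I k))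
      ∈ smoothFun (chartTarget φ)
  R_smooth : ∀ φ ∈ IsManifold.maximalAtlas 𝓘(ℝ, Euc d) ∞ M, ∀ I : Fin (n + 1) → Fin d,
    (fun y : chartTarget φ => R (φ.symm y) fun k => dx φ (φ.symm y) (I k))
      ∈ smoothFun (chartTarget φ)
  H_smooth : ∀ φ ∈ IsManifold.maximalAtlas 𝓘(ℝ, Euc d) ∞ M, ∀ I : Fin (n + 2) → Fin d,
    (fun y : chartTarget φ => H (φ.symm y) fun k => ddx φ y (I k)) ∈ smoothFun (chartTarget φ)

namespace RPoissonData

variable {n d : ℕ} {M : Type*} [TopologicalSpace M] [ChartedSpace (Euc d) M]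
  (S : RPoissonData n d M) {φ : OpenPartialHomeomorph M (Euc d)}
  (hφ : φ ∈ IsManifold.maximalAtlas 𝓘(ℝ, Euc d) ∞ M)

/-- The components `Π^{μν}` in a chart. -/
def PComp (I : Fin 2 → Fin d) : smoothFun (chartTarget φ) := ⟨_, S.P_smooth φ hφ I⟩

/-- The components `R^{μ₁…μ_{n+1}}` in a chart. -/
def RComp (I : Fin (n + 1) → Fin d) : smoothFun (chartTarget φ) := ⟨_, S.R_smooth φ hφ I⟩

/-- The components `H_{μ₁…μ_{n+2}}` in a chart. -/
def HComp (I : Fin (n + 2) → Fin d) : smoothFun (chartTarget φ) := ⟨_, S.H_smooth φ hφ I⟩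

/-- Twisted R-Poisson structures of order `n + 1`: in every chart `[Π, Π] = 0`, `dH = 0` and
`[Π, R] = (-1)^{n+1} ⟨Π^{⊗(n+2)}, H⟩`, with `H` contracted with the first indices of the `Π`s. -/
structure IsTwistedRPoisson : Prop where
  poisson : ∀ (φ : OpenPartialHomeomorph M (Euc d))
    (hφ : φ ∈ IsManifold.maximalAtlas 𝓘(ℝ, Euc d) ∞ M) (l : Fin 3 → Fin d),
    schouten (pderiv (chartTarget φ)) (p := 1) (q := 1) rfl (S.PComp hφ) (S.PComp hφ) l = 0
  closed : ∀ (φ : OpenPartialHomeomorph M (Euc d))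
    (hφ : φ ∈ IsManifold.maximalAtlas 𝓘(ℝ, Euc d) ∞ M) (l : Fin (n + 3) → Fin d),
    ∑ i : Fin (n + 3), (-1 : ℝ) ^ (i : ℕ) •
      pderiv (chartTarget φ) (l i) (S.HComp hφ fun k => l (i.succAbove k)) = 0
  twisted : ∀ (φ : OpenPartialHomeomorph M (Euc d))
    (hφ : φ ∈ IsManifold.maximalAtlas 𝓘(ℝ, Euc d) ∞ M) (l : Fin (n + 2) → Fin d),
    schouten (pderiv (chartTarget φ)) (p := 1) (q := n) (by omega)
        (S.PComp hφ) (S.RComp hφ) l =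
      (-1 : ℝ) ^ (n + 1) • ∑ κ : Fin (n + 2) → Fin d,
        (∏ k, S.PComp hφ ![κ k, l k]) * S.HComp hφ κ

/-- The functions `f_μ^{ν₁…ν_{n+1}} = ∂_μ R^{ν₁…ν_{n+1}} - H_μ^{ν₁…ν_{n+1}}`, where
`H_μ^{ν₁…} = Π^{ν₁κ₁} ⋯ H_{μκ₁…}`. -/
def fComp (μ : Fin d) (ν : Fin (n + 1) → Fin d) : smoothFun (chartTarget φ) :=
  pderiv (chartTarget φ) μ (S.RComp hφ ν)
    - ∑ κ : Fin (n + 1) → Fin d, (∏ k, S.PComp hφ ![ν k, κ k]) * S.HComp hφ (Fin.cons μ κ)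

open GrAlg in
/-- The components of the vector field `Q_H^{RP_n}` on `T^*[n]T^*[1]M`. The coordinates
`a_μ`, `y^μ`, `z_μ` of degrees `1`, `n - 1`, `n` are `.a μ`, `.xdot μ` and `.adot μ`. -/
def qComp : Coord d d → GrAlg n d d (smoothFun (chartTarget φ))
  | .inl ν => ∑ μ, fn (S.PComp hφ ![μ, ν]) * gen (.a μ)
  | .inr (.a ρ) => -((1 / 2 : ℝ) • ∑ μ, ∑ ν,
      fn (pderiv _ ρ (S.PComp hφ ![μ, ν])) * gen (.a μ) * gen (.a ν))
  | .inr (.xdot μ) =>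
      (-1 : ℝ) ^ n • (∑ ν, fn (S.PComp hφ ![ν, μ]) * gen (.adot ν))
      - (∑ ν, ∑ κ, fn (pderiv _ ν (S.PComp hφ ![μ, κ])) * gen (.a κ) * gen (.xdot ν))
      + (1 / (n.factorial : ℝ)) •
          ∑ I : Fin n → Fin d, fn (S.RComp hφ (Fin.cons μ I)) * mono I
  | .inr (.adot μ) =>
      -((∑ ν, ∑ κ, fn (pderiv _ μ (S.PComp hφ ![ν, κ])) * gen (.a ν) * gen (.adot κ))
        + ((-1 : ℝ) ^ n / 2) • (∑ ν, ∑ κ, ∑ l,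
            fn (pderiv _ μ (pderiv _ ν (S.PComp hφ ![κ, l])))
              * gen (.xdot ν) * gen (.a κ) * gen (.a l))
        - ((-1 : ℝ) ^ n / ((n + 1).factorial : ℝ)) •
            ∑ I : Fin (n + 1) → Fin d, fn (S.fComp hφ μ I) * mono I)

/-- The vector field `Q_H^{RP_n}` on `T^*[n]T^*[1]M` in the coordinates induced by a chart. -/
def Q : GrAlg n d d (smoothFun (chartTarget φ)) →ₗ[ℝ] GrAlg n d d (smoothFun (chartTarget φ)) :=
  GrAlg.vectorField (pderiv (chartTarget φ)) (S.qComp hφ)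

end RPoissonData

end RPoisson

end GappedLie

end

set_option linter.unusedSectionVars false

noncomputable section

namespace GappedLie

/-! ### Graded derivations of the algebra of functions of a chart -/

namespace GrAlg

variable {n d r : ℕ} {A : Type*} [CommRing A] [Algebra ℝ A]

/-! The functions of `x` and `a` are the functions on `E[1]`, and the dotted coordinates are, up to
sign, the images of `x` and `a` under the derivation `δ = ẋ ∂/∂x + c ȧ ∂/∂a` with `c² = 1`. Two
vector fields on `E[1]` enter: `X` of degree `1`, with components `ρ_a^μ a^a` and `-½ C_{ab}^c a^a
a^b`, and `P` of degree `n`, built in the same way from `ρ_{n+1}` and `b_{n+1}`. The field `Q` is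
the lift `liftComp` of this pair: it restricts to `X` on functions of `x` and `a`, and on these
functions `Q δ = (-1)^{n-1} δ X + P`.

Applying `Q` twice gives `Q² = X²` on functions of `x` and `a`, and `Q² δ = δ X² + (X P - (-1)^n P
X)`. Hence `Q² = 0` if and only if `X² = 0` and the graded commutator `[X, P]` vanishes
(`liftComp_sq_eq_zero_iff`), which is a statement about `E[1]` alone. In the same way, the
transformation law of `ȧ` says exactly that `δ` commutes with changes of coordinates, so `Q` is well
defined as soon as `X` and `P` are (`isCoordChange_liftComp`).

The components of `[X, P]` are polynomials in the odd coordinates `a`, and such a polynomial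
vanishes if and only if the alternating part of its coefficients does. On sections of a frame, the
`x`-components are the defect `anc` of the mixed morphism condition. The `a`-components are the
defect `jac` of the mixed Jacobi identity. For `P = X` the same computation describes `[X, X] = 2
X²` and yields the axioms of a Lie algebroid.

The passage from frames to all sections rests on two identities, proved algebraically for a
`LeibnizBracket` over any commutative algebra and carried to the manifold by cutoff functions. The
defect `anc` is linear over functions (`anc_linear`), and `jac` obeys `jac(f s, v) = f jac(s, v) ±
anc(v)(f) s` (`jac_leibniz`). So if `anc = 0`, then `jac` is a tensor and can be tested on frames.
Conversely `jac = 0` forces `anc = 0`, which is why the Jacobi identities alone already imply the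
morphism conditions.

For twisted R-Poisson structures the same lift is used with `E = T^*M` and `c = -1`. Here `X` is the
Hamiltonian vector field of `-Π`, and `P` is the Hamiltonian vector field of `R` corrected by an
`H`-term in its `a`-components. The commutator of two Hamiltonian fields consists of the derivatives
of one function, `X(R)`, which is a multiple of `[Π, R]`. Thus `[Π, Π] = 0` gives `X² = 0`, and the
twisting condition identifies `X(R)` with `1/(n+2)!` times `H` evaluated on the components of `X`.
The correction cancels the `a`-derivatives of this function directly, and its `x`-derivatives once
`dH = 0` and `X² = 0` are used. -/

theorem neg_one_pow_mul_self_eq_one (k : ℕ) : (-1 : ℝ) ^ k * (-1 : ℝ) ^ k = 1 := by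
  rw [← mul_pow]; simp

theorem fn_one : (fn (1 : A) : GrAlg n d r A) = 1 := by
  simpa using fn_algebraMap (n := n) (d := d) (r := r) (A := A) 1

/-- Functions of degree `0` as a ring homomorphism. -/
def fnHom : A →+* GrAlg n d r A where
  toFun := fn
  map_one' := fn_one
  map_zero' := fn_zero
  map_add' := fn_add
  map_mul' := fn_mul

theorem fn_smul (c : ℝ) (f : A) : (fn (c • f) : GrAlg n d r A) = c • fn f := by
  rw [Algebra.smul_def, fn_mul, fn_algebraMap, ← Algebra.smul_def]

theorem fn_sum {ι : Type*} (s : Finset ι) (f : ι → A) :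
    (fn (∑ i ∈ s, f i) : GrAlg n d r A) = ∑ i ∈ s, fn (f i) :=
  map_sum (fnHom : A →+* GrAlg n d r A) f s

theorem fn_neg (f : A) : (fn (-f) : GrAlg n d r A) = -fn f :=
  map_neg (fnHom : A →+* GrAlg n d r A) f

/-- The subalgebra generated by functions of degree `0` and by a set of coordinates. -/
def genBy (S : Set (Gen d r)) : Subalgebra ℝ (GrAlg n d r A) :=
  Algebra.adjoin ℝ (Set.range fn ∪ gen '' S)

theorem fn_mem_genBy (S : Set (Gen d r)) (f : A) : (fn f : GrAlg n d r A) ∈ genBy S :=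
  Algebra.subset_adjoin (.inl ⟨f, rfl⟩)

theorem gen_mem_genBy {S : Set (Gen d r)} {g : Gen d r} (h : g ∈ S) :
    (gen g : GrAlg n d r A) ∈ genBy S :=
  Algebra.subset_adjoin (.inr ⟨g, h, rfl⟩)

theorem genBy_induction {S : Set (Gen d r)} {p : GrAlg n d r A → Prop}
    (hfn : ∀ f, p (fn f)) (hgen : ∀ g ∈ S, p (gen g))
    (hadd : ∀ u v, p u → p v → p (u + v)) (hmul : ∀ u v, p u → p v → p (u * v))
    {u : GrAlg n d r A} (hu : u ∈ genBy S) : p u := by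
  refine Algebra.adjoin_induction (p := fun u _ => p u) ?_ ?_ ?_ ?_ hu
  · rintro _ (⟨f, rfl⟩ | ⟨g, hg, rfl⟩)
    · exact hfn f
    · exact hgen g hg
  · intro c
    rw [← fn_algebraMap]
    exact hfn _
  · intro u v _ _ h h'; exact hadd u v h h'
  · intro u v _ _ h h'; exact hmul u v h h'

theorem genBy_univ : (genBy Set.univ : Subalgebra ℝ (GrAlg n d r A)) = ⊤ := by
  rw [eq_top_iff]
  rintro u -
  obtain ⟨w, rfl⟩ := RingQuot.mkAlgHom_surjective ℝ (GrRel n d r A) u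
  induction w using FreeAlgebra.induction with
  | grade0 c => simp
  | grade1 x =>
    rcases x with f | g
    · exact fn_mem_genBy _ f
    · exact gen_mem_genBy (Set.mem_univ g)
  | mul a b ha hb => rw [map_mul]; exact Subalgebra.mul_mem _ ha hb
  | add a b ha hb => rw [map_add]; exact Subalgebra.add_mem _ ha hb

theorem mem_genBy_univ (u : GrAlg n d r A) : u ∈ genBy (n := n) (A := A) (Set.univ : Set (Gen d r)) := by
  rw [genBy_univ]; exact Algebra.mem_top

theorem induction_mul {p : GrAlg n d r A → Prop}
    (hfn : ∀ f, p (fn f)) (hgen : ∀ g, p (gen g))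
    (hadd : ∀ u v, p u → p v → p (u + v)) (hmul : ∀ u v, p u → p v → p (u * v))
    (u : GrAlg n d r A) : p u :=
  genBy_induction hfn (fun g _ => hgen g) hadd hmul (mem_genBy_univ u)

theorem fn_comm (f : A) (u : GrAlg n d r A) : fn f * u = u * fn f := by
  induction u using induction_mul with
  | hfn f' => rw [← fn_mul, ← fn_mul, mul_comm]
  | hgen g => rw [gen_mul_fn]
  | hadd u v hu hv => rw [mul_add, add_mul, hu, hv]
  | hmul u v hu hv => rw [← mul_assoc, hu, mul_assoc, hv, mul_assoc]

theorem fn_mem_homogeneous (f : A) : (fn f : GrAlg n d r A) ∈ homogeneous 0 :=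
  Submodule.subset_span ⟨f, [], rfl, by simp⟩

theorem gen_mem_homogeneous (g : Gen d r) :
    (gen g : GrAlg n d r A) ∈ homogeneous (g.deg n) :=
  Submodule.subset_span ⟨1, [g], by simp, by simp [fn_one]⟩

theorem mul_mem_homogeneous {j k : ℕ} {u v : GrAlg n d r A} (hu : u ∈ homogeneous j)
    (hv : v ∈ homogeneous k) : u * v ∈ homogeneous (j + k) := by
  induction hu, hv using Submodule.span_induction₂ with
  | mem_mem x y hx hy =>
    obtain ⟨f, l, rfl, rfl⟩ := hx
    obtain ⟨f', l', rfl, rfl⟩ := hy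
    refine Submodule.subset_span ⟨f * f', l ++ l', by simp, ?_⟩
    rw [List.map_append, List.prod_append, fn_mul, mul_assoc, ← mul_assoc (l.map gen).prod,
      ← fn_comm f', mul_assoc, mul_assoc]
  | zero_left y hy => rw [zero_mul]; exact zero_mem _
  | zero_right x hx => rw [mul_zero]; exact zero_mem _
  | add_left x y z _ _ _ h h' => rw [add_mul]; exact add_mem h h'
  | add_right x y z _ _ _ h h' => rw [mul_add]; exact add_mem h h'
  | smul_left c x y _ _ h => rw [smul_mul_assoc]; exact Submodule.smul_mem _ _ h
  | smul_right c x y _ _ h => rw [mul_smul_comm]; exact Submodule.smul_mem _ _ h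

theorem fn_mul_mem_homogeneous {k : ℕ} (f : A) {u : GrAlg n d r A} (hu : u ∈ homogeneous k) :
    fn f * u ∈ homogeneous k := by
  simpa using mul_mem_homogeneous (fn_mem_homogeneous f) hu

/-- The automorphism `u ↦ (-1)^{k |u|} u`. -/
def sig (k : ℕ) : GrAlg n d r A →ₐ[ℝ] GrAlg n d r A :=
  lift fn (fun g => (-1 : ℝ) ^ (k * g.deg n) • gen g) fn_add fn_mul fn_algebraMap
    (fun f g => by simp [gen_mul_fn])
    (fun g h => by
      simp only [smul_mul_smul_comm]
      rw [gen_mul_gen g h, smul_comm,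
        mul_comm ((-1 : ℝ) ^ (k * g.deg n)) ((-1 : ℝ) ^ (k * h.deg n))])

@[simp] theorem sig_fn (k : ℕ) (f : A) : sig k (fn f : GrAlg n d r A) = fn f := lift_fn ..

theorem sig_gen (k : ℕ) (g : Gen d r) :
    sig k (gen g : GrAlg n d r A) = (-1 : ℝ) ^ (k * g.deg n) • gen g := lift_gen ..

theorem parity_eq_sig : (parity : GrAlg n d r A →ₐ[ℝ] GrAlg n d r A) = sig 1 := by
  refine hom_ext (fun f => ?_) (fun g => ?_)
  · rw [sig_fn]; exact lift_fn ..
  · rw [sig_gen, one_mul]; exact lift_gen ..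

theorem sig_sig (j k : ℕ) (u : GrAlg n d r A) : sig j (sig k u) = sig (j + k) u := by
  have : (sig j).comp (sig k) = (sig (j + k) : GrAlg n d r A →ₐ[ℝ] _) := by
    refine hom_ext (fun f => by simp) (fun g => ?_)
    simp [sig_gen, smul_smul, ← pow_add, add_mul, add_comm]
  exact DFunLike.congr_fun this u

/-- Only the parity of `k` enters the sign `(-1)^{k |u|}`; this absorbs even shifts of degree below.
-/
theorem sig_congr {j k : ℕ} (h : Even (j + k)) (u : GrAlg n d r A) : sig j u = sig k u := by
  have : (sig j : GrAlg n d r A →ₐ[ℝ] _) = sig k := by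
    refine hom_ext (fun f => by simp) (fun g => ?_)
    rw [sig_gen, sig_gen]
    congr 1
    apply neg_one_pow_congr
    rw [Nat.even_mul, Nat.even_mul]
    rw [Nat.even_add] at h
    tauto
  rw [this]

theorem sig_eq_self {k : ℕ} (h : Even k) (u : GrAlg n d r A) : sig k u = u := by
  have h0 : (sig 0 : GrAlg n d r A →ₐ[ℝ] _) = AlgHom.id ℝ _ :=
    hom_ext (fun f => by simp) (fun g => by simp [sig_gen])
  rw [sig_congr (k := 0) (by simpa using h), h0, AlgHom.id_apply]

theorem sig_of_mem {k j : ℕ} {u : GrAlg n d r A} (hu : u ∈ homogeneous j) :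
    sig k u = (-1 : ℝ) ^ (k * j) • u := by
  induction hu using Submodule.span_induction with
  | mem x hx =>
    obtain ⟨f, l, rfl, rfl⟩ := hx
    rw [map_mul, sig_fn, ← mul_smul_comm]
    congr 1
    induction l with
    | nil => simp
    | cons g l ih =>
      rw [List.map_cons, List.prod_cons, map_mul, ih, sig_gen, smul_mul_smul_comm, ← pow_add,
        List.map_cons, List.sum_cons, mul_add]
  | zero => simp
  | add x y _ _ hx hy => rw [map_add, hx, hy, smul_add]
  | smul c x _ hx => rw [map_smul, hx, smul_comm]

theorem gen_mul (g : Gen d r) (u : GrAlg n d r A) : gen g * u = sig (g.deg n) u * gen g := by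
  induction u using induction_mul with
  | hfn f' => rw [sig_fn, gen_mul_fn]
  | hgen h => rw [sig_gen, gen_mul_gen, smul_mul_assoc]
  | hadd u v hu hv => rw [mul_add, map_add, add_mul, hu, hv]
  | hmul u v hu hv => rw [← mul_assoc, hu, mul_assoc, hv, map_mul, mul_assoc]

/-- Graded commutativity with only one homogeneous factor: `sig k` records the sign degree by
degree, so `v` may be arbitrary and no decomposition into homogeneous parts is needed. -/
theorem mul_eq_sig_mul {k : ℕ} {u : GrAlg n d r A} (hu : u ∈ homogeneous k)
    (v : GrAlg n d r A) : u * v = sig k v * u := by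
  induction hu using Submodule.span_induction with
  | mem x hx =>
    obtain ⟨f, l, rfl, rfl⟩ := hx
    have : ∀ v : GrAlg n d r A, (l.map gen).prod * v = sig (l.map (Gen.deg n)).sum v * (l.map gen).prod := by
      induction l with
      | nil => intro v; simp [sig_eq_self]
      | cons g l ih =>
        intro v
        rw [List.map_cons, List.prod_cons, mul_assoc, ih, ← mul_assoc, gen_mul, sig_sig,
          List.map_cons, List.sum_cons, mul_assoc]
    rw [mul_assoc, this, ← mul_assoc, fn_comm, mul_assoc]
  | zero => simp
  | add x y _ _ hx hy => rw [add_mul, hx, hy, mul_add]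
  | smul c x _ hx => rw [smul_mul_assoc, hx, mul_smul_comm]

theorem mul_comm_of_mem {j k : ℕ} {u v : GrAlg n d r A} (hu : u ∈ homogeneous j)
    (hv : v ∈ homogeneous k) : u * v = (-1 : ℝ) ^ (j * k) • (v * u) := by
  rw [mul_eq_sig_mul hu, sig_of_mem hv, smul_mul_assoc]

/-! #### Graded derivations -/

/-- Graded derivations of degree `k`. -/
def IsGDer (k : ℕ) (V : GrAlg n d r A →ₗ[ℝ] GrAlg n d r A) : Prop :=
  ∀ u v, V (u * v) = V u * v + sig k u * V v

/-- Maps with the same Leibniz rule along an algebra homomorphism agree on a generated subalgebra if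
they agree on the generators. -/
theorem eq_on_genBy {n' r' : ℕ} {A' : Type*} [CommRing A'] [Algebra ℝ A'] {S : Set (Gen d r')} {k : ℕ}
    (T : GrAlg n' d r' A' →ₐ[ℝ] GrAlg n d r A) {U V : GrAlg n' d r' A' →ₗ[ℝ] GrAlg n d r A}
    (hU : ∀ u v, U (u * v) = U u * T v + T (sig k u) * U v)
    (hV : ∀ u v, V (u * v) = V u * T v + T (sig k u) * V v)
    (hfn : ∀ f, U (fn f) = V (fn f)) (hgen : ∀ g ∈ S, U (gen g) = V (gen g))
    {u : GrAlg n' d r' A'} (hu : u ∈ genBy S) : U u = V u := by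
  refine genBy_induction (p := fun u => U u = V u) hfn hgen ?_ ?_ hu
  · intro u v hu hv
    rw [map_add, map_add, hu, hv]
  · intro u v hu hv
    rw [hU, hV, hu, hv]

theorem IsGDer.eq_on {S : Set (Gen d r)} {k : ℕ} {U V : GrAlg n d r A →ₗ[ℝ] GrAlg n d r A}
    (hU : IsGDer k U) (hV : IsGDer k V)
    (hfn : ∀ f, U (fn f) = V (fn f)) (hgen : ∀ g ∈ S, U (gen g) = V (gen g))
    {u : GrAlg n d r A} (hu : u ∈ genBy S) : U u = V u :=
  eq_on_genBy (AlgHom.id ℝ _) hU hV hfn hgen hu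

variable (D : Fin d → Derivation ℝ A A)

/-- The diagonal of the matrix consists of `sig` and the identity, so the off-diagonal entry of a
product of two such matrices is the graded Leibniz rule for `partialDeriv`. -/
theorem partialHom_apply (c : Coord d r) (u : GrAlg n d r A) :
    partialHom D c u = !![sig (coordDeg n c) u, partialDeriv D c u; 0, u] := by
  have h0 : (partialHom D c u) 0 0 = sig (coordDeg n c) u ∧ (partialHom D c u) 1 0 = 0 ∧
      (partialHom D c u) 1 1 = u := by
    induction u using induction_mul with
    | hfn f => simp [partialHom, lift_fn]
    | hgen g => simp [partialHom, lift_gen, sig_gen]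
    | hadd u v hu hv => simp [hu, hv]
    | hmul u v hu hv => simp [Matrix.mul_apply, hu, hv]
  ext i j
  fin_cases i <;> fin_cases j
  · exact h0.1
  · rfl
  · exact h0.2.1
  · exact h0.2.2

theorem partialDeriv_mul (c : Coord d r) (u v : GrAlg n d r A) :
    partialDeriv D c (u * v) =
      partialDeriv D c u * v + sig (coordDeg n c) u * partialDeriv D c v := by
  have h := partialHom_apply D c (u * v)
  rw [map_mul, partialHom_apply, partialHom_apply] at h
  have := congrFun (congrFun h 0) 1
  simp only [Matrix.mul_apply, Fin.sum_univ_two] at this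
  simpa [add_comm] using this.symm

variable {D}

theorem vectorField_apply (X : Coord d r → GrAlg n d r A) (u : GrAlg n d r A) :
    vectorField D X u = ∑ c, X c * partialDeriv D c u := by
  simp [vectorField, LinearMap.sum_apply]

theorem vectorField_fn (X : Coord d r → GrAlg n d r A) (f : A) :
    vectorField D X (fn f) = ∑ μ, X (.inl μ) * fn (D μ f) := by
  rw [vectorField_apply, Fintype.sum_sum_type]
  simp [partialDeriv_fn, baseDeriv, fn_zero]

theorem vectorField_gen (X : Coord d r → GrAlg n d r A) (g : Gen d r) :
    vectorField D X (gen g) = X (.inr g) := by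
  rw [vectorField_apply, Fintype.sum_sum_type]
  simp [partialDeriv_gen, genDeriv]

/-- The components of a vector field of degree `k`. -/
def IsComp (k : ℕ) (X : Coord d r → GrAlg n d r A) : Prop :=
  ∀ c, X c ∈ homogeneous (coordDeg n c + k)

/-- The partial derivative along `c` produces `sig |c| u`. Moving the component, of degree `|c| +
k`, past it leaves `sig` of `2|c| + k`, which has the parity of `k` whatever `c` is. -/
theorem isGDer_vectorField {k : ℕ} {X : Coord d r → GrAlg n d r A} (hX : IsComp k X) :
    IsGDer k (vectorField D X) := by
  intro u v
  simp only [vectorField_apply, Finset.sum_mul, Finset.mul_sum, ← Finset.sum_add_distrib]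
  refine Finset.sum_congr rfl fun c _ => ?_
  rw [partialDeriv_mul, mul_add, ← mul_assoc, ← mul_assoc, mul_eq_sig_mul (hX c) (sig _ u),
    sig_sig, mul_assoc (sig _ u)]
  rw [sig_congr (k := k) ⟨coordDeg n c + k, by ring⟩]

theorem vectorField_mem {k j : ℕ} {X : Coord d r → GrAlg n d r A} (hX : IsComp k X)
    {u : GrAlg n d r A} (hu : u ∈ homogeneous j) :
    vectorField D X u ∈ homogeneous (j + k) := by
  have hder := isGDer_vectorField (D := D) hX
  have hfn : ∀ f, vectorField D X (fn f) ∈ homogeneous (0 + k) := fun f => by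
    rw [vectorField_fn]
    refine Submodule.sum_mem _ fun μ _ => ?_
    rw [← fn_comm]
    exact fn_mul_mem_homogeneous _ (hX (.inl μ))
  have hsig : ∀ {u : GrAlg n d r A} {j : ℕ}, u ∈ homogeneous j → sig k u ∈ homogeneous j :=
    fun hu => by rw [sig_of_mem hu]; exact Submodule.smul_mem _ _ hu
  induction hu using Submodule.span_induction with
  | mem x hx =>
    obtain ⟨f, l, rfl, rfl⟩ := hx
    have hl : ∀ l : List (Gen d r), (l.map gen).prod ∈
        homogeneous (n := n) (A := A) (l.map (Gen.deg n)).sum := fun l => 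
      Submodule.subset_span ⟨1, l, rfl, by simp [fn_one]⟩
    have hl' : vectorField D X (l.map gen).prod ∈ homogeneous ((l.map (Gen.deg n)).sum + k) := by
      induction l with
      | nil => simpa [fn_one] using hfn 1
      | cons g l ih =>
        simp only [List.map_cons, List.prod_cons, List.sum_cons]
        rw [hder, vectorField_gen]
        refine add_mem ?_ ?_
        · rw [add_right_comm]
          exact mul_mem_homogeneous (hX (.inr g)) (hl l)
        · rw [add_assoc]
          exact mul_mem_homogeneous (hsig (gen_mem_homogeneous g)) ih
    rw [hder, sig_fn]
    refine add_mem ?_ (fn_mul_mem_homogeneous _ hl')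
    have := mul_mem_homogeneous (hfn f) (hl l)
    rwa [zero_add, add_comm] at this
  | zero => simp
  | add x y _ _ hx hy => rw [map_add]; exact add_mem hx hy
  | smul c x _ hx => rw [map_smul]; exact Submodule.smul_mem _ _ hx

theorem isDegreeOneVectorField_vectorField {X : Coord d r → GrAlg n d r A} (hX : IsComp 1 X) :
    IsDegreeOneVectorField (vectorField D X) where
  leibniz u v := by rw [parity_eq_sig]; exact isGDer_vectorField hX u v
  degree _ _ hu := vectorField_mem hX hu

/-- A field of degree `k` shifts degrees by `k`. For elements which need not be homogeneous this is
obtained by comparing two maps with the same Leibniz rule along `sig j`, which agree on generators.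
-/
theorem vectorField_sig {k : ℕ} (j : ℕ) {X : Coord d r → GrAlg n d r A} (hX : IsComp k X)
    (u : GrAlg n d r A) :
    vectorField D X (sig j u) = (-1 : ℝ) ^ (j * k) • sig j (vectorField D X u) := by
  have hder := isGDer_vectorField (D := D) hX
  refine eq_on_genBy (S := Set.univ) (k := k) (sig j)
    (U := (vectorField D X).comp (sig j).toLinearMap)
    (V := (-1 : ℝ) ^ (j * k) • (sig j).toLinearMap.comp (vectorField D X)) ?_ ?_ ?_ ?_
    (mem_genBy_univ u)
  · intro u v
    simp only [LinearMap.comp_apply, AlgHom.toLinearMap_apply, map_mul, hder _ _, sig_sig,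
      add_comm]
  · intro u v
    simp only [LinearMap.comp_apply, LinearMap.smul_apply, AlgHom.toLinearMap_apply, map_mul,
      hder _ _, map_add, smul_add, smul_mul_assoc, mul_smul_comm]
  · intro f
    simp only [LinearMap.comp_apply, LinearMap.smul_apply, AlgHom.toLinearMap_apply, sig_fn]
    have : vectorField D X (fn f) ∈ homogeneous (0 + k) := vectorField_mem hX (fn_mem_homogeneous f)
    rw [sig_of_mem this, smul_smul, zero_add, neg_one_pow_mul_self_eq_one, one_smul]
  · intro g _
    simp only [LinearMap.comp_apply, LinearMap.smul_apply, AlgHom.toLinearMap_apply, sig_gen,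
      map_smul, vectorField_gen]
    rw [sig_of_mem (hX (.inr g)), smul_smul, ← pow_add]
    congr 1
    apply neg_one_pow_congr
    simp only [coordDeg, Nat.even_add, Nat.even_mul]
    tauto

/-- The graded commutator of two vector fields is a vector field. -/
theorem gcomm_vectorField (hD : ∀ μ ν f, D μ (D ν f) = D ν (D μ f)) {p q : ℕ}
    {X Y : Coord d r → GrAlg n d r A} (hX : IsComp p X) (hY : IsComp q Y) (u : GrAlg n d r A) :
    vectorField D X (vectorField D Y u)
      - (-1 : ℝ) ^ (p * q) • vectorField D Y (vectorField D X u) =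
    vectorField D (fun c => vectorField D X (Y c) - (-1 : ℝ) ^ (p * q) • vectorField D Y (X c))
      u := by
  have hV := isGDer_vectorField (D := D) hX
  have hW := isGDer_vectorField (D := D) hY
  have hZ : IsComp (p + q)
      (fun c => vectorField D X (Y c) - (-1 : ℝ) ^ (p * q) • vectorField D Y (X c)) := fun c => by
    refine sub_mem ?_ (Submodule.smul_mem _ _ ?_)
    · have := vectorField_mem (D := D) hX (hY c)
      rwa [add_assoc, add_comm q] at this
    · rw [← add_assoc]; exact vectorField_mem hY (hX c)
  have hs := neg_one_pow_mul_self_eq_one (p * q)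
  set V := vectorField D X with hVdef
  set W := vectorField D Y with hWdef
  refine IsGDer.eq_on (S := Set.univ) (k := p + q)
    (U := V.comp W - (-1 : ℝ) ^ (p * q) • W.comp V) ?_ (isGDer_vectorField hZ) ?_ ?_
    (mem_genBy_univ u)
  · intro u v
    -- Both fields pass through `sig` with the sign `(-1)^{pq}`; with it the products of first
    -- derivatives of `u` and `v` cancel between the two compositions.
    have h1 : V (sig q u) = (-1 : ℝ) ^ (p * q) • sig q (V u) := by
      rw [hVdef, vectorField_sig _ hX, mul_comm q p]
    have h2 : W (sig p u) = (-1 : ℝ) ^ (p * q) • sig p (W u) := by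
      rw [hWdef, vectorField_sig _ hY]
    simp only [LinearMap.sub_apply, LinearMap.smul_apply, LinearMap.comp_apply, hV _ _, hW _ _,
      map_add, h1, h2, sig_sig, add_comm q p, smul_add, smul_mul_assoc, smul_smul, hs, one_smul,
      sub_mul, mul_sub, mul_smul_comm]
    abel
  · intro f
    simp only [LinearMap.sub_apply, LinearMap.smul_apply, LinearMap.comp_apply]
    rw [vectorField_fn, hWdef, vectorField_fn, hVdef, vectorField_fn, map_sum, map_sum,
      ← hWdef, ← hVdef]
    simp only [hV _ _, hW _ _, sub_mul, smul_mul_assoc, Finset.sum_sub_distrib,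
      Finset.sum_add_distrib, smul_add, Finset.smul_sum]
    -- These are the second-order terms in `f`: exchanging the two components costs exactly
    -- `(-1)^{pq}`, and the derivations `D` commute, so they drop out of the commutator.
    have h3 : ∑ μ, sig p (Y (.inl μ)) * V (fn (D μ f)) =
        ∑ μ, (-1 : ℝ) ^ (p * q) • (sig q (X (.inl μ)) * W (fn (D μ f))) := by
      have hX' : ∀ μ, X (.inl μ) ∈ homogeneous p := fun μ => by simpa [coordDeg] using hX (.inl μ)
      have hY' : ∀ μ, Y (.inl μ) ∈ homogeneous q := fun μ => by simpa [coordDeg] using hY (.inl μ)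
      simp only [hVdef, hWdef, vectorField_fn, sig_of_mem (hX' _), sig_of_mem (hY' _),
        Finset.mul_sum, Finset.smul_sum, smul_mul_assoc, smul_smul, mul_comm q p, hs, one_smul]
      rw [Finset.sum_comm]
      refine Finset.sum_congr rfl fun μ _ => Finset.sum_congr rfl fun ν _ => ?_
      rw [← mul_assoc, ← mul_assoc, mul_comm_of_mem (hY' ν) (hX' μ), smul_mul_assoc, smul_smul,
        mul_comm q p, hs, one_smul, hD]
    rw [h3]
    abel
  · intro g _
    simp only [LinearMap.sub_apply, LinearMap.smul_apply, LinearMap.comp_apply]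
    rw [hWdef, hVdef, vectorField_gen, vectorField_gen, vectorField_gen]

end GrAlg

end GappedLie

end

noncomputable section

namespace GappedLie

/-! ### Lifts of pairs of vector fields to the dotted coordinates -/

namespace GrAlg

variable {n d r : ℕ} {A : Type*} [CommRing A] [Algebra ℝ A] {D : Fin d → Derivation ℝ A A}

/-- The algebra of functions of the coordinates `x^μ` and `a^a`. -/
abbrev base (n d r : ℕ) (A : Type*) [CommRing A] [Algebra ℝ A] : Subalgebra ℝ (GrAlg n d r A) :=
  genBy (Set.range Gen.a)

theorem neg_smul_grAlg (c : ℝ) (u : GrAlg n d r A) : (-c) • u = -(c • u) := by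
  exact neg_smul c u

/-- Since `2` is invertible, `[Q, Q] = 2 Q²` carries the same information as `Q²`, and odd elements
square to zero. -/
theorem eq_zero_of_add_self {u : GrAlg n d r A} (h : u + u = 0) : u = 0 := by
  have h2 : (2 : ℝ) • u = 0 := by rw [two_smul, h]
  simpa [smul_smul] using congrArg ((1 / 2 : ℝ) • ·) h2

theorem a_mem_base (i : Fin r) : (gen (.a i) : GrAlg n d r A) ∈ base n d r A :=
  gen_mem_genBy ⟨i, rfl⟩

theorem fn_mem_base (f : A) : (fn f : GrAlg n d r A) ∈ base n d r A := fn_mem_genBy _ f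

/-- The components of a vector field along the coordinates `x^μ` and `a^a`. -/
def baseComp (Px : Fin d → GrAlg n d r A) (Pa : Fin r → GrAlg n d r A) :
    Coord d r → GrAlg n d r A
  | .inl μ => Px μ
  | .inr (.a i) => Pa i
  | .inr (.xdot _) => 0
  | .inr (.adot _) => 0

/-- The components of the vector field `ẋ^μ ∂/∂x^μ + c ȧ^a ∂/∂a^a`. -/
def deltaComp (c : ℝ) : Coord d r → GrAlg n d r A
  | .inl μ => gen (.xdot μ)
  | .inr (.a i) => c • gen (.adot i)
  | .inr (.xdot _) => 0
  | .inr (.adot _) => 0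

variable (D) in
/-- The components of the lift to all coordinates of a vector field of degree `1` with components
`Xx`, `Xa` and of a vector field of degree `n` with components `Px`, `Pa`. -/
def liftComp (c : ℝ) (Xx Px : Fin d → GrAlg n d r A) (Xa Pa : Fin r → GrAlg n d r A) :
    Coord d r → GrAlg n d r A
  | .inl μ => Xx μ
  | .inr (.a i) => Xa i
  | .inr (.xdot μ) => (-1 : ℝ) ^ (n - 1) • vectorField D (deltaComp c) (Xx μ) + Px μ
  | .inr (.adot i) =>
      c • ((-1 : ℝ) ^ (n - 1) • vectorField D (deltaComp c) (Xa i) + Pa i)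

theorem isComp_baseComp {k : ℕ} {Px : Fin d → GrAlg n d r A} {Pa : Fin r → GrAlg n d r A}
    (hx : ∀ μ, Px μ ∈ homogeneous k) (ha : ∀ i, Pa i ∈ homogeneous (k + 1)) :
    IsComp k (baseComp Px Pa) := by
  rintro (μ | i | μ | i)
  · simpa [baseComp, coordDeg] using hx μ
  · simpa [baseComp, coordDeg, Gen.deg, add_comm] using ha i
  · exact zero_mem _
  · exact zero_mem _

theorem isComp_deltaComp (hn : 1 ≤ n) (c : ℝ) :
    IsComp (n - 1) (deltaComp c : Coord d r → GrAlg n d r A) := by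
  rintro (μ | i | μ | i)
  · simpa [deltaComp, coordDeg, Gen.deg] using
      gen_mem_homogeneous (n := n) (A := A) (Gen.xdot μ : Gen d r)
  · have := gen_mem_homogeneous (n := n) (A := A) (Gen.adot i : Gen d r)
    refine Submodule.smul_mem _ _ ?_
    simpa [coordDeg, Gen.deg, Nat.add_sub_cancel' hn] using this
  · exact zero_mem _
  · exact zero_mem _

theorem vectorField_mem_base {Px : Fin d → GrAlg n d r A} {Pa : Fin r → GrAlg n d r A} {k : ℕ}
    (hx : ∀ μ, Px μ ∈ homogeneous k) (ha : ∀ i, Pa i ∈ homogeneous (k + 1))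
    (hPx : ∀ μ, Px μ ∈ base n d r A) (hPa : ∀ i, Pa i ∈ base n d r A)
    {u : GrAlg n d r A} (hu : u ∈ base n d r A) :
    vectorField D (baseComp Px Pa) u ∈ base n d r A := by
  have hder := isGDer_vectorField (D := D) (isComp_baseComp hx ha)
  -- The Leibniz rule involves `sig k u`, so the induction must carry its membership along.
  suffices u ∈ base n d r A ∧ sig k u ∈ base n d r A ∧
      vectorField D (baseComp Px Pa) u ∈ base n d r A from this.2.2
  refine genBy_induction (p := fun u => u ∈ base n d r A ∧ sig k u ∈ base n d r A ∧
      vectorField D (baseComp Px Pa) u ∈ base n d r A) ?_ ?_ ?_ ?_ hu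
  · intro f
    refine ⟨fn_mem_base f, by rw [sig_fn]; exact fn_mem_base f, ?_⟩
    rw [vectorField_fn]
    exact Subalgebra.sum_mem _ fun μ _ => Subalgebra.mul_mem _ (hPx μ) (fn_mem_base _)
  · rintro _ ⟨i, rfl⟩
    refine ⟨a_mem_base i, ?_, ?_⟩
    · rw [sig_gen]; exact Subalgebra.smul_mem _ (a_mem_base i) _
    · rw [vectorField_gen]; exact hPa i
  · rintro u v ⟨h1, h2, h3⟩ ⟨h1', h2', h3'⟩
    simp only [map_add]
    exact ⟨add_mem h1 h1', add_mem h2 h2', add_mem h3 h3'⟩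
  · rintro u v ⟨h1, h2, h3⟩ ⟨h1', h2', h3'⟩
    rw [map_mul, hder]
    exact ⟨mul_mem h1 h1', mul_mem h2 h2', add_mem (mul_mem h3 h1') (mul_mem h2 h3')⟩

theorem gen_mem_homogeneous' {k : ℕ} {g : Gen d r} (h : g.deg n = k) :
    (gen g : GrAlg n d r A) ∈ homogeneous k := h ▸ gen_mem_homogeneous g

theorem isComp_gcomm {p q : ℕ} {X Y : Coord d r → GrAlg n d r A} (hX : IsComp p X)
    (hY : IsComp q Y) (s : ℝ) :
    IsComp (p + q) (fun c => vectorField D X (Y c) - s • vectorField D Y (X c)) := fun c => by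
  refine sub_mem ?_ (Submodule.smul_mem _ _ ?_)
  · have := vectorField_mem (D := D) hX (hY c)
    rwa [add_assoc, add_comm q] at this
  · rw [← add_assoc]; exact vectorField_mem hY (hX c)

/-- Homogeneous functions of the coordinates `x^μ`, `a^a` which are the components of a vector field
of degree `k`. -/
structure IsBase (k : ℕ) (Px : Fin d → GrAlg n d r A) (Pa : Fin r → GrAlg n d r A) : Prop where
  x : ∀ μ, Px μ ∈ homogeneous k
  a : ∀ i, Pa i ∈ homogeneous (k + 1)
  bx : ∀ μ, Px μ ∈ base n d r A
  ba : ∀ i, Pa i ∈ base n d r A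

theorem IsBase.isComp {k : ℕ} {Px : Fin d → GrAlg n d r A} {Pa : Fin r → GrAlg n d r A}
    (h : IsBase k Px Pa) : IsComp k (baseComp Px Pa) := isComp_baseComp h.x h.a

variable {c : ℝ} {Xx Px : Fin d → GrAlg n d r A} {Xa Pa : Fin r → GrAlg n d r A}

theorem isComp_liftComp (hn : 1 ≤ n) (hX : IsBase 1 Xx Xa) (hP : IsBase n Px Pa) :
    IsComp 1 (liftComp D c Xx Px Xa Pa) := by
  have hδ := isComp_deltaComp (A := A) (d := d) (r := r) hn c
  rintro (μ | i | μ | i)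
  · simpa [coordDeg, liftComp] using hX.x μ
  · simpa [coordDeg, liftComp, Gen.deg] using hX.a i
  · refine add_mem (Submodule.smul_mem _ _ ?_) ?_
    · have := vectorField_mem (D := D) hδ (hX.x μ)
      rwa [add_comm] at this
    · have := hP.x μ
      simpa [coordDeg, Gen.deg, Nat.sub_add_cancel hn] using this
  · refine Submodule.smul_mem _ _ (add_mem (Submodule.smul_mem _ _ ?_) (hP.a i))
    have := vectorField_mem (D := D) hδ (hX.a i)
    simp only [coordDeg, Gen.deg]
    convert this using 2
    omega

theorem vectorField_liftComp_of_mem_base (hn : 1 ≤ n) (hX : IsBase 1 Xx Xa)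
    (hP : IsBase n Px Pa) {u : GrAlg n d r A} (hu : u ∈ base n d r A) :
    vectorField D (liftComp D c Xx Px Xa Pa) u = vectorField D (baseComp Xx Xa) u := by
  refine (isGDer_vectorField (isComp_liftComp hn hX hP)).eq_on
    (isGDer_vectorField hX.isComp) ?_ ?_ hu
  · intro f
    rw [vectorField_fn, vectorField_fn]
    rfl
  · rintro _ ⟨i, rfl⟩
    rw [vectorField_gen, vectorField_gen]
    rfl

/-- The relation that characterises the lift: `[Q, δ] = P` on functions of `x` and `a`. The
commutator is a vector field of degree `n`, so it suffices to compare its `x`- and `a`-components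
with those of `P`. The dotted components in `liftComp` are chosen to make these agree, and `c * c =
1` removes the factor in `δ a = c ȧ`. -/
theorem vectorField_liftComp_delta (hD : ∀ μ ν f, D μ (D ν f) = D ν (D μ f)) (hn : 1 ≤ n)
    (hc : c * c = 1) (hX : IsBase 1 Xx Xa)
    (hP : IsBase n Px Pa) {u : GrAlg n d r A} (hu : u ∈ base n d r A) :
    vectorField D (liftComp D c Xx Px Xa Pa) (vectorField D (deltaComp c) u) =
      (-1 : ℝ) ^ (n - 1) • vectorField D (deltaComp c) (vectorField D (baseComp Xx Xa) u)
        + vectorField D (baseComp Px Pa) u := by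
  have hQ := isComp_liftComp (D := D) (c := c) hn hX hP
  have hδ := isComp_deltaComp (A := A) (d := d) (r := r) hn c
  have h := gcomm_vectorField hD hQ hδ u
  rw [sub_eq_iff_eq_add, vectorField_liftComp_of_mem_base hn hX hP hu, one_mul] at h
  rw [h, add_comm]
  congr 1
  have hk : 1 + (n - 1) = n := by omega
  have hZ := isComp_gcomm (D := D) hQ hδ ((-1 : ℝ) ^ (n - 1))
  rw [hk] at hZ
  refine (isGDer_vectorField hZ).eq_on (isGDer_vectorField hP.isComp) ?_ ?_ hu
  · intro f
    rw [vectorField_fn, vectorField_fn]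
    refine Finset.sum_congr rfl fun μ _ => ?_
    simp [deltaComp, vectorField_gen, baseComp, liftComp]
  · rintro _ ⟨i, rfl⟩
    rw [vectorField_gen, vectorField_gen]
    simp only [deltaComp, map_smul, vectorField_gen, baseComp, liftComp, smul_smul, hc, one_smul]
    abel

/-- The lift of a pair of vector fields squares to zero exactly if the vector field of degree `1`
squares to zero and commutes with the vector field of degree `n` in the graded sense. -/
theorem liftComp_sq_eq_zero_iff (hD : ∀ μ ν f, D μ (D ν f) = D ν (D μ f)) (hn : 1 ≤ n)
    (hx : ∃ x : Fin d → A, ∀ μ ν, D ν (x μ) = if ν = μ then 1 else 0)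
    (hc : c * c = 1) (hX : IsBase 1 Xx Xa) (hP : IsBase n Px Pa) :
    (∀ u, vectorField D (liftComp D c Xx Px Xa Pa)
        (vectorField D (liftComp D c Xx Px Xa Pa) u) = 0) ↔
      ((∀ μ, vectorField D (baseComp Xx Xa) (Xx μ) = 0) ∧
        (∀ i, vectorField D (baseComp Xx Xa) (Xa i) = 0)) ∧
      (∀ μ, vectorField D (baseComp Xx Xa) (Px μ)
        - (-1 : ℝ) ^ n • vectorField D (baseComp Px Pa) (Xx μ) = 0) ∧
      (∀ i, vectorField D (baseComp Xx Xa) (Pa i)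
        - (-1 : ℝ) ^ n • vectorField D (baseComp Px Pa) (Xa i) = 0) := by
  have hQ := isComp_liftComp (D := D) (c := c) hn hX hP
  have hb := fun {u} => vectorField_liftComp_of_mem_base (D := D) (c := c) (u := u) hn hX hP
  have hδ := fun {u} => vectorField_liftComp_delta (D := D) (c := c) (u := u) hD hn hc hX hP
  set Q := vectorField D (liftComp D c Xx Px Xa Pa) with hQdef
  have hs : (-1 : ℝ) ^ n = -(-1 : ℝ) ^ (n - 1) := by
    obtain ⟨k, rfl⟩ := Nat.exists_eq_add_of_le' hn
    simp [pow_succ]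
  -- This computes `Q²` on a dotted coordinate, with `b` and `p` in the roles of the components of
  -- `X` and `P`: the `δ`-part is `X²`, the rest is the graded commutator of `X` and `P`.
  have key : ∀ (b p : GrAlg n d r A), b ∈ base n d r A → p ∈ base n d r A →
      Q ((-1 : ℝ) ^ (n - 1) • vectorField D (deltaComp c) b + p) =
        vectorField D (deltaComp c) (vectorField D (baseComp Xx Xa) b)
        + (vectorField D (baseComp Xx Xa) p - (-1 : ℝ) ^ n • vectorField D (baseComp Px Pa) b) := by
    intro b p hb' hp
    rw [map_add, map_smul, hδ hb', hb hp, smul_add, smul_smul, neg_one_pow_mul_self_eq_one,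
      one_smul, hs, neg_smul_grAlg]
    abel
  -- As `2 Q² = [Q, Q]` is a vector field with the components `2 Q(Q^c)`, it vanishes as soon as
  -- these do. Conversely, the components are recovered by applying `Q²` to the coordinates, those
  -- of degree `0` being supplied by `hx`.
  have hcomp : (∀ u, Q (Q u) = 0) ↔ ∀ e, Q (liftComp D c Xx Px Xa Pa e) = 0 := by
    constructor
    · rintro h (μ | g)
      · obtain ⟨x, hx⟩ := hx
        have := h (fn (x μ))
        rw [hQdef, vectorField_fn, ← hQdef] at this
        simp only [hx] at this
        rw [Finset.sum_eq_single μ] at this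
        · simpa [fn_one] using this
        · intro ν _ hν
          simp [hν, fn_zero]
        · simp
      · have := h (gen g)
        rwa [hQdef, vectorField_gen, ← hQdef] at this
    · intro h u
      have h1 := gcomm_vectorField hD hQ hQ u
      simp only [← hQdef, h] at h1
      simp only [one_mul, pow_one, neg_smul_grAlg, one_smul, sub_neg_eq_add, add_zero] at h1
      refine eq_zero_of_add_self (h1.trans ?_)
      rw [vectorField_apply]
      simp
  rw [hcomp]
  constructor
  · intro h
    have hX0 : ∀ μ, vectorField D (baseComp Xx Xa) (Xx μ) = 0 := fun μ => by
      rw [← hb (hX.bx μ)]; exact h (.inl μ)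
    have hX1 : ∀ i, vectorField D (baseComp Xx Xa) (Xa i) = 0 := fun i => by
      rw [← hb (hX.ba i)]; exact h (.inr (.a i))
    refine ⟨⟨hX0, hX1⟩, fun μ => ?_, fun i => ?_⟩
    · have := h (.inr (.xdot μ))
      simp only [liftComp] at this
      rwa [key _ _ (hX.bx μ) (hP.bx μ), hX0, map_zero, zero_add] at this
    · have := h (.inr (.adot i))
      simp only [liftComp] at this
      rw [map_smul, key _ _ (hX.ba i) (hP.ba i), hX1, map_zero, zero_add] at this
      have h2 := congrArg (c • ·) this
      simpa only [smul_smul, hc, one_smul, smul_zero] using h2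
  · rintro ⟨⟨h1, h2⟩, h3, h4⟩ (μ | i | μ | i)
    · simp only [liftComp]; rw [hb (hX.bx μ), h1]
    · simp only [liftComp]; rw [hb (hX.ba i), h2]
    · simp only [liftComp]; rw [key _ _ (hX.bx μ) (hP.bx μ), h1, h3, map_zero, zero_add]
    · simp only [liftComp]
      rw [map_smul, key _ _ (hX.ba i) (hP.ba i), h2, h4, map_zero, zero_add, smul_zero]

/-! #### Changes of coordinates -/

section CoordChange

variable {A' : Type*} [CommRing A'] [Algebra ℝ A'] {D' : Fin d → Derivation ℝ A' A'}
  {s : ℝ} {tr : A' →+* A} {x' : Fin d → A} {g : Fin r → Fin r → A}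

/-- Changes of coordinates exist. -/
theorem exists_isCoordChange (hn : 1 ≤ n) (s : ℝ) (tr : A' →+* A)
    (htr : ∀ c : ℝ, tr (algebraMap ℝ A' c) = algebraMap ℝ A c) (x' : Fin d → A)
    (g : Fin r → Fin r → A) :
    ∃ T : GrAlg n d r A' →ₐ[ℝ] GrAlg n d r A, IsCoordChange s D tr x' g T := by
  let v : Gen d r → GrAlg n d r A
    | .a b => ∑ a, fn (g b a) * gen (.a a)
    | .xdot μ => ∑ ν, fn (D ν (x' μ)) * gen (.xdot ν)
    | .adot b => (∑ a, fn (g b a) * gen (.adot a))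
        + s • ∑ ν, ∑ a, fn (D ν (g b a)) * gen (.a a) * gen (.xdot ν)
  have hv : ∀ h, v h ∈ homogeneous (h.deg n) := by
    rintro (b | μ | b)
    · exact sum_mem fun a _ => fn_mul_mem_homogeneous _ (gen_mem_homogeneous' rfl)
    · exact sum_mem fun a _ => fn_mul_mem_homogeneous _ (gen_mem_homogeneous' rfl)
    · refine add_mem (sum_mem fun a _ => fn_mul_mem_homogeneous _ (gen_mem_homogeneous' rfl))
        (Submodule.smul_mem _ _ (sum_mem fun ν _ => sum_mem fun a _ => ?_))
      have := mul_mem_homogeneous (fn_mul_mem_homogeneous (D ν (g b a))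
        (gen_mem_homogeneous (n := n) (.a a))) (gen_mem_homogeneous (n := n) (.xdot ν))
      simpa [Gen.deg, Nat.add_sub_cancel' hn] using this
  let T : GrAlg n d r A' →ₐ[ℝ] GrAlg n d r A :=
    lift (fun f => fn (tr f)) v (fun f f' => by rw [map_add, fn_add])
      (fun f f' => by rw [map_mul, fn_mul]) (fun c => by rw [htr, fn_algebraMap])
      (fun f h => (fn_comm _ _).symm) (fun h h' => mul_comm_of_mem (hv h) (hv h'))
  refine ⟨T, ⟨fun f => lift_fn .., fun b => ?_, fun μ => ?_, fun b => ?_⟩⟩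
  all_goals exact lift_gen ..

variable {T : GrAlg n d r A' →ₐ[ℝ] GrAlg n d r A}

theorem isCoordChange_gen_mem (hT : IsCoordChange s D tr x' g T) (hn : 1 ≤ n) (h : Gen d r) :
    T (gen h) ∈ homogeneous (h.deg n) := by
  rcases h with (b | μ | b)
  · rw [hT.a]
    exact sum_mem fun a _ => fn_mul_mem_homogeneous _ (gen_mem_homogeneous' rfl)
  · rw [hT.xdot]
    exact sum_mem fun a _ => fn_mul_mem_homogeneous _ (gen_mem_homogeneous' rfl)
  · rw [hT.adot]
    refine add_mem (sum_mem fun a _ => fn_mul_mem_homogeneous _ (gen_mem_homogeneous' rfl))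
      (Submodule.smul_mem _ _ (sum_mem fun ν _ => sum_mem fun a _ => ?_))
    have := mul_mem_homogeneous (fn_mul_mem_homogeneous (D ν (g b a))
      (gen_mem_homogeneous (n := n) (.a a))) (gen_mem_homogeneous (n := n) (.xdot ν))
    simpa [Gen.deg, Nat.add_sub_cancel' hn] using this

theorem isCoordChange_sig (hT : IsCoordChange s D tr x' g T) (hn : 1 ≤ n) (k : ℕ)
    (u : GrAlg n d r A') : T (sig k u) = sig k (T u) := by
  induction u using induction_mul with
  | hfn f => rw [sig_fn, hT.fn, sig_fn]
  | hgen h => rw [sig_gen, map_smul, sig_of_mem (isCoordChange_gen_mem hT hn h)]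
  | hadd u v hu hv => simp only [map_add, hu, hv]
  | hmul u v hu hv => simp only [map_mul, hu, hv]

theorem isCoordChange_mem_base (hT : IsCoordChange s D tr x' g T) {u : GrAlg n d r A'}
    (hu : u ∈ base n d r A') : T u ∈ base n d r A := by
  refine genBy_induction (p := fun u => T u ∈ base n d r A) ?_ ?_ ?_ ?_ hu
  · intro f; rw [hT.fn]; exact fn_mem_base _
  · rintro _ ⟨i, rfl⟩
    rw [hT.a]
    exact Subalgebra.sum_mem _ fun a _ => mul_mem (fn_mem_base _) (a_mem_base _)
  · intro u v hu hv; rw [map_add]; exact add_mem hu hv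
  · intro u v hu hv; rw [map_mul]; exact mul_mem hu hv

/-- Vector fields of the same degree which are related on a set of generators are related on the
generated subalgebra. -/
theorem isCoordChange_related (hT : IsCoordChange s D tr x' g T) (hn : 1 ≤ n) {k : ℕ}
    {S : Set (Gen d r)}
    {Y : Coord d r → GrAlg n d r A} {Y' : Coord d r → GrAlg n d r A'} (hY : IsComp k Y)
    (hY' : IsComp k Y')
    (hfn : ∀ f, vectorField D Y (fn (tr f)) = T (vectorField D' Y' (fn f)))
    (hgen : ∀ h ∈ S, vectorField D Y (T (gen h)) = T (vectorField D' Y' (gen h)))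
    {u : GrAlg n d r A'} (hu : u ∈ genBy S) :
    vectorField D Y (T u) = T (vectorField D' Y' u) := by
  refine eq_on_genBy (k := k) (S := S) T (U := (vectorField D Y).comp T.toLinearMap)
    (V := T.toLinearMap.comp (vectorField D' Y')) ?_ ?_ ?_ ?_ hu
  · intro u v
    simp only [LinearMap.comp_apply, AlgHom.toLinearMap_apply, map_mul,
      isGDer_vectorField hY _ _, isCoordChange_sig hT hn]
  · intro u v
    simp only [LinearMap.comp_apply, AlgHom.toLinearMap_apply, map_mul,
      isGDer_vectorField hY' _ _, isCoordChange_sig hT hn, map_add]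
  · intro f
    simp only [LinearMap.comp_apply, AlgHom.toLinearMap_apply, hT.fn, hfn]
  · intro h hh
    exact hgen h hh

/-- Applying `δ` to `a'^b = g^b_a a^a` gives `c g ȧ` and the term `∂_ν g ẋ^ν a`. Moving `ẋ` behind
`a` costs `(-1)^{n-1} = c s`, which is the coefficient produced by `c` times the transformation law
of `ȧ`. -/
theorem isCoordChange_delta (hT : IsCoordChange s D tr x' g T) (hn : 1 ≤ n)
    (hcs : c * s = (-1 : ℝ) ^ (n - 1))
    (hchain : ∀ ν f, D ν (tr f) = ∑ μ, D ν (x' μ) * tr (D' μ f))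
    {u : GrAlg n d r A'} (hu : u ∈ base n d r A') :
    vectorField D (deltaComp c) (T u) = T (vectorField D' (deltaComp c) u) := by
  refine isCoordChange_related hT hn (isComp_deltaComp hn c) (isComp_deltaComp hn c) ?_ ?_ hu
  · intro f
    rw [vectorField_fn, vectorField_fn, map_sum]
    simp only [hchain, fn_sum, fn_mul, map_mul, deltaComp, hT.xdot, hT.fn, Finset.mul_sum,
      Finset.sum_mul]
    rw [Finset.sum_comm]
    refine Finset.sum_congr rfl fun μ _ => Finset.sum_congr rfl fun ν _ => ?_
    rw [← mul_assoc, gen_mul_fn]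
  · rintro _ ⟨b, rfl⟩
    rw [vectorField_gen, hT.a, map_sum]
    simp only [isGDer_vectorField (isComp_deltaComp hn c) _ _, sig_fn, vectorField_gen,
      vectorField_fn, deltaComp, map_smul, hT.adot, Finset.sum_add_distrib, smul_add, smul_smul,
      hcs, Finset.sum_mul, Finset.smul_sum, mul_smul_comm]
    rw [add_comm, Finset.sum_comm]
    congr 1
    refine Finset.sum_congr rfl fun μ _ => Finset.sum_congr rfl fun ν _ => ?_
    rw [gen_mul_fn, mul_assoc, gen_mul_gen, mul_smul_comm, ← mul_assoc]
    simp [Gen.deg]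

/-- Lifts of related vector fields are related. -/
theorem isCoordChange_liftComp (hT : IsCoordChange s D tr x' g T)
    (hD : ∀ μ ν f, D μ (D ν f) = D ν (D μ f)) (hn : 1 ≤ n) (hc : c * c = 1)
    (hcs : c * s = (-1 : ℝ) ^ (n - 1))
    (hchain : ∀ ν f, D ν (tr f) = ∑ μ, D ν (x' μ) * tr (D' μ f))
    (hx : ∃ x : Fin d → A', (∀ μ, tr (x μ) = x' μ) ∧ ∀ μ ν, D' ν (x μ) = if ν = μ then 1 else 0)
    {Xx' Px' : Fin d → GrAlg n d r A'} {Xa' Pa' : Fin r → GrAlg n d r A'}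
    (hX : IsBase 1 Xx Xa) (hP : IsBase n Px Pa) (hX' : IsBase 1 Xx' Xa') (hP' : IsBase n Px' Pa')
    (hXT : ∀ u ∈ base n d r A', vectorField D (baseComp Xx Xa) (T u) =
      T (vectorField D' (baseComp Xx' Xa') u))
    (hPT : ∀ u ∈ base n d r A', vectorField D (baseComp Px Pa) (T u) =
      T (vectorField D' (baseComp Px' Pa') u)) (u : GrAlg n d r A') :
    vectorField D (liftComp D c Xx Px Xa Pa) (T u) =
      T (vectorField D' (liftComp D' c Xx' Px' Xa' Pa') u) := by
  have hδ := fun {u} => isCoordChange_delta hT (c := c) hn hcs hchain (u := u)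
  -- The dotted coordinates are, up to the factor `c`, the images under `δ` of base coordinates. On
  -- such images relatedness follows from `Q δ = (-1)^{n-1} δ X + P` in both charts, because `δ`,
  -- `X` and `P` are related.
  have hkey : ∀ u ∈ base n d r A', vectorField D (liftComp D c Xx Px Xa Pa)
      (T (vectorField D' (deltaComp c) u)) =
      T ((-1 : ℝ) ^ (n - 1) • vectorField D' (deltaComp c) (vectorField D' (baseComp Xx' Xa') u)
        + vectorField D' (baseComp Px' Pa') u) := by
    intro u hu
    rw [← hδ hu, vectorField_liftComp_delta hD hn hc hX hP (isCoordChange_mem_base hT hu), hXT u hu, hPT u hu,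
      hδ (vectorField_mem_base hX'.x hX'.a hX'.bx hX'.ba hu), map_add, map_smul]
  refine isCoordChange_related hT hn (isComp_liftComp hn hX hP) (isComp_liftComp hn hX' hP') ?_ ?_
    (mem_genBy_univ u)
  · intro f
    rw [vectorField_liftComp_of_mem_base hn hX hP (fn_mem_base _), ← hT.fn, hXT _ (fn_mem_base f),
      vectorField_liftComp_of_mem_base hn hX' hP' (fn_mem_base _)]
  · rintro (b | μ | b) -
    · rw [vectorField_liftComp_of_mem_base hn hX hP (isCoordChange_mem_base hT (a_mem_base b)),
        hXT _ (a_mem_base b), vectorField_liftComp_of_mem_base hn hX' hP' (a_mem_base b)]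
    · obtain ⟨x, -, hx⟩ := hx
      have hfn : ∀ Y : Coord d r → GrAlg n d r A', vectorField D' Y (fn (x μ)) = Y (.inl μ) := by
        intro Y
        rw [vectorField_fn, Finset.sum_eq_single μ]
        · simp [hx, fn_one]
        · intro ν _ hν
          simp [hx, hν, fn_zero]
        · simp
      have := hkey _ (fn_mem_base (x μ))
      rw [hfn, hfn, hfn] at this
      rw [vectorField_gen]
      exact this
    · have := hkey _ (a_mem_base b)
      rw [vectorField_gen, vectorField_gen, vectorField_gen] at this
      simp only [deltaComp, baseComp, map_smul] at this
      have h2 := congrArg (c • ·) this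
      simp only [smul_smul, hc, one_smul] at h2
      rw [h2, vectorField_gen, liftComp, map_smul]

end CoordChange

end GrAlg

end GappedLie

end

noncomputable section

namespace GappedLie

/-! ### Alternating sums -/

/-- The sign of a permutation as a real number. -/
abbrev rsign {m : ℕ} (σ : Equiv.Perm (Fin m)) : ℝ := ((Equiv.Perm.sign σ : ℤ) : ℝ)

theorem rsign_mul_self {m : ℕ} (σ : Equiv.Perm (Fin m)) : rsign σ * rsign σ = 1 := by
  rcases Int.units_eq_one_or (Equiv.Perm.sign σ) with h | h <;> simp [rsign, h]

theorem rsign_mul {m : ℕ} (σ τ : Equiv.Perm (Fin m)) : rsign (σ * τ) = rsign σ * rsign τ := by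
  simp [rsign]

theorem rsign_inv {m : ℕ} (σ : Equiv.Perm (Fin m)) : rsign σ⁻¹ = rsign σ := by
  simp [rsign]

theorem rsign_cycleRange {m : ℕ} (i : Fin m) : rsign i.cycleRange = (-1) ^ (i : ℕ) := by
  simp [rsign, Fin.sign_cycleRange]

theorem map_perm_rsign {ι N : Type*} [AddCommGroup ι] [Module ℝ ι] [AddCommGroup N] [Module ℝ N]
    {m : ℕ} (f : ι [⋀^Fin m]→ₗ[ℝ] N) (v : Fin m → ι) (σ : Equiv.Perm (Fin m)) :
    f (v ∘ σ) = rsign σ • f v := by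
  rw [AlternatingMap.map_perm, rsign, Int.cast_smul_eq_zsmul]
  rfl

section AltSum

variable {ι N : Type*} [AddCommGroup N] [Module ℝ N]

/-- The alternating sum over all permutations of the arguments. -/
def altSum {m : ℕ} (F : (Fin m → ι) → N) (v : Fin m → ι) : N :=
  ∑ σ : Equiv.Perm (Fin m), rsign σ • F (v ∘ σ)

theorem altSum_perm {m : ℕ} (F : (Fin m → ι) → N) (v : Fin m → ι) (τ : Equiv.Perm (Fin m)) :
    altSum F (v ∘ τ) = rsign τ • altSum F v := by
  unfold altSum
  rw [← Equiv.sum_comp (Equiv.mulLeft τ⁻¹), Finset.smul_sum]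
  refine Finset.sum_congr rfl fun σ _ => ?_
  rw [Equiv.coe_mulLeft, smul_smul, rsign_mul, rsign_inv]
  congr 2
  funext i
  simp

theorem altSum_comp_perm {m : ℕ} (F : (Fin m → ι) → N) (v : Fin m → ι) (τ : Equiv.Perm (Fin m)) :
    altSum (fun w => F (w ∘ τ)) v = rsign τ • altSum F v := by
  unfold altSum
  rw [← Equiv.sum_comp (Equiv.mulRight τ) (fun σ => rsign σ • F (v ∘ σ)), Finset.smul_sum]
  refine Finset.sum_congr rfl fun σ _ => ?_
  rw [Equiv.coe_mulRight, smul_smul, rsign_mul, mul_comm (rsign σ), ← mul_assoc, rsign_mul_self,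
    one_mul]
  rfl

theorem altSum_of_alternating {m : ℕ} {F : (Fin m → ι) → N}
    (hF : ∀ v (τ : Equiv.Perm (Fin m)), F (v ∘ τ) = rsign τ • F v) (v : Fin m → ι) :
    altSum F v = (m.factorial : ℝ) • F v := by
  unfold altSum
  simp only [hF, smul_smul, rsign_mul_self, one_smul, Finset.sum_const, Finset.card_univ,
    Fintype.card_perm, Fintype.card_fin]
  rw [Nat.cast_smul_eq_nsmul]

theorem altSum_add {m : ℕ} (F G : (Fin m → ι) → N) (v : Fin m → ι) :
    altSum (fun w => F w + G w) v = altSum F v + altSum G v := by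
  simp [altSum, Finset.sum_add_distrib]

theorem altSum_smul {m : ℕ} (c : ℝ) (F : (Fin m → ι) → N) (v : Fin m → ι) :
    altSum (fun w => c • F w) v = c • altSum F v := by
  simp only [altSum, Finset.smul_sum]
  exact Finset.sum_congr rfl fun σ _ => smul_comm _ _ _

/-- The alternating sum of a function which is alternating in all arguments but the first. -/
theorem altSum_succ {m : ℕ} (F : ι → (Fin m → ι) → N)
    (hF : ∀ x v (τ : Equiv.Perm (Fin m)), F x (v ∘ τ) = rsign τ • F x v) (e : Fin (m + 1) → ι) :
    altSum (fun w => F (w 0) (fun i => w i.succ)) e =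
      (m.factorial : ℝ) • ∑ i : Fin (m + 1), (-1 : ℝ) ^ (i : ℕ) •
        F (e i) (fun k => e (i.succAbove k)) := by
  unfold altSum
  rw [← Equiv.sum_comp Equiv.Perm.decomposeFin.symm, Fintype.sum_prod_type, Finset.smul_sum]
  refine Finset.sum_congr rfl fun p _ => ?_
  -- A permutation is split into the image `p` of `0` and a permutation `τ` of the rest; each of the
  -- `m!` choices of `τ` contributes the same term.
  have h : ∀ τ : Equiv.Perm (Fin m), rsign (Equiv.Perm.decomposeFin.symm (p, τ)) •
      F ((e ∘ (Equiv.Perm.decomposeFin.symm (p, τ))) 0)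
        (fun i => (e ∘ (Equiv.Perm.decomposeFin.symm (p, τ))) i.succ) =
      (-1 : ℝ) ^ (p : ℕ) • F (e p) (fun k => e (p.succAbove k)) := by
    intro τ
    have h1 : (fun i : Fin m => (e ∘ (Equiv.Perm.decomposeFin.symm (p, τ))) i.succ) =
        (fun i : Fin m => e (Equiv.swap 0 p i.succ)) ∘ τ := by
      funext i
      simp [Equiv.Perm.decomposeFin_symm_apply_succ]
    rw [h1, hF, smul_smul]
    simp only [Function.comp, Equiv.Perm.decomposeFin_symm_apply_zero]
    refine Fin.cases ?_ (fun i => ?_) p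
    · simp only [rsign, Equiv.Perm.decomposeFin.symm_sign]
      simp only [if_true, one_mul, Fin.val_zero, pow_zero, Equiv.swap_self, Equiv.refl_apply,
        Fin.zero_succAbove]
      congr 1
      exact rsign_mul_self τ
    -- After the swap of `0` and `i.succ` the remaining arguments are in increasing order up to a
    -- cycle of sign `(-1)^i`; together with the sign of the swap this is `(-1)^{i+1}`.
    · have h2 : (fun k : Fin m => e (Equiv.swap 0 i.succ k.succ)) =
          (fun k : Fin m => e (i.succ.succAbove k)) ∘ i.cycleRange := by
        funext k
        simp
      rw [h2, hF, smul_smul, rsign_cycleRange]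
      have h3 : rsign (Equiv.Perm.decomposeFin.symm (i.succ, τ)) = - rsign τ := by
        simp only [rsign, Equiv.Perm.decomposeFin.symm_sign]
        simp [Fin.succ_ne_zero]
      rw [h3, neg_mul, rsign_mul_self, Fin.val_succ, pow_succ]
      congr 1
      ring
  rw [Finset.sum_congr rfl fun τ _ => h τ]
  simp only [Finset.sum_const, Finset.card_univ, Fintype.card_perm, Fintype.card_fin]
  rw [Nat.cast_smul_eq_nsmul]

/-- Alternating sums with the last argument in a special position. -/
theorem altSum_last {m : ℕ} (F : ι → (Fin m → ι) → N) (e : Fin (m + 1) → ι) :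
    altSum (fun w => F (w (Fin.last m)) (fun i => w i.castSucc)) e =
      (-1 : ℝ) ^ m • altSum (fun w => F (w 0) (fun i => w i.succ)) e := by
  have := altSum_comp_perm (fun w => F (w (Fin.last m)) (fun i => w i.castSucc)) e
    (finRotate (m + 1))
  simp only [Function.comp, finRotate_last] at this
  have h2 : ∀ i : Fin m, finRotate (m + 1) i.castSucc = i.succ := fun i => by
    rw [finRotate_apply]
    exact Fin.coeSucc_eq_succ
  simp only [h2] at this
  rw [this, smul_smul, rsign, sign_finRotate]
  simp [← mul_pow]

end AltSum

theorem sum_fin_cons {α N : Type*} [Fintype α] [AddCommMonoid N] {m : ℕ}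
    (G : (Fin (m + 1) → α) → N) :
    ∑ I, G I = ∑ i, ∑ J : Fin m → α, G (Fin.cons i J) := by
  rw [← Equiv.sum_comp (Fin.consEquiv fun _ => α), Fintype.sum_prod_type]
  rfl

/-- Signed sums over the ways to single out one of the indices. -/
theorem sum_sum_succAbove {α N : Type*} [Fintype α] [AddCommGroup N] [Module ℝ N] {m : ℕ}
    (F : (Fin (m + 1) → α) → Fin (m + 1) → α → (Fin m → α) → N)
    (G : α → (Fin m → α) → N)
    (h : ∀ j i J, F (Fin.insertNth j i J) j i J = G i J) :
    ∑ I, ∑ j, F I j (I j) (fun k => I (j.succAbove k)) =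
      ((m + 1 : ℕ) : ℝ) • ∑ i, ∑ J : Fin m → α, G i J := by
  rw [Finset.sum_comm]
  have h2 : ∀ j : Fin (m + 1), ∑ I : Fin (m + 1) → α, F I j (I j) (fun k => I (j.succAbove k)) =
      ∑ i, ∑ J : Fin m → α, G i J := by
    intro j
    rw [← Equiv.sum_comp (Fin.insertNthEquiv (fun _ => α) j), Fintype.sum_prod_type]
    refine Finset.sum_congr rfl fun i _ => Finset.sum_congr rfl fun J _ => ?_
    simp only [Fin.insertNthEquiv_apply, Fin.insertNth_apply_same, Fin.insertNth_apply_succAbove]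
    exact h j i J
  rw [Finset.sum_congr rfl fun j _ => h2 j]
  simp only [Finset.sum_const, Finset.card_univ, Fintype.card_fin]
  rw [Nat.cast_smul_eq_nsmul]

/-! ### Monomials in odd elements -/

namespace GrAlg

variable {n d r : ℕ} {A : Type*} [CommRing A] [Algebra ℝ A] {D : Fin d → Derivation ℝ A A}

/-- The product `v_{I 0} v_{I 1} ⋯`. -/
def word {α : Type*} (v : α → GrAlg n d r A) {k : ℕ} (I : Fin k → α) : GrAlg n d r A :=
  (List.ofFn fun i => v (I i)).prod

theorem mono_eq_word {k : ℕ} (I : Fin k → Fin r) :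
    (mono I : GrAlg n d r A) = word (fun i => gen (.a i)) I := rfl

section Word

variable {α : Type*} (v : α → GrAlg n d r A)

@[simp] theorem word_zero (I : Fin 0 → α) : word v I = 1 := by simp [word]

theorem word_succ {k : ℕ} (I : Fin (k + 1) → α) :
    word v I = v (I 0) * word v (fun i => I i.succ) := by
  simp [word, List.ofFn_succ]

@[simp] theorem word_cons {k : ℕ} (i : α) (I : Fin k → α) :
    word v (Fin.cons i I : Fin (k + 1) → α) = v i * word v I := by
  simp [word_succ]

variable {v}

theorem word_mem_homogeneous (hv : ∀ i, v i ∈ homogeneous 1) {k : ℕ} (I : Fin k → α) :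
    word v I ∈ homogeneous k := by
  induction k with
  | zero => simpa [fn_one] using fn_mem_homogeneous (n := n) (d := d) (r := r) (1 : A)
  | succ k ih =>
    have := mul_mem_homogeneous (hv (I 0)) (ih fun i => I i.succ)
    rw [add_comm] at this
    rwa [word_succ]

theorem word_mem {S : Subalgebra ℝ (GrAlg n d r A)} (hv : ∀ i, v i ∈ S) {k : ℕ} (I : Fin k → α) :
    word v I ∈ S := by
  induction k with
  | zero => simp
  | succ k ih =>
    rw [word_succ]
    exact mul_mem (hv _) (ih _)

variable [Fintype α] [DecidableEq α]

/-- A linear combination of the odd elements `v i` squares to zero, so `v` extends to an algebra map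
from the exterior algebra. Words are images of wedge products of basis vectors and inherit their
sign rule. -/
theorem word_perm (hv : ∀ i, v i ∈ homogeneous 1) {k : ℕ} (I : Fin k → α)
    (σ : Equiv.Perm (Fin k)) : word v (I ∘ σ) = rsign σ • word v I := by
  let f : (α → ℝ) →ₗ[ℝ] GrAlg n d r A := Fintype.linearCombination ℝ v
  have hf : ∀ c, f c * f c = 0 := by
    intro c
    have hc : f c ∈ homogeneous 1 := by
      simp only [f, Fintype.linearCombination_apply]
      exact sum_mem fun i _ => Submodule.smul_mem _ _ (hv i)
    apply eq_zero_of_add_self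
    have := mul_comm_of_mem hc hc
    rw [mul_one, pow_one, neg_smul_grAlg, one_smul] at this
    nth_rewrite 1 [this]
    exact neg_add_cancel _
  have hw : ∀ J : Fin k → α, word v J = ExteriorAlgebra.lift ℝ ⟨f, hf⟩
      (ExteriorAlgebra.ιMulti ℝ k (fun i => (Pi.single (J i) 1 : α → ℝ))) := by
    intro J
    rw [ExteriorAlgebra.ιMulti_apply, map_list_prod, List.map_ofFn, word]
    congr 2
    funext i
    simp [f, Fintype.linearCombination_apply_single]
  rw [hw, hw]
  have := map_perm_rsign (ExteriorAlgebra.ιMulti ℝ k (M := α → ℝ))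
    (fun i => (Pi.single (I i) 1 : α → ℝ)) σ
  rw [← map_smul, ← this]
  rfl

end Word

theorem a_mem_homogeneous (i : Fin r) : (gen (.a i) : GrAlg n d r A) ∈ homogeneous 1 :=
  gen_mem_homogeneous' rfl

/-- The Leibniz rule for a product of odd elements. -/
theorem gder_word {α : Type*} {v : α → GrAlg n d r A} {k e : ℕ}
    {V : GrAlg n d r A →ₗ[ℝ] GrAlg n d r A} (hV : IsGDer k V) (he : Even (k + 1 + e))
    (hv : ∀ i, v i ∈ homogeneous 1) (hVv : ∀ i, V (v i) ∈ homogeneous e)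
    {m : ℕ} (I : Fin (m + 1) → α) :
    V (word v I) =
      ∑ j : Fin (m + 1), (-1 : ℝ) ^ (j : ℕ) • (V (v (I j)) * word v fun i => I (j.succAbove i)) := by
  induction m with
  | zero =>
    rw [word_succ, Fin.sum_univ_one]
    simp
  | succ m ih =>
    rw [word_succ, hV, ih, Fin.sum_univ_succ (n := m + 1), Finset.mul_sum]
    congr 1
    · simp
    · refine Finset.sum_congr rfl fun j _ => ?_
      rw [word_succ v fun i => I (j.succ.succAbove i), mul_smul_comm, ← mul_assoc, ← mul_assoc,
        sig_of_mem (hv _), smul_mul_assoc, mul_comm_of_mem (hv _) (hVv _), smul_smul,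
        smul_mul_assoc, smul_smul]
      simp only [Fin.succ_succAbove_zero, Fin.succ_succAbove_succ]
      congr 1
      rw [Fin.val_succ, pow_succ, ← pow_add, mul_one, one_mul]
      -- By `he` the degree `e` of `V (v i)` has the parity of `k + 1`. Passing `V` and then `V (v
      -- i)` across an odd factor therefore costs one sign `-1` per factor.
      have h1 : (-1 : ℝ) ^ (k + e) = -1 := Odd.neg_one_pow (by
        rw [add_right_comm] at he
        simpa [Nat.even_add_one] using he)
      rw [h1]

/-- The Leibniz rule for an alternating polynomial in odd elements. -/
theorem sum_mul_gder_word {α : Type*} [Fintype α] [DecidableEq α] {v : α → GrAlg n d r A}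
    {k e : ℕ} {V : GrAlg n d r A →ₗ[ℝ] GrAlg n d r A} (hV : IsGDer k V) (he : Even (k + 1 + e))
    (hv : ∀ i, v i ∈ homogeneous 1) (hVv : ∀ i, V (v i) ∈ homogeneous e)
    {m : ℕ} (F : (Fin (m + 1) → α) → A)
    (hF : ∀ I (σ : Equiv.Perm (Fin (m + 1))), F (I ∘ σ) = rsign σ • F I) :
    ∑ I, fn (F I) * V (word v I) =
      ((m + 1 : ℕ) : ℝ) • ∑ i, ∑ J : Fin m → α, fn (F (Fin.cons i J)) * (V (v i) * word v J) := by
  simp only [gder_word hV he hv hVv, Finset.mul_sum]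
  refine sum_sum_succAbove
    (fun I j i J => fn (F I) * ((-1 : ℝ) ^ (j : ℕ) • (V (v i) * word v J)))
    (fun i J => fn (F (Fin.cons i J)) * (V (v i) * word v J)) ?_
  intro j i J
  -- Moving index `j` of the alternating coefficient to the front gives `(-1)^j`, which cancels the
  -- sign of the Leibniz rule; hence all slots contribute equally.
  rw [← Fin.cons_comp_cycleRange, hF, rsign_cycleRange, fn_smul, smul_mul_assoc, mul_smul_comm,
    smul_smul, neg_one_pow_mul_self_eq_one, one_smul]

/-- Only the alternating part of the coefficients of a polynomial in odd elements matters. -/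
theorem sum_fn_altSum_mul_word {α : Type*} [Fintype α] [DecidableEq α] {v : α → GrAlg n d r A}
    (hv : ∀ i, v i ∈ homogeneous 1) {m : ℕ} (F : (Fin m → α) → A) :
    ∑ I, fn (altSum F I) * word v I = (m.factorial : ℝ) • ∑ I, fn (F I) * word v I := by
  simp only [altSum, fn_sum, Finset.sum_mul]
  rw [Finset.sum_comm]
  have : ∀ σ : Equiv.Perm (Fin m), ∑ I, fn (rsign σ • F (I ∘ σ)) * word v I =
      ∑ I, fn (F I) * word v I := by
    intro σ
    rw [← Equiv.sum_comp (Equiv.arrowCongr σ (Equiv.refl α))]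
    refine Finset.sum_congr rfl fun I _ => ?_
    have h1 : (Equiv.arrowCongr σ (Equiv.refl α)) I = I ∘ ⇑σ⁻¹ := rfl
    have h2 : (I ∘ ⇑σ⁻¹) ∘ ⇑σ = I := by funext i; simp
    rw [h1, h2, word_perm hv, fn_smul, rsign_inv, smul_mul_smul_comm, rsign_mul_self, one_smul]
  rw [Finset.sum_congr rfl fun σ _ => this σ]
  simp only [Finset.sum_const, Finset.card_univ, Fintype.card_perm, Fintype.card_fin]
  rw [Nat.cast_smul_eq_nsmul]

/-- The projection to the exterior algebra which kills the coordinates of degree `n - 1` and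
`n`. -/
theorem exists_hom_exteriorAlgebra : ∃ T : GrAlg n d r A →ₐ[ℝ] ExteriorAlgebra A (Fin r → A),
    (∀ f, T (fn f) = algebraMap A _ f) ∧
      ∀ i, T (gen (.a i)) = ExteriorAlgebra.ι A (Pi.single i 1) := by
  let v : Gen d r → ExteriorAlgebra A (Fin r → A)
    | .a i => ExteriorAlgebra.ι A (Pi.single i 1)
    | .xdot _ => 0
    | .adot _ => 0
  refine ⟨lift (fun f => algebraMap A _ f) v (map_add _) (map_mul _)
    (fun c => (IsScalarTower.algebraMap_apply ℝ A _ c).symm)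
    (fun f g => (Algebra.commutes f (v g)).symm) ?_, fun f => lift_fn .., fun i => lift_gen ..⟩
  -- The dotted coordinates map to zero, so only the relation between two coordinates `a` has
  -- content, and it is the anticommutation of `ι`.
  rintro (i | i | i) (j | j | j) <;> simp only [v, mul_zero, zero_mul, smul_zero]
  simp only [Gen.deg, mul_one, pow_one, neg_smul, one_smul]
  exact eq_neg_of_add_eq_zero_left (ExteriorAlgebra.ι_add_mul_swap _ _)

/-- A polynomial in the coordinates of degree `1` vanishes if and only if the alternating part of
its coefficients does. -/
theorem sum_fn_mul_mono_eq_zero_iff {m : ℕ} (F : (Fin m → Fin r) → A) :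
    (∑ I, fn (F I) * mono I : GrAlg n d r A) = 0 ↔ ∀ I, altSum F I = 0 := by
  constructor
  · intro h I₀
    obtain ⟨T, hT, hT'⟩ := exists_hom_exteriorAlgebra (n := n) (d := d) (r := r) (A := A)
    have h1 := congrArg T h
    have hmono : ∀ I : Fin m → Fin r, T (mono I) =
        ExteriorAlgebra.ιMulti A m (fun i => (Pi.single (I i) 1 : Fin r → A)) := by
      intro I
      rw [ExteriorAlgebra.ιMulti_apply, mono, map_list_prod, List.map_ofFn]
      congr 2
      funext i
      exact hT' _
    simp only [map_sum, map_mul, hT, hmono, map_zero, ← Algebra.smul_def] at h1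
    -- The minor on the columns `I₀`, as an alternating form. On a wedge of basis vectors it sees
    -- only the index tuples that are rearrangements of `I₀`, with their signs, so it extracts the
    -- alternating part of the coefficients at `I₀`.
    let φ : (Fin r → A) [⋀^Fin m]→ₗ[A] A :=
      Matrix.detRowAlternating.compLinearMap (LinearMap.funLeft A A I₀)
    have h2 := congrArg (ExteriorAlgebra.liftAlternating (R := A) (Pi.single m φ)) h1
    simp only [map_sum, map_smul, ExteriorAlgebra.liftAlternating_apply_ιMulti, Pi.single_eq_same,
      map_zero] at h2
    have hφ : ∀ I : Fin m → Fin r, φ (fun i => (Pi.single (I i) 1 : Fin r → A)) =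
        ∑ σ : Equiv.Perm (Fin m), if I = I₀ ∘ ⇑σ⁻¹ then ((Equiv.Perm.sign σ : ℤ) : A) else 0 := by
      intro I
      change Matrix.det (Matrix.of fun i j => (Pi.single (I i) 1 : Fin r → A) (I₀ j)) = _
      rw [Matrix.det_apply']
      refine Finset.sum_congr rfl fun σ _ => ?_
      by_cases hI : I = I₀ ∘ ⇑σ⁻¹
      · rw [if_pos hI, hI]
        simp
      · rw [if_neg hI]
        have : ∃ i, I (σ i) ≠ I₀ i := by
          by_contra hcon
          push Not at hcon
          exact hI (funext fun i => by simpa using hcon (σ⁻¹ i))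
        obtain ⟨i, hi⟩ := this
        rw [Finset.prod_eq_zero (Finset.mem_univ i), mul_zero]
        simp [Pi.single_apply, Ne.symm hi]
    simp only [hφ, Finset.smul_sum] at h2
    rw [Finset.sum_comm] at h2
    simp only [smul_ite, smul_zero, Finset.sum_ite_eq', Finset.mem_univ, if_true] at h2
    rw [altSum, ← Equiv.sum_comp (Equiv.inv _), ← h2]
    refine Finset.sum_congr rfl fun σ _ => ?_
    rw [Equiv.inv_apply, rsign_inv, rsign, smul_eq_mul, Int.cast_smul_eq_zsmul, zsmul_eq_mul,
      mul_comm]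
  · intro h
    have h1 := sum_fn_altSum_mul_word (n := n) (d := d) (v := fun i => gen (.a i))
      a_mem_homogeneous F
    simp only [h, fn_zero, zero_mul, Finset.sum_const_zero] at h1
    have h2 : (m.factorial : ℝ) ≠ 0 := by positivity
    have h3 := congrArg ((m.factorial : ℝ)⁻¹ • ·) h1.symm
    simp only [smul_smul, inv_mul_cancel₀ h2, one_smul, smul_zero] at h3
    exact h3

end GrAlg

end GappedLie

end

noncomputable section

namespace GappedLie

/-! ### Vector fields with anchors and structure functions as coefficients -/

namespace GrAlg

variable {n d r : ℕ} {A : Type*} [CommRing A] [Algebra ℝ A] {D : Fin d → Derivation ℝ A A}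

/-- The polynomial in the coordinates of degree `1` with given coefficients. -/
def poly {m : ℕ} (F : (Fin m → Fin r) → A) : GrAlg n d r A := ∑ I, fn (F I) * mono I

theorem poly_add {m : ℕ} (F G : (Fin m → Fin r) → A) :
    (poly (fun I => F I + G I) : GrAlg n d r A) = poly F + poly G := by
  simp [poly, fn_add, add_mul, Finset.sum_add_distrib]

theorem poly_smul {m : ℕ} (c : ℝ) (F : (Fin m → Fin r) → A) :
    (poly (fun I => c • F I) : GrAlg n d r A) = c • poly F := by
  simp [poly, fn_smul, Finset.smul_sum]

theorem poly_sum {ι : Type*} (s : Finset ι) {m : ℕ} (F : ι → (Fin m → Fin r) → A) :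
    (poly (fun I => ∑ i ∈ s, F i I) : GrAlg n d r A) = ∑ i ∈ s, poly (F i) := by
  simp only [poly, fn_sum, Finset.sum_mul]
  exact Finset.sum_comm

theorem poly_eq_zero_iff {m : ℕ} (F : (Fin m → Fin r) → A) :
    (poly F : GrAlg n d r A) = 0 ↔ ∀ I, altSum F I = 0 :=
  sum_fn_mul_mono_eq_zero_iff F

theorem mono_mem_homogeneous {m : ℕ} (I : Fin m → Fin r) :
    (mono I : GrAlg n d r A) ∈ homogeneous m := by
  rw [mono_eq_word]
  exact word_mem_homogeneous a_mem_homogeneous I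

theorem mono_mem_base {m : ℕ} (I : Fin m → Fin r) : (mono I : GrAlg n d r A) ∈ base n d r A := by
  rw [mono_eq_word]
  exact word_mem a_mem_base I

theorem mono_succ {m : ℕ} (I : Fin (m + 1) → Fin r) :
    (mono I : GrAlg n d r A) = gen (.a (I 0)) * mono (fun i => I i.succ) := by
  simp only [mono_eq_word, word_succ]

theorem mono_zero (I : Fin 0 → Fin r) : (mono I : GrAlg n d r A) = 1 := by
  simp [mono_eq_word]

theorem sum_fin_one {α N : Type*} [Fintype α] [AddCommMonoid N] (G : (Fin 1 → α) → N) :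
    ∑ I, G I = ∑ a, G fun _ => a := by
  rw [sum_fin_cons]
  simp only [Fintype.sum_unique]
  refine Finset.sum_congr rfl fun a _ => congrArg G ?_
  funext i
  fin_cases i
  rfl

theorem sum_fin_two {α N : Type*} [Fintype α] [AddCommMonoid N] (G : (Fin 2 → α) → N) :
    ∑ I, G I = ∑ a, ∑ b, G ![a, b] := by
  rw [sum_fin_cons]
  refine Finset.sum_congr rfl fun a _ => ?_
  rw [sum_fin_one]
  refine Finset.sum_congr rfl fun b _ => congrArg G ?_
  funext i
  fin_cases i <;> rfl

theorem mono_one (a : Fin r) : (mono (fun _ : Fin 1 => a) : GrAlg n d r A) = gen (.a a) := by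
  simp [mono_succ, mono_zero]

theorem mono_two (a b : Fin r) :
    (mono ![a, b] : GrAlg n d r A) = gen (.a a) * gen (.a b) := by
  simp [mono_succ, mono_zero]

theorem poly_mem_homogeneous {m : ℕ} (F : (Fin m → Fin r) → A) :
    (poly F : GrAlg n d r A) ∈ homogeneous m :=
  sum_mem fun I _ => fn_mul_mem_homogeneous _ (mono_mem_homogeneous I)

theorem poly_mem_base {m : ℕ} (F : (Fin m → Fin r) → A) :
    (poly F : GrAlg n d r A) ∈ base n d r A :=
  Subalgebra.sum_mem _ fun I _ => mul_mem (fn_mem_base _) (mono_mem_base I)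

theorem poly_succ {m : ℕ} (F : Fin r → (Fin m → Fin r) → A) :
    (poly (fun I : Fin (m + 1) → Fin r => F (I 0) fun i => I i.succ) : GrAlg n d r A) =
      ∑ a, ∑ J, fn (F a J) * (gen (.a a) * mono J) := by
  rw [poly, sum_fin_cons]
  simp [mono_succ]

theorem poly_succ_succ {m : ℕ} (F : Fin r → Fin r → (Fin m → Fin r) → A) :
    (poly (fun I : Fin (m + 2) → Fin r => F (I 0) (I 1) fun i => I i.succ.succ) :
        GrAlg n d r A) =
      ∑ a, ∑ b, ∑ J, fn (F a b J) * (gen (.a a) * (gen (.a b) * mono J)) := by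
  rw [poly, sum_fin_cons]
  refine Finset.sum_congr rfl fun a _ => ?_
  rw [sum_fin_cons]
  refine Finset.sum_congr rfl fun b _ => Finset.sum_congr rfl fun J _ => ?_
  rw [mono_succ, mono_succ]
  rfl

theorem poly_mul_of_mem {m k : ℕ} (F : (Fin m → Fin r) → A) {u : GrAlg n d r A}
    (hu : u ∈ homogeneous k) :
    poly F * u = (-1 : ℝ) ^ (m * k) • ∑ J, fn (F J) * (u * mono J) := by
  rw [poly, Finset.sum_mul, Finset.smul_sum]
  refine Finset.sum_congr rfl fun J _ => ?_
  rw [mul_assoc, mul_comm_of_mem (mono_mem_homogeneous J) hu, mul_smul_comm]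

/-- The `x`-components of the vector field with a given anchor. -/
def anchorComp {m : ℕ} (ρ : (Fin m → Fin r) → Fin d → A) (μ : Fin d) : GrAlg n d r A :=
  (1 / (m.factorial : ℝ)) • poly fun I => ρ I μ

/-- The `a`-components of the vector field with given structure functions. -/
def bracketComp {m : ℕ} (C : (Fin (m + 1) → Fin r) → Fin r → A) (c : Fin r) : GrAlg n d r A :=
  (-(1 / ((m + 1).factorial : ℝ))) • poly fun I => C I c

theorem isBase_anchorComp {m : ℕ} (ρ : (Fin m → Fin r) → Fin d → A)
    (C : (Fin (m + 1) → Fin r) → Fin r → A) :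
    IsBase (n := n) m (anchorComp ρ) (bracketComp C) where
  x _ := Submodule.smul_mem _ _ (poly_mem_homogeneous _)
  a _ := Submodule.smul_mem _ _ (poly_mem_homogeneous _)
  bx _ := Subalgebra.smul_mem _ (poly_mem_base _) _
  ba _ := Subalgebra.smul_mem _ (poly_mem_base _) _

/-- The given formula is the lift with `c = (-1)^{n-1}`. Applying `δ` to `X^μ` yields the terms with
`ρ ȧ` and `∂ρ a ẋ`. Applying it to `X^c` yields the term with `∂C` and two terms with `C`, which are
equal by skew-symmetry and absorb the factor `½`. -/
theorem qHat_eq_liftComp (ρ : (Fin 1 → Fin r) → Fin d → A)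
    (ρn : (Fin n → Fin r) → Fin d → A) (C : (Fin 2 → Fin r) → Fin r → A)
    (hC : ∀ a b c, C ![a, b] c = - C ![b, a] c)
    (Cn : (Fin (n + 1) → Fin r) → Fin r → A) (hn : 1 ≤ n) :
    qHat D (fun a => ρ fun _ => a) ρn (fun a b => C ![a, b]) Cn =
      liftComp D ((-1) ^ (n - 1)) (anchorComp ρ) (anchorComp ρn) (bracketComp C)
        (bracketComp Cn) := by
  have h1 : ∀ μ, (anchorComp ρ μ : GrAlg n d r A) = ∑ a, fn (ρ (fun _ => a) μ) * gen (.a a) := by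
    intro μ
    rw [anchorComp, poly, sum_fin_one]
    simp only [Nat.factorial_one, Nat.cast_one, div_one, one_smul, mono_one]
  have h2 : ∀ c, (bracketComp C c : GrAlg n d r A) =
      (-(1 / 2 : ℝ)) • ∑ a, ∑ b, fn (C ![a, b] c) * gen (.a a) * gen (.a b) := by
    intro c
    rw [bracketComp, poly, sum_fin_two]
    simp only [mono_two, mul_assoc]
    congr 1
  have hδ := isGDer_vectorField (D := D) (isComp_deltaComp (A := A) (d := d) (r := r) hn
    ((-1) ^ (n - 1)))
  have hs := neg_one_pow_mul_self_eq_one (n - 1)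
  have hpar : n * 1 = (n - 1) + 1 := by omega
  have hx : ∀ i μ, (gen (.xdot μ) * gen (.a i) : GrAlg n d r A) =
      (-1 : ℝ) ^ (n - 1) • (gen (.a i) * gen (.xdot μ)) := fun i μ => by
    rw [gen_mul_gen]; simp [Gen.deg]
  have ha : ∀ i j, (gen (.adot i) * gen (.a j) : GrAlg n d r A) =
      (-(-1 : ℝ) ^ (n - 1)) • (gen (.a j) * gen (.adot i)) := fun i j => by
    rw [gen_mul_gen]; simp only [Gen.deg]; rw [hpar, pow_succ]; simp
  have hδfn : ∀ f, vectorField D (deltaComp ((-1) ^ (n - 1))) (fn f : GrAlg n d r A) =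
      ∑ ν, fn (D ν f) * gen (.xdot ν) := fun f => by
    rw [vectorField_fn]
    exact Finset.sum_congr rfl fun ν _ => gen_mul_fn _ _
  have hδa : ∀ i, vectorField D (deltaComp ((-1) ^ (n - 1))) (gen (.a i) : GrAlg n d r A) =
      (-1 : ℝ) ^ (n - 1) • gen (.adot i) := fun i => by
    rw [vectorField_gen]; rfl
  funext e
  rcases e with (μ | c | μ | c)
  · exact (h1 μ).symm
  · rw [liftComp, h2, qHat, neg_smul_grAlg]
  · rw [liftComp, h1, qHat, map_sum]
    congr 1
    simp only [hδ _ _, sig_fn, hδfn, hδa, Finset.sum_mul, Finset.sum_add_distrib, smul_add,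
      mul_smul_comm, Finset.smul_sum, smul_smul, hs, one_smul, mul_assoc, hx]
    rw [add_comm]
    congr 1
    exact Finset.sum_comm
  · have hCsum : ∑ a, ∑ b, fn (C ![a, b] c) * (gen (.a a) * gen (.adot b)) =
        - ∑ a, ∑ b, (fn (C ![a, b] c) * (gen (.a b) * gen (.adot a)) : GrAlg n d r A) := by
      rw [Finset.sum_comm, ← Finset.sum_neg_distrib]
      refine Finset.sum_congr rfl fun a _ => ?_
      rw [← Finset.sum_neg_distrib]
      refine Finset.sum_congr rfl fun b _ => ?_
      rw [hC, fn_neg]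
      exact neg_mul (fn (C ![a, b] c)) _
    have e1 : vectorField D (deltaComp ((-1) ^ (n - 1))) (bracketComp C c : GrAlg n d r A) =
        (-(1 / 2 : ℝ)) • ((∑ μ, ∑ a, ∑ b,
            fn (D μ (C ![a, b] c)) * gen (.xdot μ) * gen (.a a) * gen (.a b))
          + (2 : ℝ) • ∑ a, ∑ b, fn (C ![a, b] c) * (gen (.a a) * gen (.adot b))) := by
      rw [h2, map_smul]
      congr 1
      have e2 : ∀ a b, vectorField D (deltaComp ((-1) ^ (n - 1)))
          (fn (C ![a, b] c) * gen (.a a) * gen (.a b) : GrAlg n d r A) =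
          (∑ μ, fn (D μ (C ![a, b] c)) * gen (.xdot μ) * gen (.a a) * gen (.a b))
          + ((-1 : ℝ) • (fn (C ![a, b] c) * (gen (.a b) * gen (.adot a)))
          + fn (C ![a, b] c) * (gen (.a a) * gen (.adot b))) := by
        intro a b
        have hc : (-1 : ℝ) ^ (n - 1) * -(-1) ^ (n - 1) = -1 := by
          rw [mul_neg, hs]
        rw [mul_assoc, hδ, hδ, sig_fn, hδfn, hδa, hδa, sig_gen]
        simp only [Gen.deg, mul_one, smul_mul_assoc, mul_smul_comm, smul_smul, hs, one_smul, ha,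
          Finset.sum_mul, mul_add, mul_assoc, hc]
      simp only [map_sum, e2, Finset.sum_add_distrib]
      rw [two_smul]
      congr 1
      · symm
        rw [Finset.sum_comm]
        refine Finset.sum_congr rfl fun a _ => ?_
        rw [Finset.sum_comm]
      · congr 1
        rw [hCsum]
        simp only [← Finset.smul_sum]
        rw [neg_smul_grAlg, one_smul]
    rw [liftComp, e1, qHat, bracketComp, poly]
    rw [smul_add, smul_smul, hs, one_smul]
    simp only [mul_assoc]
    have hpn : (-1 : ℝ) ^ (n - 1) = (-1) ^ (n + 1) := neg_one_pow_congr (by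
      obtain ⟨k, rfl⟩ := Nat.exists_eq_add_of_le' hn
      simp [Nat.even_add_one])
    rw [hpn]
    generalize (∑ a, ∑ b, fn (C ![a, b] c) * (gen (.a a) * gen (.adot b)) : GrAlg n d r A) = u
    generalize (∑ I, fn (Cn I c) * mono I : GrAlg n d r A) = v
    module

/-- The derivative of a function along the vector field with the components `ρ_I^μ`. -/
def act {m : ℕ} (D : Fin d → Derivation ℝ A A) (ρ : (Fin m → Fin r) → Fin d → A)
    (I : Fin m → Fin r) (f : A) : A := ∑ μ, ρ I μ * D μ f

theorem act_smul {m : ℕ} (ρ : (Fin m → Fin r) → Fin d → A) (I : Fin m → Fin r) (c : ℝ) (f : A) :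
    act D ρ I (c • f) = c • act D ρ I f := by
  simp [act, Finset.smul_sum]

section

variable {m : ℕ} {ρ : (Fin m → Fin r) → Fin d → A} {C : (Fin (m + 1) → Fin r) → Fin r → A}

theorem vectorField_anchorComp_fn (f : A) :
    (vectorField D (baseComp (anchorComp ρ) (bracketComp C)) (fn f) : GrAlg n d r A) =
      (1 / (m.factorial : ℝ)) • poly fun I => act D ρ I f := by
  rw [vectorField_fn]
  simp only [baseComp, anchorComp, smul_mul_assoc, ← Finset.smul_sum]
  congr 1
  simp only [act, poly_sum]
  refine Finset.sum_congr rfl fun μ _ => ?_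
  simp only [poly, Finset.sum_mul]
  refine Finset.sum_congr rfl fun I _ => ?_
  rw [mul_assoc, ← fn_comm, ← mul_assoc, fn_mul]

/-- The field differentiates either a coefficient, through the anchor, or one of the factors `a`,
through the bracket. Since `F` is alternating, the `k + 1` factors contribute equally. -/
theorem vectorField_anchorComp_poly {k : ℕ} (F : (Fin (k + 1) → Fin r) → A)
    (hF : ∀ I (σ : Equiv.Perm (Fin (k + 1))), F (I ∘ σ) = rsign σ • F I) :
    (vectorField D (baseComp (anchorComp ρ) (bracketComp C)) (poly F) : GrAlg n d r A) =
      (1 / (m.factorial : ℝ)) • ∑ I, poly (fun J => act D ρ J (F I)) * mono I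
      + ((k + 1 : ℕ) : ℝ) • ∑ a, ∑ K, fn (F (Fin.cons a K)) * (bracketComp C a * mono K) := by
  have hder := isGDer_vectorField (D := D)
    (isBase_anchorComp (n := n) ρ C).isComp
  rw [poly, map_sum]
  simp only [hder _ _, sig_fn, vectorField_anchorComp_fn, Finset.sum_add_distrib, smul_mul_assoc,
    ← Finset.smul_sum]
  congr 1
  have := sum_mul_gder_word (n := n) (v := fun i => gen (.a i)) hder ⟨_, rfl⟩
    a_mem_homogeneous
    (fun i => by rw [vectorField_gen]; exact (isBase_anchorComp ρ C).a i) F hF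
  simp only [vectorField_gen, baseComp] at this
  exact this

theorem vectorField_anchorComp_poly_one (F : (Fin 1 → Fin r) → A) :
    (vectorField D (baseComp (anchorComp ρ) (bracketComp C)) (poly F) : GrAlg n d r A) =
      (1 / (m.factorial : ℝ)) • ∑ a, poly (fun J => act D ρ J (F fun _ => a)) * gen (.a a)
      + ∑ a, fn (F fun _ => a) * bracketComp C a := by
  have hder := isGDer_vectorField (D := D) (isBase_anchorComp (n := n) ρ C).isComp
  rw [poly, sum_fin_one, map_sum]
  simp only [mono_one, hder _ _, sig_fn, vectorField_anchorComp_fn, Finset.sum_add_distrib,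
    smul_mul_assoc, ← Finset.smul_sum, vectorField_gen]
  rfl

theorem vectorField_anchorComp_poly_two (F : (Fin 2 → Fin r) → A)
    (hF : ∀ I (σ : Equiv.Perm (Fin 2)), F (I ∘ σ) = rsign σ • F I) :
    (vectorField D (baseComp (anchorComp ρ) (bracketComp C)) (poly F) : GrAlg n d r A) =
      (1 / (m.factorial : ℝ)) • ∑ a, ∑ b,
        poly (fun J => act D ρ J (F ![a, b])) * (gen (.a a) * gen (.a b))
      + (2 : ℝ) • ∑ a, ∑ b, fn (F ![a, b]) * (bracketComp C a * gen (.a b)) := by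
  have h := vectorField_anchorComp_poly (n := n) (D := D) (ρ := ρ) (C := C) (k := 1) F hF
  have e : ∀ a b : Fin r, (Fin.cons a fun _ => b : Fin 2 → Fin r) = ![a, b] := fun a b => by
    funext i; fin_cases i <;> rfl
  rw [h, sum_fin_two]
  congr 1
  · simp only [mono_two]
  · rw [show ((1 + 1 : ℕ) : ℝ) = 2 by norm_num]
    congr 1
    refine Finset.sum_congr rfl fun a _ => ?_
    rw [sum_fin_one]
    simp only [mono_one, e]

end

section Commutator

variable {m : ℕ} {ρ : (Fin 1 → Fin r) → Fin d → A} {C : (Fin 2 → Fin r) → Fin r → A}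

/-- The action of the vector field of degree `1` on an alternating polynomial. -/
theorem vectorField_one_poly {k : ℕ} (F : (Fin (k + 1) → Fin r) → A)
    (hF : ∀ I (σ : Equiv.Perm (Fin (k + 1))), F (I ∘ σ) = rsign σ • F I) :
    (vectorField D (baseComp (anchorComp ρ) (bracketComp C)) (poly F) : GrAlg n d r A) =
      poly fun I : Fin (k + 2) → Fin r => act D ρ (fun _ => I 0) (F fun i => I i.succ)
        + (-((k + 1 : ℕ) : ℝ) / 2) •
          ∑ a, C ![I 0, I 1] a * F (Fin.cons a fun i : Fin k => I i.succ.succ) := by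
  rw [vectorField_anchorComp_poly F hF, poly_add]
  congr 1
  · rw [poly_succ (fun a J => act D ρ (fun _ => a) (F J)), Finset.sum_comm]
    simp only [Nat.factorial_one, Nat.cast_one, div_one, one_smul]
    refine Finset.sum_congr rfl fun I _ => ?_
    rw [poly, sum_fin_one, Finset.sum_mul]
    simp only [mono_one, mul_assoc]
  · rw [poly_smul]
    simp only [bracketComp, smul_mul_assoc, mul_smul_comm, ← Finset.smul_sum, smul_smul]
    congr 1
    · norm_num; ring
    · rw [poly_sum]
      refine Finset.sum_congr rfl fun a _ => ?_
      rw [poly_succ_succ (fun b c K => C ![b, c] a * F (Fin.cons a K))]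
      have e : (poly (fun I => C I a) : GrAlg n d r A) =
          ∑ b, ∑ c, fn (C ![b, c] a) * (gen (.a b) * gen (.a c)) := by
        rw [poly, sum_fin_two]
        simp only [mono_two]
      simp only [e, Finset.sum_mul, Finset.mul_sum]
      rw [Finset.sum_comm]
      refine Finset.sum_congr rfl fun b _ => ?_
      rw [Finset.sum_comm]
      refine Finset.sum_congr rfl fun c _ => Finset.sum_congr rfl fun K _ => ?_
      rw [mul_comm (C _ _), fn_mul]
      simp only [mul_assoc]

variable {ρn : (Fin m → Fin r) → Fin d → A} {Cn : (Fin (m + 1) → Fin r) → Fin r → A}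

theorem neg_poly {k : ℕ} (F : (Fin k → Fin r) → A) :
    -(poly F : GrAlg n d r A) = poly fun I => (-1 : ℝ) • F I := by
  rw [poly_smul, neg_smul_grAlg, one_smul]

/-- The `x`-components of the commutator of the vector fields of degrees `1` and `k + 1`. -/
theorem commutator_anchorComp {k : ℕ} {ρn : (Fin (k + 1) → Fin r) → Fin d → A}
    {Cn : (Fin (k + 2) → Fin r) → Fin r → A} (μ : Fin d)
    (hρn : ∀ I (σ : Equiv.Perm (Fin (k + 1))), ρn (I ∘ σ) μ = rsign σ • ρn I μ) :
    (vectorField D (baseComp (anchorComp ρ) (bracketComp C)) (anchorComp ρn μ)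
      - (-1 : ℝ) ^ (k + 1) •
        vectorField D (baseComp (anchorComp ρn) (bracketComp Cn)) (anchorComp ρ μ) :
        GrAlg n d r A) =
      poly fun I : Fin (k + 2) → Fin r =>
        (1 / ((k + 1).factorial : ℝ)) • (act D ρ (fun _ => I 0) (ρn (fun i => I i.succ) μ)
          - act D ρn (fun i => I i.succ) (ρ (fun _ => I 0) μ))
        + ((-(1 / (2 * (k.factorial : ℝ)))) • ∑ a, C ![I 0, I 1] a *
            ρn (Fin.cons a fun i : Fin k => I i.succ.succ) μ
        + ((-1 : ℝ) ^ (k + 1) / ((k + 2).factorial : ℝ)) • ∑ a, ρ (fun _ => a) μ * Cn I a) := by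
  have hP : (vectorField D (baseComp (anchorComp ρn) (bracketComp Cn)) (anchorComp ρ μ) :
      GrAlg n d r A) = poly fun I : Fin (k + 2) → Fin r =>
        ((-1 : ℝ) ^ (k + 1) / ((k + 1).factorial : ℝ)) •
          act D ρn (fun i => I i.succ) (ρ (fun _ => I 0) μ)
        + (-(1 / ((k + 2).factorial : ℝ))) • ∑ a, ρ (fun _ => a) μ * Cn I a := by
    rw [anchorComp, map_smul, vectorField_anchorComp_poly_one, poly_add, poly_smul, poly_smul,
      poly_succ (fun a J => act D ρn J (ρ (fun _ => a) μ)), poly_sum]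
    simp only [Nat.factorial_one, Nat.cast_one, div_one, one_smul,
      poly_mul_of_mem _ (a_mem_homogeneous _), bracketComp, mul_smul_comm, ← Finset.smul_sum,
      smul_smul, mul_one]
    congr 2
    · ring
    · refine Finset.sum_congr rfl fun a _ => ?_
      simp only [poly, Finset.mul_sum, fn_mul, mul_assoc]
  have hF : ∀ I (σ : Equiv.Perm (Fin (k + 1))),
      (1 / ((k + 1).factorial : ℝ)) • ρn (I ∘ σ) μ =
        rsign σ • (1 / ((k + 1).factorial : ℝ)) • ρn I μ := fun I σ => by
    rw [hρn, smul_comm]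
  rw [hP, anchorComp, ← poly_smul, vectorField_one_poly _ hF, ← poly_smul, sub_eq_add_neg,
    neg_poly, ← poly_add]
  congr 1
  funext I
  simp only [act_smul, mul_smul_comm, ← Finset.smul_sum, smul_smul, smul_add]
  have hs := neg_one_pow_mul_self_eq_one (k + 1)
  have e3 : -((k + 1 : ℕ) : ℝ) / 2 * (1 / ((k + 1).factorial : ℝ)) = -(1 / (2 * k.factorial)) := by
    rw [Nat.factorial_succ]
    push_cast
    field_simp
  have e4 : -1 * ((-1 : ℝ) ^ (k + 1) * ((-1) ^ (k + 1) / ((k + 1).factorial : ℝ))) =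
      -(1 / ((k + 1).factorial : ℝ)) := by
    rw [← mul_div_assoc, hs]; ring
  have e5 : -1 * ((-1 : ℝ) ^ (k + 1) * -(1 / ((k + 2).factorial : ℝ))) =
      (-1) ^ (k + 1) / ((k + 2).factorial : ℝ) := by ring
  rw [e3, e4, e5]
  module

-- One half of the commutator in `commutator_bracketComp`: the field of degree `m` acts on the
-- quadratic polynomial `X^c`. Moving the remaining factor `a` in front of `m + 1` odd factors is
-- the source of `(-1)^{m+1}`.
set_option maxHeartbeats 400000 in
theorem vectorField_bracketComp (c : Fin r)
    (hC : ∀ I (σ : Equiv.Perm (Fin 2)), C (I ∘ σ) c = rsign σ • C I c) :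
    (vectorField D (baseComp (anchorComp ρn) (bracketComp Cn)) (bracketComp C c) :
    GrAlg n d r A) = poly fun I : Fin (m + 1 + 1) → Fin r =>
      (-(1 / (2 * (m.factorial : ℝ)))) • act D ρn (fun i => I i.succ.succ) (C ![I 0, I 1] c)
      + ((-1 : ℝ) ^ (m + 1) / ((m + 1).factorial : ℝ)) •
        ∑ a, Cn (fun i => I i.succ) a * C ![a, I 0] c := by
  have e2 : ∀ a b, (gen (.a a) * gen (.a b) : GrAlg n d r A) ∈ homogeneous 2 := fun a b =>
    mul_mem_homogeneous (j := 1) (k := 1) (a_mem_homogeneous a) (a_mem_homogeneous b)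
  rw [bracketComp, map_smul, vectorField_anchorComp_poly_two _ hC, poly_add, poly_smul,
    poly_smul, poly_succ_succ (fun a b K => act D ρn K (C ![a, b] c)), smul_add,
    poly_succ (fun b J => ∑ a, Cn J a * C ![a, b] c)]
  simp only [poly_mul_of_mem _ (e2 _ _), poly_mul_of_mem _ (a_mem_homogeneous _), bracketComp,
    smul_mul_assoc, mul_smul_comm, ← Finset.smul_sum, smul_smul, mul_assoc]
  have c1 : -(1 / ((1 + 1).factorial : ℝ)) * (1 / (m.factorial : ℝ) * (-1) ^ (m * 2)) =
      -(1 / (2 * (m.factorial : ℝ))) := by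
    rw [Even.neg_one_pow (even_two.mul_left m)]
    norm_num
    ring
  have c2 : -(1 / ((1 + 1).factorial : ℝ)) *
      (2 * (-(1 / ((m + 1).factorial : ℝ)) * (-1) ^ ((m + 1) * 1))) =
      (-1) ^ (m + 1) / ((m + 1).factorial : ℝ) := by
    norm_num
    ring
  have e3 : (∑ a, ∑ b, fn (C ![a, b] c) * ∑ J, fn (Cn J a) * (gen (.a b) * mono J) :
      GrAlg n d r A) =
      ∑ b, ∑ J, fn (∑ a, Cn J a * C ![a, b] c) * (gen (.a b) * mono J) := by
    rw [Finset.sum_comm]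
    refine Finset.sum_congr rfl fun b _ => ?_
    simp only [fn_sum, Finset.sum_mul, Finset.mul_sum]
    rw [Finset.sum_comm]
    refine Finset.sum_congr rfl fun J _ => Finset.sum_congr rfl fun a _ => ?_
    rw [← mul_assoc, ← fn_mul, mul_comm (C _ _)]
  rw [c1, c2, e3]

set_option maxHeartbeats 400000 in
/-- The `a`-components of the commutator of the vector fields of degrees `1` and `m`. -/
theorem commutator_bracketComp (c : Fin r)
    (hC : ∀ I (σ : Equiv.Perm (Fin 2)), C (I ∘ σ) c = rsign σ • C I c)
    (hCn : ∀ I (σ : Equiv.Perm (Fin (m + 1))), Cn (I ∘ σ) c = rsign σ • Cn I c) :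
    (vectorField D (baseComp (anchorComp ρ) (bracketComp C)) (bracketComp Cn c)
      - (-1 : ℝ) ^ m • vectorField D (baseComp (anchorComp ρn) (bracketComp Cn)) (bracketComp C c) :
        GrAlg n d r A) =
      poly fun I : Fin (m + 2) → Fin r =>
        (1 / ((m + 1).factorial : ℝ)) • (∑ a, Cn (fun i => I i.succ) a * C ![a, I 0] c
          - act D ρ (fun _ => I 0) (Cn (fun i => I i.succ) c))
        + (1 / (2 * (m.factorial : ℝ))) • (∑ a, C ![I 0, I 1] a *
            Cn (Fin.cons a fun i : Fin m => I i.succ.succ) c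
          + (-1 : ℝ) ^ m • act D ρn (fun i => I i.succ.succ) (C ![I 0, I 1] c)) := by
  have hF : ∀ I (σ : Equiv.Perm (Fin (m + 1))),
      (-(1 / ((m + 1).factorial : ℝ))) • Cn (I ∘ σ) c =
        rsign σ • (-(1 / ((m + 1).factorial : ℝ))) • Cn I c := fun I σ => by
    rw [hCn, smul_comm]
  rw [vectorField_bracketComp c hC, bracketComp, ← poly_smul, vectorField_one_poly _ hF,
    ← poly_smul, sub_eq_add_neg, neg_poly, ← poly_add]
  refine congrArg poly (funext fun I => ?_)
  simp only [act_smul, mul_smul_comm, ← Finset.smul_sum, smul_smul, smul_add]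
  have hs := neg_one_pow_mul_self_eq_one m
  have e3 : -((m + 1 : ℕ) : ℝ) / 2 * -(1 / ((m + 1).factorial : ℝ)) = 1 / (2 * m.factorial) := by
    rw [Nat.factorial_succ]
    push_cast
    field_simp
  have e4 : -1 * ((-1 : ℝ) ^ m * ((-1) ^ (m + 1) / ((m + 1).factorial : ℝ))) =
      1 / ((m + 1).factorial : ℝ) := by
    rw [pow_succ, ← mul_div_assoc, ← mul_assoc, hs]; ring
  have e5 : -1 * ((-1 : ℝ) ^ m * -(1 / (2 * (m.factorial : ℝ)))) =
      1 / (2 * (m.factorial : ℝ)) * (-1) ^ m := by ring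
  rw [e3, e4, e5]
  generalize (∑ a, Cn (fun i => I i.succ) a * C ![a, I 0] c) = u₁
  generalize act D ρ (fun _ => I 0) (Cn (fun i => I i.succ) c) = u₂
  generalize act D ρn (fun i => I i.succ.succ) (C ![I 0, I 1] c) = u₃
  generalize (∑ a, C ![I 0, I 1] a * Cn (Fin.cons a fun i : Fin m => I i.succ.succ) c) = u₄
  module

end Commutator

end GrAlg

end GappedLie

end

noncomputable section

namespace GappedLie

/-! ### Anchored brackets over a commutative algebra -/

section Tensorial

variable {A L N : Type*} [CommRing A] [AddCommGroup L] [Module A L] [AddCommGroup N] [Module A N]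
  [Module ℝ N] [SMulCommClass ℝ A N]

/-- An alternating function which is linear in its first argument is multilinear. -/
theorem exists_multilinearMap {m : ℕ} (T : (Fin m → L) → N)
    (hperm : ∀ v (σ : Equiv.Perm (Fin m)), T (v ∘ σ) = rsign σ • T v)
    (hlin : ∀ (h : 0 < m) (f : A) (s t : L) (v : Fin m → L),
      T (Function.update v ⟨0, h⟩ (f • s + t)) =
        f • T (Function.update v ⟨0, h⟩ s) + T (Function.update v ⟨0, h⟩ t)) :
    ∃ T' : MultilinearMap A (fun _ : Fin m => L) N, ∀ v, T' v = T v := by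
  have key : ∀ (i : Fin m) (f : A) (s t : L) (v : Fin m → L),
      T (Function.update v i (f • s + t)) =
        f • T (Function.update v i s) + T (Function.update v i t) := by
    intro i f s t v
    have h0 : 0 < m := i.pos
    -- Linearity is assumed in slot `0` only; a transposition carries slot `i` there, at the price
    -- of a sign that appears on both sides.
    have h1 : ∀ u, T (Function.update v i u) = rsign (Equiv.swap ⟨0, h0⟩ i) •
        T (Function.update (v ∘ Equiv.swap ⟨0, h0⟩ i) ⟨0, h0⟩ u) := by
      intro u
      rw [← hperm]
      congr 1
      rw [Function.update_comp_equiv]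
      simp [Function.comp_assoc, ← Equiv.Perm.coe_mul]
    rw [h1, h1, h1, hlin, smul_add, smul_comm]
  have hadd : ∀ (i : Fin m) (s t : L) (v : Fin m → L), T (Function.update v i (s + t)) =
      T (Function.update v i s) + T (Function.update v i t) := fun i s t v => by
    simpa using key i 1 s t v
  have hzero : ∀ (i : Fin m) (v : Fin m → L), T (Function.update v i 0) = 0 := fun i v => by
    simpa using hadd i 0 0 v
  refine ⟨⟨T, ?_, ?_⟩, fun v => rfl⟩
  · intro _ v i x y
    convert hadd i x y v
  · intro _ v i c x
    have := key i c x 0 v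
    rw [add_zero, hzero, add_zero] at this
    convert this

/-- The expansion of an alternating tensor in terms of its values on a generating family. -/
theorem tensor_expansion {m : ℕ} {ι : Type*} [Fintype ι] (T : (Fin m → L) → N)
    (hperm : ∀ v (σ : Equiv.Perm (Fin m)), T (v ∘ σ) = rsign σ • T v)
    (hlin : ∀ (h : 0 < m) (f : A) (s t : L) (v : Fin m → L),
      T (Function.update v ⟨0, h⟩ (f • s + t)) =
        f • T (Function.update v ⟨0, h⟩ s) + T (Function.update v ⟨0, h⟩ t))
    (χ : A) (v : Fin m → L) (w : ι → L) (c : Fin m → ι → A)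
    (hv : ∀ i, χ • v i = ∑ a, c i a • w a) :
    χ ^ m • T v = ∑ I : Fin m → ι, (∏ i, c i (I i)) • T fun i => w (I i) := by
  classical
  obtain ⟨T', hT'⟩ := exists_multilinearMap T hperm hlin
  have h1 := T'.map_smul_univ (fun _ => χ) v
  simp only [hv, Finset.prod_const, Finset.card_univ, Fintype.card_fin] at h1
  rw [← hT', ← h1, MultilinearMap.map_sum]
  refine Finset.sum_congr rfl fun I _ => ?_
  rw [MultilinearMap.map_smul_univ, hT']

end Tensorial

/-- Separates the ordered pairs of slots that involve slot `0`. The pairs `(0, i)` and `(i, 0)`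
contribute equally, because `G` and the position sign both change sign. The resulting `2` cancels
the `½` in `jac` and `anc`. -/
theorem sum_pairs_succ {N : Type*} [AddCommGroup N] [Module ℝ N] {m : ℕ}
    (G : Fin (m + 2) → Fin (m + 1) → N) (h : ∀ i : Fin (m + 1), G i.succ 0 = -G 0 i) :
    ∑ i : Fin (m + 2), (-1 : ℝ) ^ (i : ℕ) • ∑ j : Fin (m + 1), (-1 : ℝ) ^ (j : ℕ) • G i j =
      (2 : ℝ) • ∑ i : Fin (m + 1), (-1 : ℝ) ^ (i : ℕ) • G 0 i
      + ∑ i : Fin (m + 1), (-1 : ℝ) ^ (i : ℕ) • ∑ j : Fin m, (-1 : ℝ) ^ (j : ℕ) •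
          G i.succ j.succ := by
  rw [Fin.sum_univ_succ, two_smul, add_assoc (Finset.sum _ _)]
  simp only [Fin.val_zero, pow_zero, one_smul]
  congr 1
  rw [← Finset.sum_add_distrib]
  refine Finset.sum_congr rfl fun i _ => ?_
  rw [Fin.sum_univ_succ, h]
  simp only [Fin.val_zero, pow_zero, one_smul, Fin.val_succ, pow_succ, mul_neg, mul_one, neg_smul,
    Finset.sum_neg_distrib, smul_add, smul_neg]
  abel

theorem rsign_decomposeFin_zero {m : ℕ} (τ : Equiv.Perm (Fin m)) :
    rsign (Equiv.Perm.decomposeFin.symm ((0 : Fin (m + 1)), τ)) = rsign τ := by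
  simp only [rsign, Equiv.Perm.decomposeFin.symm_sign]
  simp

theorem cons_comp_perm {α : Type*} {m : ℕ} (x : α) (v : Fin m → α) (τ : Equiv.Perm (Fin m)) :
    (Fin.cons x (v ∘ τ) : Fin (m + 1) → α) =
      (Fin.cons x v) ∘ Equiv.Perm.decomposeFin.symm ((0 : Fin (m + 1)), τ) := by
  funext i
  refine Fin.cases ?_ (fun i => ?_) i <;> simp

/-- Alternating in the tail first is redundant: each permutation of the tail extends to one of all
arguments fixing `0` with the same sign, and the outer sum absorbs it. -/
theorem altSum_altSum_succ {ι N : Type*} [AddCommGroup N] [Module ℝ N] {m : ℕ}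
    (G : ι → (Fin m → ι) → N) (e : Fin (m + 1) → ι) :
    altSum (fun w => altSum (G (w 0)) fun i => w i.succ) e =
      (m.factorial : ℝ) • altSum (fun w => G (w 0) fun i => w i.succ) e := by
  have h : ∀ τ : Equiv.Perm (Fin m),
      altSum (fun w : Fin (m + 1) → ι => rsign τ • G (w 0) ((fun i => w i.succ) ∘ τ)) e =
        altSum (fun w => G (w 0) fun i => w i.succ) e := by
    intro τ
    rw [altSum_smul]
    have h1 := altSum_comp_perm (fun w => G (w 0) fun i => w i.succ) e
      (Equiv.Perm.decomposeFin.symm (0, τ))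
    have h2 := rsign_decomposeFin_zero τ
    simp only [Function.comp, Equiv.Perm.decomposeFin_symm_apply_zero,
      Equiv.Perm.decomposeFin_symm_apply_succ, Equiv.swap_self, Equiv.refl_apply] at h1
    have h3 := congrArg (rsign τ • ·) h1
    simp only [h2, smul_smul, rsign_mul_self, one_smul] at h3
    exact h3
  have h4 : altSum (fun w => altSum (G (w 0)) fun i => w i.succ) e =
      ∑ τ : Equiv.Perm (Fin m),
        altSum (fun w : Fin (m + 1) → ι => rsign τ • G (w 0) ((fun i => w i.succ) ∘ τ)) e := by
    simp only [altSum, Finset.smul_sum]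
    rw [Finset.sum_comm]
  rw [h4, Finset.sum_congr rfl fun τ _ => h τ]
  simp only [Finset.sum_const, Finset.card_univ, Fintype.card_perm, Fintype.card_fin]
  rw [Nat.cast_smul_eq_nsmul]

/-- The alternating sum of a function which is alternating in all arguments but the first two. -/
theorem altSum_succ_succ {ι N : Type*} [AddCommGroup N] [Module ℝ N] {m : ℕ}
    (F : ι → ι → (Fin m → ι) → N)
    (hF : ∀ x y v (τ : Equiv.Perm (Fin m)), F x y (v ∘ τ) = rsign τ • F x y v)
    (e : Fin (m + 2) → ι) :
    altSum (fun w => F (w 0) (w 1) fun i => w i.succ.succ) e =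
      (m.factorial : ℝ) • ∑ i : Fin (m + 2), (-1 : ℝ) ^ (i : ℕ) • ∑ j : Fin (m + 1),
        (-1 : ℝ) ^ (j : ℕ) •
          F (e i) (e (i.succAbove j)) fun q => e (i.succAbove (j.succAbove q)) := by
  have h := altSum_altSum_succ (fun x (v : Fin (m + 1) → ι) => F x (v 0) fun i => v i.succ) e
  rw [altSum_succ (fun x v => altSum (fun v : Fin (m + 1) → ι => F x (v 0) fun i => v i.succ) v)
    (fun x v τ => altSum_perm _ v τ)] at h
  -- Inserting an alternation of the tail makes the single-slot expansion applicable; it produces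
  -- `(m+1)!` on both sides, which is cancelled before expanding a second time.
  have h2 := smul_right_injective N
    (show ((m + 1).factorial : ℝ) ≠ 0 from Nat.cast_ne_zero.2 (Nat.factorial_ne_zero _)) h
  refine h2.symm.trans ?_
  rw [Finset.smul_sum]
  refine Finset.sum_congr rfl fun i _ => ?_
  rw [altSum_succ (F (e i)) (hF _), smul_comm]

/-- An alternating `ℝ`-multilinear operation on a module with an anchor and the Leibniz rule. -/
structure LeibnizBracket (A L : Type*) [CommRing A] [Algebra ℝ A] [AddCommGroup L] [Module A L]
    [Module ℝ L] (m : ℕ) where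
  ρ : L [⋀^Fin m]→ₗ[A] Derivation ℝ A A
  b : L [⋀^Fin (m + 1)]→ₗ[ℝ] L
  leibniz : ∀ (f : A) (s : L) (v : Fin m → L),
    b (Fin.cons (f • s) v) = f • b (Fin.cons s v) + ((-1 : ℝ) ^ m • ρ v f) • s

namespace LeibnizBracket

variable {A L : Type*} [CommRing A] [Algebra ℝ A] [AddCommGroup L] [Module A L]
    [Module ℝ L]

section

variable {m : ℕ} (P : LeibnizBracket A L m)

theorem b_cons_add (s t : L) (v : Fin m → L) :
    P.b (Fin.cons (s + t) v) = P.b (Fin.cons s v) + P.b (Fin.cons t v) := by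
  have := P.b.map_update_add (Fin.cons 0 v) 0 s t
  simpa only [Fin.update_cons_zero] using this

theorem b_cons_sub (s t : L) (v : Fin m → L) :
    P.b (Fin.cons (s - t) v) = P.b (Fin.cons s v) - P.b (Fin.cons t v) := by
  have := P.b.map_update_sub (Fin.cons 0 v) 0 s t
  simpa only [Fin.update_cons_zero] using this

theorem ρ_cons_add {k : ℕ} (P : LeibnizBracket A L (k + 1)) (s t : L) (v : Fin k → L) :
    P.ρ (Fin.cons (s + t) v) = P.ρ (Fin.cons s v) + P.ρ (Fin.cons t v) := by
  have := P.ρ.map_update_add (Fin.cons 0 v) 0 s t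
  simpa only [Fin.update_cons_zero] using this

theorem ρ_cons_smul {k : ℕ} (P : LeibnizBracket A L (k + 1)) (f : A) (s : L) (v : Fin k → L) :
    P.ρ (Fin.cons (f • s) v) = f • P.ρ (Fin.cons s v) := by
  have := P.ρ.map_update_smul (Fin.cons 0 v) 0 f s
  simpa only [Fin.update_cons_zero] using this

theorem cons_cons_comp_swap {α : Type*} {k : ℕ} (s t : α) (v : Fin k → α) :
    (Fin.cons s (Fin.cons t v) : Fin (k + 2) → α) ∘ Equiv.swap 0 1 = Fin.cons t (Fin.cons s v) := by
  funext i
  refine Fin.cases ?_ (fun i => Fin.cases ?_ (fun i => ?_) i) i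
  · simp
  · simp
  · have h : Equiv.swap (0 : Fin (k + 2)) 1 i.succ.succ = i.succ.succ :=
      Equiv.swap_apply_of_ne_of_ne (Fin.succ_ne_zero _) (by
        rw [← Fin.succ_zero_eq_one]
        exact fun h => Fin.succ_ne_zero _ (Fin.succ_injective _ h))
    simp [h]

theorem b_swap {k : ℕ} (P : LeibnizBracket A L (k + 1)) (s t : L) (v : Fin k → L) :
    P.b (Fin.cons s (Fin.cons t v)) = -P.b (Fin.cons t (Fin.cons s v)) := by
  rw [← cons_cons_comp_swap, P.b.map_swap _ (by simp)]

theorem ρ_swap {k : ℕ} (P : LeibnizBracket A L (k + 2)) (s t : L) (v : Fin k → L) :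
    P.ρ (Fin.cons s (Fin.cons t v)) = -P.ρ (Fin.cons t (Fin.cons s v)) := by
  rw [← cons_cons_comp_swap, P.ρ.map_swap _ (by simp)]

end

variable (X : LeibnizBracket A L 1)

/-- The binary bracket. -/
def br (s t : L) : L := X.b (Fin.cons s fun _ => t)

/-- The anchor of the binary bracket. -/
def an (s : L) : Derivation ℝ A A := X.ρ fun _ => s

theorem an_add (s t : L) : X.an (s + t) = X.an s + X.an t := by
  have := X.ρ_cons_add s t (fun i : Fin 0 => i.elim0)
  convert this using 2
  · simp only [an]; congr 1; funext i; fin_cases i; rfl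
  · simp only [an]; congr 1; funext i; fin_cases i; rfl
  · simp only [an]; congr 1; funext i; fin_cases i; rfl

theorem an_smul (f : A) (s : L) : X.an (f • s) = f • X.an s := by
  have := X.ρ_cons_smul f s (fun i : Fin 0 => i.elim0)
  convert this using 2
  · simp only [an]; congr 1; funext i; fin_cases i; rfl
  · simp only [an]; congr 1; funext i; fin_cases i; rfl

theorem br_add_left (s t u : L) : X.br (s + t) u = X.br s u + X.br t u := X.b_cons_add s t _

theorem br_smul_left (f : A) (s u : L) : X.br (f • s) u = f • X.br s u - (X.an u f) • s := by
  simp only [br, X.leibniz, an, pow_one, neg_smul, one_smul]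
  abel

theorem br_swap (s t : L) : X.br s t = -X.br t s := by
  have h : ∀ s t : L, (Fin.cons s fun _ => t : Fin 2 → L) =
      Fin.cons s (Fin.cons t fun i : Fin 0 => i.elim0) := fun s t => by
    funext i; fin_cases i <;> rfl
  simp only [br, h]
  exact X.b_swap s t _

theorem br_add_right (s t u : L) : X.br u (s + t) = X.br u s + X.br u t := by
  rw [br_swap, br_add_left, br_swap X u s, br_swap X u t]
  abel

theorem br_smul_right (f : A) (s u : L) : X.br u (f • s) = f • X.br u s + (X.an u f) • s := by
  rw [br_swap, br_smul_left, br_swap X u s, smul_neg]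
  abel

variable {m : ℕ} (P : LeibnizBracket A L m)

/-- The mixed Jacobiator. -/
def jac (e : Fin (m + 2) → L) : L :=
  (∑ i : Fin (m + 2), (-1 : ℝ) ^ (i : ℕ) • X.br (P.b fun j => e (i.succAbove j)) (e i))
  + (1 / 2 : ℝ) • ∑ i : Fin (m + 2), (-1 : ℝ) ^ (i : ℕ) • ∑ j : Fin (m + 1), (-1 : ℝ) ^ (j : ℕ) •
      P.b (Fin.cons (X.br (e i) (e (i.succAbove j))) fun q => e (i.succAbove (j.succAbove q)))

/-- The defect of the mixed morphism condition. -/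
def anc {k : ℕ} (P : LeibnizBracket A L (k + 1)) (e : Fin (k + 2) → L) : Derivation ℝ A A :=
  (∑ i : Fin (k + 2), (-1 : ℝ) ^ (i : ℕ) • ⁅X.an (e i), P.ρ fun j => e (i.succAbove j)⁆)
  - (1 / 2 : ℝ) • (∑ i : Fin (k + 2), (-1 : ℝ) ^ (i : ℕ) •
      ∑ j : Fin (k + 1), (-1 : ℝ) ^ (j : ℕ) •
      P.ρ (Fin.cons (X.br (e i) (e (i.succAbove j))) fun q => e (i.succAbove (j.succAbove q))))
  + (-1 : ℝ) ^ (k + 1) • X.an (P.b e)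

theorem cons_comp_succAbove {α : Type*} {k : ℕ} (s : α) (v : Fin (k + 1) → α) (i : Fin (k + 1)) :
    (fun j => (Fin.cons s v : Fin (k + 2) → α) (i.succ.succAbove j)) =
      Fin.cons s fun q => v (i.succAbove q) := by
  funext j
  refine Fin.cases ?_ (fun j => ?_) j <;> simp

theorem cons_comp_succAbove_succAbove {α : Type*} {k : ℕ} (s : α) (v : Fin (k + 2) → α)
    (i : Fin (k + 2)) (j : Fin (k + 1)) :
    (fun q => (Fin.cons s v : Fin (k + 3) → α) (i.succ.succAbove (j.succ.succAbove q))) =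
      Fin.cons s fun q => v (i.succAbove (j.succAbove q)) := by
  funext q
  refine Fin.cases ?_ (fun q => ?_) q <;> simp

theorem b_cons_neg (s : L) (v : Fin m → L) : P.b (Fin.cons (-s) v) = -P.b (Fin.cons s v) := by
  have := P.b.map_update_neg (Fin.cons 0 v) 0 s
  simpa only [Fin.update_cons_zero] using this

theorem ρ_cons_neg {k : ℕ} (P : LeibnizBracket A L (k + 1)) (s : L) (v : Fin k → L) :
    P.ρ (Fin.cons (-s) v) = -P.ρ (Fin.cons s v) := by
  have := P.ρ.map_update_neg (Fin.cons 0 v) 0 s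
  simpa only [Fin.update_cons_zero] using this

/-- Terms are collected by the position of `s`. The grouping into differences is chosen so that the
cross terms of the two Leibniz rules cancel inside each difference. -/
theorem jac_cons {k : ℕ} (P : LeibnizBracket A L (k + 1)) (s : L) (v : Fin (k + 2) → L) :
    jac X P (Fin.cons s v) = X.br (P.b v) s
      + (∑ i : Fin (k + 2), (-1 : ℝ) ^ (i : ℕ) •
        (P.b (Fin.cons (X.br s (v i)) fun q => v (i.succAbove q))
          - X.br (P.b (Fin.cons s fun q => v (i.succAbove q))) (v i)))
      + (1 / 2 : ℝ) • ∑ i : Fin (k + 2), (-1 : ℝ) ^ (i : ℕ) •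
        ∑ j : Fin (k + 1), (-1 : ℝ) ^ (j : ℕ) •
        P.b (Fin.cons (X.br (v i) (v (i.succAbove j)))
          (Fin.cons s fun q => v (i.succAbove (j.succAbove q)))) := by
  rw [jac, Fin.sum_univ_succ, sum_pairs_succ]
  · simp only [cons_comp_succAbove, cons_comp_succAbove_succAbove, Fin.cons_zero, Fin.cons_succ,
      Fin.succ_succAbove_succ, Fin.zero_succAbove, Fin.val_zero, pow_zero,
      one_smul, Fin.val_succ, pow_succ, smul_sub, Finset.sum_sub_distrib, mul_neg, mul_one,
      neg_smul, Finset.sum_neg_distrib, smul_add, smul_smul]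
    norm_num
    abel
  · intro i
    simp only [Fin.cons_zero, Fin.cons_succ, Fin.succ_succAbove_zero, Fin.zero_succAbove,
      Fin.succ_succAbove_succ]
    rw [br_swap, b_cons_neg]

/-- The same separation for `anc`. The tail in the last double sum keeps its index form: for `k = 0`
that sum is empty and there is no slot left to display `s` in. -/
theorem anc_cons {k : ℕ} (P : LeibnizBracket A L (k + 1)) (s : L) (v : Fin (k + 1) → L) :
    anc X P (Fin.cons s v) = ⁅X.an s, P.ρ v⁆
      - (∑ i : Fin (k + 1), (-1 : ℝ) ^ (i : ℕ) •
        (P.ρ (Fin.cons (X.br s (v i)) fun q => v (i.succAbove q))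
          + ⁅X.an (v i), P.ρ (Fin.cons s fun q => v (i.succAbove q))⁆))
      - (1 / 2 : ℝ) • (∑ i : Fin (k + 1), (-1 : ℝ) ^ (i : ℕ) •
        ∑ j : Fin k, (-1 : ℝ) ^ (j : ℕ) •
        P.ρ (Fin.cons (X.br (v i) (v (i.succAbove j)))
          fun q => (Fin.cons s v : Fin (k + 2) → L) (i.succ.succAbove (j.succ.succAbove q))))
      + (-1 : ℝ) ^ (k + 1) • X.an (P.b (Fin.cons s v)) := by
  rw [anc, Fin.sum_univ_succ, sum_pairs_succ]
  · simp only [cons_comp_succAbove, Fin.cons_zero, Fin.cons_succ,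
      Fin.succ_succAbove_succ, Fin.zero_succAbove, Fin.val_zero, pow_zero,
      one_smul, Fin.val_succ, pow_succ, Finset.sum_add_distrib, mul_neg, mul_one,
      neg_smul, Finset.sum_neg_distrib, smul_add, smul_smul]
    norm_num
    abel
  · intro i
    simp only [Fin.cons_zero, Fin.cons_succ, Fin.succ_succAbove_zero, Fin.zero_succAbove,
      Fin.succ_succAbove_succ]
    rw [br_swap, ρ_cons_neg]

/-- The factorials compensate for permutations inside the arguments of the inner bracket and of the
tail. In this form the alternation of `jac` is automatic, and the comparison with polynomials in odd
coordinates is direct. -/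
theorem jac_eq_altSum (e : Fin (m + 2) → L) :
    jac X P e = altSum (fun w =>
      (1 / ((m + 1).factorial : ℝ)) • X.br (P.b fun i => w i.succ) (w 0)
        + (1 / (2 * (m.factorial : ℝ))) •
          P.b (Fin.cons (X.br (w 0) (w 1)) fun i => w i.succ.succ)) e := by
  have h1 : ((m + 1).factorial : ℝ) ≠ 0 := Nat.cast_ne_zero.2 (Nat.factorial_ne_zero _)
  have h2 : (m.factorial : ℝ) ≠ 0 := Nat.cast_ne_zero.2 (Nat.factorial_ne_zero _)
  rw [altSum_add, altSum_smul, altSum_smul, altSum_succ (fun x v => X.br (P.b v) x),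
    altSum_succ_succ (fun x y v => P.b (Fin.cons (X.br x y) v)), smul_smul, smul_smul, jac]
  · congr 2
    · field_simp
      rw [one_smul]
    · field_simp
  · intro x y v τ
    rw [cons_comp_perm, map_perm_rsign, rsign_decomposeFin_zero]
  · intro x v τ
    have h3 := X.b.map_update_smul (Fin.cons 0 fun _ => x) 0 (rsign τ) (P.b v)
    simp only [Fin.update_cons_zero] at h3
    rw [map_perm_rsign, br, h3, br]

theorem ρ_perm (v : Fin m → L) (σ : Equiv.Perm (Fin m)) : P.ρ (v ∘ σ) = rsign σ • P.ρ v := by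
  rw [AlternatingMap.map_perm, rsign, Int.cast_smul_eq_zsmul]
  rfl

theorem jac_perm (e : Fin (m + 2) → L) (σ : Equiv.Perm (Fin (m + 2))) :
    jac X P (e ∘ σ) = rsign σ • jac X P e := by
  rw [jac_eq_altSum, jac_eq_altSum, altSum_perm]

variable [IsScalarTower ℝ A L]

theorem an_real_smul (c : ℝ) (s : L) : X.an (c • s) = c • X.an s := by
  rw [← algebraMap_smul A c s, an_smul, algebraMap_smul]

/-- The counterpart of `jac_eq_altSum`. The last term is already alternating, so its alternating sum
counts it `(k+2)!` times. -/
theorem anc_eq_altSum {k : ℕ} (P : LeibnizBracket A L (k + 1)) (e : Fin (k + 2) → L) :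
    anc X P e = altSum (fun w =>
      (1 / ((k + 1).factorial : ℝ)) • ⁅X.an (w 0), P.ρ fun i => w i.succ⁆
        + ((-(1 / (2 * (k.factorial : ℝ)))) •
          P.ρ (Fin.cons (X.br (w 0) (w 1)) fun i => w i.succ.succ)
        + ((-1 : ℝ) ^ (k + 1) / ((k + 2).factorial : ℝ)) • X.an (P.b w))) e := by
  have h1 : ((k + 1).factorial : ℝ) ≠ 0 := Nat.cast_ne_zero.2 (Nat.factorial_ne_zero _)
  have h2 : (k.factorial : ℝ) ≠ 0 := Nat.cast_ne_zero.2 (Nat.factorial_ne_zero _)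
  have h4 : ((k + 2).factorial : ℝ) ≠ 0 := Nat.cast_ne_zero.2 (Nat.factorial_ne_zero _)
  rw [altSum_add, altSum_add, altSum_smul, altSum_smul, altSum_smul,
    altSum_succ (fun x v => ⁅X.an x, P.ρ v⁆),
    altSum_succ_succ (fun x y v => P.ρ (Fin.cons (X.br x y) v)),
    altSum_of_alternating (F := fun w => X.an (P.b w)), smul_smul, smul_smul, smul_smul, anc]
  · have c1 : 1 / ((k + 1).factorial : ℝ) * (k + 1).factorial = 1 := by field_simp
    have c2 : -(1 / (2 * (k.factorial : ℝ))) * k.factorial = -(1 / 2) := by field_simp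
    have c3 : (-1 : ℝ) ^ (k + 1) / ((k + 2).factorial : ℝ) * (k + 2).factorial = (-1) ^ (k + 1) := by
      field_simp
    rw [c1, c2, c3, one_smul, neg_smul]
    abel
  · intro v τ
    rw [map_perm_rsign, an_real_smul]
  · intro x y v τ
    rw [cons_comp_perm, ρ_perm, rsign_decomposeFin_zero]
  · intro x v τ
    rw [ρ_perm]
    ext f
    simp only [Derivation.commutator_apply, Derivation.smul_apply, Derivation.map_smul, smul_sub]

theorem anc_perm {k : ℕ} (P : LeibnizBracket A L (k + 1)) (e : Fin (k + 2) → L)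
    (σ : Equiv.Perm (Fin (k + 2))) : anc X P (e ∘ σ) = rsign σ • anc X P e := by
  rw [anc_eq_altSum, anc_eq_altSum, altSum_perm]

/-- The tensor which expresses the components of the bracket in terms of those of its values on a
frame. -/
def structTensor {k : ℕ} (P : LeibnizBracket A L (k + 1)) (β : L →ₗ[A] A)
    (v : Fin (k + 2) → L) : A :=
  β (P.b v) - (-1 : ℝ) ^ (k + 1) • ∑ i : Fin (k + 2), (-1 : ℝ) ^ (i : ℕ) •
    P.ρ (fun j => v (i.succAbove j)) (β (v i))

theorem structTensor_perm {k : ℕ} (P : LeibnizBracket A L (k + 1)) (β : L →ₗ[A] A)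
    (v : Fin (k + 2) → L) (σ : Equiv.Perm (Fin (k + 2))) :
    structTensor P β (v ∘ σ) = rsign σ • structTensor P β v := by
  have h : ∀ v : Fin (k + 2) → L, ∑ i : Fin (k + 2), (-1 : ℝ) ^ (i : ℕ) •
      P.ρ (fun j => v (i.succAbove j)) (β (v i)) = (1 / ((k + 1).factorial : ℝ)) •
      altSum (fun w => P.ρ (fun j => w j.succ) (β (w 0))) v := by
    intro v
    have h1 : ((k + 1).factorial : ℝ) ≠ 0 := Nat.cast_ne_zero.2 (Nat.factorial_ne_zero _)
    rw [altSum_succ (fun x v => P.ρ v (β x)), smul_smul, one_div_mul_cancel h1, one_smul]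
    intro x v τ
    rw [ρ_perm, Derivation.smul_apply]
  have h2 : ∀ (c : ℝ) (s : L), β (c • s) = c • β s := fun c s => by
    rw [← algebraMap_smul A c s, map_smul, algebraMap_smul]
  rw [structTensor, structTensor, h, h, altSum_perm, map_perm_rsign, h2]
  module

/-- Sums termwise Leibniz rules: the `f`-linear parts, the parts without `f`, and the derivatives of
`f` in front of `s` are collected separately. -/
theorem sum_smul_leibniz {ι K : Type*} [Fintype ι] [AddCommGroup K] [Module A K] [Module ℝ K]
    [IsScalarTower ℝ A K] (c : ι → ℝ) (f : A) (s : K) (B B' : ι → K) (C : ι → A) :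
    ∑ i, c i • (f • B i + B' i + C i • s) =
      f • ∑ i, c i • B i + ∑ i, c i • B' i + (∑ i, c i • C i) • s := by
  simp only [smul_add, Finset.sum_add_distrib, Finset.smul_sum, Finset.sum_smul, smul_assoc]
  congr 2
  have := IsScalarTower.to_smulCommClass (R := ℝ) (A := A) (M := K)
  exact Finset.sum_congr rfl fun i _ => smul_comm _ _ _

theorem derivation_sum_apply {ι : Type*} [Fintype ι] (V : ι → Derivation ℝ A A) (f : A) :
    (∑ i, V i) f = ∑ i, V i f := by
  classical
  induction (Finset.univ : Finset ι) using Finset.induction_on with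
  | empty => simp
  | insert i s hi ih => rw [Finset.sum_insert hi, Finset.sum_insert hi, Derivation.add_apply, ih]

/-- The Leibniz rule of the mixed Jacobiator. -/
theorem jac_leibniz {k : ℕ} (P : LeibnizBracket A L (k + 1)) (f : A) (s t : L)
    (v : Fin (k + 2) → L) :
    jac X P (Fin.cons (f • s + t) v) = f • jac X P (Fin.cons s v) + jac X P (Fin.cons t v)
      + ((-1 : ℝ) ^ (k + 1) • anc X P v f) • s := by
  -- In each difference the terms with one derivative of `f` in front of a bracket cancel, and the
  -- two second derivatives of `f` combine into a commutator of anchors.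
  have h1 : ∀ i : Fin (k + 2),
      P.b (Fin.cons (X.br (f • s + t) (v i)) fun q => v (i.succAbove q))
          - X.br (P.b (Fin.cons (f • s + t) fun q => v (i.succAbove q))) (v i) =
      f • (P.b (Fin.cons (X.br s (v i)) fun q => v (i.succAbove q))
          - X.br (P.b (Fin.cons s fun q => v (i.succAbove q))) (v i))
      + (P.b (Fin.cons (X.br t (v i)) fun q => v (i.succAbove q))
          - X.br (P.b (Fin.cons t fun q => v (i.succAbove q))) (v i))
      + ((-1 : ℝ) ^ (k + 1) • (⁅X.an (v i), P.ρ fun q => v (i.succAbove q)⁆ f)) • s := by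
    intro i
    rw [br_add_left, br_smul_left, b_cons_add, b_cons_sub, P.leibniz, P.leibniz, P.b_cons_add,
      P.leibniz, br_add_left, br_add_left, br_smul_left, br_smul_left, Derivation.commutator_apply,
      Derivation.map_smul]
    simp only [Algebra.smul_def (R := ℝ) (A := A)]
    module
  -- The Leibniz rule concerns the first slot, so `f • s + t` is swapped to the front and back,
  -- which flips the sign of the anchor term.
  have h2 : ∀ (i : Fin (k + 2)) (j : Fin (k + 1)), P.b (Fin.cons (X.br (v i) (v (i.succAbove j)))
      (Fin.cons (f • s + t) fun q => v (i.succAbove (j.succAbove q)))) =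
      f • P.b (Fin.cons (X.br (v i) (v (i.succAbove j)))
        (Fin.cons s fun q => v (i.succAbove (j.succAbove q))))
      + P.b (Fin.cons (X.br (v i) (v (i.succAbove j)))
        (Fin.cons t fun q => v (i.succAbove (j.succAbove q))))
      + (-((-1 : ℝ) ^ (k + 1) • P.ρ (Fin.cons (X.br (v i) (v (i.succAbove j)))
        fun q => v (i.succAbove (j.succAbove q))) f)) • s := by
    intro i j
    rw [b_swap, b_cons_add, P.leibniz, b_swap, b_swap P _ t]
    module
  have h3 : X.br (P.b v) (f • s + t) = f • X.br (P.b v) s + X.br (P.b v) t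
      + X.an (P.b v) f • s := by
    rw [br_add_right, br_smul_right]
    abel
  have hs := GrAlg.neg_one_pow_mul_self_eq_one (k + 1)
  rw [jac_cons, jac_cons, jac_cons, h3, anc]
  simp only [h1, h2, sum_smul_leibniz]
  have h4 : (∑ i : Fin (k + 2), (-1 : ℝ) ^ (i : ℕ) • (-1 : ℝ) ^ (k + 1) •
      (⁅X.an (v i), P.ρ fun q => v (i.succAbove q)⁆ f)) = (-1 : ℝ) ^ (k + 1) •
      (∑ i : Fin (k + 2), (-1 : ℝ) ^ (i : ℕ) • ⁅X.an (v i), P.ρ fun q => v (i.succAbove q)⁆) f := by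
    rw [derivation_sum_apply, Finset.smul_sum]
    exact Finset.sum_congr rfl fun i _ => smul_comm _ _ _
  have h5 : (∑ i : Fin (k + 2), (-1 : ℝ) ^ (i : ℕ) • ∑ j : Fin (k + 1), (-1 : ℝ) ^ (j : ℕ) •
      -((-1 : ℝ) ^ (k + 1) • P.ρ (Fin.cons (X.br (v i) (v (i.succAbove j)))
        fun q => v (i.succAbove (j.succAbove q))) f)) = (-1 : ℝ) ^ (k + 1) •
      -((∑ i : Fin (k + 2), (-1 : ℝ) ^ (i : ℕ) • ∑ j : Fin (k + 1), (-1 : ℝ) ^ (j : ℕ) •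
        P.ρ (Fin.cons (X.br (v i) (v (i.succAbove j)))
        fun q => v (i.succAbove (j.succAbove q)))) f) := by
    simp only [derivation_sum_apply, Derivation.smul_apply, Finset.smul_sum,
      smul_neg, Finset.sum_neg_distrib, neg_inj]
    refine Finset.sum_congr rfl fun i _ => Finset.sum_congr rfl fun j _ => ?_
    module
  rw [h4, h5]
  simp only [Derivation.add_apply, Derivation.sub_apply, Derivation.smul_apply, smul_add, smul_smul,
    hs, one_smul, smul_sub]
  simp only [Algebra.smul_def (R := ℝ) (A := A), map_mul]
  module

/-- The defect of the mixed morphism condition is linear over functions. -/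
theorem anc_linear {k : ℕ} (P : LeibnizBracket A L (k + 1)) (f : A) (s t : L)
    (v : Fin (k + 1) → L) :
    anc X P (Fin.cons (f • s + t) v) = f • anc X P (Fin.cons s v) + anc X P (Fin.cons t v) := by
  -- The derivative of `f` along `v i` occurs once with each sign: from the Leibniz rule of the
  -- bracket inside the anchor and from the commutator of derivations.
  have h1 : ∀ i : Fin (k + 1),
      P.ρ (Fin.cons (X.br (f • s + t) (v i)) fun q => v (i.succAbove q))
        + ⁅X.an (v i), P.ρ (Fin.cons (f • s + t) fun q => v (i.succAbove q))⁆ =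
      f • (P.ρ (Fin.cons (X.br s (v i)) fun q => v (i.succAbove q))
        + ⁅X.an (v i), P.ρ (Fin.cons s fun q => v (i.succAbove q))⁆)
      + (P.ρ (Fin.cons (X.br t (v i)) fun q => v (i.succAbove q))
        + ⁅X.an (v i), P.ρ (Fin.cons t fun q => v (i.succAbove q))⁆) := by
    intro i
    ext g
    simp only [br_add_left, br_smul_left, ρ_cons_add, ρ_cons_smul, sub_eq_add_neg, ρ_cons_neg,
      Derivation.add_apply, Derivation.smul_apply, Derivation.commutator_apply, map_add,
      Derivation.leibniz, smul_eq_mul, Derivation.neg_apply]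
    ring
  have h2 : ∀ (i : Fin (k + 1)) (j : Fin k), P.ρ (Fin.cons (X.br (v i) (v (i.succAbove j)))
      fun q => (Fin.cons (f • s + t) v : Fin (k + 2) → L)
        (i.succ.succAbove (j.succ.succAbove q))) =
      f • P.ρ (Fin.cons (X.br (v i) (v (i.succAbove j)))
        fun q => (Fin.cons s v : Fin (k + 2) → L) (i.succ.succAbove (j.succ.succAbove q)))
      + P.ρ (Fin.cons (X.br (v i) (v (i.succAbove j)))
        fun q => (Fin.cons t v : Fin (k + 2) → L) (i.succ.succAbove (j.succ.succAbove q))) := by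
    -- For `k = 0` there is no index `j`; otherwise the slot containing `s` can be swapped to the
    -- front of the anchor.
    rcases k with _ | k
    · intro i j
      exact j.elim0
    · intro i j
      rw [cons_comp_succAbove_succAbove, cons_comp_succAbove_succAbove,
        cons_comp_succAbove_succAbove, ρ_swap, ρ_cons_add, ρ_cons_smul, ρ_swap, ρ_swap P t]
      module
  -- The commutator fails to be linear by the derivative of `f` along `P.ρ v`; the Leibniz rule of
  -- `P.b` in `h4` contributes the same term with the opposite sign.
  have h3 : ⁅X.an (f • s + t), P.ρ v⁆ = f • ⁅X.an s, P.ρ v⁆ + ⁅X.an t, P.ρ v⁆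
      - (P.ρ v f) • X.an s := by
    ext g
    simp only [an_add, an_smul, Derivation.add_apply, Derivation.smul_apply,
      Derivation.commutator_apply, map_add, Derivation.leibniz, smul_eq_mul, Derivation.sub_apply]
    ring
  have hs := GrAlg.neg_one_pow_mul_self_eq_one (k + 1)
  have h4 : (-1 : ℝ) ^ (k + 1) • X.an (P.b (Fin.cons (f • s + t) v)) =
      f • (-1 : ℝ) ^ (k + 1) • X.an (P.b (Fin.cons s v)) +
        (-1 : ℝ) ^ (k + 1) • X.an (P.b (Fin.cons t v)) + (P.ρ v f) • X.an s := by
    rw [b_cons_add, P.leibniz, an_add, an_add, an_smul, an_smul, smul_add, smul_add,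
      smul_assoc, smul_smul, hs, one_smul, smul_comm f]
    abel
  have h5 := fun (B B' : Fin (k + 1) → Derivation ℝ A A) =>
    sum_smul_leibniz (fun i : Fin (k + 1) => (-1 : ℝ) ^ (i : ℕ)) f 0 B B' 0
  have h6 := fun (B B' : Fin k → Derivation ℝ A A) =>
    sum_smul_leibniz (fun i : Fin k => (-1 : ℝ) ^ (i : ℕ)) f 0 B B' 0
  simp only [smul_zero, add_zero] at h5 h6
  rw [anc_cons, anc_cons, anc_cons, h3, h4]
  simp only [h1, h2, h5, h6]
  module

theorem structTensor_cons {k : ℕ} (P : LeibnizBracket A L (k + 1)) (β : L →ₗ[A] A)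
    (s : L) (v : Fin (k + 1) → L) :
    structTensor P β (Fin.cons s v) = β (P.b (Fin.cons s v)) - (-1 : ℝ) ^ (k + 1) • P.ρ v (β s)
      + (-1 : ℝ) ^ (k + 1) • ∑ i : Fin (k + 1), (-1 : ℝ) ^ (i : ℕ) •
        P.ρ (Fin.cons s fun j => v (i.succAbove j)) (β (v i)) := by
  rw [structTensor, Fin.sum_univ_succ]
  simp only [cons_comp_succAbove, Fin.cons_zero, Fin.cons_succ, Fin.zero_succAbove, Fin.val_zero,
    pow_zero, one_smul, Fin.val_succ, pow_succ, mul_neg, mul_one, neg_smul,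
    Finset.sum_neg_distrib, smul_add, smul_neg]
  abel

/-- The Leibniz rule of `P.b` produces `β s` times the derivative of `f`. The subtracted term
differentiates `f β(s)` and produces the same expression, so the two cancel; the other corrections
are linear in `s` through the anchor. -/
theorem structTensor_linear {k : ℕ} (P : LeibnizBracket A L (k + 1)) (β : L →ₗ[A] A) (f : A)
    (s t : L) (v : Fin (k + 1) → L) :
    structTensor P β (Fin.cons (f • s + t) v) =
      f • structTensor P β (Fin.cons s v) + structTensor P β (Fin.cons t v) := by
  have h := fun (B B' : Fin (k + 1) → A) =>
    sum_smul_leibniz (fun i : Fin (k + 1) => (-1 : ℝ) ^ (i : ℕ)) f 0 B B' 0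
  simp only [smul_zero, add_zero] at h
  simp only [structTensor_cons, b_cons_add, ρ_cons_add, ρ_cons_smul, P.leibniz, map_add, map_smul,
    Derivation.add_apply, Derivation.smul_apply, h]
  simp only [Algebra.smul_def (R := ℝ) (A := A), smul_eq_mul, Derivation.leibniz]
  ring

end LeibnizBracket

end GappedLie

end

/-! ### Smooth vector fields as derivations of the algebra of smooth functions -/

noncomputable section

namespace GappedLie

open Filter Topology

section Functions

variable {d : ℕ} {M : Type*} [TopologicalSpace M] [ChartedSpace (Euc d) M]

/-- The algebra of smooth functions on a manifold. -/
abbrev SmoothFn (d : ℕ) (M : Type*) [TopologicalSpace M] [ChartedSpace (Euc d) M] : Type _ :=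
  C^∞⟮𝓘(ℝ, Euc d), M; 𝓘(ℝ, ℝ), ℝ⟯

theorem SmoothFn.mdifferentiableAt (f : SmoothFn d M) (x : M) :
    MDifferentiableAt 𝓘(ℝ, Euc d) 𝓘(ℝ, ℝ) f x :=
  f.contMDiff.mdifferentiable (by simp) x

theorem derivAlong_add (f g : SmoothFn d M) {x : M} (v : TangentSpace 𝓘(ℝ, Euc d) x) :
    derivAlong (f + g) v = derivAlong f v + derivAlong g v := by
  have := mfderiv_add (f.mdifferentiableAt x) (g.mdifferentiableAt x)
  simp only [derivAlong, ContMDiffMap.coe_add]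
  exact congrArg (fun L : Euc d →L[ℝ] ℝ => L v) this

theorem derivAlong_smul (c : ℝ) (f : SmoothFn d M) {x : M} (v : TangentSpace 𝓘(ℝ, Euc d) x) :
    derivAlong (c • f) v = c * derivAlong f v := by
  have := const_smul_mfderiv (f.mdifferentiableAt x) c
  simp only [derivAlong, ContMDiffMap.coe_smul]
  exact congrArg (fun L : Euc d →L[ℝ] ℝ => L v) this

theorem derivAlong_mul (f g : SmoothFn d M) {x : M} (v : TangentSpace 𝓘(ℝ, Euc d) x) :
    derivAlong (f * g) v = f x * derivAlong g v + g x * derivAlong f v := by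
  have := ((f.mdifferentiableAt x).hasMFDerivAt.mul (g.mdifferentiableAt x).hasMFDerivAt).mfderiv
  simp only [derivAlong, ContMDiffMap.coe_mul]
  exact congrArg (fun L : Euc d →L[ℝ] ℝ => L v) this

theorem derivAlong_congr {f : SmoothFn d M} {h : M → ℝ} {x : M} (hf : f =ᶠ[𝓝 x] h)
    (v : TangentSpace 𝓘(ℝ, Euc d) x) :
    derivAlong f v = mfderiv 𝓘(ℝ, Euc d) 𝓘(ℝ, ℝ) h x v := by
  unfold derivAlong
  have h2 := hf.mfderiv_eq (I := 𝓘(ℝ, Euc d)) (I' := 𝓘(ℝ, ℝ))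
  exact congrArg (fun L : Euc d →L[ℝ] ℝ => L v) h2

theorem mfderiv_comp_euc {g : Euc d → ℝ} {φ : M → Euc d} {x : M}
    (hg : DifferentiableAt ℝ g (φ x)) (hφ : MDifferentiableAt 𝓘(ℝ, Euc d) 𝓘(ℝ, Euc d) φ x)
    (v : TangentSpace 𝓘(ℝ, Euc d) x) :
    mfderiv 𝓘(ℝ, Euc d) 𝓘(ℝ, ℝ) (fun y => g (φ y)) x v =
      fderiv ℝ g (φ x) (mfderiv 𝓘(ℝ, Euc d) 𝓘(ℝ, Euc d) φ x v) := by
  have h := mfderiv_comp_apply (I := 𝓘(ℝ, Euc d)) (I' := 𝓘(ℝ, Euc d)) (I'' := 𝓘(ℝ, ℝ)) x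
    hg.mdifferentiableAt hφ v
  rw [mfderiv_eq_fderiv] at h
  exact h

variable [IsManifold 𝓘(ℝ, Euc d) ∞ M]

/-- The derivative of a smooth function along a smooth vector field. -/
theorem contMDiff_derivAlong (f : SmoothFn d M) {X : (x : M) → TangentSpace 𝓘(ℝ, Euc d) x}
    (hX : ContMDiff 𝓘(ℝ, Euc d) 𝓘(ℝ, Euc d).tangent ∞
      (fun x => (⟨x, X x⟩ : TangentBundle 𝓘(ℝ, Euc d) M))) :
    ContMDiff 𝓘(ℝ, Euc d) 𝓘(ℝ, ℝ) ∞ (fun x => derivAlong f (X x)) := by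
  have h1 := f.contMDiff.contMDiff_tangentMap (m := ∞) (by simp)
  have h2 := h1.comp hX
  exact (contMDiff_snd_tangentBundle_modelSpace ℝ 𝓘(ℝ, ℝ) (n := ∞)).comp h2

/-- A smooth vector field as a derivation of the algebra of smooth functions. -/
def vfDer (X : (x : M) → TangentSpace 𝓘(ℝ, Euc d) x)
    (hX : ContMDiff 𝓘(ℝ, Euc d) 𝓘(ℝ, Euc d).tangent ∞
      (fun x => (⟨x, X x⟩ : TangentBundle 𝓘(ℝ, Euc d) M))) :
    Derivation ℝ (SmoothFn d M) (SmoothFn d M) :=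
  Derivation.mk'
    { toFun := fun f => ⟨fun x => derivAlong f (X x), contMDiff_derivAlong f hX⟩
      map_add' := fun f g => ContMDiffMap.ext fun x => derivAlong_add f g (X x)
      map_smul' := fun c f => ContMDiffMap.ext fun x => derivAlong_smul c f (X x) }
    fun f g => ContMDiffMap.ext fun x => derivAlong_mul f g (X x)

theorem vfDer_apply {X : (x : M) → TangentSpace 𝓘(ℝ, Euc d) x}
    (hX : ContMDiff 𝓘(ℝ, Euc d) 𝓘(ℝ, Euc d).tangent ∞
      (fun x => (⟨x, X x⟩ : TangentBundle 𝓘(ℝ, Euc d) M))) (f : SmoothFn d M) (x : M) :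
    vfDer X hX f x = derivAlong f (X x) := rfl

/-- The derivative along a Lie bracket is the commutator of the derivatives. -/
theorem derivAlong_mlieBracket {X Y : (x : M) → TangentSpace 𝓘(ℝ, Euc d) x}
    (hX : ContMDiff 𝓘(ℝ, Euc d) 𝓘(ℝ, Euc d).tangent ∞
      (fun x => (⟨x, X x⟩ : TangentBundle 𝓘(ℝ, Euc d) M)))
    (hY : ContMDiff 𝓘(ℝ, Euc d) 𝓘(ℝ, Euc d).tangent ∞
      (fun x => (⟨x, Y x⟩ : TangentBundle 𝓘(ℝ, Euc d) M))) (f : SmoothFn d M) (x : M) :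
    derivAlong f (VectorField.mlieBracket 𝓘(ℝ, Euc d) X Y x) =
      derivAlong (vfDer Y hY f) (X x) - derivAlong (vfDer X hX f) (Y x) := by
  have : IsManifold 𝓘(ℝ, Euc d) 2 M := inferInstance
  set ψ := extChartAt 𝓘(ℝ, Euc d) x with hψ
  -- The Lie bracket is defined by pulling fields back to a chart, so the identity is proved there
  -- and transported.
  let pb : ((y : M) → TangentSpace 𝓘(ℝ, Euc d) y) → Euc d → Euc d := fun V =>
    VectorField.mpullbackWithin 𝓘(ℝ, Euc d) 𝓘(ℝ, Euc d) ψ.symm V (Set.range 𝓘(ℝ, Euc d))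
  have hinv : ∀ y ∈ ψ.target, (mfderivWithin 𝓘(ℝ, Euc d) 𝓘(ℝ, Euc d) ψ.symm
      (Set.range 𝓘(ℝ, Euc d)) y).IsInvertible := fun y hy =>
    isInvertible_mfderivWithin_extChartAt_symm hy
  have key : ∀ (h : SmoothFn d M) (V : (y : M) → TangentSpace 𝓘(ℝ, Euc d) y), ∀ y ∈ ψ.target,
      fderiv ℝ (h ∘ ψ.symm) y (pb V y) = derivAlong h (V (ψ.symm y)) := by
    intro h V y hy
    have hL := hinv y hy
    have h1 : MDifferentiableAt 𝓘(ℝ, Euc d) 𝓘(ℝ, Euc d) ψ.symm y := by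
      have := mdifferentiableWithinAt_extChartAt_symm (I := 𝓘(ℝ, Euc d)) hy
      rw [ModelWithCorners.range_eq_univ, mdifferentiableWithinAt_univ] at this
      exact this
    have h2 := mfderiv_comp (I := 𝓘(ℝ, Euc d)) (I' := 𝓘(ℝ, Euc d)) (I'' := 𝓘(ℝ, ℝ)) y
      (h.mdifferentiableAt (ψ.symm y)) h1
    have h3 : mfderivWithin 𝓘(ℝ, Euc d) 𝓘(ℝ, Euc d) ψ.symm (Set.range 𝓘(ℝ, Euc d)) y =
        mfderiv 𝓘(ℝ, Euc d) 𝓘(ℝ, Euc d) ψ.symm y := by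
      simp [mfderivWithin_univ]
    rw [← mfderiv_eq_fderiv, h2]
    have h4 : mfderiv 𝓘(ℝ, Euc d) 𝓘(ℝ, Euc d) ψ.symm y (pb V y) = V (ψ.symm y) := by
      rw [← h3]
      obtain ⟨e, he⟩ := hL
      simp only [pb, VectorField.mpullbackWithin_apply]
      rw [← he, ContinuousLinearMap.inverse_equiv]
      exact e.apply_symm_apply _
    exact congrArg (mfderiv 𝓘(ℝ, Euc d) 𝓘(ℝ, ℝ) h (ψ.symm y)) h4
  have hx : ψ x ∈ ψ.target := mem_extChartAt_target x
  have hto : ψ.symm (ψ x) = x := extChartAt_to_inv x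
  set u := VectorField.lieBracket ℝ (pb X) (pb Y) (ψ x) with hu
  have hbr : VectorField.mlieBracket 𝓘(ℝ, Euc d) X Y x =
      (mfderiv 𝓘(ℝ, Euc d) 𝓘(ℝ, Euc d) ψ x).inverse u := by
    rw [hu, ← VectorField.lieBracketWithin_univ, ← VectorField.mlieBracketWithin_univ,
      VectorField.mlieBracketWithin_apply]
    simp only [Set.preimage_univ, Set.univ_inter, ModelWithCorners.range_eq_univ]
    simp only [pb, ModelWithCorners.range_eq_univ]
    rfl
  have hmd : ∀ {V : (y : M) → TangentSpace 𝓘(ℝ, Euc d) y},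
      ContMDiff 𝓘(ℝ, Euc d) 𝓘(ℝ, Euc d).tangent ∞
        (fun x => (⟨x, V x⟩ : TangentBundle 𝓘(ℝ, Euc d) M)) →
      DifferentiableAt ℝ (pb V) (ψ x) := by
    intro V hV
    have h1 : MDifferentiableWithinAt 𝓘(ℝ, Euc d) 𝓘(ℝ, Euc d).tangent
        (fun x => (⟨x, V x⟩ : TangentBundle 𝓘(ℝ, Euc d) M)) Set.univ x :=
      (hV.mdifferentiable (by simp) x).mdifferentiableWithinAt
    have h2 := h1.differentiableWithinAt_mpullbackWithin_vectorField
    simp only [Set.preimage_univ, Set.univ_inter] at h2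
    rw [← differentiableWithinAt_univ, ← ModelWithCorners.range_eq_univ 𝓘(ℝ, Euc d)]
    exact h2
  have hF : ContDiffAt ℝ ∞ (f ∘ ψ.symm) (ψ x) := by
    rw [← contMDiffAt_iff_contDiffAt]
    have h1 := contMDiffWithinAt_extChartAt_symm_range (I := 𝓘(ℝ, Euc d)) (n := ∞) x hx
    rw [ModelWithCorners.range_eq_univ, contMDiffWithinAt_univ] at h1
    exact (f.contMDiff _).comp _ h1
  -- The Euclidean form of the statement, which rests on the symmetry of second derivatives.
  have hsnd := VectorField.fderiv_apply_lieBracket hF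
    (by rw [minSmoothness_of_isRCLikeNormedField]; exact ENat.LEInfty.out) (hmd hY) (hmd hX)
  -- Equality near the base point is needed, not only at it, because the first derivatives are
  -- differentiated once more.
  have hev : ∀ {V : (y : M) → TangentSpace 𝓘(ℝ, Euc d) y} (hV : ContMDiff 𝓘(ℝ, Euc d)
      𝓘(ℝ, Euc d).tangent ∞ (fun x => (⟨x, V x⟩ : TangentBundle 𝓘(ℝ, Euc d) M))),
      (fun y => fderiv ℝ (f ∘ ψ.symm) y (pb V y)) =ᶠ[𝓝 (ψ x)] (vfDer V hV f) ∘ ψ.symm := by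
    intro V hV
    filter_upwards [(isOpen_extChartAt_target x).mem_nhds hx] with y hy
    exact key f V y hy
  rw [(hev hY).fderiv_eq, (hev hX).fderiv_eq, key _ _ _ hx, key _ _ _ hx, hto] at hsnd
  have h1 : ∀ v : TangentSpace 𝓘(ℝ, Euc d) x, derivAlong f v =
      fderiv ℝ (f ∘ ψ.symm) (ψ x) (mfderiv 𝓘(ℝ, Euc d) 𝓘(ℝ, Euc d) ψ x v) := by
    intro v
    rw [← mfderiv_comp_euc (hF.differentiableAt (by simp))
      (mdifferentiableAt_extChartAt (mem_chart_source _ x))]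
    refine derivAlong_congr ?_ v
    filter_upwards [extChartAt_source_mem_nhds (I := 𝓘(ℝ, Euc d)) x] with y hy
    exact congrArg f (ψ.left_inv hy).symm
  rw [← hsnd, hbr, h1]
  exact congrArg _
    ((isInvertible_mfderiv_extChartAt (mem_extChartAt_source x)).self_apply_inverse u)

end Functions

end GappedLie

end

/-! ### Cutoff functions and components of tangent vectors in charts -/

noncomputable section

namespace GappedLie

open Filter Topology

section Cutoff

variable {d : ℕ} {M : Type*} [TopologicalSpace M] [ChartedSpace (Euc d) M]

/-- Extension by zero: `h` may be arbitrary outside `U`, since the product vanishes near every point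
off the support of `χ`. -/
theorem contMDiff_mul_of_tsupport {χ : SmoothFn d M} {U : Set M} (hU : IsOpen U)
    (hχ : tsupport χ ⊆ U) {h : M → ℝ} (hh : ContMDiffOn 𝓘(ℝ, Euc d) 𝓘(ℝ, ℝ) ∞ h U) :
    ContMDiff 𝓘(ℝ, Euc d) 𝓘(ℝ, ℝ) ∞ fun y => χ y * h y := by
  refine contMDiff_of_tsupport fun y hy => ?_
  have hy' : y ∈ U := hχ (tsupport_mul_subset_left hy)
  exact (χ.contMDiff y).mul (hh.contMDiffAt (hU.mem_nhds hy'))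

theorem mdifferentiableAt_chart {φ : OpenPartialHomeomorph M (Euc d)}
    (hφ : φ ∈ IsManifold.maximalAtlas 𝓘(ℝ, Euc d) ∞ M) {x : M} (hx : x ∈ φ.source) :
    MDifferentiableAt 𝓘(ℝ, Euc d) 𝓘(ℝ, Euc d) φ x :=
  ((contMDiffOn_of_mem_maximalAtlas hφ).contMDiffAt (φ.open_source.mem_nhds hx)).mdifferentiableAt
    (by simp)

theorem mdifferentiableAt_chart_symm {φ : OpenPartialHomeomorph M (Euc d)}
    (hφ : φ ∈ IsManifold.maximalAtlas 𝓘(ℝ, Euc d) ∞ M) {y : Euc d} (hy : y ∈ φ.target) :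
    MDifferentiableAt 𝓘(ℝ, Euc d) 𝓘(ℝ, Euc d) φ.symm y :=
  ((contMDiffOn_symm_of_mem_maximalAtlas hφ).contMDiffAt
    (φ.open_target.mem_nhds hy)).mdifferentiableAt (by simp)

theorem mfderiv_chart_symm_mfderiv {φ : OpenPartialHomeomorph M (Euc d)}
    (hφ : φ ∈ IsManifold.maximalAtlas 𝓘(ℝ, Euc d) ∞ M) {x : M} (hx : x ∈ φ.source)
    (v : TangentSpace 𝓘(ℝ, Euc d) x) :
    mfderiv 𝓘(ℝ, Euc d) 𝓘(ℝ, Euc d) φ.symm (φ x) (mfderiv 𝓘(ℝ, Euc d) 𝓘(ℝ, Euc d) φ x v) = v := by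
  rw [← mfderiv_comp_apply x (mdifferentiableAt_chart_symm hφ (φ.map_source hx))
    (mdifferentiableAt_chart hφ hx)]
  have h : φ.symm ∘ φ =ᶠ[𝓝 x] id := by
    filter_upwards [φ.open_source.mem_nhds hx] with y hy
    exact φ.left_inv hy
  have h2 := h.mfderiv_eq (I := 𝓘(ℝ, Euc d)) (I' := 𝓘(ℝ, Euc d))
  rw [mfderiv_id] at h2
  exact congrArg (fun L : Euc d →L[ℝ] Euc d => L v) h2

/-- A tangent vector with vanishing components is zero. -/
theorem eq_zero_of_dx_eq_zero {φ : OpenPartialHomeomorph M (Euc d)}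
    (hφ : φ ∈ IsManifold.maximalAtlas 𝓘(ℝ, Euc d) ∞ M) {x : M} (hx : x ∈ φ.source)
    {v : TangentSpace 𝓘(ℝ, Euc d) x} (h : ∀ μ, dx φ x μ v = 0) : v = 0 := by
  have h1 : mfderiv 𝓘(ℝ, Euc d) 𝓘(ℝ, Euc d) φ x v = 0 := by
    refine PiLp.ext fun μ => ?_
    exact h μ
  rw [← mfderiv_chart_symm_mfderiv hφ hx v, h1]
  exact map_zero _

theorem euc_eq_sum (w : Euc d) : w = ∑ μ, w μ • EuclideanSpace.single μ (1 : ℝ) := by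
  refine PiLp.ext fun ν => ?_
  simp [Finset.sum_apply, Pi.single_apply]

theorem mfderiv_coord {φ : OpenPartialHomeomorph M (Euc d)}
    (hφ : φ ∈ IsManifold.maximalAtlas 𝓘(ℝ, Euc d) ∞ M) {x : M} (hx : x ∈ φ.source) (μ : Fin d)
    (v : TangentSpace 𝓘(ℝ, Euc d) x) :
    mfderiv 𝓘(ℝ, Euc d) 𝓘(ℝ, ℝ) (fun y => φ y μ) x v = dx φ x μ v := by
  have h := mfderiv_comp_euc (g := (EuclideanSpace.proj μ : Euc d →L[ℝ] ℝ))
    ((EuclideanSpace.proj μ : Euc d →L[ℝ] ℝ).differentiableAt) (mdifferentiableAt_chart hφ hx) v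
  rw [ContinuousLinearMap.fderiv] at h
  exact h

variable [IsManifold 𝓘(ℝ, Euc d) ∞ M]

theorem exists_cutoff [T2Space M] {U : Set M} (hU : IsOpen U) {x : M} (hx : x ∈ U) :
    ∃ χ : SmoothFn d M, (∀ᶠ y in 𝓝 x, χ y = 1) ∧ tsupport χ ⊆ U := by
  obtain ⟨f, -, hf⟩ := (SmoothBumpFunction.nhds_basis_tsupport (I := 𝓘(ℝ, Euc d)) x).mem_iff.1
    (hU.mem_nhds hx)
  exact ⟨⟨f, f.contMDiff⟩, f.eventuallyEq_one, hf⟩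

/-- Every local germ comes from a global function. This is needed because brackets and derivations
only accept global objects, whereas coordinates are local. -/
theorem exists_smoothFn_eventuallyEq [T2Space M] {U : Set M} (hU : IsOpen U) {x : M} (hx : x ∈ U)
    {h : M → ℝ} (hh : ContMDiffOn 𝓘(ℝ, Euc d) 𝓘(ℝ, ℝ) ∞ h U) :
    ∃ f : SmoothFn d M, f =ᶠ[𝓝 x] h := by
  obtain ⟨χ, h1, h2⟩ := exists_cutoff (d := d) hU hx
  refine ⟨⟨_, contMDiff_mul_of_tsupport hU h2 hh⟩, ?_⟩
  filter_upwards [h1] with y hy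
  simp [hy]

/-- Tangent vectors are determined by the derivatives of functions along them. -/
theorem eq_zero_of_derivAlong_eq_zero [T2Space M] {x : M} {v : TangentSpace 𝓘(ℝ, Euc d) x}
    (h : ∀ f : SmoothFn d M, derivAlong f v = 0) : v = 0 := by
  have hφ := IsManifold.chart_mem_maximalAtlas (I := 𝓘(ℝ, Euc d)) (n := ∞) x
  have hx := mem_chart_source (Euc d) x
  refine eq_zero_of_dx_eq_zero hφ hx fun μ => ?_
  obtain ⟨f, hf⟩ := exists_smoothFn_eventuallyEq (chartAt (Euc d) x).open_source hx
    (contMDiffOn_coord hφ μ)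
  rw [← mfderiv_coord hφ hx, ← derivAlong_congr hf, h]

variable {φ : OpenPartialHomeomorph M (Euc d)}
  (hφ : φ ∈ IsManifold.maximalAtlas 𝓘(ℝ, Euc d) ∞ M)

/-- A point of the domain of a chart as a point of the domain of the coordinates. -/
abbrev coordPt {x : M} (hx : x ∈ φ.source) : chartTarget φ := ⟨φ x, φ.map_source hx⟩

theorem inCoord_apply {h : M → ℝ} (hh : ContMDiffOn 𝓘(ℝ, Euc d) 𝓘(ℝ, ℝ) ∞ h φ.source) {x : M}
    (hx : x ∈ φ.source) : (inCoord hφ h hh).1 (coordPt hx) = h x :=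
  congrArg h (φ.left_inv hx)

theorem smoothFun_ext {f g : smoothFun (chartTarget φ)}
    (h : ∀ x (hx : x ∈ φ.source), f.1 (coordPt hx) = g.1 (coordPt hx)) : f = g := by
  refine Subtype.ext (funext fun y => ?_)
  have := h (φ.symm y) (φ.map_target y.2)
  have e : coordPt (φ.map_target y.2) = y := Subtype.ext (φ.right_inv y.2)
  rwa [e] at this

/-- The derivative along a tangent vector in terms of its components. -/
theorem mfderiv_eq_sum {h : M → ℝ} (hh : ContMDiffOn 𝓘(ℝ, Euc d) 𝓘(ℝ, ℝ) ∞ h φ.source) {x : M}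
    (hx : x ∈ φ.source) (v : TangentSpace 𝓘(ℝ, Euc d) x) :
    mfderiv 𝓘(ℝ, Euc d) 𝓘(ℝ, ℝ) h x v =
      ∑ μ, dx φ x μ v * (pderiv (chartTarget φ) μ (inCoord hφ h hh)).1 (coordPt hx) := by
  have hg : DifferentiableAt ℝ (fun y => h (φ.symm y)) (φ x) := by
    have h1 : ContMDiffAt 𝓘(ℝ, Euc d) 𝓘(ℝ, ℝ) ∞ (fun y => h (φ.symm y)) (φ x) :=
      (hh.comp (contMDiffOn_symm_of_mem_maximalAtlas hφ)
        (fun y hy => φ.map_target hy)).contMDiffAt (φ.open_target.mem_nhds (φ.map_source hx))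
    exact (contMDiffAt_iff_contDiffAt.1 h1).differentiableAt (by simp)
  have h1 := mfderiv_comp_euc hg (mdifferentiableAt_chart hφ hx) v
  have h2 : h =ᶠ[𝓝 x] fun y => h (φ.symm (φ y)) := by
    filter_upwards [φ.open_source.mem_nhds hx] with y hy
    rw [φ.left_inv hy]
  have h3 := h2.mfderiv_eq (I := 𝓘(ℝ, Euc d)) (I' := 𝓘(ℝ, ℝ))
  have h4 : mfderiv 𝓘(ℝ, Euc d) 𝓘(ℝ, ℝ) h x v =
      mfderiv 𝓘(ℝ, Euc d) 𝓘(ℝ, ℝ) (fun y => h (φ.symm (φ y))) x v :=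
    congrArg (fun L : Euc d →L[ℝ] ℝ => L v) h3
  rw [h4, h1]
  have h5 : ∀ w : Euc d, fderiv ℝ (fun y => h (φ.symm y)) (φ x) w = ∑ μ, w μ *
      fderiv ℝ (fun y => h (φ.symm y)) (φ x) (EuclideanSpace.single μ 1) := by
    intro w
    conv_lhs => rw [euc_eq_sum w]
    simp only [map_sum, map_smul, smul_eq_mul]
  refine (h5 _).trans (Finset.sum_congr rfl fun μ _ => ?_)
  congr 1
  exact (pderivAt_eq μ (g := fun y => h (φ.symm y)) (fun _ => rfl) (coordPt hx)).symm

end Cutoff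

/-! ### Anchored brackets on sections -/

section Sections

variable {d r m : ℕ} {M : Type*} [TopologicalSpace M] [ChartedSpace (Euc d) M]
  {E : M → Type*} [∀ x, AddCommGroup (E x)] [∀ x, Module ℝ (E x)]
  [∀ x, TopologicalSpace (E x)] [TopologicalSpace (Bundle.TotalSpace (Euc r) E)]
  [FiberBundle (Euc r) E] [VectorBundle ℝ (Euc r) E]

instance secModule : Module (SmoothFn d M) (Sec d r E) where
  smul := fsmul
  one_smul e := ContMDiffSection.ext fun x => one_smul ℝ (e x)
  mul_smul f g e := ContMDiffSection.ext fun x => mul_smul (f x) (g x) (e x)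
  smul_zero f := ContMDiffSection.ext fun x => smul_zero (f x)
  smul_add f e e' := ContMDiffSection.ext fun x => smul_add (f x) (e x) (e' x)
  add_smul f g e := ContMDiffSection.ext fun x => add_smul (f x) (g x) (e x)
  zero_smul e := ContMDiffSection.ext fun x => zero_smul ℝ (e x)

theorem smul_eq_fsmul (f : SmoothFn d M) (e : Sec d r E) : f • e = fsmul f e := rfl

theorem smul_sec_apply (f : SmoothFn d M) (e : Sec d r E) (x : M) : (f • e) x = f x • e x := rfl

theorem add_sec_apply (e e' : Sec d r E) (x : M) : (e + e') x = e x + e' x := rfl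

instance secIsScalarTower : IsScalarTower ℝ (SmoothFn d M) (Sec d r E) where
  smul_assoc c f e := ContMDiffSection.ext fun x => smul_assoc c (f x) (e x)

variable [IsManifold 𝓘(ℝ, Euc d) ∞ M]

/-- A skew-symmetric operation with `m + 1` arguments on sections, with an anchor and the Leibniz
rule. -/
structure AnchoredBracket (d r m : ℕ) {M : Type*} [TopologicalSpace M] [ChartedSpace (Euc d) M]
    [IsManifold 𝓘(ℝ, Euc d) ∞ M]
    (E : M → Type*) [∀ x, AddCommGroup (E x)] [∀ x, Module ℝ (E x)]
    [∀ x, TopologicalSpace (E x)] [TopologicalSpace (Bundle.TotalSpace (Euc r) E)]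
    [FiberBundle (Euc r) E] [VectorBundle ℝ (Euc r) E] where
  ρ : ∀ x, E x [⋀^Fin m]→ₗ[ℝ] TangentSpace 𝓘(ℝ, Euc d) x
  smooth : ∀ e : Fin m → Sec d r E, ContMDiff 𝓘(ℝ, Euc d) 𝓘(ℝ, Euc d).tangent ∞
    (fun x => (⟨x, ρ x (fun i => e i x)⟩ : TangentBundle 𝓘(ℝ, Euc d) M))
  b : Sec d r E [⋀^Fin (m + 1)]→ₗ[ℝ] Sec d r E
  leibniz : ∀ (f : SmoothFn d M) (e : Sec d r E) (e' : Fin m → Sec d r E) (x : M),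
    b (Fin.cons (f • e) e') x = f x • b (Fin.cons e e') x
      + ((-1 : ℝ) ^ m * derivAlong f (ρ x (fun i => e' i x))) • e x

namespace AnchoredBracket

variable (B : AnchoredBracket d r m E)

theorem sec_update_apply {x : M} (v : Fin m → Sec d r E) (i : Fin m) (s : Sec d r E) :
    (fun j => Function.update v i s j x) = Function.update (fun j => v j x) i (s x) := by
  funext j
  by_cases h : j = i
  · subst h; simp
  · simp [h]

theorem derivAlong_add_right {x : M} (f : SmoothFn d M) (v w : TangentSpace 𝓘(ℝ, Euc d) x) :
    derivAlong f (v + w) = derivAlong f v + derivAlong f w :=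
  map_add (mfderiv 𝓘(ℝ, Euc d) 𝓘(ℝ, ℝ) f x) v w

theorem derivAlong_smul_right {x : M} (f : SmoothFn d M) (c : ℝ) (v : TangentSpace 𝓘(ℝ, Euc d) x) :
    derivAlong f (c • v) = c * derivAlong f v :=
  map_smul (mfderiv 𝓘(ℝ, Euc d) 𝓘(ℝ, ℝ) f x) c v

theorem derivAlong_zero_right {x : M} (f : SmoothFn d M) :
    derivAlong f (0 : TangentSpace 𝓘(ℝ, Euc d) x) = 0 :=
  map_zero (mfderiv 𝓘(ℝ, Euc d) 𝓘(ℝ, ℝ) f x)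

/-- The operation as a bracket over the algebra of smooth functions. -/
def toLeibniz : LeibnizBracket (SmoothFn d M) (Sec d r E) m where
  ρ :=
    { toFun := fun v => vfDer (fun x => B.ρ x fun i => v i x) (B.smooth v)
      map_update_add' := fun {inst} v i s t => by
        -- The field quantifies over all decidability instances, while the update lemma is stated
        -- for the standard one.
        obtain rfl := Subsingleton.elim inst (instDecidableEqFin m)
        refine Derivation.ext fun f => ContMDiffMap.ext fun x => ?_
        rw [Derivation.add_apply, ContMDiffMap.coe_add, Pi.add_apply]
        simp only [vfDer_apply, sec_update_apply, add_sec_apply, AlternatingMap.map_update_add,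
          derivAlong_add_right]
      map_update_smul' := fun {inst} v i f s => by
        obtain rfl := Subsingleton.elim inst (instDecidableEqFin m)
        refine Derivation.ext fun g => ContMDiffMap.ext fun x => ?_
        rw [Derivation.smul_apply, smul_eq_mul, ContMDiffMap.coe_mul, Pi.mul_apply]
        simp only [vfDer_apply, sec_update_apply, smul_sec_apply, AlternatingMap.map_update_smul,
          derivAlong_smul_right]
      map_eq_zero_of_eq' := fun v i j h hij => by
        refine Derivation.ext fun f => ContMDiffMap.ext fun x => ?_
        rw [vfDer_apply, (B.ρ x).map_eq_zero_of_eq _ (by rw [h]) hij, derivAlong_zero_right]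
        rfl }
  b := B.b
  leibniz f s v := ContMDiffSection.ext fun x => B.leibniz f s v x

theorem toLeibniz_ρ_apply (v : Fin m → Sec d r E) (f : SmoothFn d M) (x : M) :
    B.toLeibniz.ρ v f x = derivAlong f (B.ρ x fun i => v i x) := rfl

end AnchoredBracket

end Sections

end GappedLie

end

/-! ### Evaluation at points and components with respect to a frame -/

noncomputable section

namespace GappedLie

open Filter Topology

section Eval

variable {d : ℕ}

/-- Evaluation of smooth functions at a point. -/
def evalAt {V : TopologicalSpace.Opens (Euc d)} (y : V) : smoothFun V →ₐ[ℝ] ℝ :=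
  (Pi.evalAlgHom ℝ (fun _ : V => ℝ) y).comp (smoothFun V).val

/-- Symmetry of second derivatives. This is the only property of `∂/∂x` beyond the Leibniz rule that
the commutator computations need. -/
theorem pderiv_comm (V : TopologicalSpace.Opens (Euc d)) (μ ν : Fin d) (f : smoothFun V) :
    pderiv V μ (pderiv V ν f) = pderiv V ν (pderiv V μ f) := by
  obtain ⟨f, g, hg, h⟩ := f
  refine Subtype.ext (funext fun y => ?_)
  have key : ∀ μ ν : Fin d, pderivAt μ (pderivAt ν f) y =
      fderiv ℝ (fderiv ℝ g) y (EuclideanSpace.single μ 1) (EuclideanSpace.single ν 1) := by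
    intro μ ν
    rw [pderivAt_eq μ (g := fun z => fderiv ℝ g z (EuclideanSpace.single ν 1))
      (pderivAt_eq ν h) y]
    have hd : DifferentiableAt ℝ (fderiv ℝ g) y :=
      ((hg.fderiv_of_isOpen V.isOpen (m := ∞) (by simp)).contDiffAt
        (V.isOpen.mem_nhds y.2)).differentiableAt (by simp)
    rw [fderiv_clm_apply hd (differentiableAt_const _)]
    simp
  have hs : IsSymmSndFDerivAt ℝ g y :=
    (hg.contDiffAt (V.isOpen.mem_nhds y.2)).isSymmSndFDerivAt
      (by rw [minSmoothness_of_isRCLikeNormedField]; exact ENat.LEInfty.out)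
  exact (key μ ν).trans ((hs _ _).trans (key ν μ).symm)

/-- The coordinates as smooth functions. -/
def coordFn (V : TopologicalSpace.Opens (Euc d)) (μ : Fin d) : smoothFun V :=
  ⟨fun y => (y : Euc d) μ, fun y => y μ,
    (EuclideanSpace.proj μ : Euc d →L[ℝ] ℝ).contDiff.contDiffOn, fun _ => rfl⟩

theorem pderiv_coordFn (V : TopologicalSpace.Opens (Euc d)) (μ ν : Fin d) :
    pderiv V ν (coordFn V μ) = if ν = μ then 1 else 0 := by
  refine Subtype.ext (funext fun y => ?_)
  have h := pderivAt_eq ν (f := (coordFn V μ).1) (g := (EuclideanSpace.proj μ : Euc d →L[ℝ] ℝ))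
    (fun _ => rfl) y
  refine h.trans ?_
  rw [ContinuousLinearMap.fderiv]
  by_cases hν : ν = μ
  · subst hν; simp
  · simp [hν, Ne.symm hν]

end Eval

namespace LeibnizBracket

variable {A L : Type*} [CommRing A] [Algebra ℝ A] [AddCommGroup L] [Module A L] [Module ℝ L]

theorem b_cons_sum {m : ℕ} {ι : Type*} (P : LeibnizBracket A L m) (t : Finset ι) (s : ι → L)
    (v : Fin m → L) : P.b (Fin.cons (∑ i ∈ t, s i) v) = ∑ i ∈ t, P.b (Fin.cons (s i) v) := by
  have h : ∀ u : L, P.b (Fin.cons u v) =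
      P.b.toMultilinearMap.toLinearMap (Fin.cons 0 v : Fin (m + 1) → L) 0 u := fun u => by
    simp [Fin.update_cons_zero]
  simp only [h, map_sum]

end LeibnizBracket

section Local

variable {d r m : ℕ} {M : Type*} [TopologicalSpace M] [ChartedSpace (Euc d) M]
  {E : M → Type*} [∀ x, AddCommGroup (E x)] [∀ x, Module ℝ (E x)]
  [∀ x, TopologicalSpace (E x)] [TopologicalSpace (Bundle.TotalSpace (Euc r) E)]
  [FiberBundle (Euc r) E] [VectorBundle ℝ (Euc r) E]
  [IsManifold 𝓘(ℝ, Euc d) ∞ M]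

theorem evalAt_inCoord {φ : OpenPartialHomeomorph M (Euc d)}
    (hφ : φ ∈ IsManifold.maximalAtlas 𝓘(ℝ, Euc d) ∞ M) {h : M → ℝ}
    (hh : ContMDiffOn 𝓘(ℝ, Euc d) 𝓘(ℝ, ℝ) ∞ h φ.source) {x : M} (hx : x ∈ φ.source) :
    evalAt (coordPt hx) (inCoord hφ h hh) = h x := inCoord_apply hφ hh hx

theorem evalAt_ext {φ : OpenPartialHomeomorph M (Euc d)} {f g : smoothFun (chartTarget φ)}
    (h : ∀ x (hx : x ∈ φ.source), evalAt (coordPt hx) f = evalAt (coordPt hx) g) : f = g :=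
  smoothFun_ext h

/-- The value of a derivation at a function and a point, as a linear map. -/
def derEval (f : SmoothFn d M) (x : M) :
    Derivation ℝ (SmoothFn d M) (SmoothFn d M) →ₗ[ℝ] ℝ where
  toFun V := V f x
  map_add' _ _ := rfl
  map_smul' _ _ := rfl

namespace BundleCoord

variable (κ : BundleCoord d r E)

theorem evalAt_secComp (e : Sec d r E) (c : Fin r) {x : M} (hx : x ∈ κ.chart.source) :
    evalAt (coordPt hx) (κ.secComp e c) = κ.isFrame.coeff c x (e x) :=
  evalAt_inCoord κ.chart_mem (contMDiffOn_coeff κ.chart.open_source κ.isFrame e c) hx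

theorem evalAt_vecComp {X : (x : M) → TangentSpace 𝓘(ℝ, Euc d) x}
    (hX : ContMDiff 𝓘(ℝ, Euc d) 𝓘(ℝ, Euc d).tangent ∞
      (fun x => (⟨x, X x⟩ : TangentBundle 𝓘(ℝ, Euc d) M))) (μ : Fin d) {x : M}
    (hx : x ∈ κ.chart.source) :
    evalAt (coordPt hx) (κ.vecComp X hX μ) = dx κ.chart x μ (X x) :=
  evalAt_inCoord κ.chart_mem (contMDiffOn_dx κ.chart_mem μ hX) hx

/-- A component of a section at a point, as a linear map. -/
def coeffLin (c : Fin r) (x : M) : Sec d r E →ₗ[ℝ] ℝ where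
  toFun e := κ.isFrame.coeff c x (e x)
  map_add' e e' := map_add (κ.isFrame.coeff c x) (e x) (e' x)
  map_smul' a e := map_smul (κ.isFrame.coeff c x) a (e x)

theorem coeffLin_apply (c : Fin r) (x : M) (e : Sec d r E) :
    κ.coeffLin c x e = κ.isFrame.coeff c x (e x) := rfl

theorem coeffLin_smul (c : Fin r) (x : M) (f : SmoothFn d M) (e : Sec d r E) :
    κ.coeffLin c x (f • e) = f x * κ.coeffLin c x e :=
  map_smul (κ.isFrame.coeff c x) (f x) (e x)

theorem coeff_frame {x : M} (hx : x ∈ κ.chart.source) (c a : Fin r) :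
    κ.coeffLin c x (κ.frame a) = if a = c then 1 else 0 := by
  rw [coeffLin_apply, IsLocalFrameOn.coeff_apply_of_mem _ hx (fun x => κ.frame a x)]
  have : κ.frame a x = κ.isFrame.toBasisAt hx a := (κ.isFrame.toBasisAt_coe hx a).symm
  rw [this, Module.Basis.repr_self, Finsupp.single_apply]

theorem sec_eq_sum {x : M} (hx : x ∈ κ.chart.source) (e : Sec d r E) :
    e x = ∑ a, κ.coeffLin a x e • κ.frame a x :=
  κ.isFrame.coeff_sum_eq (fun x => e x) hx

theorem sec_eq_zero_iff {x : M} (hx : x ∈ κ.chart.source) (e : Sec d r E) :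
    e x = 0 ↔ ∀ c, κ.coeffLin c x e = 0 := by
  refine ⟨fun h c => by rw [coeffLin_apply, h, map_zero], fun h => ?_⟩
  rw [κ.sec_eq_sum hx e]
  simp [h]

theorem sec_sum_apply {ι : Type*} (t : Finset ι) (e : ι → Sec d r E) (x : M) :
    (∑ i ∈ t, e i) x = ∑ i ∈ t, e i x :=
  map_sum (⟨⟨fun e : Sec d r E => e x, rfl⟩, fun _ _ => rfl⟩ : Sec d r E →+ E x) e t

/-- Sections multiplied by a function supported in the domain of the coordinates are combinations
of the sections of the frame. -/
theorem exists_smul_eq_sum {χ : SmoothFn d M} (hχ : tsupport χ ⊆ κ.chart.source) (e : Sec d r E) :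
    ∃ g : Fin r → SmoothFn d M, (∀ a x, g a x = χ x * κ.coeffLin a x e) ∧
      χ • e = ∑ a, g a • κ.frame a := by
  refine ⟨fun a => ⟨_, contMDiff_mul_of_tsupport κ.chart.open_source hχ
    (contMDiffOn_coeff κ.chart.open_source κ.isFrame e a)⟩, fun a x => rfl, ?_⟩
  refine ContMDiffSection.ext fun x => ?_
  rw [sec_sum_apply]
  simp only [smul_sec_apply]
  by_cases hx : x ∈ κ.chart.source
  · rw [κ.sec_eq_sum hx e, Finset.smul_sum]
    exact Finset.sum_congr rfl fun a _ => smul_smul _ _ _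
  · have h0 : χ x = 0 := image_eq_zero_of_notMem_tsupport fun h => hx (hχ h)
    rw [h0, zero_smul]
    refine (Finset.sum_eq_zero fun a _ => ?_).symm
    have : (χ x * κ.isFrame.coeff a x (e x)) • κ.frame a x = 0 := by rw [h0, zero_mul, zero_smul]
    exact this

end BundleCoord

/-- The derivative of a function along a tangent vector. -/
def dirDeriv (h : M → ℝ) {x : M} (v : TangentSpace 𝓘(ℝ, Euc d) x) : ℝ :=
  mfderiv 𝓘(ℝ, Euc d) 𝓘(ℝ, ℝ) h x v

theorem derivAlong_of_eventuallyEq_one {χ : SmoothFn d M} {x : M} (hχ : ∀ᶠ y in 𝓝 x, χ y = 1)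
    (v : TangentSpace 𝓘(ℝ, Euc d) x) : derivAlong χ v = 0 := by
  rw [derivAlong_congr (h := fun _ => 1) hχ, mfderiv_const]
  rfl

namespace AnchoredBracket

variable (B : AnchoredBracket d r m E) (κ : BundleCoord d r E)

/-- The components of the anchor. -/
def anchorCoef (I : Fin m → Fin r) (μ : Fin d) : smoothFun κ.domain :=
  κ.vecComp (fun x => B.ρ x fun i => κ.frame (I i) x) (B.smooth fun i => κ.frame (I i)) μ

/-- The structure functions of the bracket. -/
def structCoef (I : Fin (m + 1) → Fin r) (c : Fin r) : smoothFun κ.domain :=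
  κ.secComp (B.b fun i => κ.frame (I i)) c

variable {κ} {x : M} (hx : x ∈ κ.chart.source)

theorem evalAt_anchorCoef (I : Fin m → Fin r) (μ : Fin d) :
    evalAt (coordPt hx) (B.anchorCoef κ I μ) =
      dx κ.chart x μ (B.ρ x fun i => κ.frame (I i) x) := κ.evalAt_vecComp _ _ hx

theorem evalAt_structCoef (I : Fin (m + 1) → Fin r) (c : Fin r) :
    evalAt (coordPt hx) (B.structCoef κ I c) = κ.coeffLin c x (B.b fun i => κ.frame (I i)) :=
  κ.evalAt_secComp _ _ hx

theorem anchorCoef_perm (I : Fin m → Fin r) (μ : Fin d) (σ : Equiv.Perm (Fin m)) :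
    B.anchorCoef κ (I ∘ σ) μ = rsign σ • B.anchorCoef κ I μ := by
  refine evalAt_ext fun x hx => ?_
  rw [map_smul, evalAt_anchorCoef, evalAt_anchorCoef, ← map_smul]
  congr 1
  exact map_perm_rsign (B.ρ x) (fun i => κ.frame (I i) x) σ

theorem structCoef_perm (I : Fin (m + 1) → Fin r) (c : Fin r) (σ : Equiv.Perm (Fin (m + 1))) :
    B.structCoef κ (I ∘ σ) c = rsign σ • B.structCoef κ I c := by
  refine evalAt_ext fun x hx => ?_
  rw [map_smul, evalAt_structCoef, evalAt_structCoef, ← map_smul]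
  congr 1
  exact map_perm_rsign B.b (fun i => κ.frame (I i)) σ

theorem evalAt_act {h : M → ℝ} (hh : ContMDiffOn 𝓘(ℝ, Euc d) 𝓘(ℝ, ℝ) ∞ h κ.chart.source)
    (I : Fin m → Fin r) :
    evalAt (coordPt hx) (GrAlg.act (pderiv κ.domain) (B.anchorCoef κ) I
      (inCoord κ.chart_mem h hh)) =
      dirDeriv h (B.ρ x fun i => κ.frame (I i) x) := by
  rw [dirDeriv, mfderiv_eq_sum κ.chart_mem hh hx, GrAlg.act, map_sum]
  refine Finset.sum_congr rfl fun μ _ => ?_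
  rw [map_mul, evalAt_anchorCoef]
  rfl

variable [T2Space M]

/-- The bracket in terms of the components of its first argument. -/
theorem coeffLin_b_cons (hx : x ∈ κ.chart.source) (s : Sec d r E) (v : Fin m → Sec d r E) (c : Fin r) :
    κ.coeffLin c x (B.b (Fin.cons s v)) =
      ∑ a, κ.coeffLin a x s * κ.coeffLin c x (B.b (Fin.cons (κ.frame a) v))
        + (-1 : ℝ) ^ m * dirDeriv (fun y => κ.coeffLin c y s)
          (B.ρ x fun i => v i x) := by
  -- Multiplying `s` by a function equal to `1` near `x` does not change the bracket at `x`, as the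
  -- derivative of that function vanishes there. The product is a combination of frame sections with
  -- global coefficients, to which the Leibniz rule applies.
  obtain ⟨χ, hχ1, hχ2⟩ := exists_cutoff (d := d) κ.chart.open_source hx
  obtain ⟨g, hg, hs⟩ := κ.exists_smul_eq_sum hχ2 s
  have hbl : ∀ (f : SmoothFn d M) (s : Sec d r E), κ.coeffLin c x (B.b (Fin.cons (f • s) v)) =
      f x * κ.coeffLin c x (B.b (Fin.cons s v))
        + (-1 : ℝ) ^ m * derivAlong f (B.ρ x fun i => v i x) * κ.coeffLin c x s := by
    intro f s
    simp only [BundleCoord.coeffLin_apply, B.leibniz, map_add, map_smul, smul_eq_mul]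
  have h1 := hbl χ s
  have hχx : χ x = 1 := hχ1.self_of_nhds
  rw [derivAlong_of_eventuallyEq_one hχ1, hχx, hs] at h1
  have hsum := congrArg (κ.coeffLin c x)
    (B.toLeibniz.b_cons_sum Finset.univ (fun a => g a • κ.frame a) v)
  rw [map_sum] at hsum
  have hd : derivAlong (g c) (B.ρ x fun i => v i x) =
      dirDeriv (fun y => κ.coeffLin c y s) (B.ρ x fun i => v i x) := by
    refine derivAlong_congr ?_ _
    filter_upwards [hχ1] with y hy
    rw [hg, hy, one_mul]
  simp only [mul_zero, zero_mul, add_zero, one_mul] at h1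
  rw [← h1, ← hd]
  refine hsum.trans ?_
  have h2 : ∀ a, κ.coeffLin c x (B.toLeibniz.b (Fin.cons (g a • κ.frame a) v)) =
      κ.coeffLin a x s * κ.coeffLin c x (B.b (Fin.cons (κ.frame a) v)) +
      (-1 : ℝ) ^ m * derivAlong (g a) (B.ρ x fun i => v i x) * if a = c then 1 else 0 := by
    intro a
    refine (hbl (g a) (κ.frame a)).trans ?_
    rw [hg, hχx, one_mul, κ.coeff_frame hx]
  rw [Finset.sum_congr rfl fun a _ => h2 a, Finset.sum_add_distrib]
  simp

end AnchoredBracket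

end Local

end GappedLie

end

/-! ### The defects on frames as coefficients in coordinates -/

noncomputable section

namespace GappedLie

open Filter Topology LeibnizBracket

theorem map_altSum {m : ℕ} {ι ι' N N' : Type*} [AddCommGroup N] [Module ℝ N] [AddCommGroup N']
    [Module ℝ N'] (g : N →ₗ[ℝ] N') (F : (Fin m → ι') → N) (w : ι → ι') (I : Fin m → ι) :
    g (altSum F fun i => w (I i)) = altSum (fun J => g (F fun i => w (J i))) I := by
  simp only [altSum, map_sum, map_smul]
  rfl

theorem map_cons_sum_smul {V W : Type*} [AddCommGroup V] [Module ℝ V] [AddCommGroup W] [Module ℝ W]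
    {ι : Type*} {m : ℕ} (T : V [⋀^Fin (m + 1)]→ₗ[ℝ] W) (t : Finset ι) (c : ι → ℝ) (s : ι → V)
    (v : Fin m → V) :
    T (Fin.cons (∑ i ∈ t, c i • s i) v) = ∑ i ∈ t, c i • T (Fin.cons (s i) v) := by
  have h : ∀ u : V, T (Fin.cons u v) =
      T.toMultilinearMap.toLinearMap (Fin.cons 0 v : Fin (m + 1) → V) 0 u := fun u => by
    simp [Fin.update_cons_zero]
  simp only [h, map_sum, map_smul]

section Local

variable {d r m : ℕ} {M : Type*} [TopologicalSpace M] [ChartedSpace (Euc d) M]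
  {E : M → Type*} [∀ x, AddCommGroup (E x)] [∀ x, Module ℝ (E x)]
  [∀ x, TopologicalSpace (E x)] [TopologicalSpace (Bundle.TotalSpace (Euc r) E)]
  [FiberBundle (Euc r) E] [VectorBundle ℝ (Euc r) E]
  [IsManifold 𝓘(ℝ, Euc d) ∞ M]

namespace AnchoredBracket

variable (X : AnchoredBracket d r 1 E) (P : AnchoredBracket d r m E) (κ : BundleCoord d r E)

/-- The local expression whose alternating sum is the defect of the mixed Jacobi identity. -/
def jacCoef (c : Fin r) (I : Fin (m + 2) → Fin r) : smoothFun κ.domain :=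
  (1 / ((m + 1).factorial : ℝ)) •
      (∑ a, P.structCoef κ (fun i => I i.succ) a * X.structCoef κ ![a, I 0] c
        - GrAlg.act (pderiv κ.domain) (X.anchorCoef κ) (fun _ => I 0)
          (P.structCoef κ (fun i => I i.succ) c))
    + (1 / (2 * (m.factorial : ℝ))) • (∑ a, X.structCoef κ ![I 0, I 1] a *
        P.structCoef κ (Fin.cons a fun i : Fin m => I i.succ.succ) c
      + (-1 : ℝ) ^ m • GrAlg.act (pderiv κ.domain) (P.anchorCoef κ) (fun i => I i.succ.succ)
        (X.structCoef κ ![I 0, I 1] c))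

/-- The local expression whose alternating sum is the defect of the mixed morphism condition. -/
def ancCoef {k : ℕ} (P : AnchoredBracket d r (k + 1) E) (μ : Fin d) (I : Fin (k + 2) → Fin r) :
    smoothFun κ.domain :=
  (1 / ((k + 1).factorial : ℝ)) •
      (GrAlg.act (pderiv κ.domain) (X.anchorCoef κ) (fun _ => I 0)
          (P.anchorCoef κ (fun i => I i.succ) μ)
        - GrAlg.act (pderiv κ.domain) (P.anchorCoef κ) (fun i => I i.succ)
          (X.anchorCoef κ (fun _ => I 0) μ))
    + ((-(1 / (2 * (k.factorial : ℝ)))) • ∑ a, X.structCoef κ ![I 0, I 1] a *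
        P.anchorCoef κ (Fin.cons a fun i : Fin k => I i.succ.succ) μ
      + ((-1 : ℝ) ^ (k + 1) / ((k + 2).factorial : ℝ)) •
        ∑ a, X.anchorCoef κ (fun _ => a) μ * P.structCoef κ I a)

variable {κ} {x : M}

theorem frame_cons (a : Fin r) (J : Fin m → Fin r) :
    (Fin.cons (κ.frame a) fun i => κ.frame (J i) : Fin (m + 1) → Sec d r E) =
      fun i => κ.frame ((Fin.cons a J : Fin (m + 1) → Fin r) i) := by
  funext i
  refine Fin.cases rfl (fun i => rfl) i

theorem br_frame (a b : Fin r) : X.toLeibniz.br (κ.frame a) (κ.frame b) =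
    X.b fun i => κ.frame (![a, b] i) := by
  unfold LeibnizBracket.br
  refine congrArg X.b ?_
  funext i
  fin_cases i <;> rfl

section

variable [T2Space M]

theorem coeffLin_b_frame (hx : x ∈ κ.chart.source) (s : Sec d r E) (J : Fin m → Fin r)
    (c : Fin r) :
    κ.coeffLin c x (P.b (Fin.cons s fun i => κ.frame (J i))) =
      evalAt (coordPt hx) (∑ a, κ.secComp s a * P.structCoef κ (Fin.cons a J) c
        + (-1 : ℝ) ^ m •
          GrAlg.act (pderiv κ.domain) (P.anchorCoef κ) J (κ.secComp s c)) := by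
  rw [P.coeffLin_b_cons hx, map_add, map_smul, map_sum, smul_eq_mul]
  congr 1
  · refine Finset.sum_congr rfl fun a _ => ?_
    rw [map_mul, evalAt_structCoef, κ.evalAt_secComp, frame_cons]
    rfl
  · congr 1
    exact (P.evalAt_act hx (contMDiffOn_coeff κ.chart.open_source κ.isFrame s c) J).symm

/-- The components of the defect of the mixed Jacobi identity. -/
theorem coeffLin_jac (hx : x ∈ κ.chart.source) (I : Fin (m + 2) → Fin r) (c : Fin r) :
    κ.coeffLin c x (jac X.toLeibniz P.toLeibniz fun i => κ.frame (I i)) =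
      evalAt (coordPt hx) (altSum (X.jacCoef P κ c) I) := by
  rw [jac_eq_altSum, map_altSum (κ.coeffLin c x)]
  have h := map_altSum (evalAt (coordPt hx)).toLinearMap (X.jacCoef P κ c) id I
  refine Eq.trans ?_ h.symm
  congr 1
  funext J
  rw [map_add, map_smul, map_smul]
  simp only [id, AlgHom.toLinearMap_apply, jacCoef, map_add, map_smul]
  congr 2
  · have h1 := X.coeffLin_b_frame hx (P.b fun i => κ.frame (J i.succ)) (fun _ => J 0) c
    refine h1.trans ?_
    congr 1
    rw [pow_one, neg_smul, one_smul, ← sub_eq_add_neg]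
    congr 1
    refine Finset.sum_congr rfl fun a _ => ?_
    congr 2
    funext i
    fin_cases i <;> rfl
  · rw [br_frame]
    exact P.coeffLin_b_frame hx _ _ c

theorem coeffLin_jac_eq_zero_iff :
    (∀ I c, altSum (X.jacCoef P κ c) I = 0) ↔ ∀ I : Fin (m + 2) → Fin r, ∀ x ∈ κ.chart.source,
      jac X.toLeibniz P.toLeibniz (fun i => κ.frame (I i)) x = 0 := by
  constructor
  · intro h I x hx
    rw [κ.sec_eq_zero_iff hx]
    intro c
    rw [coeffLin_jac X P hx, h, map_zero]
  · intro h I c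
    refine evalAt_ext fun x hx => ?_
    rw [← coeffLin_jac X P hx, map_zero]
    exact (κ.sec_eq_zero_iff hx _).1 (h I x hx) c

end

/-- Applied to a function that agrees with the coordinate `x^μ` near `x`, an anchor returns its
`μ`-component. The equality holds near `x` because commutators differentiate it again. -/
theorem toLeibniz_ρ_eventuallyEq {f : SmoothFn d M} {μ : Fin d} (hx : x ∈ κ.chart.source)
    (hf : f =ᶠ[𝓝 x] fun y => κ.chart y μ) (v : Fin m → Sec d r E) :
    (P.toLeibniz.ρ v f : M → ℝ) =ᶠ[𝓝 x] fun y => dx κ.chart y μ (P.ρ y fun i => v i y) := by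
  filter_upwards [hf.eventually_nhds, κ.chart.open_source.mem_nhds hx] with y hy hy'
  rw [toLeibniz_ρ_apply, derivAlong_congr hy, mfderiv_coord κ.chart_mem hy']

theorem dx_ρ_cons {k : ℕ} (P : AnchoredBracket d r (k + 1) E) (hx : x ∈ κ.chart.source) (μ : Fin d)
    (s : Sec d r E) (J : Fin k → Fin r) :
    dx κ.chart x μ (P.ρ x fun i => (Fin.cons s fun i => κ.frame (J i) : Fin (k + 1) → Sec d r E) i x) =
      ∑ a, κ.coeffLin a x s * evalAt (coordPt hx) (P.anchorCoef κ (Fin.cons a J) μ) := by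
  have h1 : (fun i => (Fin.cons s fun i => κ.frame (J i) : Fin (k + 1) → Sec d r E) i x) =
      Fin.cons (s x) fun i => κ.frame (J i) x := by
    funext i
    refine Fin.cases rfl (fun i => rfl) i
  rw [h1, κ.sec_eq_sum hx s, map_cons_sum_smul, map_sum]
  refine Finset.sum_congr rfl fun a _ => ?_
  rw [map_smul, smul_eq_mul, evalAt_anchorCoef]
  congr 3
  funext i
  refine Fin.cases rfl (fun i => rfl) i

theorem evalAt_act_anchorCoef {j : ℕ} (B : AnchoredBracket d r j E) (hx : x ∈ κ.chart.source)
    {f : SmoothFn d M} {μ : Fin d}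
    (hf : f =ᶠ[𝓝 x] fun y => κ.chart y μ) (I : Fin j → Fin r) (J : Fin m → Fin r) :
    evalAt (coordPt hx) (GrAlg.act (pderiv κ.domain) (B.anchorCoef κ) I (P.anchorCoef κ J μ)) =
      B.toLeibniz.ρ (fun i => κ.frame (I i)) (P.toLeibniz.ρ (fun i => κ.frame (J i)) f) x := by
  rw [toLeibniz_ρ_apply, derivAlong_congr (P.toLeibniz_ρ_eventuallyEq hx hf _)]
  exact B.evalAt_act hx (contMDiffOn_dx κ.chart_mem μ (P.smooth fun i => κ.frame (J i))) I

/-- The components of the defect of the mixed morphism condition. -/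
theorem anc_frame {k : ℕ} (P : AnchoredBracket d r (k + 1) E) {f : SmoothFn d M} {μ : Fin d}
    (hx : x ∈ κ.chart.source) (hf : f =ᶠ[𝓝 x] fun y => κ.chart y μ) (I : Fin (k + 2) → Fin r) :
    anc X.toLeibniz P.toLeibniz (fun i => κ.frame (I i)) f x =
      evalAt (coordPt hx) (altSum (X.ancCoef κ P μ) I) := by
  rw [anc_eq_altSum]
  refine (map_altSum (derEval f x) _ κ.frame I).trans ?_
  have h := map_altSum (evalAt (coordPt hx)).toLinearMap (X.ancCoef κ P μ) id I
  refine Eq.trans ?_ h.symm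
  congr 1
  funext J
  -- Testing a derivation on a function with the germ of `x^μ` reads off its `μ`-component, which
  -- turns the algebraic defect into the coordinate expression.
  have hρ : ∀ {j : ℕ} (B : AnchoredBracket d r j E) (v : Fin j → Sec d r E),
      derEval f x (B.toLeibniz.ρ v) = dx κ.chart x μ (B.ρ x fun i => v i x) := fun B v =>
    (B.toLeibniz_ρ_eventuallyEq hx hf v).self_of_nhds
  rw [map_add, map_add, map_smul, map_smul, map_smul]
  simp only [id, AlgHom.toLinearMap_apply, ancCoef, map_add, map_smul]
  congr 1
  · congr 1
    rw [map_sub, evalAt_act_anchorCoef _ _ hx hf, evalAt_act_anchorCoef _ _ hx hf]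
    rfl
  · congr 1
    · congr 1
      rw [hρ, br_frame, P.dx_ρ_cons hx, map_sum]
      refine Finset.sum_congr rfl fun a _ => ?_
      rw [map_mul, evalAt_structCoef]
    · congr 1
      have h1 := X.dx_ρ_cons hx μ (P.b fun i => κ.frame (J i)) Fin.elim0
      refine Eq.trans ?_ (h1.trans ?_)
      · refine (hρ X _).trans ?_
        congr 2
        funext i
        fin_cases i
        rfl
      · rw [map_sum]
        refine Finset.sum_congr rfl fun a _ => ?_
        rw [map_mul, evalAt_structCoef, mul_comm]
        congr 3
        funext i
        fin_cases i
        rfl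

end AnchoredBracket

end Local

end GappedLie

end

/-! ### From frames to arbitrary sections -/

noncomputable section

namespace GappedLie

open Filter Topology LeibnizBracket

section Global

variable {d r m : ℕ} {M : Type*} [TopologicalSpace M] [ChartedSpace (Euc d) M]
  {E : M → Type*} [∀ x, AddCommGroup (E x)] [∀ x, Module ℝ (E x)]
  [∀ x, TopologicalSpace (E x)] [TopologicalSpace (Bundle.TotalSpace (Euc r) E)]
  [FiberBundle (Euc r) E] [VectorBundle ℝ (Euc r) E]
  [IsManifold 𝓘(ℝ, Euc d) ∞ M]

/-- The derivative of a function as a linear map on tangent vectors. -/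
def derivAlongLin (f : SmoothFn d M) (x : M) : TangentSpace 𝓘(ℝ, Euc d) x →ₗ[ℝ] ℝ where
  toFun v := derivAlong f v
  map_add' v w := map_add (mfderiv 𝓘(ℝ, Euc d) 𝓘(ℝ, ℝ) f x) v w
  map_smul' c v := map_smul (mfderiv 𝓘(ℝ, Euc d) 𝓘(ℝ, ℝ) f x) c v

theorem derEval_smul (f h : SmoothFn d M) (x : M)
    (V : Derivation ℝ (SmoothFn d M) (SmoothFn d M)) : derEval f x (h • V) = h x * V f x := rfl

variable (d r E) in
/-- Coordinates exist near every point. -/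
theorem exists_bundleCoord [T2Space M] [ContMDiffVectorBundle ∞ (Euc r) E 𝓘(ℝ, Euc d)] (x : M) :
    ∃ κ : BundleCoord d r E, x ∈ κ.chart.source := by
  set t := trivializationAt (Euc r) E x with ht
  let b := (EuclideanSpace.basisFun (Fin r) ℝ).toBasis
  have hx : x ∈ t.baseSet := FiberBundle.mem_baseSet_trivializationAt' x
  -- The frame sections in `BundleCoord` are global, so the local frame is cut off; the chart is
  -- then shrunk to where the cutoff equals `1` and the frame is unchanged.
  obtain ⟨χ, hχ1, hχ2⟩ := exists_cutoff (d := d) t.open_baseSet hx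
  have hfr := t.isLocalFrameOn_localFrame_baseSet 𝓘(ℝ, Euc d) ∞ b
  let s : Fin r → Sec d r E := fun a => ⟨fun y => χ y • t.localFrame b a y,
    ContMDiffOn.smul_section_of_tsupport χ.contMDiff.contMDiffOn t.open_baseSet hχ2
      (hfr.contMDiffOn a)⟩
  set W := t.baseSet ∩ interior {y | χ y = 1} with hW
  have hWo : IsOpen W := t.open_baseSet.inter isOpen_interior
  have hxW : x ∈ W := ⟨hx, mem_interior_iff_mem_nhds.2 hχ1⟩
  let φ := (chartAt (Euc d) x).restr W
  have hφW : φ.source ⊆ W := by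
    rw [OpenPartialHomeomorph.restr_source' _ _ hWo]
    exact Set.inter_subset_right
  refine ⟨⟨φ, restr_mem_maximalAtlas _ (IsManifold.chart_mem_maximalAtlas x) hWo, s, ?_⟩, ?_⟩
  · refine (hfr.mono (hφW.trans Set.inter_subset_left)).congr fun a y hy => ?_
    have hy' : y ∈ {y | χ y = 1} := interior_subset (hφW hy).2
    have : χ y = 1 := hy'
    exact ((congrArg (· • t.localFrame b a y) this).trans (one_smul ℝ _)).symm
  · change x ∈ ((chartAt (Euc d) x).restr W).source
    rw [OpenPartialHomeomorph.restr_source' _ _ hWo]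
    exact ⟨mem_chart_source _ _, hxW⟩

namespace AnchoredBracket

variable (X : AnchoredBracket d r 1 E)

/-- The defect of the mixed morphism condition as a tangent vector. -/
def ancVec {k : ℕ} (P : AnchoredBracket d r (k + 1) E) (e : Fin (k + 2) → Sec d r E) (x : M) :
    TangentSpace 𝓘(ℝ, Euc d) x :=
  (∑ i : Fin (k + 2), (-1 : ℝ) ^ (i : ℕ) • VectorField.mlieBracket 𝓘(ℝ, Euc d)
      (fun y => X.ρ y fun _ => e i y) (fun y => P.ρ y fun j => e (i.succAbove j) y) x)
  - (1 / 2 : ℝ) • (∑ i : Fin (k + 2), (-1 : ℝ) ^ (i : ℕ) •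
      ∑ j : Fin (k + 1), (-1 : ℝ) ^ (j : ℕ) •
      P.ρ x fun l => (Fin.cons (X.toLeibniz.br (e i) (e (i.succAbove j)))
        fun q => e (i.succAbove (j.succAbove q)) : Fin (k + 1) → Sec d r E) l x)
  + (-1 : ℝ) ^ (k + 1) • X.ρ x fun _ => P.b e x

/-- The Lie bracket of fields acts as the commutator of derivations, so the geometric defect and the
algebraic one contain the same information; the algebra is done with `anc`, the statement is about
`ancVec`. -/
theorem derivAlong_ancVec {k : ℕ} (P : AnchoredBracket d r (k + 1) E)
    (e : Fin (k + 2) → Sec d r E) (f : SmoothFn d M) (x : M) :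
    derivAlong f (X.ancVec P e x) = anc X.toLeibniz P.toLeibniz e f x := by
  change derivAlongLin f x (X.ancVec P e x) =
    derEval f x (anc X.toLeibniz P.toLeibniz e)
  unfold ancVec anc
  simp only [map_add, map_sub, map_smul, map_sum]
  congr 1
  congr 1
  refine Finset.sum_congr rfl fun i _ => ?_
  congr 1
  exact derivAlong_mlieBracket (X.smooth fun _ => e i) (P.smooth fun j => e (i.succAbove j)) f x

variable [T2Space M]

theorem ancVec_frame_eq_zero_iff {k : ℕ} (P : AnchoredBracket d r (k + 1) E)
    (κ : BundleCoord d r E) :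
    (∀ I μ, altSum (X.ancCoef κ P μ) I = 0) ↔ ∀ I : Fin (k + 2) → Fin r, ∀ x ∈ κ.chart.source,
      X.ancVec P (fun i => κ.frame (I i)) x = 0 := by
  have key : ∀ (I : Fin (k + 2) → Fin r) (μ : Fin d) (x : M) (hx : x ∈ κ.chart.source),
      dx κ.chart x μ (X.ancVec P (fun i => κ.frame (I i)) x) =
        evalAt (coordPt hx) (altSum (X.ancCoef κ P μ) I) := by
    intro I μ x hx
    obtain ⟨f, hf⟩ := exists_smoothFn_eventuallyEq κ.chart.open_source hx
      (contMDiffOn_coord κ.chart_mem μ)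
    rw [← anc_frame X P hx hf, ← derivAlong_ancVec, derivAlong_congr hf,
      mfderiv_coord κ.chart_mem hx]
  constructor
  · intro h I x hx
    refine eq_zero_of_dx_eq_zero κ.chart_mem hx fun μ => ?_
    rw [key I μ x hx, h, map_zero]
  · intro h I μ
    refine evalAt_ext fun x hx => ?_
    rw [← key I μ x hx, h I x hx, map_zero, map_zero]

theorem anc_eq_zero_iff {k : ℕ} (P : AnchoredBracket d r (k + 1) E)
    (e : Fin (k + 2) → Sec d r E) :
    anc X.toLeibniz P.toLeibniz e = 0 ↔ ∀ x, X.ancVec P e x = 0 := by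
  constructor
  · intro h x
    refine eq_zero_of_derivAlong_eq_zero fun f => ?_
    rw [derivAlong_ancVec, h]
    rfl
  · intro h
    refine Derivation.ext fun f => ContMDiffMap.ext fun x => ?_
    rw [← derivAlong_ancVec, h]
    exact map_zero (derivAlongLin f x)

theorem update_cons_zero' {α : Type*} {k : ℕ} (h : 0 < k + 1) (v : Fin (k + 1) → α) (s : α) :
    Function.update v ⟨0, h⟩ s = Fin.cons s fun i => v i.succ := by
  conv_lhs => rw [← Fin.cons_self_tail v]
  exact Fin.update_cons_zero _ _ _

variable [ContMDiffVectorBundle ∞ (Euc r) E 𝓘(ℝ, Euc d)]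

/-- The mixed morphism condition can be checked in coordinates. -/
theorem forall_ancCoef_eq_zero_iff {k : ℕ} (P : AnchoredBracket d r (k + 1) E) :
    (∀ (κ : BundleCoord d r E) I μ, altSum (X.ancCoef κ P μ) I = 0) ↔
      ∀ e, anc X.toLeibniz P.toLeibniz e = 0 := by
  simp only [ancVec_frame_eq_zero_iff, anc_eq_zero_iff]
  refine ⟨fun h e x => ?_, fun h κ I x _ => h _ x⟩
  obtain ⟨κ, hx⟩ := exists_bundleCoord d r E x
  obtain ⟨χ, hχ1, hχ2⟩ := exists_cutoff (d := d) κ.chart.open_source hx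
  choose g _ hg using fun i => κ.exists_smul_eq_sum hχ2 (e i)
  -- Being function-linear, `anc` on the cut-off sections is determined by its values on the frame;
  -- at `x` the power of the cutoff is `1`.
  have key := tensor_expansion (anc X.toLeibniz P.toLeibniz) (anc_perm _ _)
    (fun _ f s t v => by
      simp only [update_cons_zero']
      exact anc_linear _ _ f s t _) χ e κ.frame g hg
  refine eq_zero_of_derivAlong_eq_zero fun f => ?_
  rw [derivAlong_ancVec]
  have h2 := congrArg (derEval f x) key
  have hχx : (χ ^ (k + 2) : SmoothFn d M) x = 1 := by
    rw [ContMDiffMap.coe_pow, Pi.pow_apply, hχ1.self_of_nhds, one_pow]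
  have hl : derEval f x (χ ^ (k + 2) • anc X.toLeibniz P.toLeibniz e) =
      anc X.toLeibniz P.toLeibniz e f x := by
    rw [derEval_smul, hχx, one_mul]
  rw [← hl, h2, map_sum]
  refine Finset.sum_eq_zero fun I _ => ?_
  rw [derEval_smul, ← derivAlong_ancVec, h κ I x hx]
  exact mul_eq_zero_of_right _ (map_zero (derivAlongLin f x))

/-- If the mixed morphism condition holds, then the mixed Jacobi identity can be checked in
coordinates. -/
theorem forall_jacCoef_eq_zero_iff {k : ℕ} (P : AnchoredBracket d r (k + 1) E)
    (hanc : ∀ e, anc X.toLeibniz P.toLeibniz e = 0) :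
    (∀ (κ : BundleCoord d r E) I c, altSum (X.jacCoef P κ c) I = 0) ↔
      ∀ e, jac X.toLeibniz P.toLeibniz e = 0 := by
  simp only [coeffLin_jac_eq_zero_iff]
  refine ⟨fun h e => ContMDiffSection.ext fun x => ?_, fun h κ I x _ => by rw [h]; rfl⟩
  obtain ⟨κ, hx⟩ := exists_bundleCoord d r E x
  obtain ⟨χ, hχ1, hχ2⟩ := exists_cutoff (d := d) κ.chart.open_source hx
  choose g _ hg using fun i => κ.exists_smul_eq_sum hχ2 (e i)
  -- Here `hanc` is essential: it removes the derivative term in `jac_leibniz`, so that `jac`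
  -- becomes a tensor.
  have key := tensor_expansion (jac X.toLeibniz P.toLeibniz) (jac_perm _ _)
    (fun _ f s t v => by
      simp only [update_cons_zero']
      rw [jac_leibniz, hanc]
      simp) χ e κ.frame g hg
  have h2 := congrArg (fun s : Sec d r E => s x) key
  have hχx : (χ ^ (k + 1 + 2) : SmoothFn d M) x = 1 := by
    rw [ContMDiffMap.coe_pow, Pi.pow_apply, hχ1.self_of_nhds, one_pow]
  simp only [smul_sec_apply, hχx, one_smul, BundleCoord.sec_sum_apply, h κ _ x hx, smul_zero,
    Finset.sum_const_zero] at h2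
  exact h2

/-- The mixed Jacobi identity implies the mixed morphism condition. -/
theorem anc_eq_zero_of_jac_eq_zero {k : ℕ} (P : AnchoredBracket d r (k + 1) E)
    (h : ∀ e, jac X.toLeibniz P.toLeibniz e = 0) (e : Fin (k + 2) → Sec d r E) :
    anc X.toLeibniz P.toLeibniz e = 0 := by
  refine Derivation.ext fun f => ContMDiffMap.ext fun x => ?_
  obtain ⟨κ, hx⟩ := exists_bundleCoord d r E x
  rcases Nat.eq_zero_or_pos r with hr | hr
  -- In rank `0` there is no nonzero section against which to test, but then all arguments vanish
  -- and linearity of `anc` suffices.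
  · have hs : e 0 = 0 := ContMDiffSection.ext fun y => by
      obtain ⟨κ, hy⟩ := exists_bundleCoord d r E y
      subst hr
      rw [κ.sec_eq_sum hy]
      rfl
    have h1 := anc_linear X.toLeibniz P.toLeibniz 0 0 0 (fun i => e i.succ)
    rw [smul_zero, add_zero, zero_smul, zero_add] at h1
    have h3 : e = Fin.cons 0 fun i => e i.succ := by
      conv_lhs => rw [← Fin.cons_self_tail e, hs]
      rfl
    have h2 := anc_linear X.toLeibniz P.toLeibniz 1 0 0 (fun i => e i.succ)
    rw [smul_zero, add_zero, one_smul] at h2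
    rw [h3, left_eq_add.1 h2]
  -- With `jac = 0` the Leibniz rule leaves `anc(e)(f)` times a section; a frame section does not
  -- vanish at `x`, so its coefficient does.
  · let a : Fin r := ⟨0, hr⟩
    have h1 := jac_leibniz X.toLeibniz P.toLeibniz f (κ.frame a) 0 e
    simp only [h, smul_zero, zero_add, add_zero] at h1
    have h2 := congrArg (κ.coeffLin a x) h1
    rw [map_zero, κ.coeffLin_smul, κ.coeff_frame hx, if_pos rfl, mul_one] at h2
    have h3 : (-1 : ℝ) ^ (k + 1) * anc X.toLeibniz P.toLeibniz e f x = 0 := h2.symm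
    exact (mul_eq_zero.1 h3).resolve_left (pow_ne_zero _ (by norm_num))

end AnchoredBracket

end Global

end GappedLie

end

/-! ### The conditions on the data as vanishing of defects -/

noncomputable section

namespace GappedLie

open Filter Topology LeibnizBracket GrAlg

section Data

variable {n d r : ℕ} {M : Type*} [TopologicalSpace M] [ChartedSpace (Euc d) M]
  {E : M → Type*} [∀ x, AddCommGroup (E x)] [∀ x, Module ℝ (E x)]
  [∀ x, TopologicalSpace (E x)] [TopologicalSpace (Bundle.TotalSpace (Euc r) E)]
  [FiberBundle (Euc r) E] [VectorBundle ℝ (Euc r) E]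
  [IsManifold 𝓘(ℝ, Euc d) ∞ M]

namespace AnchoredBrackets

variable (S : AnchoredBrackets n d r E)

theorem b2_eq (v : Fin 2 → Sec d r E) : S.b2 v = S.b2 ![v 0, v 1] := by
  congr 1
  funext i
  fin_cases i <;> rfl

theorem b2_swap (e e' : Sec d r E) : S.b2 ![e, e'] = -S.b2 ![e', e] := by
  rw [← S.b2.map_swap _ (show (0 : Fin 2) ≠ 1 by decide), S.b2_eq (_ ∘ _)]
  rfl

/-- The binary bracket and its anchor. -/
def two : AnchoredBracket d r 1 E where
  ρ x := AlternatingMap.ofSubsingleton ℝ (E x) (TangentSpace 𝓘(ℝ, Euc d) x) 0 (S.rho2 x)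
  smooth e := S.rho2_smooth (e 0)
  b := S.b2
  leibniz f e e' x := by
    have h : ∀ s : Sec d r E, S.b2 (Fin.cons s e') = -S.b2 ![e' 0, s] := fun s => by
      rw [S.b2_eq, S.b2_swap]
      rfl
    have h1 := S.leibniz2 f (e' 0) e x
    rw [h, h]
    have h2 : ∀ s : Sec d r E, (-s) x = -(s x) := fun s => rfl
    rw [h2, h2, ← smul_eq_fsmul] at *
    rw [h1, smul_neg, neg_add, pow_one, neg_one_mul, neg_smul]
    rfl

theorem two_br (s t : Sec d r E) : S.two.toLeibniz.br s t = S.b2 ![s, t] := S.b2_eq _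

/-- The bracket of higher arity and its anchor. -/
def top : AnchoredBracket d r n E where
  ρ := S.rhoN
  smooth := S.rhoN_smooth
  b := S.bN
  leibniz := S.leibnizN

/-- When the second bracket is `b₂` itself, the two halves of `jac` coincide and each is the usual
Jacobiator, hence the factor `2`. -/
theorem jac_two (e : Fin 3 → Sec d r E) : jac S.two.toLeibniz S.two.toLeibniz e =
    (2 : ℝ) • (S.b2 ![S.b2 ![e 0, e 1], e 2] + S.b2 ![S.b2 ![e 1, e 2], e 0]
      + S.b2 ![S.b2 ![e 2, e 0], e 1]) := by
  have hb : ∀ v : Fin 2 → Sec d r E, S.two.toLeibniz.b v = S.b2 ![v 0, v 1] := S.b2_eq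
  have hn : ∀ u s : Sec d r E, S.b2 ![-u, s] = -S.b2 ![u, s] := fun u s => by
    rw [← two_br, ← two_br]
    exact b_cons_neg _ _ _
  unfold jac
  simp only [two_br, hb]
  simp only [Fin.sum_univ_succ, Fin.sum_univ_zero]
  simp [Fin.succAbove]
  rw [S.b2_swap (e 1) (e 0), S.b2_swap (e 2) (e 1), S.b2_swap (e 0) (e 2), hn, hn, hn]
  module

theorem jacobi_iff : S.Jacobi ↔ ∀ e, jac S.two.toLeibniz S.two.toLeibniz e = 0 := by
  simp only [jac_two]
  refine ⟨fun h e => by rw [h, smul_zero], fun h e₁ e₂ e₃ => ?_⟩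
  have := h ![e₁, e₂, e₃]
  rw [smul_eq_zero_iff_right (two_ne_zero)] at this
  exact this

/-- For two arguments both orderings of the bracket of anchors agree up to the sign in the sum, and
the two terms with `b₂` add up; everything is counted twice. -/
theorem ancVec_two (e : Fin 2 → Sec d r E) (x : M) : S.two.ancVec S.two e x =
    (2 : ℝ) • (VectorField.mlieBracket 𝓘(ℝ, Euc d) (fun y => S.rho2 y (e 0 y))
      (fun y => S.rho2 y (e 1 y)) x - S.rho2 x (S.b2 ![e 0, e 1] x)) := by
  have hρ : ∀ (y : M) (v : Fin 1 → E y), S.two.ρ y v = S.rho2 y (v 0) := fun y v => rfl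
  have hb : S.two.b e = S.b2 ![e 0, e 1] := S.b2_eq e
  have h1 := VectorField.mlieBracket_swap_apply (I := 𝓘(ℝ, Euc d)) (x := x)
    (V := fun y => S.rho2 y (e 1 y)) (W := fun y => S.rho2 y (e 0 y))
  have hneg : S.rho2 x (S.b2 ![e 1, e 0] x) = -S.rho2 x (S.b2 ![e 0, e 1] x) := by
    rw [S.b2_swap (e 1)]
    exact map_neg (S.rho2 x) (S.b2 ![e 0, e 1] x)
  unfold AnchoredBracket.ancVec
  simp only [hρ, two_br, hb, Fin.cons_zero]
  simp only [Fin.sum_univ_succ, Fin.sum_univ_zero]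
  simp [Fin.succAbove]
  rw [h1, hneg]
  module

theorem anchorHom_iff [T2Space M] :
    S.AnchorHom ↔ ∀ e, anc S.two.toLeibniz S.two.toLeibniz (k := 0) e = 0 := by
  simp only [AnchoredBracket.anc_eq_zero_iff]
  constructor
  · intro h e x
    refine (S.ancVec_two e x).trans ?_
    rw [← h, sub_self, smul_zero]
  · intro h e e' x
    have := (S.ancVec_two ![e, e'] x).symm.trans (h _ x)
    rw [smul_eq_zero_iff_right (two_ne_zero), sub_eq_zero] at this
    exact this.symm

/-- In the statement the single argument of `b₂` stands last, in `jac` it stands first. Moving it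
across `n + 1` arguments gives an overall sign `(-1)^{n+1}`, which does not affect vanishing. -/
theorem mixedJacobi_iff : S.MixedJacobi ↔ ∀ e, jac S.two.toLeibniz S.top.toLeibniz e = 0 := by
  have key : ∀ e : Fin (n + 2) → Sec d r E,
      ∑ σ : Equiv.Perm (Fin (n + 2)), ((Equiv.Perm.sign σ : ℤ) : ℝ) •
      ((1 / ((n + 1).factorial : ℝ)) •
          S.b2 ![S.bN (fun i => e (σ i.castSucc)), e (σ (Fin.last (n + 1)))]
        + ((-1 : ℝ) ^ (n + 1) / (2 * (n.factorial : ℝ))) •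
          S.bN (Fin.cons (S.b2 ![e (σ 0), e (σ 1)]) (fun i => e (σ i.succ.succ)))) =
      (-1 : ℝ) ^ (n + 1) • jac S.two.toLeibniz S.top.toLeibniz e := by
    intro e
    rw [jac_eq_altSum, altSum_add, smul_add, ← altSum_last (fun s v =>
      (1 / ((n + 1).factorial : ℝ)) • S.two.toLeibniz.br (S.top.toLeibniz.b v) s),
      ← altSum_smul, ← altSum_add]
    unfold altSum
    refine Finset.sum_congr rfl fun σ _ => ?_
    simp only [two_br, smul_smul, Function.comp]
    congr 3
    ring
  unfold MixedJacobi
  simp only [key]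
  refine forall_congr' fun e => ?_
  rw [smul_eq_zero_iff_right (pow_ne_zero _ (by norm_num))]

theorem mixedMorphism_iff [T2Space M] {k : ℕ} (S : AnchoredBrackets (k + 1) d r E) :
    S.MixedMorphism ↔ ∀ e, anc S.two.toLeibniz S.top.toLeibniz e = 0 := by
  simp only [AnchoredBracket.anc_eq_zero_iff]
  refine forall_congr' fun e => forall_congr' fun x => ?_
  -- `ancVec` is `(-1)^{k+1}` times the difference of the two sides, so the equation is brought to
  -- this normalisation first.
  rw [← sub_eq_zero, ← smul_eq_zero_iff_right (pow_ne_zero (k + 1) (show (-1 : ℝ) ≠ 0 by norm_num))]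
  have h1 := altSum_succ_succ (fun (s t : Sec d r E) (v : Fin k → Sec d r E) =>
    S.top.ρ x fun l => (Fin.cons (S.b2 ![s, t]) v : Fin (k + 1) → Sec d r E) l x)
    (fun s t v τ => by
      rw [cons_comp_perm, ← rsign_decomposeFin_zero τ]
      exact map_perm_rsign (S.top.ρ x) (fun l => (Fin.cons (S.b2 ![s, t]) v :
        Fin (k + 1) → Sec d r E) l x) _) e
  have h2 : ∑ σ : Equiv.Perm (Fin (k + 1 + 1)), ((Equiv.Perm.sign σ : ℤ) : ℝ) •
            S.rhoN x (fun i : Fin (k + 1) =>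
              if (i : ℕ) = 0 then S.b2 ![e (σ 0), e (σ 1)] x else e (σ i.succ) x) =
      altSum (fun w => S.top.ρ x fun l => (Fin.cons (S.b2 ![w 0, w 1]) fun i => w i.succ.succ :
        Fin (k + 1) → Sec d r E) l x) e := by
    refine Finset.sum_congr rfl fun σ _ => ?_
    congr 2
    funext i
    refine Fin.cases ?_ (fun i => ?_) i
    · simp
    · simp
  rw [h2, h1]
  have h3 : ∀ i : Fin (k + 2), (-1 : ℝ) ^ (k + 1 - (i : ℕ)) • VectorField.mlieBracket 𝓘(ℝ, Euc d)
      (fun y => S.rhoN y (fun k => e (i.succAbove k) y)) (fun y => S.rho2 y (e i y)) x =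
      (-1 : ℝ) ^ k • (-1 : ℝ) ^ (i : ℕ) • VectorField.mlieBracket 𝓘(ℝ, Euc d)
        (fun y => S.two.ρ y fun _ => e i y) (fun y => S.top.ρ y fun j => e (i.succAbove j) y) x := by
    intro i
    -- The subtraction is not truncated, since `i ≤ k + 1`. The extra minus sign is used up by
    -- reversing the Lie bracket.
    have hs : (-1 : ℝ) ^ (k + 1 - (i : ℕ)) = -((-1 : ℝ) ^ k * (-1 : ℝ) ^ (i : ℕ)) := by
      obtain ⟨q, hq⟩ := Nat.exists_eq_add_of_le (Nat.le_of_lt_succ i.2)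
      have h4 : (-1 : ℝ) ^ k = -(-1 : ℝ) ^ (k + 1) := by ring
      have h5 := neg_one_pow_mul_self_eq_one (i : ℕ)
      rw [h4, hq, Nat.add_sub_cancel_left, pow_add]
      linear_combination (-(-1 : ℝ) ^ q) * h5
    rw [VectorField.mlieBracket_swap_apply, hs, smul_neg, neg_smul, neg_neg, mul_smul]
    rfl
  rw [Finset.sum_congr rfl fun i _ => h3 i, ← Finset.smul_sum]
  refine iff_of_eq (congrArg (· = 0) ?_)
  unfold AnchoredBracket.ancVec
  simp only [two_br, Nat.add_sub_cancel]
  have hf : (k.factorial : ℝ) ≠ 0 := Nat.cast_ne_zero.2 (Nat.factorial_ne_zero _)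
  have h4 : ((-1 : ℝ) ^ (k + 1 + 1) / (2 * (k.factorial : ℝ))) * (k.factorial : ℝ) =
      (-1 : ℝ) ^ k * (1 / 2) := by
    field_simp
    ring
  have h5 := neg_one_pow_mul_self_eq_one k
  have e1 : (-1 : ℝ) ^ (k + 1) * ((-1 : ℝ) ^ k * (1 / 2)) = -(1 / 2) := by
    rw [pow_succ]
    linear_combination (-1 / 2 : ℝ) * h5
  have e2 : (-1 : ℝ) ^ (k + 1) * (-1 : ℝ) ^ k = -1 := by
    rw [pow_succ]
    linear_combination (-1 : ℝ) * h5
  rw [smul_smul, h4, smul_sub, smul_add, smul_smul, smul_smul, e1, e2]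
  have h6 : S.rho2 x (S.bN e x) = S.two.ρ x fun _ => S.top.b e x := rfl
  rw [h6]
  module

/-- The local expression in terms of the components of anchors and brackets. -/
theorem Q_eq (hn : 1 ≤ n) (κ : BundleCoord d r E) :
    S.Q κ = vectorField (pderiv κ.domain) (liftComp (pderiv κ.domain) ((-1) ^ (n - 1))
      (anchorComp (S.two.anchorCoef κ)) (anchorComp (S.top.anchorCoef κ))
      (bracketComp (S.two.structCoef κ)) (bracketComp (S.top.structCoef κ))) := by
  rw [← qHat_eq_liftComp _ _ _ _ _ hn]
  · unfold Q
    congr 2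
    funext a b c
    unfold AnchoredBracket.structCoef
    congr 1
    exact (S.b2_eq fun i => κ.frame (![a, b] i)).symm
  · intro a b c
    have h := S.two.structCoef_perm (κ := κ) ![b, a] c (Equiv.swap 0 1)
    rw [rsign, Equiv.Perm.sign_swap (by decide)] at h
    have h2 : (![b, a] ∘ Equiv.swap (0 : Fin 2) 1) = ![a, b] := by
      funext i
      fin_cases i <;> rfl
    rw [h2] at h
    rw [h]
    simp

theorem isDegreeOneVectorField_Q (hn : 1 ≤ n) (κ : BundleCoord d r E) :
    IsDegreeOneVectorField (S.Q κ) := by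
  rw [S.Q_eq hn]
  exact isDegreeOneVectorField_vectorField
    (isComp_liftComp hn (isBase_anchorComp _ _) (isBase_anchorComp _ _))

/-- The condition `X² = 0` is handled by the commutator formulas with `P = X`, so the Lie algebroid
axioms and the mixed conditions are read off from the same two computations. -/
theorem Q_sq_eq_zero_iff {k : ℕ} (S : AnchoredBrackets (k + 1) d r E) (κ : BundleCoord d r E) :
    (∀ u, S.Q κ (S.Q κ u) = 0) ↔
      ((∀ I μ, altSum (S.two.ancCoef κ S.two (k := 0) μ) I = 0) ∧
        ∀ I c, altSum (S.two.jacCoef S.two κ c) I = 0) ∧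
      (∀ I μ, altSum (S.two.ancCoef κ S.top μ) I = 0) ∧
        ∀ I c, altSum (S.two.jacCoef S.top κ c) I = 0 := by
  rw [S.Q_eq (by omega)]
  refine (liftComp_sq_eq_zero_iff (n := k + 1) (D := pderiv κ.domain)
    (Xx := anchorComp (S.two.anchorCoef κ)) (Px := anchorComp (S.top.anchorCoef κ))
    (Xa := bracketComp (S.two.structCoef κ)) (Pa := bracketComp (S.top.structCoef κ))
    (pderiv_comm κ.domain) (by omega) ⟨coordFn κ.domain, pderiv_coordFn κ.domain⟩
    (neg_one_pow_mul_self_eq_one _)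
    (isBase_anchorComp _ _) (isBase_anchorComp _ _)).trans ?_
  -- For degree `1` the graded commutator of `X` with itself is `2 X²`; this puts `X²` into the
  -- shape of the commutator formulas.
  have hdouble : ∀ u : κ.Fun (k + 1), u = 0 ↔ u - (-1 : ℝ) ^ 1 • u = 0 := fun u => by
    rw [pow_one, neg_smul_grAlg, one_smul, sub_neg_eq_add]
    exact ⟨fun h => by rw [h, add_zero], eq_zero_of_add_self⟩
  have ha : ∀ μ, vectorField (pderiv κ.domain) (baseComp (anchorComp (S.two.anchorCoef κ))
      (bracketComp (S.two.structCoef κ))) (anchorComp (S.two.anchorCoef κ) μ : κ.Fun (k + 1)) = 0 ↔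
      ∀ I, altSum (S.two.ancCoef κ S.two (k := 0) μ) I = 0 := fun μ => by
    rw [hdouble, ← poly_eq_zero_iff (n := k + 1)]
    exact iff_of_eq (congrArg (· = 0) (commutator_anchorComp (k := 0) μ fun I σ =>
      S.two.anchorCoef_perm I μ σ))
  have hb : ∀ c, vectorField (pderiv κ.domain) (baseComp (anchorComp (S.two.anchorCoef κ))
      (bracketComp (S.two.structCoef κ))) (bracketComp (S.two.structCoef κ) c : κ.Fun (k + 1)) = 0 ↔
      ∀ I, altSum (S.two.jacCoef S.two κ c) I = 0 := fun c => by
    rw [hdouble, ← poly_eq_zero_iff (n := k + 1)]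
    exact iff_of_eq (congrArg (· = 0) (commutator_bracketComp (m := 1) c
      (fun I σ => S.two.structCoef_perm I c σ) fun I σ => S.two.structCoef_perm I c σ))
  have hc : ∀ μ, _ ↔ ∀ I, altSum (S.two.ancCoef κ S.top μ) I = 0 := fun μ =>
    (iff_of_eq (congrArg (· = 0) (commutator_anchorComp (n := k + 1) (D := pderiv κ.domain)
      (ρ := S.two.anchorCoef κ) (C := S.two.structCoef κ) (Cn := S.top.structCoef κ)
      (k := k) μ fun I σ => S.top.anchorCoef_perm (κ := κ) I μ σ))).trans (poly_eq_zero_iff _)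
  have hd : ∀ c, _ ↔ ∀ I, altSum (S.two.jacCoef S.top κ c) I = 0 := fun c =>
    (iff_of_eq (congrArg (· = 0) (commutator_bracketComp (n := k + 1) (D := pderiv κ.domain)
      (ρ := S.two.anchorCoef κ) (ρn := S.top.anchorCoef κ) c
      (fun I σ => S.two.structCoef_perm (κ := κ) I c σ)
      fun I σ => S.top.structCoef_perm (κ := κ) I c σ))).trans (poly_eq_zero_iff _)
  simp only [ha, hb, hc, hd]
  exact and_congr (and_congr forall_comm forall_comm) (and_congr forall_comm forall_comm)

/-- The vector field squares to zero if and only if all four defects vanish. -/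
theorem forall_Q_sq_eq_zero_iff [T2Space M] [ContMDiffVectorBundle ∞ (Euc r) E 𝓘(ℝ, Euc d)]
    (hn : 1 ≤ n) (S : AnchoredBrackets n d r E) :
    (∀ (κ : BundleCoord d r E) (u : κ.Fun n), S.Q κ (S.Q κ u) = 0) ↔
      S.IsGroundLieAlgebroid ∧ S.MixedMorphism ∧ S.MixedJacobi := by
  obtain ⟨k, rfl⟩ := Nat.exists_eq_add_of_le' hn
  simp only [Q_sq_eq_zero_iff]
  rw [IsGroundLieAlgebroid, jacobi_iff, anchorHom_iff, mixedMorphism_iff, mixedJacobi_iff]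
  constructor
  · intro h
    -- The order matters: the Jacobi defects can be tested on frames only after the morphism defects
    -- are known to vanish for all sections.
    have h1 := (S.two.forall_ancCoef_eq_zero_iff S.two (k := 0)).1 fun κ => (h κ).1.1
    have h2 := (S.two.forall_ancCoef_eq_zero_iff S.top).1 fun κ => (h κ).2.1
    exact ⟨⟨(S.two.forall_jacCoef_eq_zero_iff S.two (k := 0) h1).1 fun κ => (h κ).1.2, h1⟩, h2,
      (S.two.forall_jacCoef_eq_zero_iff S.top h2).1 fun κ => (h κ).2.2⟩
  · rintro ⟨⟨h1, h2⟩, h3, h4⟩ κ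
    exact ⟨⟨(S.two.forall_ancCoef_eq_zero_iff S.two (k := 0)).2 h2 κ,
      (S.two.forall_jacCoef_eq_zero_iff S.two (k := 0) h2).2 h1 κ⟩,
      (S.two.forall_ancCoef_eq_zero_iff S.top).2 h3 κ,
      (S.two.forall_jacCoef_eq_zero_iff S.top h3).2 h4 κ⟩

/-- The content is that each Jacobi identity implies the corresponding morphism condition, by
`anc_eq_zero_of_jac_eq_zero`. -/
theorem isGappedLieAlgebroid_iff [T2Space M] [ContMDiffVectorBundle ∞ (Euc r) E 𝓘(ℝ, Euc d)]
    (hn : 1 ≤ n) (S : AnchoredBrackets n d r E) :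
    S.IsGappedLieAlgebroid ↔ S.IsGroundLieAlgebroid ∧ S.MixedMorphism ∧ S.MixedJacobi := by
  obtain ⟨k, rfl⟩ := Nat.exists_eq_add_of_le' hn
  rw [IsGappedLieAlgebroid, IsGroundLieAlgebroid, jacobi_iff, anchorHom_iff, mixedMorphism_iff,
    mixedJacobi_iff]
  constructor
  · rintro ⟨h1, h2⟩
    exact ⟨⟨h1, S.two.anc_eq_zero_of_jac_eq_zero S.two (k := 0) h1⟩,
      S.two.anc_eq_zero_of_jac_eq_zero S.top h2, h2⟩
  · rintro ⟨⟨h1, -⟩, -, h2⟩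
    exact ⟨h1, h2⟩

end AnchoredBrackets

end Data

end GappedLie

end

/-! ### Changes of coordinates of polynomial vector fields -/

noncomputable section

namespace GappedLie

open Filter Topology LeibnizBracket

namespace GrAlg

section CoordChange

variable {n d r : ℕ} {A : Type*} [CommRing A] [Algebra ℝ A] {D : Fin d → Derivation ℝ A A}
  {A' : Type*} [CommRing A'] [Algebra ℝ A'] {D' : Fin d → Derivation ℝ A' A'}
  {s : ℝ} {tr : A' →+* A} {x' : Fin d → A} {g : Fin r → Fin r → A}
  {T : GrAlg n d r A' →ₐ[ℝ] GrAlg n d r A}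

/-- Only the alternating part of the coefficients matters in a polynomial in odd variables, so a
signed sum over `m + 1` slots may be replaced by `m + 1` times a single slot. -/
theorem poly_sum_succAbove {m : ℕ} (F : Fin r → (Fin m → Fin r) → A)
    (hF : ∀ a J (σ : Equiv.Perm (Fin m)), F a (J ∘ σ) = rsign σ • F a J) :
    (poly (fun I : Fin (m + 1) → Fin r => ∑ i : Fin (m + 1), (-1 : ℝ) ^ (i : ℕ) •
      F (I i) fun k => I (i.succAbove k)) : GrAlg n d r A) =
      ((m + 1 : ℕ) : ℝ) • poly fun I : Fin (m + 1) → Fin r => F (I 0) fun k => I k.succ := by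
  have h1 : (poly (altSum fun I : Fin (m + 1) → Fin r => F (I 0) fun k => I k.succ) :
      GrAlg n d r A) = ((m + 1).factorial : ℝ) • poly fun I : Fin (m + 1) → Fin r =>
        F (I 0) fun k => I k.succ :=
    sum_fn_altSum_mul_word a_mem_homogeneous _
  have h2 : (altSum fun I : Fin (m + 1) → Fin r => F (I 0) fun k => I k.succ) = fun I =>
      (m.factorial : ℝ) • ∑ i : Fin (m + 1), (-1 : ℝ) ^ (i : ℕ) •
        F (I i) fun k => I (i.succAbove k) := funext fun I => altSum_succ F hF I
  rw [h2, poly_smul, Nat.factorial_succ, mul_comm, Nat.cast_mul, mul_smul] at h1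
  exact smul_right_injective _ (Nat.cast_ne_zero.2 (Nat.factorial_ne_zero m)) h1

theorem word_eq_sum {g : Fin r → Fin r → A} {v w : Fin r → GrAlg n d r A}
    (hv : ∀ b, v b = ∑ a, fn (g b a) * w a) {m : ℕ} (J : Fin m → Fin r) :
    word v J = ∑ I : Fin m → Fin r, fn (∏ i, g (J i) (I i)) * word w I := by
  induction m with
  | zero =>
    rw [word_zero, Fintype.sum_unique, word_zero, mul_one, Fin.prod_univ_zero, fn_one]
  | succ m ih =>
    rw [word_succ, hv, ih, Finset.sum_mul, sum_fin_cons]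
    refine Finset.sum_congr rfl fun a _ => ?_
    rw [Finset.mul_sum]
    refine Finset.sum_congr rfl fun K _ => ?_
    rw [word_cons, Fin.prod_univ_succ, mul_assoc, ← mul_assoc (w a), ← fn_comm, fn_mul]
    simp only [mul_assoc, Fin.cons_zero, Fin.cons_succ]

theorem word_eq_poly {g : Fin r → Fin r → A} {v : Fin r → GrAlg n d r A}
    (hv : ∀ b, v b = ∑ a, fn (g b a) * gen (.a a)) {m : ℕ} (J : Fin m → Fin r) :
    word v J = poly fun I => ∏ i, g (J i) (I i) :=
  word_eq_sum hv J

theorem isCoordChange_mono (hT : IsCoordChange s D tr x' g T) {m : ℕ} (J : Fin m → Fin r) :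
    T (mono J) = poly fun I => ∏ i, g (J i) (I i) := by
  rw [← word_eq_poly hT.a, mono_eq_word, word, word, map_list_prod, List.map_ofFn]
  rfl

theorem isCoordChange_poly (hT : IsCoordChange s D tr x' g T) {m : ℕ} (F : (Fin m → Fin r) → A') :
    T (poly F) = poly fun I => ∑ J, (∏ i, g (J i) (I i)) * tr (F J) := by
  rw [poly, map_sum, poly_sum]
  refine Finset.sum_congr rfl fun J _ => ?_
  rw [map_mul, hT.fn, isCoordChange_mono hT, poly, poly, Finset.mul_sum]
  refine Finset.sum_congr rfl fun I _ => ?_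
  rw [← mul_assoc, ← fn_mul, mul_comm]

/-- Vector fields given by anchors and structure functions are related by a change of coordinates
if the anchors and structure functions transform as they should. -/
theorem isCoordChange_anchorComp_bracketComp (hT : IsCoordChange s D tr x' g T) (hn : 1 ≤ n) {m : ℕ}
    {ρ : (Fin m → Fin r) → Fin d → A} {C : (Fin (m + 1) → Fin r) → Fin r → A}
    {ρ' : (Fin m → Fin r) → Fin d → A'} {C' : (Fin (m + 1) → Fin r) → Fin r → A'}
    (hρ : ∀ I μ (σ : Equiv.Perm (Fin m)), ρ (I ∘ σ) μ = rsign σ • ρ I μ)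
    (hanchor : ∀ I f, act D ρ I (tr f) = ∑ J, (∏ i, g (J i) (I i)) * tr (act D' ρ' J f))
    (hbracket : ∀ (I : Fin (m + 1) → Fin r) b, ∑ a, g b a * C I a
      - (-1 : ℝ) ^ m • ∑ i : Fin (m + 1), (-1 : ℝ) ^ (i : ℕ) •
        act D ρ (fun k => I (i.succAbove k)) (g b (I i)) =
      ∑ J, (∏ i, g (J i) (I i)) * tr (C' J b)) :
    ∀ u ∈ base n d r A', vectorField D (baseComp (anchorComp ρ) (bracketComp C)) (T u) =
      T (vectorField D' (baseComp (anchorComp ρ') (bracketComp C')) u) := by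
  intro u hu
  refine isCoordChange_related hT hn (isBase_anchorComp ρ C).isComp
    (isBase_anchorComp ρ' C').isComp ?_ ?_ hu
  · intro f
    rw [vectorField_anchorComp_fn, vectorField_anchorComp_fn, map_smul, isCoordChange_poly hT]
    simp only [hanchor]
  · rintro _ ⟨b, rfl⟩
    have h1 : T (gen (.a b)) = poly fun I : Fin 1 → Fin r => g b (I 0) := by
      rw [hT.a, poly, sum_fin_one]
      simp only [mono_one]
    rw [h1, vectorField_anchorComp_poly_one, vectorField_gen]
    have h2 : ∑ a, poly (fun J => act D ρ J (g b a)) * gen (.a a) =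
        ((-1 : ℝ) ^ m • poly fun I : Fin (m + 1) → Fin r =>
          act D ρ (fun k => I k.succ) (g b (I 0)) : GrAlg n d r A) := by
      rw [poly_succ (fun a J => act D ρ J (g b a)), Finset.smul_sum]
      refine Finset.sum_congr rfl fun a _ => ?_
      rw [poly_mul_of_mem _ (a_mem_homogeneous a), mul_one]
    have h3 : ∑ a, fn (g b a) * bracketComp C a =
        ((-(1 / ((m + 1).factorial : ℝ))) • poly fun I => ∑ a, g b a * C I a :
          GrAlg n d r A) := by
      rw [poly_sum, Finset.smul_sum]
      refine Finset.sum_congr rfl fun a _ => ?_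
      rw [bracketComp, mul_smul_comm, poly, poly, Finset.mul_sum]
      simp only [fn_mul, mul_assoc]
    have h4 : T (bracketComp C' b) = (-(1 / ((m + 1).factorial : ℝ))) •
        (poly fun I => ∑ a, g b a * C I a) + (1 / (m.factorial : ℝ)) • (-1 : ℝ) ^ m •
        poly fun I : Fin (m + 1) → Fin r => act D ρ (fun k => I k.succ) (g b (I 0)) := by
      rw [bracketComp, map_smul, isCoordChange_poly hT]
      simp only [← hbracket]
      -- The transformation law of structure functions sums over all slots of the derivative of `g`,
      -- whereas the vector field differentiates one factor; the resulting `m + 1` turns `1/(m+1)!`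
      -- into `1/m!`.
      have h5 := poly_sum_succAbove (n := n) (d := d) (fun a J => act D ρ J (g b a)) (fun a J σ => by
        simp only [act, hρ, smul_mul_assoc, Finset.smul_sum])
      have h6 : (poly fun I => ∑ a, g b a * C I a
          - (-1 : ℝ) ^ m • ∑ i : Fin (m + 1), (-1 : ℝ) ^ (i : ℕ) •
          act D ρ (fun k => I (i.succAbove k)) (g b (I i)) : GrAlg n d r A) =
          (poly fun I => ∑ a, g b a * C I a) + (-(-1 : ℝ) ^ m) •
          poly fun I => ∑ i : Fin (m + 1), (-1 : ℝ) ^ (i : ℕ) •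
            act D ρ (fun k => I (i.succAbove k)) (g b (I i)) := by
        rw [← poly_smul, ← poly_add]
        congr 1
        funext I
        rw [neg_smul, sub_eq_add_neg]
      rw [h6, h5, smul_add, smul_smul, smul_smul, smul_smul]
      congr 2
      rw [Nat.factorial_succ]
      push_cast
      have : (m.factorial : ℝ) ≠ 0 := Nat.cast_ne_zero.2 (Nat.factorial_ne_zero _)
      have : (m : ℝ) + 1 ≠ 0 := by positivity
      field_simp
    rw [h2, h3]
    simp only [baseComp]
    rw [h4, add_comm]

end CoordChange

end GrAlg

end GappedLie

end

/-! ### The chain rule and the transformation laws of anchors and structure functions -/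

noncomputable section

namespace GappedLie

open Filter Topology LeibnizBracket GrAlg

section Transfer

variable {d : ℕ} {M : Type*} [TopologicalSpace M] [ChartedSpace (Euc d) M]
  [IsManifold 𝓘(ℝ, Euc d) ∞ M]
  {φ φ' : OpenPartialHomeomorph M (Euc d)}
  (hφ : φ ∈ IsManifold.maximalAtlas 𝓘(ℝ, Euc d) ∞ M)
  (hφ' : φ' ∈ IsManifold.maximalAtlas 𝓘(ℝ, Euc d) ∞ M) (h : φ.source ⊆ φ'.source)

theorem evalAt_transfer (f : smoothFun (chartTarget φ')) {x : M} (hx : x ∈ φ.source) :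
    evalAt (coordPt hx) (transfer hφ hφ' h f) = evalAt (coordPt (h hx)) f := by
  refine (evalAt_inCoord hφ ((contMDiffOn_extend hφ' f).mono h) hx).trans ?_
  exact Subtype.val_injective.extend_apply f.1 0 (coordPt (h hx))

/-- The change of coordinates of functions as a homomorphism of rings. -/
def transferHom : smoothFun (chartTarget φ') →+* smoothFun (chartTarget φ) where
  toFun := transfer hφ hφ' h
  map_one' := evalAt_ext fun _ hx => by rw [evalAt_transfer, map_one, map_one]
  map_mul' f g := evalAt_ext fun x hx => by simp only [evalAt_transfer, map_mul]
  map_zero' := evalAt_ext fun x hx => by rw [evalAt_transfer, map_zero, map_zero]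
  map_add' f g := evalAt_ext fun x hx => by simp only [evalAt_transfer, map_add]

theorem transferHom_algebraMap (c : ℝ) :
    transferHom hφ hφ' h (algebraMap ℝ _ c) = algebraMap ℝ _ c :=
  evalAt_ext fun _ hx => (evalAt_transfer hφ hφ' h _ hx).trans (by simp only [AlgHom.commutes])

theorem transferHom_coordFn (μ : Fin d) :
    transferHom hφ hφ' h (coordFn _ μ) = coordChange hφ hφ' h μ :=
  evalAt_ext fun _ hx => (evalAt_transfer hφ hφ' h _ hx).trans
    (evalAt_inCoord hφ ((contMDiffOn_coord hφ' μ).mono h) hx).symm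

/-- The coordinate vectors of a chart at a point of its domain. -/
def coordVec (φ : OpenPartialHomeomorph M (Euc d)) (x : M) (ν : Fin d) :
    TangentSpace 𝓘(ℝ, Euc d) x :=
  (mfderiv 𝓘(ℝ, Euc d) 𝓘(ℝ, Euc d) φ.symm (φ x) (EuclideanSpace.single ν (1 : ℝ) : Euc d) : Euc d)

theorem dx_coordVec (hφ : φ ∈ IsManifold.maximalAtlas 𝓘(ℝ, Euc d) ∞ M) {x : M} (hx : x ∈ φ.source) (μ ν : Fin d) :
    dx φ x μ (coordVec φ x ν) = if ν = μ then 1 else 0 := by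
  have h1 := mfderiv_comp_apply (I := 𝓘(ℝ, Euc d)) (I' := 𝓘(ℝ, Euc d)) (I'' := 𝓘(ℝ, Euc d)) (φ x)
    (g := φ) (f := φ.symm)
    (by rw [φ.left_inv hx]; exact mdifferentiableAt_chart hφ hx)
    (mdifferentiableAt_chart_symm hφ (φ.map_source hx))
    (EuclideanSpace.single ν (1 : ℝ) : Euc d)
  have h2 : φ ∘ φ.symm =ᶠ[𝓝 (φ x)] id := by
    filter_upwards [φ.open_target.mem_nhds (φ.map_source hx)] with y hy
    exact φ.right_inv hy
  have h3 := h2.mfderiv_eq (I := 𝓘(ℝ, Euc d)) (I' := 𝓘(ℝ, Euc d))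
  rw [mfderiv_id] at h3
  have h4 := congrArg (fun L : Euc d →L[ℝ] Euc d => L (EuclideanSpace.single ν (1 : ℝ))) h3
  -- The points `φ.symm (φ x)` and `x` are equal but not syntactically; the derivative is
  -- transported between their tangent spaces, both being the model space.
  have h5 : ∀ z, z = x → ∀ w : Euc d, (mfderiv 𝓘(ℝ, Euc d) 𝓘(ℝ, Euc d) φ z w : Euc d) =
      mfderiv 𝓘(ℝ, Euc d) 𝓘(ℝ, Euc d) φ x w := by
    rintro z rfl w
    rfl
  have h6 : (mfderiv 𝓘(ℝ, Euc d) 𝓘(ℝ, Euc d) φ x (coordVec φ x ν) : Euc d) =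
      EuclideanSpace.single ν (1 : ℝ) :=
    (h5 _ (φ.left_inv hx) _).symm.trans (h1.symm.trans h4)
  have h7 := congrArg (fun w : Euc d => w μ) h6
  refine Eq.trans h7 ?_
  by_cases hν : ν = μ
  · subst hν; simp
  · simp [hν, Ne.symm hν]

theorem evalAt_pderiv_inCoord {f : M → ℝ} (hf : ContMDiffOn 𝓘(ℝ, Euc d) 𝓘(ℝ, ℝ) ∞ f φ.source)
    {x : M} (hx : x ∈ φ.source) (ν : Fin d) :
    evalAt (coordPt hx) (pderiv (chartTarget φ) ν (inCoord hφ f hf)) =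
      dirDeriv f (coordVec φ x ν) := by
  rw [dirDeriv, mfderiv_eq_sum hφ hf hx]
  simp only [dx_coordVec hφ hx, ite_mul, one_mul, zero_mul, Finset.sum_ite_eq, Finset.mem_univ,
    if_true]
  rfl

theorem dirDeriv_extend (hφ : φ ∈ IsManifold.maximalAtlas 𝓘(ℝ, Euc d) ∞ M)
    (f : smoothFun (chartTarget φ)) {x : M} (hx : x ∈ φ.source)
    (v : TangentSpace 𝓘(ℝ, Euc d) x) :
    dirDeriv (fun x => Function.extend Subtype.val f.1 0 (φ x)) v =
      ∑ μ, dx φ x μ v * evalAt (coordPt hx) (pderiv (chartTarget φ) μ f) := by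
  rw [dirDeriv, mfderiv_eq_sum hφ (contMDiffOn_extend hφ f) hx]
  have : inCoord hφ _ (contMDiffOn_extend hφ f) = f := evalAt_ext fun x hx =>
    (evalAt_inCoord hφ _ hx).trans (Subtype.val_injective.extend_apply f.1 0 (coordPt hx))
  rw [this]
  rfl

theorem evalAt_pderiv_coordChange {x : M} (hx : x ∈ φ.source) (μ ν : Fin d) :
    evalAt (coordPt hx) (pderiv (chartTarget φ) ν (coordChange hφ hφ' h μ)) =
      dx φ' x μ (coordVec φ x ν) := by
  refine (evalAt_pderiv_inCoord hφ ((contMDiffOn_coord hφ' μ).mono h) hx ν).trans ?_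
  exact mfderiv_coord hφ' (h hx) μ _

/-- The chain rule. -/
theorem pderiv_transfer (ν : Fin d) (f : smoothFun (chartTarget φ')) :
    pderiv (chartTarget φ) ν (transferHom hφ hφ' h f) =
      ∑ μ, pderiv (chartTarget φ) ν (coordChange hφ hφ' h μ) *
        transferHom hφ hφ' h (pderiv (chartTarget φ') μ f) := by
  refine evalAt_ext fun x hx => ?_
  refine (evalAt_pderiv_inCoord hφ ((contMDiffOn_extend hφ' f).mono h) hx ν).trans ?_
  rw [dirDeriv_extend hφ' f (h hx), map_sum]
  refine Finset.sum_congr rfl fun μ _ => ?_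
  rw [map_mul, evalAt_pderiv_coordChange]
  congr 1
  exact (evalAt_transfer hφ hφ' h _ hx).symm

/-- Evaluation of smooth functions on a manifold at a point. -/
def evalFn (d : ℕ) {M : Type*} [TopologicalSpace M] [ChartedSpace (Euc d) M] (x : M) :
    SmoothFn d M →+* ℝ where
  toFun f := f x
  map_one' := rfl
  map_mul' _ _ := rfl
  map_zero' := rfl
  map_add' _ _ := rfl

end Transfer

section CoordChange

variable {n d r m : ℕ} {M : Type*} [TopologicalSpace M] [ChartedSpace (Euc d) M]
  {E : M → Type*} [∀ x, AddCommGroup (E x)] [∀ x, Module ℝ (E x)]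
  [∀ x, TopologicalSpace (E x)] [TopologicalSpace (Bundle.TotalSpace (Euc r) E)]
  [FiberBundle (Euc r) E] [VectorBundle ℝ (Euc r) E]
  [IsManifold 𝓘(ℝ, Euc d) ∞ M] {κ κ' : BundleCoord d r E}
  (h : κ.chart.source ⊆ κ'.chart.source)

theorem evalAt_frameChange (b a : Fin r) {x : M} (hx : x ∈ κ.chart.source) :
    evalAt (coordPt hx) (κ.frameChange κ' h b a) = κ'.coeffLin b x (κ.frame a) :=
  evalAt_inCoord κ.chart_mem
    ((contMDiffOn_coeff κ'.chart.open_source κ'.isFrame (κ.frame a) b).mono h) hx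

theorem map_sum_smul_univ {V W ι : Type*} [AddCommGroup V] [Module ℝ V] [AddCommGroup W]
    [Module ℝ W] [Fintype ι] (T : V [⋀^Fin m]→ₗ[ℝ] W) (c : Fin m → ι → ℝ) (s : ι → V) :
    T (fun i => ∑ a, c i a • s a) = ∑ J : Fin m → ι, (∏ i, c i (J i)) • T fun i => s (J i) := by
  classical
  have h1 := T.toMultilinearMap.map_sum fun i a => c i a • s a
  refine h1.trans (Finset.sum_congr rfl fun J _ => ?_)
  exact T.toMultilinearMap.map_smul_univ (fun i => c i (J i)) fun i => s (J i)

/-- The transformation law of anchors. -/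
theorem AnchoredBracket.anchorCoef_transfer (B : AnchoredBracket d r m E) (I : Fin m → Fin r)
    (f : smoothFun κ'.domain) :
    act (pderiv κ.domain) (B.anchorCoef κ) I (transferHom κ.chart_mem κ'.chart_mem h f) =
      ∑ J, (∏ i, κ.frameChange κ' h (J i) (I i)) *
        transferHom κ.chart_mem κ'.chart_mem h (act (pderiv κ'.domain) (B.anchorCoef κ') J f) := by
  refine evalAt_ext fun x hx => ?_
  refine (B.evalAt_act hx ((contMDiffOn_extend κ'.chart_mem f).mono h) I).trans ?_
  rw [dirDeriv_extend κ'.chart_mem f (h hx)]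
  have h1 : (fun i => κ.frame (I i) x) = fun i => ∑ b, κ'.coeffLin b x (κ.frame (I i)) •
      κ'.frame b x := funext fun i => κ'.sec_eq_sum (h hx) _
  simp only [h1, map_sum_smul_univ, map_sum, map_smul, smul_eq_mul, Finset.sum_mul]
  rw [Finset.sum_comm]
  refine Finset.sum_congr rfl fun J _ => ?_
  rw [map_mul, map_prod]
  simp only [evalAt_frameChange]
  have h2 : evalAt (coordPt hx) (transferHom κ.chart_mem κ'.chart_mem h
      (act (pderiv κ'.domain) (B.anchorCoef κ') J f)) = _ :=
    evalAt_transfer κ.chart_mem κ'.chart_mem h _ hx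
  rw [h2, act, map_sum, Finset.mul_sum]
  refine Finset.sum_congr rfl fun μ _ => ?_
  rw [map_mul, AnchoredBracket.evalAt_anchorCoef, mul_assoc]

variable [T2Space M]

/-- The transformation law of structure functions. -/
theorem AnchoredBracket.structCoef_transfer {k : ℕ} (B : AnchoredBracket d r (k + 1) E)
    (I : Fin (k + 2) → Fin r) (b : Fin r) :
    ∑ a, κ.frameChange κ' h b a * B.structCoef κ I a
      - (-1 : ℝ) ^ (k + 1) • ∑ i : Fin (k + 2), (-1 : ℝ) ^ (i : ℕ) •
        act (pderiv κ.domain) (B.anchorCoef κ) (fun q => I (i.succAbove q))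
          (κ.frameChange κ' h b (I i)) =
      ∑ J, (∏ i, κ.frameChange κ' h (J i) (I i)) *
        transferHom κ.chart_mem κ'.chart_mem h (B.structCoef κ' J b) := by
  refine evalAt_ext fun x hx => ?_
  obtain ⟨χ, hχ1, hχ2⟩ := exists_cutoff (d := d) κ'.chart.open_source (h hx)
  have hχx : χ x = 1 := hχ1.self_of_nhds
  -- The `b`-th component in the primed frame, cut off so as to be a global function-linear form;
  -- near `x` it is the component itself.
  let β : Sec d r E →ₗ[SmoothFn d M] SmoothFn d M :=
    { toFun := fun e => ⟨_, contMDiff_mul_of_tsupport κ'.chart.open_source hχ2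
        (contMDiffOn_coeff κ'.chart.open_source κ'.isFrame e b)⟩
      map_add' := fun e e' => ContMDiffMap.ext fun y => by
        have := map_add (κ'.coeffLin b y) e e'
        change χ y * κ'.coeffLin b y (e + e') = χ y * κ'.coeffLin b y e + χ y * κ'.coeffLin b y e'
        rw [this, mul_add]
      map_smul' := fun f e => ContMDiffMap.ext fun y => by
        change χ y * κ'.coeffLin b y (f • e) = f y * (χ y * κ'.coeffLin b y e)
        rw [κ'.coeffLin_smul]
        ring }
  have hβ : ∀ e y, β e y = χ y * κ'.coeffLin b y e := fun e y => rfl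
  have hβx : ∀ e, β e x = κ'.coeffLin b x e := fun e => by rw [hβ, hχx, one_mul]
  have hβ' : ∀ e, β e =ᶠ[𝓝 x] fun y => κ'.coeffLin b y e := fun e => by
    filter_upwards [hχ1] with y hy
    rw [hβ, hy, one_mul]
  choose g hg1 hg2 using fun a => κ'.exists_smul_eq_sum hχ2 (κ.frame a)
  -- The transformation law is the expansion of this tensor, evaluated on the old frame, in terms of
  -- the new frame.
  have key := tensor_expansion (structTensor B.toLeibniz β) (structTensor_perm _ _)
    (fun _ f s t v => by
      simp only [AnchoredBracket.update_cons_zero']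
      exact structTensor_linear _ _ f s t _) χ (fun i => κ.frame (I i)) κ'.frame
      (fun i => g (I i)) (fun i => hg2 (I i))
  have hval : ∀ (e : Fin (k + 2) → Sec d r E), structTensor B.toLeibniz β e x =
      κ'.coeffLin b x (B.b e) - (-1 : ℝ) ^ (k + 1) * ∑ i : Fin (k + 2), (-1 : ℝ) ^ (i : ℕ) *
        dirDeriv (fun y => κ'.coeffLin b y (e i)) (B.ρ x fun q => e (i.succAbove q) x) := by
    intro e
    have hev : ∀ (F : Fin (k + 2) → SmoothFn d M), (∑ i, F i) x = ∑ i, F i x := fun F =>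
      map_sum (evalFn d x) _ _
    have h1 : structTensor B.toLeibniz β e x = β (B.b e) x - (-1 : ℝ) ^ (k + 1) *
        (∑ i : Fin (k + 2), (-1 : ℝ) ^ (i : ℕ) •
          B.toLeibniz.ρ (fun j => e (i.succAbove j)) (β (e i))) x := rfl
    rw [h1, hβx, hev]
    congr 2
    refine Finset.sum_congr rfl fun i _ => ?_
    refine congrArg ((-1 : ℝ) ^ (i : ℕ) * ·) ?_
    rw [AnchoredBracket.toLeibniz_ρ_apply]
    exact derivAlong_congr (hβ' _) _
  have hkey := congrArg (fun f : SmoothFn d M => f x) key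
  have hev : ∀ (F : (Fin (k + 2) → Fin r) → SmoothFn d M), (∑ i, F i) x = ∑ i, F i x := fun F =>
    map_sum (evalFn d x) _ _
  have hmul : ∀ f g : SmoothFn d M, (f • g) x = f x * g x := fun f g => rfl
  have hpow : (χ ^ (k + 2) : SmoothFn d M) x = 1 := by
    rw [ContMDiffMap.coe_pow, Pi.pow_apply, hχx, one_pow]
  have hprod : ∀ J : Fin (k + 2) → Fin r, (∏ i, g (I i) (J i) : SmoothFn d M) x =
      ∏ i, κ'.coeffLin (J i) x (κ.frame (I i)) := by
    intro J
    refine (map_prod (evalFn d x) _ _).trans ?_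
    refine Finset.prod_congr rfl fun i _ => ?_
    exact (hg1 _ _ _).trans (by rw [hχx, one_mul])
  simp only [hev, hmul, hpow, one_mul, hprod, hval] at hkey
  -- The components of the new frame in itself are constant, so the correction terms of the tensor
  -- vanish there and only the structure function remains.
  have hconst : ∀ (a : Fin r) (v : TangentSpace 𝓘(ℝ, Euc d) x),
      dirDeriv (fun y => κ'.coeffLin b y (κ'.frame a)) v = 0 := by
    intro a v
    have h1 : (fun y => κ'.coeffLin b y (κ'.frame a)) =ᶠ[𝓝 x] fun _ => if a = b then 1 else 0 := by
      filter_upwards [κ'.chart.open_source.mem_nhds (h hx)] with y hy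
      exact κ'.coeff_frame hy b a
    have h2 := h1.mfderiv_eq (I := 𝓘(ℝ, Euc d)) (I' := 𝓘(ℝ, ℝ))
    rw [mfderiv_const] at h2
    exact congrArg (fun L : Euc d →L[ℝ] ℝ => L v) h2
  simp only [hconst, mul_zero, Finset.sum_const_zero, sub_zero] at hkey
  rw [map_sub, map_smul, map_sum, map_sum, map_sum, smul_eq_mul]
  have e1 : ∑ a, evalAt (coordPt hx) (κ.frameChange κ' h b a * B.structCoef κ I a) =
      κ'.coeffLin b x (B.b fun i => κ.frame (I i)) := by
    rw [κ'.coeffLin_apply, κ.sec_eq_sum hx, map_sum]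
    refine Finset.sum_congr rfl fun a _ => ?_
    rw [map_mul, evalAt_frameChange, B.evalAt_structCoef, map_smul, smul_eq_mul, mul_comm]
    rfl
  have e2 : ∀ i : Fin (k + 2), evalAt (coordPt hx) ((-1 : ℝ) ^ (i : ℕ) •
        act (pderiv κ.domain) (B.anchorCoef κ) (fun q => I (i.succAbove q))
          (κ.frameChange κ' h b (I i))) = (-1 : ℝ) ^ (i : ℕ) *
        dirDeriv (fun y => κ'.coeffLin b y (κ.frame (I i)))
          (B.ρ x fun q => κ.frame (I (i.succAbove q)) x) := by
    intro i
    rw [map_smul, smul_eq_mul]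
    congr 1
    exact B.evalAt_act hx
      ((contMDiffOn_coeff κ'.chart.open_source κ'.isFrame (κ.frame (I i)) b).mono h) _
  rw [e1, Finset.sum_congr rfl fun i _ => e2 i, hkey]
  refine Finset.sum_congr rfl fun J _ => ?_
  rw [map_mul, map_prod]
  simp only [evalAt_frameChange]
  congr 1
  refine Eq.trans ?_ (evalAt_transfer κ.chart_mem κ'.chart_mem h _ hx).symm
  exact (B.evalAt_structCoef (h hx) J b).symm

/-- The vector field does not depend on the coordinates. -/
theorem AnchoredBrackets.exists_isCoordChange_Q (hn : 1 ≤ n) (S : AnchoredBrackets n d r E) :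
    ∃ T : κ'.Fun n →ₐ[ℝ] κ.Fun n,
        GrAlg.IsCoordChange 1 (pderiv κ.domain) (transfer κ.chart_mem κ'.chart_mem h)
          (coordChange κ.chart_mem κ'.chart_mem h) (κ.frameChange κ' h) T ∧
        ∀ u, S.Q κ (T u) = T (S.Q κ' u) := by
  obtain ⟨T, hT⟩ := exists_isCoordChange (n := n) (D := pderiv κ.domain) hn 1
    (transferHom κ.chart_mem κ'.chart_mem h)
    (transferHom_algebraMap κ.chart_mem κ'.chart_mem h)
    (coordChange κ.chart_mem κ'.chart_mem h) (κ.frameChange κ' h)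
  refine ⟨T, hT, ?_⟩
  rw [S.Q_eq hn, S.Q_eq hn]
  refine isCoordChange_liftComp hT (pderiv_comm _) hn (neg_one_pow_mul_self_eq_one _) (mul_one _)
    (pderiv_transfer κ.chart_mem κ'.chart_mem h)
    ⟨coordFn _, transferHom_coordFn κ.chart_mem κ'.chart_mem h, pderiv_coordFn _⟩
    (isBase_anchorComp _ _) (isBase_anchorComp _ _) (isBase_anchorComp _ _)
    (isBase_anchorComp _ _) ?_ ?_
  · exact isCoordChange_anchorComp_bracketComp hT hn
      (fun I μ σ => S.two.anchorCoef_perm I μ σ) (S.two.anchorCoef_transfer h)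
      (S.two.structCoef_transfer h (k := 0))
  · obtain ⟨k, rfl⟩ := Nat.exists_eq_add_of_le' hn
    exact isCoordChange_anchorComp_bracketComp hT hn
      (fun I μ σ => S.top.anchorCoef_perm I μ σ) (S.top.anchorCoef_transfer h)
      (S.top.structCoef_transfer h)

end CoordChange

end GappedLie

end

noncomputable section

namespace GappedLie

/-! ### Hamiltonian vector fields -/

namespace GrAlg

variable {n d r : ℕ} {A : Type*} [CommRing A] [Algebra ℝ A] {D : Fin d → Derivation ℝ A A}

theorem partialDeriv_sig (c : Coord d r) (k : ℕ) (u : GrAlg n d r A) :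
    partialDeriv D c (sig k u) = (-1 : ℝ) ^ (k * coordDeg n c) • sig k (partialDeriv D c u) := by
  induction u using induction_mul with
  | hfn f =>
    rw [sig_fn, partialDeriv_fn, sig_fn]
    rcases c with μ | g
    · simp [coordDeg]
    · simp [baseDeriv, fn_zero]
  | hgen g =>
    rw [sig_gen, map_smul, partialDeriv_gen, AlgHom.commutes]
    rcases c with μ | h
    · simp [genDeriv]
    · by_cases e : h = g
      · subst e; rfl
      · simp [genDeriv, e]
  | hadd u v hu hv => simp only [map_add, hu, hv, smul_add]
  | hmul u v hu hv =>
    simp only [map_mul, map_add, partialDeriv_mul, hu, hv, smul_add, sig_sig, smul_mul_assoc,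
      mul_smul_comm, add_comm k]

/-- In the inductive step for products, the mixed terms match because `partialDeriv_sig` supplies
the sign `(-1)^{|c||c'|}`. -/
theorem partialDeriv_comm (hD : ∀ μ ν f, D μ (D ν f) = D ν (D μ f)) (c c' : Coord d r)
    (u : GrAlg n d r A) :
    partialDeriv D c (partialDeriv D c' u) =
      (-1 : ℝ) ^ (coordDeg n c * coordDeg n c') • partialDeriv D c' (partialDeriv D c u) := by
  have hconst : ∀ (c : Coord d r) (t : ℝ),
      partialDeriv D c (algebraMap ℝ (GrAlg n d r A) t) = 0 := fun c t => by
    rw [← fn_algebraMap, partialDeriv_fn]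
    cases c <;> simp [baseDeriv, fn_zero]
  induction u using induction_mul with
  | hfn f =>
    simp only [partialDeriv_fn]
    rcases c with μ | g <;> rcases c' with ν | h <;>
      simp [baseDeriv, fn_zero, coordDeg, hD]
  | hgen g => simp only [partialDeriv_gen, hconst, smul_zero]
  | hadd u v hu hv => simp only [map_add, hu, hv, smul_add]
  | hmul u v hu hv =>
    simp only [map_add, partialDeriv_mul, hu, hv, smul_add, sig_sig, smul_mul_assoc,
      mul_smul_comm, partialDeriv_sig, smul_smul, mul_comm (coordDeg n c') (coordDeg n c),
      neg_one_pow_mul_self_eq_one, one_smul, add_comm (coordDeg n c') (coordDeg n c)]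
    abel

theorem vectorField_baseComp (Px : Fin d → GrAlg n d r A) (Pa : Fin r → GrAlg n d r A)
    (u : GrAlg n d r A) :
    vectorField D (baseComp Px Pa) u =
      ∑ μ, Px μ * partialDeriv D (.inl μ) u + ∑ i, Pa i * partialDeriv D (.inr (.a i)) u := by
  rw [vectorField_apply, Fintype.sum_sum_type]
  congr 1
  symm
  refine Fintype.sum_of_injective Gen.a (fun _ _ h => by injection h) _ _ ?_ fun _ => rfl
  rintro (i | μ | i) h
  · exact absurd ⟨i, rfl⟩ h
  · exact zero_mul _
  · exact zero_mul _

section Hamiltonian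

variable {B W : GrAlg n d d A} {m : ℕ}

/-- The commutator of two Hamiltonian fields is Hamiltonian. Differentiating `X_B(W)` along `a_ν`
gives the terms where the derivative hits `W`, which form `X_B` applied to a component of `X_W`. The
terms where it hits `B`, after reordering the factors, form `X_W` applied to a component of `X_B`.
-/
theorem hamiltonian_commutator_x (hD : ∀ μ ν f, D μ (D ν f) = D ν (D μ f))
    (hB1 : ∀ μ, partialDeriv D (.inr (.a μ)) B ∈ homogeneous 1)
    (hB2 : ∀ μ, partialDeriv D (.inl μ) B ∈ homogeneous 2)
    (hB11 : ∀ μ ν, partialDeriv D (.inr (.a μ)) (partialDeriv D (.inr (.a ν)) B) ∈ homogeneous 0)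
    (hB12 : ∀ μ ν, partialDeriv D (.inl μ) (partialDeriv D (.inr (.a ν)) B) ∈ homogeneous 1)
    (hW1 : ∀ μ, partialDeriv D (.inr (.a μ)) W ∈ homogeneous m)
    (hW2 : ∀ μ, partialDeriv D (.inl μ) W ∈ homogeneous (m + 1)) (ν : Fin d) :
    vectorField D (baseComp (fun μ => partialDeriv D (.inr (.a μ)) B)
        (fun μ => partialDeriv D (.inl μ) B)) (partialDeriv D (.inr (.a ν)) W)
      - (-1 : ℝ) ^ m • vectorField D (baseComp (fun μ => partialDeriv D (.inr (.a μ)) W)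
        (fun μ => (-1 : ℝ) ^ (m + 1) • partialDeriv D (.inl μ) W))
        (partialDeriv D (.inr (.a ν)) B) =
    (-1 : ℝ) • partialDeriv D (.inr (.a ν))
      (vectorField D (baseComp (fun μ => partialDeriv D (.inr (.a μ)) B)
        (fun μ => partialDeriv D (.inl μ) B)) W) := by
  have hxa : ∀ μ u, partialDeriv D (.inl μ) (partialDeriv D (.inr (.a ν)) u) =
      (partialDeriv D (.inr (.a ν)) (partialDeriv D (.inl μ) u) : GrAlg n d d A) := fun μ u => by
    rw [partialDeriv_comm hD]; simp [coordDeg]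
  have haa : ∀ μ u, partialDeriv D (.inr (.a μ)) (partialDeriv D (.inr (.a ν)) u) =
      (-1 : ℝ) • (partialDeriv D (.inr (.a ν)) (partialDeriv D (.inr (.a μ)) u) :
        GrAlg n d d A) := fun μ u => by
    rw [partialDeriv_comm hD]; simp [coordDeg, Gen.deg]
  have h1 : ∀ μ, partialDeriv D (.inr (.a μ)) W *
      partialDeriv D (.inl μ) (partialDeriv D (.inr (.a ν)) B) = (-1 : ℝ) ^ m •
      (partialDeriv D (.inr (.a ν)) (partialDeriv D (.inl μ) B) *
        partialDeriv D (.inr (.a μ)) W) := fun μ => by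
    rw [mul_comm_of_mem (hW1 μ) (hB12 μ ν), hxa, mul_one]
  have h2 : ∀ μ, partialDeriv D (.inl μ) W *
      partialDeriv D (.inr (.a μ)) (partialDeriv D (.inr (.a ν)) B) = (-1 : ℝ) •
      (partialDeriv D (.inr (.a ν)) (partialDeriv D (.inr (.a μ)) B) *
        partialDeriv D (.inl μ) W) := fun μ => by
    rw [mul_comm_of_mem (hW2 μ) (hB11 μ ν), haa, smul_mul_assoc]; simp
  have hs := neg_one_pow_mul_self_eq_one m
  simp only [vectorField_baseComp, map_add, map_sum, partialDeriv_mul, smul_mul_assoc, h1, h2]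
  simp only [hxa, haa, coordDeg, Gen.deg, sig_of_mem (hB1 _), sig_of_mem (hB2 _),
    Finset.sum_add_distrib, smul_mul_assoc, mul_smul_comm, ← Finset.smul_sum, smul_add, smul_smul,
    pow_succ, hs]
  generalize (∑ μ, partialDeriv D (.inr (.a ν)) (partialDeriv D (.inl μ) B) *
        partialDeriv D (.inr (.a μ)) W) = u1
  generalize (∑ μ, partialDeriv D (.inr (.a ν)) (partialDeriv D (.inr (.a μ)) B) *
        partialDeriv D (.inl μ) W) = u2
  have e : (-1 : ℝ) ^ m * ((-1 : ℝ) ^ m * -1 * -1) = 1 := by linear_combination hs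
  rw [e]
  module

/-- The same argument for the derivative along `x^ν`. That derivative is even and commutes with all
others, so only the reordering of factors produces signs. -/
theorem hamiltonian_commutator_a (hD : ∀ μ ν f, D μ (D ν f) = D ν (D μ f))
    (hB12 : ∀ μ ν, partialDeriv D (.inl μ) (partialDeriv D (.inr (.a ν)) B) ∈ homogeneous 1)
    (hB22 : ∀ μ ν, partialDeriv D (.inl μ) (partialDeriv D (.inl ν) B) ∈ homogeneous 2)
    (hW1 : ∀ μ, partialDeriv D (.inr (.a μ)) W ∈ homogeneous m)
    (hW2 : ∀ μ, partialDeriv D (.inl μ) W ∈ homogeneous (m + 1)) (ν : Fin d) :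
    vectorField D (baseComp (fun μ => partialDeriv D (.inr (.a μ)) B)
        (fun μ => partialDeriv D (.inl μ) B)) ((-1 : ℝ) ^ (m + 1) • partialDeriv D (.inl ν) W)
      - (-1 : ℝ) ^ m • vectorField D (baseComp (fun μ => partialDeriv D (.inr (.a μ)) W)
        (fun μ => (-1 : ℝ) ^ (m + 1) • partialDeriv D (.inl μ) W))
        (partialDeriv D (.inl ν) B) =
    (-1 : ℝ) ^ (m + 1) • partialDeriv D (.inl ν)
      (vectorField D (baseComp (fun μ => partialDeriv D (.inr (.a μ)) B)
        (fun μ => partialDeriv D (.inl μ) B)) W) := by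
  have hax : ∀ μ u, partialDeriv D (.inr (.a μ)) (partialDeriv D (.inl ν) u) =
      (partialDeriv D (.inl ν) (partialDeriv D (.inr (.a μ)) u) : GrAlg n d d A) := fun μ u => by
    rw [partialDeriv_comm hD]; simp [coordDeg]
  have hxx : ∀ μ u, partialDeriv D (.inl μ) (partialDeriv D (.inl ν) u) =
      (partialDeriv D (.inl ν) (partialDeriv D (.inl μ) u) : GrAlg n d d A) := fun μ u => by
    rw [partialDeriv_comm hD]; simp [coordDeg]
  have h1 : ∀ μ, partialDeriv D (.inr (.a μ)) W *
      partialDeriv D (.inl μ) (partialDeriv D (.inl ν) B) =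
      (partialDeriv D (.inl ν) (partialDeriv D (.inl μ) B) *
        partialDeriv D (.inr (.a μ)) W) := fun μ => by
    rw [mul_comm_of_mem (hW1 μ) (hB22 μ ν), hxx, Even.neg_one_pow (even_two.mul_left m), one_smul]
  have h2 : ∀ μ, partialDeriv D (.inl μ) W *
      partialDeriv D (.inr (.a μ)) (partialDeriv D (.inl ν) B) = (-1 : ℝ) ^ (m + 1) •
      (partialDeriv D (.inl ν) (partialDeriv D (.inr (.a μ)) B) *
        partialDeriv D (.inl μ) W) := fun μ => by
    rw [hax, mul_comm_of_mem (hW2 μ) (hB12 ν μ), mul_one]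
  have hs := neg_one_pow_mul_self_eq_one (m + 1)
  have h0 : ∀ u : GrAlg n d d A, sig 0 u = u := fun u => sig_eq_self ⟨0, rfl⟩ u
  simp only [vectorField_baseComp, map_add, map_sum, partialDeriv_mul, smul_mul_assoc, h1, h2,
    map_smul]
  simp only [hxx, hax, coordDeg, h0, Finset.sum_add_distrib, smul_add, smul_smul, hs, one_smul]
  generalize (∑ μ, partialDeriv D (.inl ν) (partialDeriv D (.inl μ) B) *
        partialDeriv D (.inr (.a μ)) W) = u1
  generalize (∑ μ, partialDeriv D (.inl ν) (partialDeriv D (.inr (.a μ)) B) *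
        partialDeriv D (.inl μ) W) = u2
  rw [pow_succ]
  module

end Hamiltonian

end GrAlg

end GappedLie

end

/-! ### Hamiltonian vector fields of multivector fields -/

noncomputable section

namespace GappedLie

namespace GrAlg

variable {n d : ℕ} {A : Type*} [CommRing A] [Algebra ℝ A] {D : Fin d → Derivation ℝ A A}

/-- The anchor of the Hamiltonian vector field of a multivector field with components `U`. -/
def hamAnchor {m : ℕ} (U : (Fin (m + 1) → Fin d) → A) (I : Fin m → Fin d) (μ : Fin d) : A :=
  U (Fin.cons μ I)

variable (D) in
/-- The structure functions of the Hamiltonian vector field of a multivector field with components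
`U`. -/
def hamBracket {m : ℕ} (U : (Fin (m + 1) → Fin d) → A) (I : Fin (m + 1) → Fin d) (μ : Fin d) : A :=
  (-1 : ℝ) ^ m • D μ (U I)

/-- The function of the coordinates given by a multivector field with components `U`. -/
def ham {m : ℕ} (U : (Fin (m + 1) → Fin d) → A) : GrAlg n d d A :=
  (1 / ((m + 1).factorial : ℝ)) • poly U

variable (D) in
/-- The Hamiltonian vector field of a multivector field with components `U`. -/
def hamField {m : ℕ} (U : (Fin (m + 1) → Fin d) → A) : GrAlg n d d A →ₗ[ℝ] GrAlg n d d A :=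
  vectorField D (baseComp (anchorComp (hamAnchor U)) (bracketComp (hamBracket D U)))

theorem isGDer_partialDeriv_x (ν : Fin d) :
    IsGDer 0 (partialDeriv D (.inl ν) : GrAlg n d d A →ₗ[ℝ] GrAlg n d d A) :=
  fun u v => partialDeriv_mul D (.inl ν) u v

theorem isGDer_partialDeriv_a (ν : Fin d) :
    IsGDer 1 (partialDeriv D (.inr (.a ν)) : GrAlg n d d A →ₗ[ℝ] GrAlg n d d A) :=
  fun u v => partialDeriv_mul D (.inr (.a ν)) u v

theorem partialDeriv_a_gen_a (ν μ : Fin d) :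
    (partialDeriv D (.inr (.a ν)) (gen (.a μ)) : GrAlg n d d A) = if ν = μ then 1 else 0 := by
  rw [partialDeriv_gen]
  by_cases h : ν = μ <;> simp [genDeriv, h]

theorem partialDeriv_a_poly {m : ℕ} (F : (Fin (m + 1) → Fin d) → A)
    (hF : ∀ I (σ : Equiv.Perm (Fin (m + 1))), F (I ∘ σ) = rsign σ • F I) (ν : Fin d) :
    (partialDeriv D (.inr (.a ν)) (poly F) : GrAlg n d d A) =
      ((m + 1 : ℕ) : ℝ) • poly fun I => F (Fin.cons ν I) := by
  have hder := isGDer_partialDeriv_a (n := n) (D := D) ν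
  have hone : (1 : GrAlg n d d A) ∈ homogeneous 0 := by
    rw [← fn_one]; exact fn_mem_homogeneous 1
  have h := sum_mul_gder_word (n := n) (v := fun i => gen (.a i)) hder (e := 0) ⟨1, rfl⟩
    a_mem_homogeneous (fun i => by
      rw [partialDeriv_a_gen_a]; split_ifs; exacts [hone, zero_mem _]) F hF
  rw [poly, map_sum]
  simp only [hder _ _, partialDeriv_fn, baseDeriv, fn_zero, zero_mul, zero_add, sig_fn,
    mono_eq_word]
  rw [h, Finset.sum_eq_single ν]
  · simp [partialDeriv_a_gen_a, poly, mono_eq_word]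
  · intro μ _ hμ
    simp [partialDeriv_a_gen_a, hμ.symm]
  · simp

theorem partialDeriv_x_word_gen (ν : Fin d) {m : ℕ} (I : Fin m → Fin d) :
    (partialDeriv D (.inl ν) (mono I) : GrAlg n d d A) = 0 := by
  induction m with
  | zero => rw [mono_zero, ← fn_one, partialDeriv_fn]; simp [baseDeriv, fn_zero]
  | succ m ih =>
    rw [mono_succ, isGDer_partialDeriv_x, ih, partialDeriv_gen]
    simp [genDeriv]

theorem partialDeriv_x_poly {m : ℕ} (F : (Fin m → Fin d) → A) (ν : Fin d) :
    (partialDeriv D (.inl ν) (poly F) : GrAlg n d d A) = poly fun I => D ν (F I) := by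
  rw [poly, map_sum, poly]
  refine Finset.sum_congr rfl fun I _ => ?_
  rw [isGDer_partialDeriv_x, partialDeriv_x_word_gen, partialDeriv_fn, mul_zero, add_zero]
  rfl

section

variable {m : ℕ} {U : (Fin (m + 1) → Fin d) → A}

theorem isBase_ham (U : (Fin (m + 1) → Fin d) → A) :
    IsBase (n := n) m (anchorComp (hamAnchor U)) (bracketComp (hamBracket D U)) :=
  isBase_anchorComp _ _

theorem partialDeriv_a_ham (hU : ∀ I (σ : Equiv.Perm (Fin (m + 1))), U (I ∘ σ) = rsign σ • U I)
    (ν : Fin d) :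
    (partialDeriv D (.inr (.a ν)) (ham U) : GrAlg n d d A) = anchorComp (hamAnchor U) ν := by
  rw [ham, map_smul, partialDeriv_a_poly U hU, smul_smul, anchorComp]
  congr 1
  rw [Nat.factorial_succ]
  push_cast
  have : (m.factorial : ℝ) ≠ 0 := Nat.cast_ne_zero.2 (Nat.factorial_ne_zero _)
  have : (m : ℝ) + 1 ≠ 0 := by positivity
  field_simp

/-- Together with `partialDeriv_a_ham` this shows that the field with anchor `hamAnchor U` and
structure functions `hamBracket D U` is Hamiltonian. The sign `(-1)^m` in `hamBracket` is chosen for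
this. -/
theorem partialDeriv_x_ham (ν : Fin d) :
    (partialDeriv D (.inl ν) (ham U) : GrAlg n d d A) =
      (-1 : ℝ) ^ (m + 1) • bracketComp (hamBracket D U) ν := by
  rw [ham, map_smul, partialDeriv_x_poly, bracketComp, smul_smul]
  simp only [hamBracket]
  rw [poly_smul, smul_smul]
  congr 1
  have := neg_one_pow_mul_self_eq_one m
  rw [pow_succ]
  linear_combination (-1 / ((m + 1).factorial : ℝ)) * this

theorem bracketComp_hamBracket (ν : Fin d) :
    (bracketComp (hamBracket D U) ν : GrAlg n d d A) =
      (-1 : ℝ) ^ (m + 1) • partialDeriv D (.inl ν) (ham U) := by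
  rw [partialDeriv_x_ham, smul_smul, neg_one_pow_mul_self_eq_one, one_smul]

variable {N : (Fin 2 → Fin d) → A}

theorem partialDeriv_a_anchorComp (μ ν : Fin d) :
    (partialDeriv D (.inr (.a μ)) (anchorComp (hamAnchor N) ν) : GrAlg n d d A) =
      fn (N ![ν, μ]) := by
  rw [anchorComp, map_smul, poly, sum_fin_one, map_sum]
  simp only [isGDer_partialDeriv_a _ _, mono_one, partialDeriv_fn, partialDeriv_a_gen_a, baseDeriv,
    fn_zero, zero_mul, zero_add, sig_fn]
  simp [hamAnchor]
  congr 2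
  funext i
  fin_cases i <;> rfl

theorem commutator_hamField_x (hD : ∀ μ ν f, D μ (D ν f) = D ν (D μ f))
    (hN : ∀ I (σ : Equiv.Perm (Fin 2)), N (I ∘ σ) = rsign σ • N I)
    (hU : ∀ I (σ : Equiv.Perm (Fin (m + 1))), U (I ∘ σ) = rsign σ • U I) (ν : Fin d) :
    (hamField D N (anchorComp (hamAnchor U) ν)
      - (-1 : ℝ) ^ m • hamField D U (anchorComp (hamAnchor N) ν) : GrAlg n d d A) =
    (-1 : ℝ) • partialDeriv D (.inr (.a ν)) (hamField D N (ham U)) := by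
  have h2 : ∀ μ, (partialDeriv D (.inl μ) (ham N) : GrAlg n d d A) =
      bracketComp (hamBracket D N) μ := fun μ => by rw [partialDeriv_x_ham]; simp
  have h := hamiltonian_commutator_x (n := n) (B := ham N) (W := ham U) (m := m) hD
    (fun μ => by rw [partialDeriv_a_ham hN]; exact (isBase_ham (D := D) N).x μ)
    (fun μ => by rw [h2]; exact (isBase_ham (D := D) N).a μ)
    (fun μ ν => by rw [partialDeriv_a_ham hN, partialDeriv_a_anchorComp]
                   exact fn_mem_homogeneous _)
    (fun μ ν => by
      rw [partialDeriv_a_ham hN, anchorComp, map_smul, partialDeriv_x_poly]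
      exact Submodule.smul_mem _ _ (poly_mem_homogeneous _))
    (fun μ => by rw [partialDeriv_a_ham hU]; exact (isBase_ham (D := D) U).x μ)
    (fun μ => by
      rw [partialDeriv_x_ham]
      exact Submodule.smul_mem _ _ ((isBase_ham (D := D) U).a μ)) ν
  simp only [partialDeriv_a_ham hN, partialDeriv_a_ham hU, h2, ← bracketComp_hamBracket] at h
  exact h

theorem commutator_hamField_a (hD : ∀ μ ν f, D μ (D ν f) = D ν (D μ f))
    (hN : ∀ I (σ : Equiv.Perm (Fin 2)), N (I ∘ σ) = rsign σ • N I)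
    (hU : ∀ I (σ : Equiv.Perm (Fin (m + 1))), U (I ∘ σ) = rsign σ • U I) (ν : Fin d) :
    (hamField D N (bracketComp (hamBracket D U) ν)
      - (-1 : ℝ) ^ m • hamField D U (bracketComp (hamBracket D N) ν) : GrAlg n d d A) =
    (-1 : ℝ) ^ (m + 1) • partialDeriv D (.inl ν) (hamField D N (ham U)) := by
  have h2 : ∀ μ, (partialDeriv D (.inl μ) (ham N) : GrAlg n d d A) =
      bracketComp (hamBracket D N) μ := fun μ => by rw [partialDeriv_x_ham]; simp
  have h := hamiltonian_commutator_a (n := n) (B := ham N) (W := ham U) (m := m) hD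
    (fun μ ν => by
      rw [partialDeriv_a_ham hN, anchorComp, map_smul, partialDeriv_x_poly]
      exact Submodule.smul_mem _ _ (poly_mem_homogeneous _))
    (fun μ ν => by
      rw [h2, bracketComp, map_smul, partialDeriv_x_poly]
      exact Submodule.smul_mem _ _ (poly_mem_homogeneous _))
    (fun μ => by rw [partialDeriv_a_ham hU]; exact (isBase_ham (D := D) U).x μ)
    (fun μ => by
      rw [partialDeriv_x_ham]
      exact Submodule.smul_mem _ _ ((isBase_ham (D := D) U).a μ)) ν
  simp only [partialDeriv_a_ham hN, partialDeriv_a_ham hU, h2, ← bracketComp_hamBracket] at h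
  exact h

/-- The Hamiltonian field of a bivector acts on multivectors as the Schouten bracket, up to
normalisation. The bivector is `N = -P`: the `x^ν`-component of the field of the theorem is `Π^{μν}
a_μ`, while the Hamiltonian anchor of `N` is `N^{νμ} a_μ`. -/
theorem hamField_ham_eq_schouten {P : (Fin 2 → Fin d) → A} (hNP : ∀ I, N I = -P I)
    (hU : ∀ I (σ : Equiv.Perm (Fin (m + 1))), U (I ∘ σ) = rsign σ • U I) (hk : m + 2 = 1 + m + 1) :
    (hamField D N (ham U) : GrAlg n d d A) =
      (-(1 / ((m + 2).factorial : ℝ))) • poly (schouten D (p := 1) (q := m) hk P U) := by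
  rw [hamField, ham, map_smul, vectorField_one_poly U hU]
  set G : (Fin (m + 2) → Fin d) → A := fun I =>
    act D (hamAnchor N) (fun _ => I 0) (U fun i => I i.succ)
      + (-((m + 1 : ℕ) : ℝ) / 2) •
        ∑ a, hamBracket D N ![I 0, I 1] a * U (Fin.cons a fun i : Fin m => I i.succ.succ) with hG
  -- The Schouten bracket is itself a sum over permutations, so the polynomial is replaced by its
  -- antisymmetrisation and the two are compared summand by summand.
  have h1 : (poly (altSum G) : GrAlg n d d A) = ((m + 2).factorial : ℝ) • poly G :=
    sum_fn_altSum_mul_word a_mem_homogeneous G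
  have h2 : altSum G = fun l => (-((m + 1).factorial : ℝ)) •
      schouten D (p := 1) (q := m) hk P U l := by
    funext l
    rw [schouten, altSum, smul_smul]
    have e : -((m + 1).factorial : ℝ) * ((-1 : ℝ) ^ (1 + 1) /
        (((1 + 1).factorial : ℝ) * ((m + 1).factorial : ℝ))) = -(1 / 2) := by
      have : ((m + 1).factorial : ℝ) ≠ 0 := Nat.cast_ne_zero.2 (Nat.factorial_ne_zero _)
      norm_num
      field_simp
    rw [e, Finset.smul_sum]
    refine Finset.sum_congr rfl fun σ _ => ?_
    rw [smul_comm (-(1 / 2 : ℝ))]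
    change rsign σ • _ = rsign σ • _
    congr 1
    rw [hG]
    simp only [act, hamAnchor, hamBracket, hNP, Finset.smul_sum, ← Finset.sum_add_distrib]
    refine Finset.sum_congr rfl fun κ _ => ?_
    have a1 : (fun i : Fin (1 + 1) => l (σ ⟨i, by omega⟩)) = ![(l ∘ σ) 0, (l ∘ σ) 1] := by
      funext i; fin_cases i <;> rfl
    have a2 : (fun j : Fin (m + 1) => l (σ ⟨1 + j, by omega⟩)) = fun i => (l ∘ σ) i.succ := by
      funext i
      exact congrArg (fun k => l (σ k)) (Fin.ext (add_comm _ _))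
    have a3 : (fun j : Fin m => l (σ ⟨1 + 1 + j, by omega⟩)) = fun i => (l ∘ σ) i.succ.succ := by
      funext i
      exact congrArg (fun k => l (σ k)) (Fin.ext (by simp; omega))
    have a4 : (fun i : Fin 1 => l (σ ⟨i, by omega⟩)) = fun _ => (l ∘ σ) 0 := by
      funext i; fin_cases i; rfl
    rw [a1, a2, a3, a4, map_neg]
    generalize D κ (U fun i => (l ∘ σ) i.succ) = u1
    generalize P (Fin.cons κ fun _ => (l ∘ σ) 0) = u2
    generalize D κ (P ![(l ∘ σ) 0, (l ∘ σ) 1]) = u3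
    generalize U (Fin.cons κ fun i => (l ∘ σ) i.succ.succ) = u4
    simp only [pow_one, neg_smul, one_smul, neg_neg, neg_mul]
    rw [mul_comm u4]
    generalize u2 * u1 = v1
    generalize u3 * u4 = v2
    push_cast
    module
  rw [h2, poly_smul] at h1
  have h3 : (m + 2).factorial ≠ 0 := Nat.factorial_ne_zero _
  have h4 : (m + 1).factorial ≠ 0 := Nat.factorial_ne_zero _
  refine smul_right_injective _ (Nat.cast_ne_zero.2 h3 : ((m + 2).factorial : ℝ) ≠ 0) ?_
  change _ • (_ • poly G) = _ • (_ • poly _)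
  rw [smul_comm, ← h1, smul_smul, smul_smul]
  congr 1
  have h3' : ((m + 2).factorial : ℝ) ≠ 0 := Nat.cast_ne_zero.2 h3
  have h4' : ((m + 1).factorial : ℝ) ≠ 0 := Nat.cast_ne_zero.2 h4
  field_simp

/-- Since `X_N` annihilates its own Hamiltonian by `[Π, Π] = 0`, both kinds of components of `[X_N,
X_N]`, being derivatives of that function, vanish. -/
theorem hamField_self_eq_zero (hD : ∀ μ ν f, D μ (D ν f) = D ν (D μ f))
    {P : (Fin 2 → Fin d) → A} (hNP : ∀ I, N I = -P I)
    (hP : ∀ I (σ : Equiv.Perm (Fin 2)), P (I ∘ σ) = rsign σ • P I)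
    (hPP : ∀ l : Fin 3 → Fin d, schouten D (p := 1) (q := 1) rfl P P l = 0) (ν : Fin d) :
    (hamField D N (anchorComp (hamAnchor N) ν) : GrAlg n d d A) = 0 ∧
      (hamField D N (bracketComp (hamBracket D N) ν) : GrAlg n d d A) = 0 := by
  have hN : ∀ I (σ : Equiv.Perm (Fin 2)), N (I ∘ σ) = rsign σ • N I := fun I σ => by
    rw [hNP, hNP, hP, smul_neg]
  have h1 : (hamField D N (ham P) : GrAlg n d d A) = 0 := by
    rw [hamField_ham_eq_schouten hNP hP rfl]
    have : schouten D (p := 1) (q := 1) rfl P P = fun _ : Fin 3 → Fin d => (0 : A) := funext hPP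
    rw [this, poly]
    simp [fn_zero]
  have h2 : (ham N : GrAlg n d d A) = (-1 : ℝ) • ham P := by
    have : N = fun I => (-1 : ℝ) • P I := funext fun I => by rw [hNP, neg_smul, one_smul]
    rw [this, ham, ham, poly_smul, smul_comm]
  have h3 : (hamField D N (ham N) : GrAlg n d d A) = 0 := by rw [h2, map_smul, h1, smul_zero]
  have hx := commutator_hamField_x (n := n) hD hN hN ν
  have ha := commutator_hamField_a (n := n) hD hN hN ν
  rw [h3, map_zero, smul_zero] at hx ha
  simp only [pow_one, neg_smul_grAlg, one_smul, sub_neg_eq_add] at hx ha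
  exact ⟨eq_zero_of_add_self hx, eq_zero_of_add_self ha⟩

end

end GrAlg

end GappedLie

end

noncomputable section

namespace GappedLie

/-! ### Twisted R-Poisson structures in coordinates -/

namespace GrAlg

variable {n d : ℕ} {A : Type*} [CommRing A] [Algebra ℝ A] {D : Fin d → Derivation ℝ A A}

theorem alternating_cons {m : ℕ} {F : (Fin (m + 1) → Fin d) → A}
    (hF : ∀ I (σ : Equiv.Perm (Fin (m + 1))), F (I ∘ σ) = rsign σ • F I) (a : Fin d)
    (J : Fin m → Fin d) (σ : Equiv.Perm (Fin m)) :
    F (Fin.cons a (J ∘ σ)) = rsign σ • F (Fin.cons a J) := by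
  rw [cons_comp_perm, hF, rsign_decomposeFin_zero]

section

variable {P N : (Fin 2 → Fin d) → A} {H : (Fin (n + 2) → Fin d) → A}
  {R : (Fin (n + 1) → Fin d) → A}

/-- The contribution of the form with components `H` to the `a`-components of the vector field of a
twisted R-Poisson structure, up to a factor. -/
def twistComp (N : (Fin 2 → Fin d) → A) (H : (Fin (n + 2) → Fin d) → A) (ν : Fin d) :
    GrAlg n d d A :=
  ∑ J : Fin (n + 1) → Fin d, fn (H (Fin.cons ν J)) * word (anchorComp (hamAnchor N)) J

theorem anchorComp_hamAnchor_two (ν : Fin d) :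
    (anchorComp (hamAnchor N) ν : GrAlg n d d A) = ∑ μ, fn (N ![ν, μ]) * gen (.a μ) := by
  rw [anchorComp, poly, sum_fin_one]
  simp only [Nat.factorial_one, Nat.cast_one, div_one, one_smul, mono_one, hamAnchor]
  refine Finset.sum_congr rfl fun μ _ => ?_
  congr 3
  funext i
  fin_cases i <;> rfl

theorem anchorComp_mem (N : (Fin 2 → Fin d) → A) (ν : Fin d) :
    (anchorComp (hamAnchor N) ν : GrAlg n d d A) ∈ homogeneous 1 :=
  Submodule.smul_mem _ _ (poly_mem_homogeneous _)

theorem twistComp_mem (ν : Fin d) : (twistComp N H ν : GrAlg n d d A) ∈ homogeneous (n + 1) :=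
  sum_mem fun _ _ => fn_mul_mem_homogeneous _ (word_mem_homogeneous (anchorComp_mem N) _)

theorem twistComp_mem_base (ν : Fin d) : (twistComp N H ν : GrAlg n d d A) ∈ base n d d A :=
  Subalgebra.sum_mem _ fun _ _ => mul_mem (fn_mem_base _)
    (word_mem (fun _ => Subalgebra.smul_mem _ (poly_mem_base _) _) _)

variable (D) in
/-- The `a`-components of the vector field of degree `n` of a twisted R-Poisson structure. -/
def twistedBracketComp (N : (Fin 2 → Fin d) → A) (R : (Fin (n + 1) → Fin d) → A)
    (H : (Fin (n + 2) → Fin d) → A) (ν : Fin d) : GrAlg n d d A :=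
  bracketComp (hamBracket D R) ν + ((-1 : ℝ) ^ n / ((n + 1).factorial : ℝ)) • twistComp N H ν

theorem isBase_twisted : IsBase (n := n) n (anchorComp (hamAnchor R)) (twistedBracketComp D N R H) where
  x := (isBase_ham (D := D) R).x
  a ν := add_mem ((isBase_ham (D := D) R).a ν) (Submodule.smul_mem _ _ (twistComp_mem ν))
  bx := (isBase_ham (D := D) R).bx
  ba ν := add_mem ((isBase_ham (D := D) R).ba ν)
    (Subalgebra.smul_mem _ (twistComp_mem_base ν) _)

theorem vectorField_twisted (u : GrAlg n d d A) :
    vectorField D (baseComp (anchorComp (hamAnchor R)) (twistedBracketComp D N R H)) u =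
      hamField D R u + ((-1 : ℝ) ^ n / ((n + 1).factorial : ℝ)) •
        ∑ i, twistComp N H i * partialDeriv D (.inr (.a i)) u := by
  rw [hamField, vectorField_baseComp, vectorField_baseComp]
  simp only [twistedBracketComp, add_mul, Finset.sum_add_distrib, smul_mul_assoc,
    ← Finset.smul_sum, add_assoc]

theorem gder_sum_word {k e : ℕ} {V : GrAlg n d d A →ₗ[ℝ] GrAlg n d d A} (hV : IsGDer k V)
    (he : Even (k + 1 + e)) (hVv : ∀ i, V (anchorComp (hamAnchor N) i) ∈ homogeneous e)
    (hH : ∀ I (σ : Equiv.Perm (Fin (n + 2))), H (I ∘ σ) = rsign σ • H I) :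
    V (∑ κ, fn (H κ) * word (anchorComp (hamAnchor N)) κ) =
      ∑ κ, V (fn (H κ)) * word (anchorComp (hamAnchor N)) κ +
      ((n + 2 : ℕ) : ℝ) • ∑ i, V (anchorComp (hamAnchor N) i) * twistComp N H i := by
  have h := sum_mul_gder_word hV he (anchorComp_mem N) hVv H hH
  rw [map_sum]
  simp only [hV _ _, sig_fn, Finset.sum_add_distrib]
  rw [h]
  congr 2
  refine Finset.sum_congr rfl fun i _ => ?_
  rw [twistComp, Finset.mul_sum]
  refine Finset.sum_congr rfl fun J _ => ?_
  rw [← mul_assoc, fn_comm, mul_assoc]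

/-- The twisting condition as an identity of functions: `X(R)` is `1/(n+2)!` times `H` evaluated on
the `x`-components of `X`. Those components are `-Π` contracted with `a`. -/
theorem hamField_ham_of_twisted (hNP : ∀ I, N I = -P I)
    (hR : ∀ I (σ : Equiv.Perm (Fin (n + 1))), R (I ∘ σ) = rsign σ • R I) (hk : n + 2 = 1 + n + 1)
    (ht : ∀ l, schouten D (p := 1) (q := n) hk P R l =
      (-1 : ℝ) ^ (n + 1) • ∑ κ : Fin (n + 2) → Fin d, (∏ k, P ![κ k, l k]) * H κ) :
    (hamField D N (ham R) : GrAlg n d d A) = (1 / ((n + 2).factorial : ℝ)) •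
      ∑ κ, fn (H κ) * word (anchorComp (hamAnchor N)) κ := by
  -- The `n + 2` factors `-Π` give `(-1)^n`. The index of `H` meets the first index of each `Π`, as
  -- in the twisting condition.
  have h1 : ∀ κ : Fin (n + 2) → Fin d, (word (anchorComp (hamAnchor N)) κ : GrAlg n d d A) =
      (-1 : ℝ) ^ n • poly fun l => ∏ k, P ![κ k, l k] := fun κ => by
    rw [word_eq_poly (anchorComp_hamAnchor_two (N := N)), ← poly_smul]
    congr 1
    funext l
    simp only [hNP]
    rw [Finset.prod_neg]
    simp only [Finset.card_univ, Fintype.card_fin, Algebra.smul_def, map_pow, map_neg, map_one]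
    ring
  rw [hamField_ham_eq_schouten hNP hR hk, funext ht, poly_smul, poly_sum, smul_smul]
  simp only [h1, mul_smul_comm, ← Finset.smul_sum, smul_smul]
  congr 1
  · rw [pow_succ]; ring
  · refine Finset.sum_congr rfl fun κ _ => ?_
    rw [poly, poly, Finset.mul_sum]
    refine Finset.sum_congr rfl fun l _ => ?_
    rw [mul_comm, fn_mul, mul_assoc]

/-- Closedness rewrites `∂_ν H` as a signed sum of derivatives along the other `n + 2` slots;
against a word in odd elements these slots contribute equally. -/
theorem sum_fn_deriv_mul_word
    (hH : ∀ I (σ : Equiv.Perm (Fin (n + 2))), H (I ∘ σ) = rsign σ • H I)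
    (hcl : ∀ l : Fin (n + 3) → Fin d, ∑ i : Fin (n + 3), (-1 : ℝ) ^ (i : ℕ) •
      D (l i) (H fun k => l (i.succAbove k)) = 0) {v : Fin d → GrAlg n d d A}
    (hv : ∀ i, v i ∈ homogeneous 1) (ν : Fin d) :
    ∑ κ, fn (D ν (H κ)) * word v κ = ((n + 2 : ℕ) : ℝ) •
      ∑ l, ∑ J : Fin (n + 1) → Fin d, fn (D l (H (Fin.cons ν J))) * (v l * word v J) := by
  have h1 := sum_fn_altSum_mul_word hv
    (fun κ : Fin (n + 2) → Fin d => D (κ 0) (H (Fin.cons ν fun i => κ i.succ)))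
  have h2 : (altSum fun κ : Fin (n + 2) → Fin d => D (κ 0) (H (Fin.cons ν fun i => κ i.succ))) =
      fun κ => ((n + 1).factorial : ℝ) • D ν (H κ) := by
    funext κ
    rw [altSum_succ (fun a J => D a (H (Fin.cons ν J))) (fun a J σ => by
      rw [alternating_cons hH, Derivation.map_smul])]
    congr 1
    have h3 := hcl (Fin.cons ν κ)
    rw [Fin.sum_univ_succ] at h3
    simp only [Fin.cons_zero, Fin.val_zero, pow_zero, one_smul, Fin.cons_succ, Fin.val_succ,
      Fin.zero_succAbove, pow_succ, mul_neg, mul_one, neg_smul, Finset.sum_neg_distrib] at h3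
    rw [add_neg_eq_zero] at h3
    rw [h3]
    refine Finset.sum_congr rfl fun i _ => ?_
    congr 3
    funext k
    refine Fin.cases ?_ (fun k => ?_) k <;> simp
  rw [h2, sum_fin_cons (fun κ => fn (D (κ 0) (H (Fin.cons ν fun i => κ i.succ))) * word v κ)] at h1
  simp only [Fin.cons_zero, Fin.cons_succ, word_cons, fn_smul, smul_mul_assoc,
    ← Finset.smul_sum] at h1
  refine smul_right_injective _ (Nat.cast_ne_zero.2 (Nat.factorial_ne_zero (n + 1)) :
    ((n + 1).factorial : ℝ) ≠ 0) ?_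
  change _ • _ = _ • _
  rw [h1, smul_smul, Nat.factorial_succ (n + 1), mul_comm, Nat.cast_mul]

/-- The commutator of `X` with the uncorrected Hamiltonian field of `R` consists of derivatives of
`X(R)`, now expressed through `H`; the `H`-correction cancels them. For the `a`-derivative this is
immediate. The `x`-derivative either hits a component of `X` or hits `H`: the first part cancels
against the correction acting on `X`, the second, by `dH = 0`, against `X` acting on the correction.
-/
theorem commutator_twisted (hD : ∀ μ ν f, D μ (D ν f) = D ν (D μ f)) (hNP : ∀ I, N I = -P I)
    (hP : ∀ I (σ : Equiv.Perm (Fin 2)), P (I ∘ σ) = rsign σ • P I)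
    (hR : ∀ I (σ : Equiv.Perm (Fin (n + 1))), R (I ∘ σ) = rsign σ • R I)
    (hH : ∀ I (σ : Equiv.Perm (Fin (n + 2))), H (I ∘ σ) = rsign σ • H I)
    (hPP : ∀ l : Fin 3 → Fin d, schouten D (p := 1) (q := 1) rfl P P l = 0)
    (hcl : ∀ l : Fin (n + 3) → Fin d, ∑ i : Fin (n + 3), (-1 : ℝ) ^ (i : ℕ) •
      D (l i) (H fun k => l (i.succAbove k)) = 0)
    (hk : n + 2 = 1 + n + 1)
    (ht : ∀ l, schouten D (p := 1) (q := n) hk P R l =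
      (-1 : ℝ) ^ (n + 1) • ∑ κ : Fin (n + 2) → Fin d, (∏ k, P ![κ k, l k]) * H κ) (ν : Fin d) :
    (hamField D N (anchorComp (hamAnchor R) ν) - (-1 : ℝ) ^ n •
      vectorField D (baseComp (anchorComp (hamAnchor R)) (twistedBracketComp D N R H))
        (anchorComp (hamAnchor N) ν) : GrAlg n d d A) = 0 ∧
    (hamField D N (twistedBracketComp D N R H ν) - (-1 : ℝ) ^ n •
      vectorField D (baseComp (anchorComp (hamAnchor R)) (twistedBracketComp D N R H))
        (bracketComp (hamBracket D N) ν) : GrAlg n d d A) = 0 := by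
  have hN : ∀ I (σ : Equiv.Perm (Fin 2)), N (I ∘ σ) = rsign σ • N I := fun I σ => by
    rw [hNP, hNP, hP, smul_neg]
  have hNs : ∀ μ ν, N ![μ, ν] = -N ![ν, μ] := fun μ ν => by
    have := hN ![ν, μ] (Equiv.swap 0 1)
    have e : ![ν, μ] ∘ (Equiv.swap 0 1 : Equiv.Perm (Fin 2)) = ![μ, ν] := by
      funext i; fin_cases i <;> simp
    rw [e] at this
    simpa [rsign] using this
  have hZ := hamField_ham_of_twisted (n := n) hNP hR hk ht
  have hs := neg_one_pow_mul_self_eq_one n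
  have hf1 : ((n + 2).factorial : ℝ) ≠ 0 := Nat.cast_ne_zero.2 (Nat.factorial_ne_zero _)
  have hf2 : ((n + 1).factorial : ℝ) ≠ 0 := Nat.cast_ne_zero.2 (Nat.factorial_ne_zero _)
  have hf3 : (1 / ((n + 2).factorial : ℝ)) * ((n + 2 : ℕ) : ℝ) = 1 / ((n + 1).factorial : ℝ) := by
    rw [Nat.factorial_succ (n + 1)]
    push_cast
    have : (n : ℝ) + 1 + 1 ≠ 0 := by positivity
    field_simp
    ring
  constructor
  · have h1 := commutator_hamField_x (n := n) hD hN hR ν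
    have h2 : (partialDeriv D (.inr (.a ν)) (hamField D N (ham R)) : GrAlg n d d A) =
        (1 / ((n + 1).factorial : ℝ)) • ∑ i, fn (N ![i, ν]) * twistComp N H i := by
      rw [hZ, map_smul, gder_sum_word (isGDer_partialDeriv_a ν) (e := 0) ⟨1, rfl⟩ (fun i => by
        rw [partialDeriv_a_anchorComp]; exact fn_mem_homogeneous _) hH]
      simp only [partialDeriv_fn, baseDeriv, fn_zero, zero_mul, Finset.sum_const_zero, zero_add,
        partialDeriv_a_anchorComp, smul_smul, hf3]
    have h3 : (∑ i, twistComp N H i * fn (N ![ν, i]) : GrAlg n d d A) =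
        (-1 : ℝ) • ∑ i, fn (N ![i, ν]) * twistComp N H i := by
      rw [Finset.smul_sum]
      refine Finset.sum_congr rfl fun i _ => ?_
      rw [← fn_comm, hNs ν i, fn_neg, neg_smul_grAlg, one_smul]
      exact neg_mul (fn (N ![i, ν])) _
    rw [vectorField_twisted]
    simp only [partialDeriv_a_anchorComp]
    rw [h3, smul_add, ← sub_sub, h1, h2]
    generalize (∑ i, fn (N ![i, ν]) * twistComp N H i : GrAlg n d d A) = u
    simp only [smul_smul]
    have e : (-1 : ℝ) ^ n * ((-1) ^ n / ((n + 1).factorial : ℝ) * -1) =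
        -(1 / ((n + 1).factorial : ℝ)) := by linear_combination (-1 / ((n + 1).factorial : ℝ)) * hs
    rw [e]
    module
  · have h1 := commutator_hamField_a (n := n) hD hN hR ν
    obtain ⟨hX1, -⟩ := forall_and.1 (hamField_self_eq_zero (n := n) hD hNP hP hPP)
    have hx : ∀ i, (partialDeriv D (.inl ν) (anchorComp (hamAnchor N) i) : GrAlg n d d A) ∈
        homogeneous 1 := fun i => by
      rw [anchorComp, map_smul, partialDeriv_x_poly]
      exact Submodule.smul_mem _ _ (poly_mem_homogeneous _)
    -- The two parts of the `x`-derivative: `T`, where `H` is differentiated, already rewritten by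
    -- closedness, and `U`, where a component of `X` is.
    set T : GrAlg n d d A := ∑ l, ∑ J : Fin (n + 1) → Fin d, fn (D l (H (Fin.cons ν J))) *
      (anchorComp (hamAnchor N) l * word (anchorComp (hamAnchor N)) J) with hT
    set U : GrAlg n d d A := ∑ i, partialDeriv D (.inl ν) (anchorComp (hamAnchor N) i) *
      twistComp N H i with hU
    have h2 : (partialDeriv D (.inl ν) (hamField D N (ham R)) : GrAlg n d d A) =
        (1 / ((n + 1).factorial : ℝ)) • (T + U) := by
      rw [hZ, map_smul, gder_sum_word (isGDer_partialDeriv_x ν) (e := 1) ⟨1, rfl⟩ hx hH]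
      simp only [partialDeriv_fn, baseDeriv]
      rw [sum_fn_deriv_mul_word hH hcl (anchorComp_mem N), ← smul_add, smul_smul, hf3]
    -- By `X² = 0` the field annihilates its own `x`-components, so in the correction only the
    -- coefficients `H` are differentiated.
    have h3 : hamField D N (twistComp N H ν) = T := by
      have hder : IsGDer 1 (hamField D N : GrAlg n d d A →ₗ[ℝ] GrAlg n d d A) :=
        isGDer_vectorField (isBase_ham N).isComp
      have hw : ∀ {k : ℕ} (J : Fin k → Fin d),
          (hamField D N (word (anchorComp (hamAnchor N)) J) : GrAlg n d d A) = 0 := by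
        intro k J
        induction k with
        | zero => rw [word_zero, ← fn_one, hamField, vectorField_fn]; simp [fn_zero]
        | succ k ih => rw [word_succ, hder, hX1, ih]; simp
      rw [twistComp, map_sum, hT, Finset.sum_comm]
      refine Finset.sum_congr rfl fun J _ => ?_
      rw [hder, hw, mul_zero, add_zero, hamField, vectorField_fn, Finset.sum_mul]
      refine Finset.sum_congr rfl fun l _ => ?_
      rw [← fn_comm, mul_assoc]
      rfl
    have h4 : (∑ i, twistComp N H i * partialDeriv D (.inr (.a i)) (bracketComp (hamBracket D N) ν) :
        GrAlg n d d A) = (-1 : ℝ) ^ (n + 1) • U := by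
      rw [hU, Finset.smul_sum]
      refine Finset.sum_congr rfl fun i _ => ?_
      rw [bracketComp_hamBracket, map_smul, partialDeriv_comm hD, partialDeriv_a_ham hN,
        Even.neg_one_pow (by norm_num), one_smul]
      simp only [coordDeg, mul_zero, pow_zero, one_smul]
      rw [mul_comm_of_mem (twistComp_mem i) (hx i), mul_one]
    rw [vectorField_twisted, h4, twistedBracketComp, map_add, map_smul, h3]
    rw [h2] at h1
    rw [sub_eq_iff_eq_add] at h1
    rw [h1, smul_add]
    simp only [smul_smul, smul_add]
    have e : (-1 : ℝ) ^ n * ((-1) ^ n / ((n + 1).factorial : ℝ) * (-1) ^ (n + 1)) =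
        (-1 : ℝ) ^ (n + 1) * (1 / ((n + 1).factorial : ℝ)) := by
      linear_combination ((-1 : ℝ) ^ (n + 1) / ((n + 1).factorial : ℝ)) * hs
    rw [e, pow_succ]
    module

end

end GrAlg

end GappedLie

end

/-! ### The vector field of a twisted R-Poisson structure as a lift -/

noncomputable section

namespace GappedLie

open GrAlg

namespace GrAlg

variable {n d : ℕ} {A : Type*} [CommRing A] [Algebra ℝ A] {D : Fin d → Derivation ℝ A A}
  {P N : (Fin 2 → Fin d) → A} {R : (Fin (n + 1) → Fin d) → A} {H : (Fin (n + 2) → Fin d) → A}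

variable (D P R H) in
/-- The functions `∂_μ R^{ν₁…ν_{n+1}} - Π^{ν₁κ₁} ⋯ H_{μκ₁…}`. -/
def rpF (μ : Fin d) (ν : Fin (n + 1) → Fin d) : A :=
  D μ (R ν) - ∑ κ : Fin (n + 1) → Fin d, (∏ k, P ![ν k, κ k]) * H (Fin.cons μ κ)

variable (D P R H) in
/-- The components of the vector field of a twisted R-Poisson structure. -/
def rpComp : Coord d d → GrAlg n d d A
  | .inl ν => ∑ μ, fn (P ![μ, ν]) * gen (.a μ)
  | .inr (.a ρ) => -((1 / 2 : ℝ) • ∑ μ, ∑ ν, fn (D ρ (P ![μ, ν])) * gen (.a μ) * gen (.a ν))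
  | .inr (.xdot μ) =>
      (-1 : ℝ) ^ n • (∑ ν, fn (P ![ν, μ]) * gen (.adot ν))
      - (∑ ν, ∑ κ, fn (D ν (P ![μ, κ])) * gen (.a κ) * gen (.xdot ν))
      + (1 / (n.factorial : ℝ)) • ∑ I : Fin n → Fin d, fn (R (Fin.cons μ I)) * mono I
  | .inr (.adot μ) =>
      -((∑ ν, ∑ κ, fn (D μ (P ![ν, κ])) * gen (.a ν) * gen (.adot κ))
        + ((-1 : ℝ) ^ n / 2) • (∑ ν, ∑ κ, ∑ l,
            fn (D μ (D ν (P ![κ, l]))) * gen (.xdot ν) * gen (.a κ) * gen (.a l))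
        - ((-1 : ℝ) ^ n / ((n + 1).factorial : ℝ)) •
            ∑ I : Fin (n + 1) → Fin d, fn (rpF D P R H μ I) * mono I)

theorem poly_rpF (hNP : ∀ I, N I = -P I) (hPs : ∀ μ ν, P ![μ, ν] = -P ![ν, μ]) (μ : Fin d) :
    (-((-1 : ℝ) ^ n / ((n + 1).factorial : ℝ))) •
      ∑ I : Fin (n + 1) → Fin d, fn (rpF D P R H μ I) * mono I =
    (twistedBracketComp D N R H μ :
      GrAlg n d d A) := by
  have hNe : ∀ μ ν, N ![μ, ν] = P ![ν, μ] := fun μ ν => by rw [hNP, hPs, neg_neg]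
  have h1 : (twistComp N H μ : GrAlg n d d A) =
      poly fun ν => ∑ κ : Fin (n + 1) → Fin d,
        (∏ k, P ![ν k, κ k]) * H (Fin.cons μ κ) := by
    rw [twistComp, poly_sum]
    refine Finset.sum_congr rfl fun κ _ => ?_
    rw [word_eq_poly (anchorComp_hamAnchor_two (N := N)), poly, poly, Finset.mul_sum]
    refine Finset.sum_congr rfl fun I _ => ?_
    simp only [hNe]
    rw [mul_comm, fn_mul, mul_assoc]
  have h2 : (bracketComp (hamBracket D R) μ :
      GrAlg n d d A) = (-((-1 : ℝ) ^ n / ((n + 1).factorial : ℝ))) •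
        poly fun I => D μ (R I) := by
    rw [bracketComp]
    simp only [hamBracket]
    rw [poly_smul, smul_smul]
    congr 1
    ring
  have h3 : (∑ I : Fin (n + 1) → Fin d, fn (rpF D P R H μ I) * mono I :
      GrAlg n d d A) =
      poly (fun I => D μ (R I)) +
        (-1 : ℝ) • twistComp N H μ := by
    rw [h1, ← poly_smul, ← poly_add, poly]
    simp only [rpF, sub_eq_add_neg, neg_smul, one_smul]
  rw [h3, twistedBracketComp, h2]
  module

/-- The conventions of `T^*[n]T^*[1]M` correspond to `c = -1`: here `δ a_μ = -z_μ`. The terms with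
`∂Π` and `∂∂Π` arise from `δ` acting on the components of the Hamiltonian field of `-Π`;
skew-symmetry of `Π` merges the two terms containing `z`. -/
theorem rpComp_eq_liftComp (hD : ∀ μ ν f, D μ (D ν f) = D ν (D μ f))
    (hNP : ∀ I, N I = -P I) (hPs : ∀ μ ν, P ![μ, ν] = -P ![ν, μ]) (hn : 1 ≤ n) :
    rpComp D P R H = liftComp D (-1) (anchorComp (hamAnchor N))
      (anchorComp (hamAnchor R))
      (bracketComp (hamBracket D N))
      (twistedBracketComp D N R H) := by
  have hNe : ∀ μ ν, N ![μ, ν] = P ![ν, μ] := fun μ ν => by rw [hNP, hPs, neg_neg]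
  have hsn : (-1 : ℝ) ^ n = -(-1 : ℝ) ^ (n - 1) := by
    obtain ⟨k, rfl⟩ := Nat.exists_eq_add_of_le' hn
    simp [pow_succ]
  have h1 : ∀ ν, (anchorComp (hamAnchor N) ν :
      GrAlg n d d A) =
        ∑ μ, fn (P ![μ, ν]) * gen (.a μ) := fun ν => by
    rw [anchorComp_hamAnchor_two]
    simp only [hNe]
  have h2 : ∀ ρ, (bracketComp (hamBracket D N) ρ :
      GrAlg n d d A) = (-(1 / 2 : ℝ)) • ∑ μ, ∑ ν,
        fn (D ρ (P ![μ, ν])) * gen (.a μ) * gen (.a ν) := fun ρ => by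
    rw [bracketComp, poly, sum_fin_two]
    simp only [mono_two, mul_assoc, hamBracket, hNP, map_neg, pow_one, smul_neg, neg_smul,
      one_smul, neg_neg]
    congr 1
  have hδ := isGDer_vectorField (D := D)
    (isComp_deltaComp (A := A) (d := d) (r := d) hn (-1))
  have hs := neg_one_pow_mul_self_eq_one (n - 1)
  have hpar : n * 1 = (n - 1) + 1 := by omega
  have hx : ∀ i μ, (gen (.xdot μ) * gen (.a i) : GrAlg n d d A) =
      (-1 : ℝ) ^ (n - 1) • (gen (.a i) * gen (.xdot μ)) := fun i μ => by
    rw [gen_mul_gen]; simp [Gen.deg]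
  have ha : ∀ i j, (gen (.adot i) * gen (.a j) : GrAlg n d d A) =
      (-(-1 : ℝ) ^ (n - 1)) • (gen (.a j) * gen (.adot i)) := fun i j => by
    rw [gen_mul_gen]; simp only [Gen.deg]; rw [hpar, pow_succ]; simp
  have hδfn : ∀ f, vectorField D (deltaComp (-1))
      (fn f : GrAlg n d d A) =
      ∑ ν, fn (D ν f) * gen (.xdot ν) := fun f => by
    rw [vectorField_fn]
    exact Finset.sum_congr rfl fun ν _ => gen_mul_fn _ _
  have hδa : ∀ i, vectorField D (deltaComp (-1))
      (gen (.a i) : GrAlg n d d A) =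
      (-1 : ℝ) • gen (.adot i) := fun i => by
    rw [vectorField_gen]; rfl
  funext e
  rcases e with (μ | c | μ | c)
  · exact (h1 μ).symm
  · rw [liftComp, h2, rpComp, neg_smul_grAlg]
  · rw [liftComp, h1, rpComp, map_sum]
    have e1 : (∑ ν, ∑ κ, fn (D ν (P ![μ, κ])) * gen (.a κ) * gen (.xdot ν) :
        GrAlg n d d A) = -∑ κ, ∑ ν,
          fn (D ν (P ![κ, μ])) * (gen (.a κ) * gen (.xdot ν)) := by
      rw [Finset.sum_comm, ← Finset.sum_neg_distrib]
      refine Finset.sum_congr rfl fun κ _ => ?_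
      rw [← Finset.sum_neg_distrib]
      refine Finset.sum_congr rfl fun ν _ => ?_
      rw [hPs μ κ, map_neg, fn_neg, mul_assoc]
      exact neg_mul (fn _) _
    rw [e1]
    congr 1
    simp only [hδ _ _, sig_fn, hδfn, hδa, Finset.sum_mul, Finset.sum_add_distrib, smul_add,
      mul_smul_comm, Finset.smul_sum, smul_smul, hs, one_smul, mul_assoc, hx, hsn]
    rw [add_comm, sub_neg_eq_add]
    congr 1
    refine Finset.sum_congr rfl fun ν _ => ?_
    rw [mul_neg, mul_one]
  · have hCsum : ∑ a, ∑ b, fn (D c (P ![a, b])) * (gen (.a b) * gen (.adot a)) =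
        - ∑ a, ∑ b, (fn (D c (P ![a, b])) * (gen (.a a) * gen (.adot b)) :
          GrAlg n d d A) := by
      rw [Finset.sum_comm, ← Finset.sum_neg_distrib]
      refine Finset.sum_congr rfl fun a _ => ?_
      rw [← Finset.sum_neg_distrib]
      refine Finset.sum_congr rfl fun b _ => ?_
      rw [hPs b a, map_neg, fn_neg]
      exact neg_mul (fn _) _
    have e1 : vectorField D (deltaComp (-1))
        (bracketComp (hamBracket D N) c :
          GrAlg n d d A) =
        (-(1 / 2 : ℝ)) • ((∑ μ, ∑ a, ∑ b,
            fn (D c (D μ (P ![a, b]))) * gen (.xdot μ) * gen (.a a) *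
              gen (.a b))
          + (2 * (-1 : ℝ) ^ n) • ∑ a, ∑ b, fn (D c (P ![a, b])) *
            (gen (.a a) * gen (.adot b))) := by
      rw [h2, map_smul]
      congr 1
      have e2 : ∀ a b, vectorField D (deltaComp (-1))
          (fn (D c (P ![a, b])) * gen (.a a) * gen (.a b) :
            GrAlg n d d A) =
          (∑ μ, fn (D c (D μ (P ![a, b]))) * gen (.xdot μ) * gen (.a a) *
            gen (.a b))
          + ((-(-1 : ℝ) ^ n) • (fn (D c (P ![a, b])) * (gen (.a b) * gen (.adot a)))
          + (-1 : ℝ) ^ n • (fn (D c (P ![a, b])) *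
            (gen (.a a) * gen (.adot b)))) := by
        intro a b
        rw [mul_assoc, hδ, hδ, sig_fn, hδfn, hδa, hδa, sig_gen]
        simp only [Gen.deg, mul_one, smul_mul_assoc, mul_smul_comm, smul_smul, ha,
          Finset.sum_mul, mul_add, mul_assoc, hsn, hD c, mul_neg, neg_neg, neg_mul,
          one_mul]
      simp only [map_sum, e2, Finset.sum_add_distrib]
      congr 1
      · symm
        rw [Finset.sum_comm]
        refine Finset.sum_congr rfl fun a _ => ?_
        rw [Finset.sum_comm]
      · simp only [← Finset.smul_sum]
        rw [hCsum]
        generalize (∑ a, ∑ b, fn (D c (P ![a, b])) * (gen (.a a) * gen (.adot b)) :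
          GrAlg n d d A) = u
        module
    rw [liftComp, e1, rpComp, ← poly_rpF hNP hPs]
    simp only [mul_assoc]
    generalize (∑ a, ∑ b, fn (D c (P ![a, b])) * (gen (.a a) * gen (.adot b)) :
      GrAlg n d d A) = u
    generalize (∑ I, fn (rpF D P R H c I) * mono I : GrAlg n d d A) = v
    generalize (∑ μ, ∑ a, ∑ b, fn (D c (D μ (P ![a, b]))) * 
      (gen (.xdot μ) * (gen (.a a) * gen (.a b))) : GrAlg n d d A) = w
    simp only [smul_smul, smul_add, hsn]
    have e3 : (-1 : ℝ) * ((-1) ^ (n - 1) * (-(1 / 2) * (2 * -(-1) ^ (n - 1)))) = -1 := by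
      linear_combination -hs
    rw [e3]
    module

end GrAlg

namespace RPoissonData

variable {n d : ℕ} {M : Type*} [TopologicalSpace M] [ChartedSpace (Euc d) M]
  (S : RPoissonData n d M) {φ : OpenPartialHomeomorph M (Euc d)}
  (hφ : φ ∈ IsManifold.maximalAtlas 𝓘(ℝ, Euc d) ∞ M)

theorem PComp_perm (I : Fin 2 → Fin d) (σ : Equiv.Perm (Fin 2)) :
    S.PComp hφ (I ∘ σ) = rsign σ • S.PComp hφ I :=
  Subtype.ext (funext fun y => map_perm_rsign (S.P (φ.symm y))
    (fun k => dx φ (φ.symm y) (I k)) σ)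

theorem RComp_perm (I : Fin (n + 1) → Fin d) (σ : Equiv.Perm (Fin (n + 1))) :
    S.RComp hφ (I ∘ σ) = rsign σ • S.RComp hφ I :=
  Subtype.ext (funext fun y => map_perm_rsign (S.R (φ.symm y))
    (fun k => dx φ (φ.symm y) (I k)) σ)

theorem HComp_perm (I : Fin (n + 2) → Fin d) (σ : Equiv.Perm (Fin (n + 2))) :
    S.HComp hφ (I ∘ σ) = rsign σ • S.HComp hφ I :=
  Subtype.ext (funext fun y => map_perm_rsign (S.H (φ.symm y))
    (fun k => ddx φ y (I k)) σ)

theorem PComp_swap (μ ν : Fin d) : S.PComp hφ ![μ, ν] = -S.PComp hφ ![ν, μ] := by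
  have := S.PComp_perm hφ ![ν, μ] (Equiv.swap 0 1)
  have e : ![ν, μ] ∘ (Equiv.swap 0 1 : Equiv.Perm (Fin 2)) = ![μ, ν] := by
    funext i; fin_cases i <;> simp
  rw [e] at this
  rw [this]
  simp [rsign]

/-- The components of the bivector field `-Π`. -/
def NComp (I : Fin 2 → Fin d) : smoothFun (chartTarget φ) := -S.PComp hφ I

theorem NComp_perm (I : Fin 2 → Fin d) (σ : Equiv.Perm (Fin 2)) :
    S.NComp hφ (I ∘ σ) = rsign σ • S.NComp hφ I := by
  rw [NComp, NComp, PComp_perm, smul_neg]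

theorem qComp_eq_liftComp (hn : 1 ≤ n) :
    S.qComp hφ = liftComp (pderiv (chartTarget φ)) (-1) (anchorComp (hamAnchor (S.NComp hφ)))
      (anchorComp (hamAnchor (S.RComp hφ)))
      (bracketComp (hamBracket (pderiv (chartTarget φ)) (S.NComp hφ)))
      (twistedBracketComp (pderiv (chartTarget φ)) (S.NComp hφ) (S.RComp hφ) (S.HComp hφ)) := by
  rw [← rpComp_eq_liftComp (D := pderiv (chartTarget φ)) (P := S.PComp hφ) (N := S.NComp hφ)
    (R := S.RComp hφ) (H := S.HComp hφ) (pderiv_comm _) (fun _ => rfl) (S.PComp_swap hφ) hn]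
  funext e
  rcases e with (μ | c | μ | c)
  · rw [qComp, rpComp]
  · rw [qComp, rpComp]
  · rw [qComp, rpComp]
  · rw [qComp, rpComp]
    simp only [fComp, rpF]

theorem isDegreeOneVectorField_Q (hn : 1 ≤ n) : IsDegreeOneVectorField (S.Q hφ) := by
  rw [Q, qComp_eq_liftComp S hφ hn]
  exact isDegreeOneVectorField_vectorField (isComp_liftComp hn (isBase_ham _) isBase_twisted)

theorem Q_Q_eq_zero (hn : 1 ≤ n) (hS : S.IsTwistedRPoisson)
    (u : GrAlg n d d (smoothFun (chartTarget φ))) : S.Q hφ (S.Q hφ u) = 0 := by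
  have hD : ∀ μ ν f, pderiv (chartTarget φ) μ (pderiv (chartTarget φ) ν f) =
      pderiv (chartTarget φ) ν (pderiv (chartTarget φ) μ f) := pderiv_comm _
  have h1 := hamField_self_eq_zero (n := n) hD (N := S.NComp hφ) (P := S.PComp hφ) (fun _ => rfl)
    (S.PComp_perm hφ) (hS.poisson φ hφ)
  have h2 := commutator_twisted (N := S.NComp hφ) hD (fun _ => rfl) (S.PComp_perm hφ)
    (S.RComp_perm hφ) (S.HComp_perm hφ) (hS.poisson φ hφ) (hS.closed φ hφ) (by omega)
    (hS.twisted φ hφ)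
  rw [Q, qComp_eq_liftComp S hφ hn]
  refine (liftComp_sq_eq_zero_iff hD hn ⟨coordFn _, fun μ ν => pderiv_coordFn _ _ _⟩ (by norm_num)
    (isBase_ham _) isBase_twisted).2 ⟨⟨fun ν => (h1 ν).1, fun ν => (h1 ν).2⟩,
      fun ν => (h2 ν).1, fun ν => (h2 ν).2⟩ u

end RPoissonData

end GappedLie

end

noncomputable section

namespace GappedLie

/-! ### Changes of coordinates of twisted R-Poisson structures -/

namespace GrAlg

theorem derivation_prod {A : Type*} [CommRing A] [Algebra ℝ A] (D : Derivation ℝ A A) {m : ℕ}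
    (f : Fin (m + 1) → A) : D (∏ i, f i) = ∑ i, (∏ k, f (i.succAbove k)) * D (f i) := by
  induction m with
  | zero => simp
  | succ m ih =>
    rw [Fin.prod_univ_succ, Derivation.leibniz, ih, Fin.sum_univ_succ (n := m + 1), add_comm,
      smul_eq_mul, smul_eq_mul, Finset.mul_sum]
    congr 1
    refine Finset.sum_congr rfl fun i _ => ?_
    rw [Fin.prod_univ_succ (fun k => f (i.succ.succAbove k))]
    simp only [Fin.succ_succAbove_zero, Fin.succ_succAbove_succ]
    ring

variable {n d : ℕ} {A : Type*} [CommRing A] [Algebra ℝ A] {D : Fin d → Derivation ℝ A A}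
  {A' : Type*} [CommRing A'] [Algebra ℝ A'] {D' : Fin d → Derivation ℝ A' A'}
  {s : ℝ} {tr : A' →+* A} {x' : Fin d → A} {g : Fin d → Fin d → A}
  {T : GrAlg n d d A' →ₐ[ℝ] GrAlg n d d A}

section Jacobian

/-- As `g` inverts the Jacobian, `g_b^a ∂_a` is the partial derivative along the primed coordinate
`x'^b`. -/
theorem sum_mul_deriv_transfer (hinv : ∀ μ l, ∑ ν, D ν (x' μ) * g l ν = if μ = l then 1 else 0)
    (hchain : ∀ ν f, D ν (tr f) = ∑ μ, D ν (x' μ) * tr (D' μ f)) (b : Fin d) (f : A') :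
    ∑ a, g b a * D a (tr f) = tr (D' b f) := by
  simp only [hchain, Finset.mul_sum]
  rw [Finset.sum_comm]
  have : ∀ μ, ∑ a, g b a * (D a (x' μ) * tr (D' μ f)) =
      (if μ = b then 1 else 0) * tr (D' μ f) := fun μ => by
    rw [← hinv, Finset.sum_mul]
    exact Finset.sum_congr rfl fun a _ => by ring
  simp [this]

theorem inverse_jacobian (hinv : ∀ μ l, ∑ ν, D ν (x' μ) * g l ν = if μ = l then 1 else 0)
    (ν κ : Fin d) : ∑ μ, g μ ν * D κ (x' μ) = if ν = κ then 1 else 0 := by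
  let J : Matrix (Fin d) (Fin d) A := Matrix.of fun μ ν => D ν (x' μ)
  let G : Matrix (Fin d) (Fin d) A := Matrix.of fun ν l => g l ν
  have h1 : J * G = 1 := by
    ext μ l
    simp [Matrix.mul_apply, J, G, hinv, Matrix.one_apply]
  have h0 : G * J = 1 := mul_eq_one_comm.1 h1
  have h2 := congrFun (congrFun h0 ν) κ
  simpa [Matrix.mul_apply, J, G, Matrix.one_apply] using h2

/-- The fields `g_b^a ∂_a` are coordinate fields, hence commute. Algebraically, differentiating `J g
= 1` expresses both sides, multiplied by the Jacobian, through second derivatives of `x'`, which are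
symmetric; the Jacobian is then cancelled by its left inverse. -/
theorem inverse_jacobian_integrable (hD : ∀ μ ν f, D μ (D ν f) = D ν (D μ f))
    (hinv : ∀ μ l, ∑ ν, D ν (x' μ) * g l ν = if μ = l then 1 else 0) (b l κ : Fin d) :
    ∑ a, g b a * D a (g l κ) = ∑ a, g l a * D a (g b κ) := by
  have h1 : ∀ b l μ, ∑ ν, D ν (x' μ) * ∑ a, g b a * D a (g l ν) =
      -∑ ν, ∑ a, g l ν * g b a * D a (D ν (x' μ)) := fun b l μ => by
    have h2 : ∑ a, g b a * D a (∑ ν, D ν (x' μ) * g l ν) = 0 := by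
      rw [hinv]
      split_ifs <;> simp
    simp only [map_sum, Derivation.leibniz, smul_eq_mul, Finset.mul_sum, mul_add,
      Finset.sum_add_distrib] at h2
    rw [← add_eq_zero_iff_eq_neg, ← h2, Finset.sum_comm (γ := Fin d)]
    simp only [Finset.mul_sum]
    congr 1
    · rw [Finset.sum_comm]
      refine Finset.sum_congr rfl fun a _ => Finset.sum_congr rfl fun ν _ => ?_
      ring
    · refine Finset.sum_congr rfl fun a _ => Finset.sum_congr rfl fun ν _ => ?_
      ring
  have h3 : ∀ μ, ∑ ν, D ν (x' μ) * ∑ a, g b a * D a (g l ν) =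
      ∑ ν, D ν (x' μ) * ∑ a, g l a * D a (g b ν) := fun μ => by
    rw [h1, h1, Finset.sum_comm]
    congr 1
    refine Finset.sum_congr rfl fun a _ => Finset.sum_congr rfl fun ν _ => ?_
    rw [hD]
    ring
  have h4 : ∀ F : Fin d → A, ∑ μ, g μ κ * ∑ ν, D ν (x' μ) * F ν = F κ := fun F => by
    simp only [Finset.mul_sum, ← mul_assoc]
    rw [Finset.sum_comm]
    simp [← Finset.sum_mul, inverse_jacobian hinv]
  rw [← h4 fun ν => ∑ a, g b a * D a (g l ν), ← h4 fun ν => ∑ a, g l a * D a (g b ν)]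
  simp only [h3]

end Jacobian

variable {m : ℕ} {U : (Fin (m + 1) → Fin d) → A} {U' : (Fin (m + 1) → Fin d) → A'}

/-- Hamiltonian vector fields of related multivector fields are related. -/
theorem isCoordChange_hamField (hT : IsCoordChange s D tr x' g T) (hn : 1 ≤ n)
    (hD : ∀ μ ν f, D μ (D ν f) = D ν (D μ f))
    (hinv : ∀ μ l, ∑ ν, D ν (x' μ) * g l ν = if μ = l then 1 else 0)
    (hchain : ∀ ν f, D ν (tr f) = ∑ μ, D ν (x' μ) * tr (D' μ f))
    (hU : ∀ I (σ : Equiv.Perm (Fin (m + 1))), U (I ∘ σ) = rsign σ • U I)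
    (hUT : ∀ I, U I = ∑ J, (∏ i, g (J i) (I i)) * tr (U' J)) :
    ∀ u ∈ base n d d A', hamField D U (T u) = T (hamField D' U' u) := by
  refine isCoordChange_anchorComp_bracketComp hT hn ?_ ?_ ?_
  · intro I μ σ
    exact alternating_cons hU μ I σ
  · intro I f
    simp only [act, hamAnchor, hUT, sum_fin_cons, Fin.prod_univ_succ, Fin.cons_zero, Fin.cons_succ,
      Finset.sum_mul, map_sum, map_mul, Finset.mul_sum,
      ← sum_mul_deriv_transfer (g := g) hinv hchain]
    rw [Finset.sum_comm]
    conv_rhs => rw [Finset.sum_comm]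
    refine Finset.sum_congr rfl fun b _ => ?_
    rw [Finset.sum_comm]
    refine Finset.sum_congr rfl fun J _ => Finset.sum_congr rfl fun μ _ => ?_
    ring
  · intro I b
    have hact : ∀ i : Fin (m + 1), (-1 : ℝ) ^ (i : ℕ) •
        act D (hamAnchor U) (fun k => I (i.succAbove k)) (g b (I i)) =
        ∑ J, (∏ k, g (J (i.succAbove k)) (I (i.succAbove k))) *
          (∑ a, g (J i) a * D a (g b (I i))) * tr (U' J) := fun i => by
      have h1 : ∀ μ, U (Fin.cons μ fun k => I (i.succAbove k)) = (-1 : ℝ) ^ (i : ℕ) •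
          U (Fin.insertNth i μ fun k => I (i.succAbove k)) := fun μ => by
        rw [← Fin.cons_comp_cycleRange, hU, rsign_cycleRange, smul_smul,
          neg_one_pow_mul_self_eq_one, one_smul]
      simp only [act, hamAnchor, h1, smul_mul_assoc, ← Finset.smul_sum, smul_smul,
        neg_one_pow_mul_self_eq_one, one_smul]
      simp only [hUT, Fin.prod_univ_succAbove _ i, Fin.insertNth_apply_same,
        Fin.insertNth_apply_succAbove, Finset.sum_mul, Finset.mul_sum]
      rw [Finset.sum_comm]
      refine Finset.sum_congr rfl fun J _ => Finset.sum_congr rfl fun a _ => ?_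
      ring
    -- The product rule applied to the transformation law of `U`. By `inverse_jacobian_integrable`
    -- the derivatives of `g` take the form of the anchor terms in `hact`, so only the transformed
    -- derivative of `U'` survives.
    have hd : ∑ a, g b a * D a (U I) =
        ∑ i : Fin (m + 1), ∑ J, (∏ k, g (J (i.succAbove k)) (I (i.succAbove k))) *
          (∑ a, g (J i) a * D a (g b (I i))) * tr (U' J) +
        ∑ J, (∏ i, g (J i) (I i)) * tr (D' b (U' J)) := by
      simp only [← inverse_jacobian_integrable hD hinv b,
        ← sum_mul_deriv_transfer (g := g) hinv hchain]
      simp only [hUT, map_sum, Derivation.leibniz, derivation_prod, smul_eq_mul, mul_add,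
        Finset.sum_add_distrib, Finset.mul_sum, Finset.sum_mul]
      rw [add_comm]
      congr 1
      · rw [Finset.sum_comm]
        conv_rhs => rw [Finset.sum_comm]
        refine Finset.sum_congr rfl fun J _ => ?_
        rw [Finset.sum_comm]
        refine Finset.sum_congr rfl fun i _ => Finset.sum_congr rfl fun a _ => ?_
        ring
      · rw [Finset.sum_comm]
        refine Finset.sum_congr rfl fun J _ => Finset.sum_congr rfl fun a _ => ?_
        ring
    simp only [hact, hamBracket, mul_smul_comm, ← Finset.smul_sum]
    rw [hd, ← smul_sub, add_sub_cancel_left, Finset.smul_sum]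
    refine Finset.sum_congr rfl fun J _ => ?_
    rw [← mul_smul_comm]
    congr 1
    simp only [Algebra.smul_def, map_mul]
    congr 1
    simp

section Twisted

variable {N : (Fin 2 → Fin d) → A} {R : (Fin (n + 1) → Fin d) → A} {H : (Fin (n + 2) → Fin d) → A}
  {N' : (Fin 2 → Fin d) → A'} {R' : (Fin (n + 1) → Fin d) → A'} {H' : (Fin (n + 2) → Fin d) → A'}

/-- The `x`-components of `X` transform with the Jacobian, as do the slots of `H`, so the
contraction matches; in the free slot `g` cancels the Jacobian. -/
theorem isCoordChange_twistComp (hT : IsCoordChange s D tr x' g T)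
    (hinv : ∀ μ l, ∑ ν, D ν (x' μ) * g l ν = if μ = l then 1 else 0)
    (hx : ∃ x : Fin d → A', (∀ μ, tr (x μ) = x' μ) ∧ ∀ μ ν, D' ν (x μ) = if ν = μ then 1 else 0)
    (hN : ∀ u ∈ base n d d A', hamField D N (T u) = T (hamField D' N' u))
    (hHT : ∀ I, H I = ∑ J, (∏ i, D (I i) (x' (J i))) * tr (H' J)) (b : Fin d) :
    ∑ a, twistComp N H a * fn (g b a) = T (twistComp N' H' b) := by
  -- The components of a field along `x'^κ` are its values on the coordinate functions, so their law
  -- is read off from relatedness on these functions.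
  have h1 : ∀ κ, T (anchorComp (hamAnchor N') κ) =
      ∑ ν, fn (D ν (x' κ)) * anchorComp (hamAnchor N) ν := fun κ => by
    obtain ⟨x, hx1, hx2⟩ := hx
    have h := hN _ (fn_mem_base (x κ))
    rw [hT.fn, hx1, hamField, hamField, vectorField_fn, vectorField_fn] at h
    simp only [hx2, baseComp] at h
    have h0 : ∑ μ, anchorComp (hamAnchor N') μ * fn (if μ = κ then 1 else 0) =
        (anchorComp (hamAnchor N') κ : GrAlg n d d A') := by
      rw [Finset.sum_eq_single κ]
      · rw [if_pos rfl, fn_one, mul_one]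
      · intro ν _ hν
        rw [if_neg hν, fn_zero, mul_zero]
      · simp
    rw [h0] at h
    rw [← h]
    exact Finset.sum_congr rfl fun ν _ => (fn_comm _ _).symm
  have h2 : ∀ J : Fin (n + 1) → Fin d, T (word (anchorComp (hamAnchor N')) J) =
      ∑ I : Fin (n + 1) → Fin d, fn (∏ i, D (I i) (x' (J i))) *
        word (anchorComp (hamAnchor N)) I := fun J => by
    rw [← word_eq_sum h1, word, word, map_list_prod, List.map_ofFn]
    rfl
  have h3 : ∀ I : Fin (n + 1) → Fin d, ∑ a, g b a * H (Fin.cons a I) =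
      ∑ J : Fin (n + 1) → Fin d, (∏ i, D (I i) (x' (J i))) * tr (H' (Fin.cons b J)) := fun I => by
    have h4 : ∀ a, g b a * H (Fin.cons a I) = ∑ J : Fin (n + 1) → Fin d, ∑ c,
        (D a (x' c) * g b a) * ((∏ i, D (I i) (x' (J i))) * tr (H' (Fin.cons c J))) := fun a => by
      rw [hHT, sum_fin_cons, Finset.sum_comm, Finset.mul_sum]
      refine Finset.sum_congr rfl fun J _ => ?_
      rw [Finset.mul_sum]
      refine Finset.sum_congr rfl fun c _ => ?_
      simp only [Fin.prod_univ_succ, Fin.cons_zero, Fin.cons_succ]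
      ring
    simp only [h4]
    rw [Finset.sum_comm]
    refine Finset.sum_congr rfl fun J _ => ?_
    rw [Finset.sum_comm]
    simp only [← Finset.sum_mul, hinv, ite_mul, one_mul, zero_mul, Finset.sum_ite_eq',
      Finset.mem_univ, if_true]
  have h5 : ∑ a, twistComp N H a * fn (g b a) = (∑ I : Fin (n + 1) → Fin d,
      fn (∑ a, g b a * H (Fin.cons a I)) * word (anchorComp (hamAnchor N)) I : GrAlg n d d A) := by
    simp only [fn_sum, fn_mul, Finset.sum_mul, mul_assoc]
    rw [Finset.sum_comm]
    refine Finset.sum_congr rfl fun a _ => ?_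
    rw [← fn_comm, twistComp, Finset.mul_sum]
  rw [h5, twistComp, map_sum]
  simp only [h3, map_mul, hT.fn, h2, fn_sum, Finset.sum_mul, Finset.mul_sum]
  rw [Finset.sum_comm]
  refine Finset.sum_congr rfl fun J _ => Finset.sum_congr rfl fun I _ => ?_
  rw [← mul_assoc, ← fn_mul, mul_comm]

theorem isCoordChange_twisted (hT : IsCoordChange s D tr x' g T) (hn : 1 ≤ n)
    (hinv : ∀ μ l, ∑ ν, D ν (x' μ) * g l ν = if μ = l then 1 else 0)
    (hx : ∃ x : Fin d → A', (∀ μ, tr (x μ) = x' μ) ∧ ∀ μ ν, D' ν (x μ) = if ν = μ then 1 else 0)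
    (hN : ∀ u ∈ base n d d A', hamField D N (T u) = T (hamField D' N' u))
    (hR : ∀ u ∈ base n d d A', hamField D R (T u) = T (hamField D' R' u))
    (hHT : ∀ I, H I = ∑ J, (∏ i, D (I i) (x' (J i))) * tr (H' J)) :
    ∀ u ∈ base n d d A',
      vectorField D (baseComp (anchorComp (hamAnchor R)) (twistedBracketComp D N R H)) (T u) =
      T (vectorField D' (baseComp (anchorComp (hamAnchor R')) (twistedBracketComp D' N' R' H')) u) := by
  intro u hu
  refine isCoordChange_related hT hn isBase_twisted.isComp isBase_twisted.isComp ?_ ?_ hu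
  · intro f
    have := hR _ (fn_mem_base f)
    rw [hT.fn] at this
    rw [vectorField_twisted, vectorField_twisted, this]
    simp [partialDeriv_fn, baseDeriv, fn_zero]
  · rintro _ ⟨b, rfl⟩
    have h1 : ∀ i, (partialDeriv D (.inr (.a i)) (T (gen (.a b))) : GrAlg n d d A) = fn (g b i) := by
      intro i
      rw [hT.a, map_sum]
      simp only [isGDer_partialDeriv_a i _ _, partialDeriv_fn, baseDeriv, fn_zero, zero_mul,
        zero_add, sig_fn, partialDeriv_a_gen_a]
      simp
    rw [vectorField_twisted, vectorField_twisted, hR _ (a_mem_base b)]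
    simp only [h1, partialDeriv_a_gen_a]
    rw [isCoordChange_twistComp hT hinv hx hN hHT]
    simp

end Twisted

end GrAlg

end GappedLie

end

/-! ### The Jacobian of a change of charts and the transformation of the tensors -/

noncomputable section

namespace GappedLie

open Filter Topology GrAlg

theorem isUnit_of_evalAt_ne_zero {d : ℕ} {V : TopologicalSpace.Opens (Euc d)} {f : smoothFun V}
    (h : ∀ y, evalAt y f ≠ 0) : IsUnit f := by
  obtain ⟨f, g, hg, hfg⟩ := f
  have hg0 : ∀ y ∈ V, g y ≠ 0 := fun y hy => by
    have := h ⟨y, hy⟩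
    rwa [show evalAt ⟨y, hy⟩ (⟨f, g, hg, hfg⟩ : smoothFun V) = g y from hfg ⟨y, hy⟩] at this
  refine IsUnit.of_mul_eq_one ⟨fun y => (f y)⁻¹, fun y => (g y)⁻¹, hg.inv hg0,
    fun y => congrArg (·⁻¹) (hfg y)⟩ ?_
  refine Subtype.ext (funext fun y => ?_)
  exact mul_inv_cancel₀ (h y)

section Tangent

variable {d : ℕ} {M : Type*} [TopologicalSpace M] [ChartedSpace (Euc d) M]
  [IsManifold 𝓘(ℝ, Euc d) ∞ M] {φ φ' : OpenPartialHomeomorph M (Euc d)}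

theorem eq_sum_coordVec (hφ : φ ∈ IsManifold.maximalAtlas 𝓘(ℝ, Euc d) ∞ M) {x : M}
    (hx : x ∈ φ.source) (v : TangentSpace 𝓘(ℝ, Euc d) x) :
    v = ∑ ν, dx φ x ν v • coordVec φ x ν := by
  have hm : φ.MDifferentiable 𝓘(ℝ, Euc d) 𝓘(ℝ, Euc d) :=
    ⟨(contMDiffOn_of_mem_maximalAtlas hφ).mdifferentiableOn (by simp),
      (contMDiffOn_symm_of_mem_maximalAtlas hφ).mdifferentiableOn (by simp)⟩
  let L : Euc d →L[ℝ] Euc d := mfderiv 𝓘(ℝ, Euc d) 𝓘(ℝ, Euc d) φ.symm (φ x)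
  let w : Euc d := mfderiv 𝓘(ℝ, Euc d) 𝓘(ℝ, Euc d) φ x v
  have h1 : L w = v :=
    congrArg (fun K : Euc d →L[ℝ] Euc d => K v) (hm.symm_comp_deriv hx)
  have h2 : w = ∑ ν, w ν • (EuclideanSpace.single ν (1 : ℝ) : Euc d) := by
    ext i
    simp [Finset.sum_apply, Pi.single_apply]
  rw [h2, map_sum] at h1
  simp only [map_smul] at h1
  exact h1.symm

theorem sum_dx_coordVec (hφ : φ ∈ IsManifold.maximalAtlas 𝓘(ℝ, Euc d) ∞ M) {x : M}
    (hx : x ∈ φ.source) (f : Module.Dual ℝ (TangentSpace 𝓘(ℝ, Euc d) x)) :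
    f = ∑ ν, f (coordVec φ x ν) • dx φ x ν := by
  refine LinearMap.ext fun v => ?_
  conv_lhs => rw [eq_sum_coordVec hφ hx v]
  rw [map_sum, LinearMap.sum_apply]
  refine Finset.sum_congr rfl fun ν _ => ?_
  rw [map_smul, LinearMap.smul_apply, smul_eq_mul, smul_eq_mul, mul_comm]

variable (hφ : φ ∈ IsManifold.maximalAtlas 𝓘(ℝ, Euc d) ∞ M)
  (hφ' : φ' ∈ IsManifold.maximalAtlas 𝓘(ℝ, Euc d) ∞ M) (h : φ.source ⊆ φ'.source)

/-- The Jacobian matrix of a change of coordinates has an inverse. -/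
theorem exists_inverse_jacobian : ∃ g : Fin d → Fin d → smoothFun (chartTarget φ),
    (∀ μ l, ∑ ν, pderiv (chartTarget φ) ν (coordChange hφ hφ' h μ) * g l ν =
      if μ = l then 1 else 0) ∧
    ∀ x (hx : x ∈ φ.source) l ν, evalAt (coordPt hx) (g l ν) = dx φ x ν (coordVec φ' x l) := by
  let J : Matrix (Fin d) (Fin d) (smoothFun (chartTarget φ)) :=
    Matrix.of fun μ ν => pderiv (chartTarget φ) ν (coordChange hφ hφ' h μ)
  -- The pointwise inverse of the Jacobian, given by the components of the primed coordinate
  -- vectors. It shows that the determinant is invertible; smoothness of the inverse then comes from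
  -- the adjugate formula over the ring of smooth functions.
  let G : M → Matrix (Fin d) (Fin d) ℝ := fun x => Matrix.of fun ν l => dx φ x ν (coordVec φ' x l)
  have hJG : ∀ x (hx : x ∈ φ.source), J.map (evalAt (coordPt hx)) * G x = 1 := by
    intro x hx
    ext μ l
    have h1 : (J.map (evalAt (coordPt hx)) * G x) μ l =
        ∑ ν, dx φ' x μ (coordVec φ x ν) * dx φ x ν (coordVec φ' x l) := by
      rw [Matrix.mul_apply]
      refine Finset.sum_congr rfl fun ν _ => ?_
      exact congrArg (· * _) (evalAt_pderiv_coordChange hφ hφ' h hx μ ν)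
    have h2 := dx_coordVec hφ' (h hx) μ l
    rw [eq_sum_coordVec hφ hx (coordVec φ' x l), map_sum] at h2
    simp only [map_smul, smul_eq_mul] at h2
    rw [h1, Matrix.one_apply]
    simp only [eq_comm (a := μ)]
    rw [← h2]
    exact Finset.sum_congr rfl fun ν _ => mul_comm _ _
  have hdet : IsUnit J.det := by
    refine isUnit_of_evalAt_ne_zero fun y => ?_
    have hx : φ.symm y ∈ φ.source := φ.map_target y.2
    have hy : coordPt hx = y := Subtype.ext (φ.right_inv y.2)
    have h1 := congrArg Matrix.det (hJG _ hx)
    rw [Matrix.det_mul, Matrix.det_one, hy] at h1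
    have h2 : evalAt y J.det = (J.map (evalAt y)).det := (evalAt y).map_det J
    rw [h2]
    exact left_ne_zero_of_mul_eq_one h1
  have hinv := Matrix.mul_nonsing_inv J hdet
  refine ⟨fun l ν => J⁻¹ ν l, fun μ l => ?_, fun x hx l ν => ?_⟩
  · have := congrFun (congrFun hinv μ) l
    rw [Matrix.mul_apply, Matrix.one_apply] at this
    exact this
  · have h1 : J.map (evalAt (coordPt hx)) * (J⁻¹).map (evalAt (coordPt hx)) = 1 := by
      rw [← Matrix.map_mul, hinv]
      exact Matrix.map_one _ (map_zero _) (map_one _)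
    have h2 := left_inv_eq_right_inv (mul_eq_one_comm.1 h1) (hJG x hx)
    exact congrFun (congrFun h2 ν) l

end Tangent

namespace RPoissonData

variable {n d : ℕ} {M : Type*} [TopologicalSpace M] [ChartedSpace (Euc d) M]
  [IsManifold 𝓘(ℝ, Euc d) ∞ M]
  (S : RPoissonData n d M) {φ φ' : OpenPartialHomeomorph M (Euc d)}
  (hφ : φ ∈ IsManifold.maximalAtlas 𝓘(ℝ, Euc d) ∞ M)
  (hφ' : φ' ∈ IsManifold.maximalAtlas 𝓘(ℝ, Euc d) ∞ M) (h : φ.source ⊆ φ'.source)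

theorem evalAt_PComp {x : M} (hx : x ∈ φ.source) (I : Fin 2 → Fin d) :
    evalAt (coordPt hx) (S.PComp hφ I) = S.P x fun k => dx φ x (I k) := by
  have : ∀ z, z = x → S.P z (fun k => dx φ z (I k)) = S.P x fun k => dx φ x (I k) := by
    rintro z rfl; rfl
  exact this _ (φ.left_inv hx)

theorem evalAt_RComp {x : M} (hx : x ∈ φ.source) (I : Fin (n + 1) → Fin d) :
    evalAt (coordPt hx) (S.RComp hφ I) = S.R x fun k => dx φ x (I k) := by
  have : ∀ z, z = x → S.R z (fun k => dx φ z (I k)) = S.R x fun k => dx φ x (I k) := by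
    rintro z rfl; rfl
  exact this _ (φ.left_inv hx)

theorem evalAt_HComp {x : M} (hx : x ∈ φ.source) (I : Fin (n + 2) → Fin d) :
    evalAt (coordPt hx) (S.HComp hφ I) = S.H x fun k => coordVec φ x (I k) := by
  have : ∀ z, z = x → ∀ w : Fin (n + 2) → Euc d, S.H z w = S.H x w := by
    rintro z rfl w; rfl
  exact this _ (φ.left_inv hx) _

/-- Covectors `dx^μ` expand in the primed ones with coefficients given by the primed coordinate
vectors; multilinearity does the rest. -/
theorem multivector_transfer {k : ℕ} {x : M} (hx : x ∈ φ'.source)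
    (hφ' : φ' ∈ IsManifold.maximalAtlas 𝓘(ℝ, Euc d) ∞ M)
    (U : Module.Dual ℝ (TangentSpace 𝓘(ℝ, Euc d) x) [⋀^Fin k]→ₗ[ℝ] ℝ) (I : Fin k → Fin d) :
    (U fun i => dx φ x (I i)) = ∑ J : Fin k → Fin d,
      (∏ i, dx φ x (I i) (coordVec φ' x (J i))) * U fun i => dx φ' x (J i) := by
  have h1 : (fun i => dx φ x (I i)) = fun i => ∑ l, dx φ x (I i) (coordVec φ' x l) • dx φ' x l :=
    funext fun i => sum_dx_coordVec hφ' hx _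
  conv_lhs => rw [h1]
  exact map_sum_smul_univ U (fun i l => dx φ x (I i) (coordVec φ' x l)) (dx φ' x)

theorem PComp_transfer {g : Fin d → Fin d → smoothFun (chartTarget φ)}
    (hg : ∀ x (hx : x ∈ φ.source) l ν,
      evalAt (coordPt hx) (g l ν) = dx φ x ν (coordVec φ' x l)) (I : Fin 2 → Fin d) :
    S.PComp hφ I = ∑ J, (∏ i, g (J i) (I i)) * transferHom hφ hφ' h (S.PComp hφ' J) := by
  refine evalAt_ext fun x hx => ?_
  rw [evalAt_PComp, multivector_transfer (h hx) hφ', map_sum]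
  refine Finset.sum_congr rfl fun J _ => ?_
  rw [map_mul, map_prod]
  simp only [hg]
  congr 1
  exact ((evalAt_transfer hφ hφ' h _ hx).trans (S.evalAt_PComp hφ' (h hx) J)).symm

theorem RComp_transfer {g : Fin d → Fin d → smoothFun (chartTarget φ)}
    (hg : ∀ x (hx : x ∈ φ.source) l ν,
      evalAt (coordPt hx) (g l ν) = dx φ x ν (coordVec φ' x l)) (I : Fin (n + 1) → Fin d) :
    S.RComp hφ I = ∑ J, (∏ i, g (J i) (I i)) * transferHom hφ hφ' h (S.RComp hφ' J) := by
  refine evalAt_ext fun x hx => ?_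
  rw [evalAt_RComp, multivector_transfer (h hx) hφ', map_sum]
  refine Finset.sum_congr rfl fun J _ => ?_
  rw [map_mul, map_prod]
  simp only [hg]
  congr 1
  exact ((evalAt_transfer hφ hφ' h _ hx).trans (S.evalAt_RComp hφ' (h hx) J)).symm

theorem HComp_transfer (I : Fin (n + 2) → Fin d) :
    S.HComp hφ I = ∑ J, (∏ i, pderiv (chartTarget φ) (I i) (coordChange hφ hφ' h (J i))) *
      transferHom hφ hφ' h (S.HComp hφ' J) := by
  refine evalAt_ext fun x hx => ?_
  have h1 : (fun i => coordVec φ x (I i)) = fun i =>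
      ∑ l, dx φ' x l (coordVec φ x (I i)) • coordVec φ' x l :=
    funext fun i => eq_sum_coordVec hφ' (h hx) _
  rw [evalAt_HComp, map_sum]
  conv_lhs => rw [h1]
  refine (map_sum_smul_univ (S.H x) (fun i l => dx φ' x l (coordVec φ x (I i)))
    (coordVec φ' x)).trans ?_
  refine Finset.sum_congr rfl fun J _ => ?_
  rw [map_mul, map_prod]
  simp only [evalAt_pderiv_coordChange]
  refine congrArg (_ * ·) ?_
  exact ((evalAt_transfer hφ hφ' h _ hx).trans (S.evalAt_HComp hφ' (h hx) J)).symm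

/-- The vector field does not depend on the coordinates. -/
theorem exists_isCoordChange_Q (hn : 1 ≤ n) :
    ∃ (g : Fin d → Fin d → smoothFun (chartTarget φ))
      (T : GrAlg n d d (smoothFun (chartTarget φ')) →ₐ[ℝ]
        GrAlg n d d (smoothFun (chartTarget φ))),
      (∀ μ l, ∑ ν, pderiv (chartTarget φ) ν (coordChange hφ hφ' h μ) * g l ν =
        if μ = l then 1 else 0) ∧
      GrAlg.IsCoordChange ((-1 : ℝ) ^ n) (pderiv (chartTarget φ)) (transfer hφ hφ' h)
        (coordChange hφ hφ' h) g T ∧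
      ∀ u, S.Q hφ (T u) = T (S.Q hφ' u) := by
  obtain ⟨g, hinv, hg⟩ := exists_inverse_jacobian hφ hφ' h
  obtain ⟨T, hT⟩ := exists_isCoordChange (n := n) (D := pderiv (chartTarget φ)) hn ((-1 : ℝ) ^ n)
    (transferHom hφ hφ' h) (transferHom_algebraMap hφ hφ' h) (coordChange hφ hφ' h) g
  refine ⟨g, T, hinv, hT, ?_⟩
  have hchain := pderiv_transfer hφ hφ' h
  have hx : ∃ x : Fin d → smoothFun (chartTarget φ'),
      (∀ μ, transferHom hφ hφ' h (x μ) = coordChange hφ hφ' h μ) ∧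
        ∀ μ ν, pderiv (chartTarget φ') ν (x μ) = if ν = μ then 1 else 0 :=
    ⟨coordFn _, transferHom_coordFn hφ hφ' h, pderiv_coordFn _⟩
  have hN := isCoordChange_hamField hT hn (pderiv_comm _) hinv hchain (S.NComp_perm hφ)
    (U' := S.NComp hφ') (fun I => by
      rw [NComp, S.PComp_transfer hφ hφ' h hg]
      refine (Finset.sum_neg_distrib _).symm.trans (Finset.sum_congr rfl fun J _ => ?_)
      rw [NComp, map_neg]
      exact (mul_neg (∏ i, g (J i) (I i)) _).symm)
  have hR := isCoordChange_hamField hT hn (pderiv_comm _) hinv hchain (S.RComp_perm hφ)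
    (U' := S.RComp hφ') (S.RComp_transfer hφ hφ' h hg)
  have hP := isCoordChange_twisted hT hn hinv hx hN hR (S.HComp_transfer hφ hφ' h)
  -- The sign `(-1)^n` in the transformation law of `z` is the one that fits `c = -1`.
  have hcs : (-1 : ℝ) * (-1 : ℝ) ^ n = (-1 : ℝ) ^ (n - 1) := by
    obtain ⟨k, rfl⟩ := Nat.exists_eq_add_of_le' hn
    rw [pow_succ]; simp
  rw [Q, Q, S.qComp_eq_liftComp hφ hn, S.qComp_eq_liftComp hφ' hn]
  exact isCoordChange_liftComp hT (pderiv_comm _) hn (by norm_num) hcs hchain hx (isBase_ham _)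
    isBase_twisted (isBase_ham _) isBase_twisted hN hP

end RPoissonData

end GappedLie

end

open GappedLie in
theorem mainTheorem4 (n d r : ℕ) (hn : 2 ≤ n)
    {M : Type*} [TopologicalSpace M] [T2Space M] [ChartedSpace (Euc d) M]
    [IsManifold 𝓘(ℝ, Euc d) ∞ M]
    {E : M → Type*} [∀ x, AddCommGroup (E x)] [∀ x, Module ℝ (E x)]
    [∀ x, TopologicalSpace (E x)] [TopologicalSpace (Bundle.TotalSpace (Euc r) E)]
    [FiberBundle (Euc r) E] [VectorBundle ℝ (Euc r) E]
    [ContMDiffVectorBundle ∞ (Euc r) E 𝓘(ℝ, Euc d)]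
    (S : AnchoredBrackets n d r E) :
    -- the local expressions are a vector field of degree `1` on `T[n-1]E[1]`
    (∀ κ : BundleCoord d r E, GrAlg.IsDegreeOneVectorField (S.Q κ)) ∧
    (∀ (κ κ' : BundleCoord d r E) (h : κ.chart.source ⊆ κ'.chart.source),
      ∃ T : κ'.Fun n →ₐ[ℝ] κ.Fun n,
        GrAlg.IsCoordChange 1 (pderiv κ.domain) (transfer κ.chart_mem κ'.chart_mem h)
          (coordChange κ.chart_mem κ'.chart_mem h) (κ.frameChange κ' h) T ∧
        ∀ u, S.Q κ (T u) = T (S.Q κ' u)) ∧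
    -- it squares to zero exactly for gapped Lie `n`-algebroids
    ((∀ (κ : BundleCoord d r E) (u : κ.Fun n), S.Q κ (S.Q κ u) = 0) ↔
      S.IsGappedLieAlgebroid) ∧
    ((∀ (κ : BundleCoord d r E) (u : κ.Fun n), S.Q κ (S.Q κ u) = 0) ↔
      S.IsGroundLieAlgebroid ∧ S.MixedMorphism ∧ S.MixedJacobi) ∧
    -- twisted R-Poisson structures
    (∀ P : RPoissonData n d M, P.IsTwistedRPoisson →
      (∀ (φ : OpenPartialHomeomorph M (Euc d))
        (hφ : φ ∈ IsManifold.maximalAtlas 𝓘(ℝ, Euc d) ∞ M),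
        GrAlg.IsDegreeOneVectorField (P.Q hφ) ∧ ∀ u, P.Q hφ (P.Q hφ u) = 0) ∧
      (∀ (φ φ' : OpenPartialHomeomorph M (Euc d))
        (hφ : φ ∈ IsManifold.maximalAtlas 𝓘(ℝ, Euc d) ∞ M)
        (hφ' : φ' ∈ IsManifold.maximalAtlas 𝓘(ℝ, Euc d) ∞ M) (h : φ.source ⊆ φ'.source),
        ∃ (g : Fin d → Fin d → smoothFun (chartTarget φ))
          (T : GrAlg n d d (smoothFun (chartTarget φ')) →ₐ[ℝ]
            GrAlg n d d (smoothFun (chartTarget φ))),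
          (∀ μ l, ∑ ν, pderiv (chartTarget φ) ν (coordChange hφ hφ' h μ) * g l ν =
            if μ = l then 1 else 0) ∧
          GrAlg.IsCoordChange ((-1 : ℝ) ^ n) (pderiv (chartTarget φ)) (transfer hφ hφ' h)
            (coordChange hφ hφ' h) g T ∧
          ∀ u, P.Q hφ (T u) = T (P.Q hφ' u))) := by
  have hn1 : 1 ≤ n := by omega
  have hsq := S.forall_Q_sq_eq_zero_iff hn1
  exact ⟨S.isDegreeOneVectorField_Q hn1,
    fun κ κ' h => AnchoredBrackets.exists_isCoordChange_Q h hn1 S,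
    hsq.trans (S.isGappedLieAlgebroid_iff hn1).symm, hsq, fun P hP =>
      ⟨fun φ hφ => ⟨P.isDegreeOneVectorField_Q hφ hn1, P.Q_Q_eq_zero hφ hn1 hP⟩,
        fun φ φ' hφ hφ' h => P.exists_isCoordChange_Q hφ hφ' h hn1⟩⟩
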